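/- Let $Q$ be a finite quiver with vertex set $I$ and edge set $E$ (loops and multiple edges allowed), fix a total order on $I$, and let $\mathbb F=\mathbb Q(q,t_e)_{e\in E}$. For $i,j\in I$ put $$\zeta_{ij}(x)=\Big(\frac{1-xq^{-1}}{1-x}\Big)^{\delta_{ij}}\prod_{e:i\to j}(1-t_ex)\prod_{e:j\to i}\Big(1-\frac{qx}{t_e}\Big).$$ For $\boldsymbol n\in\mathbb N^I$ let $\mathcal S_{\boldsymbol n}$ be the space of Laurent polynomials $R$ over $\mathbb F$ in variables $z_{ia}$ ($i\in I$, $1\le a\le n_i$), symmetric in $z_{i1},\dots,z_{in_i}$ for each $i$ separately, such that for every edge $e:i\to j$ $$R\big|_{z_{ia}=qz_{jb}/t_e=qz_{ic}}=0,\qquad R\big|_{z_{ja}=t_ez_{ib}=qz_{jc}}=0$$ for all $a\ne c$ (and further $a\ne b\ne c$ if $i=j$). Let $\mathcal S=\bigoplus_{\boldsymbol n}\mathcal S_{\boldsymbol n}$ with the shuffle product: for $R$ of degree $\boldsymbol n$ and $R'$ of degree $\boldsymbol n'$, $$R*R'=\mathrm{Sym}\Big[\frac{R(\dots,z_{i1},\dots,z_{in_i},\dots)\,R'(\dots,z_{i,n_i+1},\dots,z_{i,n_i+n_i'},\dots)}{\prod_i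 n_i!\,n_i'!}\prod_{i,j\in I}\ \prod_{1\le a\le n_i}\ \prod_{n_j<b\le n_j+n_j'}\zeta_{ij}\Big(\frac{z_{ia}}{z_{jb}}\Big)\Big],$$ where $\mathrm{Sym}$ is the sum over all permutations of $z_{i1},\dots,z_{i,n_i+n'_i}$ for each $i$ separately; $\mathcal S^{\rm op}$ is the same vector space with the opposite product. Let $e_{i,d}\in\mathcal S$ and $f_{i,d}\in\mathcal S^{\rm op}$ denote $z_{i1}^d$ in the degree which is $1$ at $i$ and $0$ elsewhere. Order the letters $i^{(d)}$ ($i\in I$, $d\in\mathbb Z$) by $i^{(d)}<j^{(e)}$ if $d>e$, or $d=e$ and $i<j$, and order words (finite sequences of letters) lexicographically, a proper prefix being smaller. For $w=[i_1^{(d_1)}\dots i_n^{(d_n)}]$ put $e_w=e_{i_1,d_1}*\dots*e_{i_n,d_n}\in\mathcal S$ and $f_w=f_{i_1,-d_1}*\dots*f_{i_n,-d_n}\in\mathcal S^{\rm op}$. The word $w$ is non-increasing if $i_1^{(d_1)}\ge\dots\ge i_n^{(d_n)}$; then $\bar w=(d_1\le\dots\le d_n)$. A word $v$ is standard if $e_v$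 is not a linear combination of the $e_w$ with $w>v$. For each $n\ge 0$ let $G$ be the graph on the non-decreasing $n$-tuples of integers with an edge between $(d_a)$ and $(d'_a)$ whenever $$d'_a=d_{\sigma(a)}-\sum_{s<a,\ \sigma(s)>\sigma(a)}c_{s,a}+\sum_{a<t,\ \sigma(a)>\sigma(t)}c_{a,t}\qquad(1\le a\le n)$$ for some permutation $\sigma\ne\mathrm{Id}$ and some integers $c_{a,b}\ge-2|E|$ (for $a<b$, $\sigma(a)>\sigma(b)$). For a connected component $H$ of $G$ let $\mathcal S_H$, respectively $\mathcal S_H^{\rm op}$, be the span of the $e_w$, respectively $f_w$, over the non-increasing words $w$ with $\bar w\in H$. Then: 1. all $e_w$ and $f_w$ lie in $\mathcal S$ and $\mathcal S^{\rm op}$, and $$\mathcal S=\bigoplus_{w\text{ standard}}\mathbb F\cdot e_w,\qquad \mathcal S^{\rm op}=\bigoplus_{w\text{ standard}}\mathbb F\cdot f_w;$$ 2. for every $n$, $\ \bigoplus_{\sum_i n_i=n}\mathcal S_{\boldsymbol n}=\bigoplus_H\mathcal S_H$ over the connected components $H$ of $G$; each $\mathcal S_H$ is finite-dimensional, and $\mathcal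 S_H=\bigoplus_{w\text{ standard},\ \bar w\in H}\mathbb F\cdot e_w$. The analogous statements hold for $\mathcal S^{\rm op}$, $\mathcal S^{\rm op}_H$ and $f_w$; 3. there is a bilinear pairing $\langle\cdot,\cdot\rangle:\mathcal S\otimes\mathcal S^{\rm op}\to\mathbb F$ such that, for all $R\in\mathcal S$ and all words $w=[i_1^{(d_1)}\dots i_n^{(d_n)}]$, $$\langle R,f_w\rangle=\int_{|z_1|\ll\dots\ll|z_n|}\frac{z_1^{-d_1}\cdots z_n^{-d_n}\,R(z_1,\dots,z_n)}{\prod_{a<b}\zeta_{i_ai_b}(z_a/z_b)}\prod_{a=1}^n\frac{dz_a}{2\pi i z_a}$$ (an iterated residue at $0$), where $R(z_1,\dots,z_n)$ is the component of $R$ in the degree $\boldsymbol n$ given by $n_i=\#\{a:i_a=i\}$, with $z_a$ plugged into one of the variables $z_{i_a\bullet}$ for each $a$; with respect to it $\langle\mathcal S_H,\mathcal S^{\rm op}_{H'}\rangle=0$ for distinct components $H\ne H'$ (for the same or for different $n$); 4. there are unique bases $\{e^v\}$ of $\mathcal S$ and $\{f^v\}$ of $\mathcal S^{\rm op}$, indexed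 by the standard words, with $\langle e^v,f_w\rangle=\langle e_v,f^w\rangle=\delta^v_w$ for all standard words $v,w$. -/

import Mathlib

namespace QuiverShuffle

noncomputable section

universe u v

/-! ### The ground field and the rational functions in the variables -/

/-- All edges of the quiver `I`. -/
abbrev Edge (I : Type u) [Quiver.{v} I] : Type (max u v) := Σ i j : I, (i ⟶ j)

/-- The field `𝔽 = ℚ(q, t_e)` of rational functions in `q` (the variable `none`) and in one
parameter `t_e` for every edge `e` (the variable `some e`). -/
abbrev GroundField (I : Type u) [Quiver.{v} I] : Type (max u v) :=
  FractionRing (MvPolynomial (Option (Edge I)) ℚ)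

/-- The parameter `q`. -/
def qPar (I : Type u) [Quiver.{v} I] : GroundField I :=
  algebraMap (MvPolynomial (Option (Edge I)) ℚ) (GroundField I) (MvPolynomial.X none)

/-- The parameter `t_e` of an edge `e`. -/
def tPar {I : Type u} [Quiver.{v} I] {i j : I} (e : i ⟶ j) : GroundField I :=
  algebraMap (MvPolynomial (Option (Edge I)) ℚ) (GroundField I) (MvPolynomial.X (some ⟨i, j, e⟩))

/-- The index set of the variables `z_{ia}`. The second index is counted from `0`: the variables
of a function of degree `n` are `z_{ia}` with `0 ≤ a < n i`. -/
abbrev Var (I : Type u) : Type u := I × ℕ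

/-- The field of rational functions over `𝔽` in all the variables `z_{ia}`. -/
abbrev RatFun (I : Type u) [Quiver.{v} I] : Type (max u v) :=
  FractionRing (MvPolynomial (Var I) (GroundField I))

/-- The variable `z_{ia}` as a rational function. -/
def zVar {I : Type u} [Quiver.{v} I] (p : Var I) : RatFun I :=
  algebraMap (MvPolynomial (Var I) (GroundField I)) (RatFun I) (MvPolynomial.X p)

lemma rename_injective {I : Type u} [Quiver.{v} I] (φ : Var I ↪ Var I) :
    Function.Injective
      ((IsScalarTower.toAlgHom (GroundField I) (MvPolynomial (Var I) (GroundField I))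
        (RatFun I)).comp (MvPolynomial.rename φ)) := by
  intro a b h
  exact MvPolynomial.rename_injective φ φ.injective
    (IsFractionRing.injective (MvPolynomial (Var I) (GroundField I)) (RatFun I) h)

/-- The substitution `z_p ↦ z_{φ p}` in rational functions, for an injective map `φ` of the
index set of the variables. -/
def renameVar {I : Type u} [Quiver.{v} I] (φ : Var I ↪ Var I) : RatFun I →ₐ[GroundField I] RatFun I :=
  IsFractionRing.liftAlgHom (rename_injective φ)

/-- The permutation `(i, a) ↦ (i, σ_i a)` for `a < n i`, which fixes `(i, a)` for `a ≥ n i`. -/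
def permVar {I : Type u} (n : I → ℕ) (σ : ∀ i, Equiv.Perm (Fin (n i))) : Equiv.Perm (Var I) :=
  Equiv.prodCongrRight fun i => (σ i).extendDomain Fin.equivSubtype

/-- The shift `(i, a) ↦ (i, n i + a)`. -/
def shiftVar {I : Type u} (n : I → ℕ) : Var I ↪ Var I where
  toFun p := (p.1, n p.1 + p.2)
  inj' := by
    rintro ⟨i, a⟩ ⟨j, b⟩ h
    simp only [Prod.mk.injEq] at h
    obtain ⟨rfl, h⟩ := h
    simpa using h

/-- Symmetrization with respect to the variables `z_{ia}`, `a < n i`, for each `i` separately. -/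
def symmetrize {I : Type u} [Fintype I] [DecidableEq I] [Quiver.{v} I] (n : I → ℕ) (R : RatFun I) :
    RatFun I :=
  ∑ σ : (∀ i, Equiv.Perm (Fin (n i))), renameVar (permVar n σ).toEmbedding R

/-! ### The shuffle product -/

/-- The function `ζ_{ij}(x)`, for `x` in any field over `𝔽`. -/
def zeta {I : Type u} [DecidableEq I] [Quiver.{v} I] [∀ i j : I, Fintype (i ⟶ j)]
    {A : Type*} [Field A] [Algebra (GroundField I) A] (i j : I) (x : A) : A :=
  (if i = j then (1 - x * algebraMap (GroundField I) A (qPar I)⁻¹) / (1 - x) else 1) *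
    (∏ e : (i ⟶ j), (1 - algebraMap (GroundField I) A (tPar e) * x)) *
    ∏ e : (j ⟶ i), (1 - algebraMap (GroundField I) A (qPar I / tPar e) * x)

/-- Families of rational functions indexed by the degrees `n ∈ ℕ^I`, almost all zero. The shuffle
algebra is a subspace of it. -/
abbrev Graded (I : Type u) [Quiver.{v} I] : Type (max u v) := (I → ℕ) →₀ RatFun I

section Product

variable {I : Type u} [Fintype I] [DecidableEq I] [Quiver.{v} I] [∀ i j : I, Fintype (i ⟶ j)]

/-- The shuffle product of `R` of degree `n` and `R'` of degree `n'`. -/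
def shuffleComp (n n' : I → ℕ) (R R' : RatFun I) : RatFun I :=
  symmetrize (n + n')
    (R * renameVar (shiftVar n) R' /
        ((∏ i, ((n i).factorial : RatFun I)) * ∏ i, ((n' i).factorial : RatFun I)) *
      ∏ i, ∏ j, ∏ a ∈ Finset.range (n i), ∏ b ∈ Finset.Ico (n j) (n j + n' j),
        zeta i j (zVar (i, a) / zVar (j, b)))

/-- The shuffle product `R * R'`. -/
def shuffleMul (R R' : Graded I) : Graded I :=
  R.sum fun n r => R'.sum fun n' r' => Finsupp.single (n + n') (shuffleComp n n' r r')

/-- The opposite product. -/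
def shuffleOpMul (R R' : Graded I) : Graded I := shuffleMul R' R

/-- The unit `1`, in degree `0`. -/
def shuffleOne : Graded I := Finsupp.single 0 1

/-- The element `z_{i1}^d` of degree `ς_i`. -/
def oneVar (i : I) (d : ℤ) : Graded I := Finsupp.single (Pi.single i 1) (zVar (i, 0) ^ d)

end Product

/-! ### The shuffle algebra -/

/-- Laurent polynomials over `𝔽` in the variables `z_{ia}`; the exponents of a monomial form a
finitely supported function on the index set of the variables. -/
abbrev LaurentPoly (I : Type u) [Quiver.{v} I] : Type (max u v) :=
  AddMonoidAlgebra (GroundField I) (Var I →₀ ℤ)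

/-- The value of a Laurent polynomial at `z_p = x p`, where the `x p` are non-zero elements of a
field over `𝔽`. -/
def evalAt {I : Type u} [Quiver.{v} I] {A : Type*} [Field A] [Algebra (GroundField I) A]
    (x : Var I → A) (P : LaurentPoly I) : A :=
  P.coeff.sum fun m c => c • m.prod fun p k => x p ^ k

lemma evalAt_zero {I : Type u} [Quiver.{v} I] {A : Type*} [Field A] [Algebra (GroundField I) A]
    (x : Var I → A) : evalAt x 0 = 0 := by
  simp [evalAt]

lemma evalAt_add {I : Type u} [Quiver.{v} I] {A : Type*} [Field A] [Algebra (GroundField I) A]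
    (x : Var I → A) (P P' : LaurentPoly I) : evalAt x (P + P') = evalAt x P + evalAt x P' := by
  unfold evalAt
  rw [AddMonoidAlgebra.coeff_add]
  exact Finsupp.sum_add_index' (by simp) (by intros; rw [add_smul])

lemma evalAt_smul {I : Type u} [Quiver.{v} I] {A : Type*} [Field A] [Algebra (GroundField I) A]
    (x : Var I → A) (c : GroundField I) (P : LaurentPoly I) :
    evalAt x (c • P) = c • evalAt x P := by
  unfold evalAt
  rw [AddMonoidAlgebra.coeff_smul, Finsupp.sum_smul_index' (by simp), Finsupp.smul_sum]
  simp only [smul_assoc]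

/-- `P` is a Laurent polynomial in the variables `z_{ia}` with `a < n i`. -/
def InVariables {I : Type u} [Quiver.{v} I] (n : I → ℕ) (P : LaurentPoly I) : Prop :=
  ∀ m, P.coeff m ≠ 0 → ∀ p : Var I, m p ≠ 0 → p.2 < n p.1

/-- `P` is symmetric in the variables `z_{ia}`, `a < n i`, for each `i` separately. -/
def IsSymmetric {I : Type u} [Quiver.{v} I] (n : I → ℕ) (P : LaurentPoly I) : Prop :=
  ∀ σ : (∀ i, Equiv.Perm (Fin (n i))), evalAt (fun p => zVar (permVar n σ p)) P = evalAt zVar P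

/-- The wheel conditions. For every edge `e` from `i` to `j`,
* `P` vanishes at `z_{ia} = q z_{jb} / t_e = q z_{ic}`,
* `P` vanishes at `z_{ja} = t_e z_{ib} = q z_{jc}`,

for all `a ≠ c`, and further `a ≠ b ≠ c` if `i = j`. -/
def WheelConditions {I : Type u} [DecidableEq I] [Quiver.{v} I] (n : I → ℕ) (P : LaurentPoly I) :
    Prop :=
  ∀ (i j : I) (e : i ⟶ j),
    (∀ a b c : ℕ, a < n i → b < n j → c < n i → a ≠ c → (i = j → a ≠ b ∧ b ≠ c) →
      evalAt (Function.update (Function.update zVar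
          (i, a) ((qPar I / tPar e) • zVar (j, b)))
          (i, c) ((tPar e)⁻¹ • zVar (j, b))) P = 0) ∧
    (∀ a b c : ℕ, a < n j → b < n i → c < n j → a ≠ c → (i = j → a ≠ b ∧ b ≠ c) →
      evalAt (Function.update (Function.update zVar
          (j, a) (tPar e • zVar (i, b)))
          (j, c) ((tPar e / qPar I) • zVar (i, b))) P = 0)

/-- The shuffle algebra `𝒮`, as a vector space: the families whose component of each degree `n` is
a Laurent polynomial in the variables `z_{ia}`, `a < n i`, symmetric for each `i` separately, that
satisfies the wheel conditions. The opposite algebra `𝒮^op` has the same underlying vector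
space. -/
def shuffleAlgebra (I : Type u) [DecidableEq I] [Quiver.{v} I] :
    Submodule (GroundField I) (Graded I) where
  carrier := {R | ∀ n, ∃ P : LaurentPoly I,
    (InVariables n P ∧ IsSymmetric n P ∧ WheelConditions n P) ∧ evalAt zVar P = R n}
  zero_mem' n := by
    refine ⟨0, ⟨?_, ?_, ?_⟩, ?_⟩
    · intro m h
      simp at h
    · intro σ
      simp only [evalAt_zero]
    · intro i j e
      simp only [evalAt_zero, implies_true, and_self]
    · simp only [evalAt_zero, Finsupp.coe_zero, Pi.zero_apply]
  add_mem' := by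
    intro R R' hR hR' n
    obtain ⟨P, ⟨h1, h2, h3⟩, h4⟩ := hR n
    obtain ⟨P', ⟨h1', h2', h3'⟩, h4'⟩ := hR' n
    refine ⟨P + P', ⟨?_, ?_, ?_⟩, ?_⟩
    · intro m hm
      by_cases h : P.coeff m = 0
      · refine h1' m fun h' => hm ?_
        rw [AddMonoidAlgebra.coeff_add, Finsupp.add_apply, h, h', add_zero]
      · exact h1 m h
    · intro σ
      rw [evalAt_add, evalAt_add, h2 σ, h2' σ]
    · intro i j e
      refine ⟨?_, ?_⟩
      · intro a b c ha hb hc hac hij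
        rw [evalAt_add, (h3 i j e).1 a b c ha hb hc hac hij,
          (h3' i j e).1 a b c ha hb hc hac hij, add_zero]
      · intro a b c ha hb hc hac hij
        rw [evalAt_add, (h3 i j e).2 a b c ha hb hc hac hij,
          (h3' i j e).2 a b c ha hb hc hac hij, add_zero]
    · rw [evalAt_add, h4, h4', Finsupp.add_apply]
  smul_mem' := by
    intro c R hR n
    obtain ⟨P, ⟨h1, h2, h3⟩, h4⟩ := hR n
    refine ⟨c • P, ⟨?_, ?_, ?_⟩, ?_⟩
    · intro m hm
      refine h1 m fun h' => hm ?_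
      rw [AddMonoidAlgebra.coeff_smul, Finsupp.smul_apply, h', smul_zero]
    · intro σ
      rw [evalAt_smul, evalAt_smul, h2 σ]
    · intro i j e
      refine ⟨?_, ?_⟩
      · intro a b d ha hb hd had hij
        rw [evalAt_smul, (h3 i j e).1 a b d ha hb hd had hij, smul_zero]
      · intro a b d ha hb hd had hij
        rw [evalAt_smul, (h3 i j e).2 a b d ha hb hd had hij, smul_zero]
    · rw [evalAt_smul, h4, Finsupp.smul_apply]

/-- The families supported in the degrees of length `N`, that is, in the degrees `n` with
`∑ i, n i = N`. -/
def ofLength (I : Type u) [Fintype I] [Quiver.{v} I] (N : ℕ) :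
    Submodule (GroundField I) (Graded I) :=
  Finsupp.supported (RatFun I) (GroundField I) {n : I → ℕ | ∑ i, n i = N}

/-! ### Words -/

/-- The letters `i^(d)`, with `i^(d) < j^(e)` if `d > e`, or `d = e` and `i < j`. -/
abbrev Letter (I : Type u) : Type u := ℤᵒᵈ ×ₗ I

/-- The exponent `d` of the letter `i^(d)`. -/
def Letter.exponent {I : Type u} (l : Letter I) : ℤ := OrderDual.ofDual (ofLex l).1

/-- The vertex `i` of the letter `i^(d)`. -/
def Letter.vertex {I : Type u} (l : Letter I) : I := (ofLex l).2

/-- Words; they are ordered lexicographically, a proper prefix of a word being smaller than the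
word. -/
abbrev Word (I : Type u) : Type u := List (Letter I)

/-- A word is non-increasing if each letter is at least as large as the next one. -/
def IsNonIncreasing {I : Type u} [LinearOrder I] (w : Word I) : Prop := w.Pairwise (· ≥ ·)

/-- The component in `ℕ^I` of the degree of a word. -/
def wordDegree {I : Type u} [DecidableEq I] (w : Word I) : I → ℕ :=
  fun i => (w.map Letter.vertex).count i

section Words

variable {I : Type u} [Fintype I] [LinearOrder I] [Quiver.{v} I] [∀ i j : I, Fintype (i ⟶ j)]

/-- `e_w = e_{i_1,d_1} * … * e_{i_n,d_n}` for `w = [i_1^(d_1) … i_n^(d_n)]`, where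
`e_{i,d} = z_{i1}^d`. -/
def eWord : Word I → Graded I
  | [] => shuffleOne
  | l :: w => shuffleMul (oneVar l.vertex l.exponent) (eWord w)

/-- `f_w = f_{i_1,-d_1} * … * f_{i_n,-d_n}` for `w = [i_1^(d_1) … i_n^(d_n)]`, where
`f_{i,d} = z_{i1}^d` and the product is the opposite one. -/
def fWord : Word I → Graded I
  | [] => shuffleOne
  | l :: w => shuffleOpMul (oneVar l.vertex (-l.exponent)) (fWord w)

/-- A word `v` is standard if `e_v` is not a linear combination of the `e_w` with `w > v`. -/
def IsStandard (v : Word I) : Prop :=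
  eWord v ∉ Submodule.span (GroundField I) (eWord '' {w : Word I | w > v})

end Words

/-! ### The graph and the pieces of the decomposition -/

/-- The edges `d ⟶ d'` between non-decreasing `n`-tuples of integers, with `m = 2 |E|`. -/
def ExponentEdge (m : ℤ) {n : ℕ} (d d' : Fin n →o ℤ) : Prop :=
  ∃ σ : Equiv.Perm (Fin n), σ ≠ 1 ∧ ∃ c : Fin n → Fin n → ℤ,
    (∀ a b, a < b → σ b < σ a → -m ≤ c a b) ∧
    ∀ a, d' a = d (σ a) - (∑ s with s < a ∧ σ a < σ s, c s a) + ∑ t with a < t ∧ σ t < σ a, c a t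

section Pieces

variable {I : Type u} [Fintype I] [LinearOrder I] [Quiver.{v} I] [∀ i j : I, Fintype (i ⟶ j)]

/-- The graph `G` on the non-decreasing `n`-tuples of integers. -/
def exponentGraph (I : Type u) [Fintype I] [Quiver.{v} I] [∀ i j : I, Fintype (i ⟶ j)] (n : ℕ) :
    SimpleGraph (Fin n →o ℤ) :=
  SimpleGraph.fromRel (ExponentEdge (2 * (Fintype.card (Edge I) : ℤ)))

/-- The sequence of exponents of `w` is a vertex of the connected component `H`; in particular it
is non-decreasing and the length of `w` is `n`. -/
def ExponentsIn {n : ℕ} (H : (exponentGraph I n).ConnectedComponent) (w : Word I) : Prop :=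
  ∃ d : Fin n →o ℤ, w.map Letter.exponent = List.ofFn d ∧
    (exponentGraph I n).connectedComponentMk d = H

/-- `𝒮_H`: the span of the `e_w`, `w` non-increasing with exponents in `H`. -/
def ePiece {n : ℕ} (H : (exponentGraph I n).ConnectedComponent) :
    Submodule (GroundField I) (Graded I) :=
  Submodule.span (GroundField I) (eWord '' {w : Word I | IsNonIncreasing w ∧ ExponentsIn H w})

/-- `𝒮^op_H`: the span of the `f_w`, `w` non-increasing with exponents in `H`. -/
def fPiece {n : ℕ} (H : (exponentGraph I n).ConnectedComponent) :
    Submodule (GroundField I) (Graded I) :=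
  Submodule.span (GroundField I) (fWord '' {w : Word I | IsNonIncreasing w ∧ ExponentsIn H w})

/-- The subspace `T` is the direct sum of the lines `𝔽 · g w`, for `w ∈ A`, and the `g w` are
non-zero. -/
def IsDirectSumOfLines (T : Submodule (GroundField I) (Graded I)) (g : Word I → Graded I)
    (A : Set (Word I)) : Prop :=
  LinearIndepOn (GroundField I) g A ∧ Submodule.span (GroundField I) (g '' A) = T

end Pieces

/-! ### The pairing -/

/-- The field of iterated Laurent series in `z_1, …, z_n`, expanded in the region
`|z_1| ≪ … ≪ |z_n|`: Hahn series with exponents in `ℤ^n`, ordered lexicographically, so that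
`z_a / z_b` is infinitesimal for `a < b`. -/
abbrev IterLaurent (I : Type u) [Quiver.{v} I] (n : ℕ) : Type (max u v) :=
  HahnSeries (Lex (Fin n → ℤ)) (GroundField I)

/-- The variable `z_a`. -/
def iterVar {I : Type u} [Quiver.{v} I] {n : ℕ} (a : Fin n) : IterLaurent I n :=
  HahnSeries.single (toLex (Pi.single a 1)) 1

/-- The variable `z_a` plugged into the variable of index `(i, k)`, for a word
`w = [i_1^(d_1) … i_n^(d_n)]`: here `a` is the `k`-th position (counted from `0`) with `i_a = i`.
The value `1` is used for the indices that do not occur in functions of the degree of `w`. -/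
def plugIn {I : Type u} [DecidableEq I] [Quiver.{v} I] (w : Word I) (p : Var I) :
    IterLaurent I w.length :=
  match ((List.finRange w.length).filter fun a => (w.get a).vertex = p.1)[p.2]? with
  | some a => iterVar a
  | none => 1

/-- For `w = [i_1^(d_1) … i_n^(d_n)]`, the iterated residue
`∫_{|z_1| ≪ … ≪ |z_n|} z_1^{-d_1} … z_n^{-d_n} P(z_1, …, z_n) / ∏_{a < b} ζ_{i_a i_b}(z_a / z_b)
∏_a dz_a / (2πi z_a)`, that is, the constant term of the expansion of the integrand. -/
def residuePairing {I : Type u} [DecidableEq I] [Quiver.{v} I] [∀ i j : I, Fintype (i ⟶ j)]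
    (P : LaurentPoly I) (w : Word I) : GroundField I :=
  ((∏ a : Fin w.length, (iterVar a : IterLaurent I w.length) ^ (-(w.get a).exponent)) *
      evalAt (plugIn w) P /
    ∏ a : Fin w.length, ∏ b ∈ Finset.Ioi a,
      zeta (w.get a).vertex (w.get b).vertex
        ((iterVar a : IterLaurent I w.length) / iterVar b)).coeff 0

end

end QuiverShuffle

open QuiverShuffle

/-! The theorem rests on one analytic fact and one counting fact about the iterated residue; the
remainder is linear algebra.

The analytic fact is that `residuePairing P w` depends linearly on the function f_w alone, so that
it descends to a pairing with 𝒮^op (`sum_residuePairing_eq_zero`). On the contour |z_1| ≪ … ≪ |z_n|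
the word enters through the order of the variables. Each variable is therefore moved to a common
contour |z_1| = … = |z_n| with |q|, |t_e|, |q/t_e| < 1. Algebraically this contour is the Hahn field
`ClusterField`, where q and t_e carry weights 2 and 1 in a dominating small variable T. After
earlier moves the points form strings y, qy, …, q^r y. A moving variable z meets the poles z = q x
and, for x not at the bottom of its string, z = x/t_e and z = t_e x/q. The wheel conditions kill the
residues at the edge poles. The zero of 1/ζ_ii on the diagonal kills z = q x unless x is the top of
its string. So a move either adds a new one-point string or lengthens an old string
(`coeff_zero_move`). The outcome is `clusterSum_eq`: the residue is a sum, over configurations of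
strings, of values of P times a symmetric weight times f_w.

The counting fact concerns ⟨e_v, f_w⟩. Expanding e_v divided by the kernel yields, for each
inversion, a factor ζ(z_b/z_a)/ζ(z_a/z_b) with a < b, whose exponents as a series in z_a/z_b are at
least -2|E|. Hence the pairing of non-increasing words vanishes unless their exponents are equal or
joined by an edge of G (`exists_exponent_relation`). Components of G are finite, because a quadratic
lower bound for the sums of the first k exponents survives along edges (`le_prefixSum_edge`,
`finite_supp`).

For the linear algebra, packaged in `IsTriangularPairing`, the quadratic relations write e_w, for w
not non-increasing, through larger words. The words on which a given R does not vanish have a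
largest element in every non-empty subset, so R is determined by its pairing with the non-increasing
f_w. Thus 𝒮_H pairs with 𝒮^op_H without left kernel. The semilinear involution z ↦ 1/z, t_e ↦ q/t_e
exchanges e_w and f_w, so both sides have the same finite dimension and the pairing is perfect. Each
R meets only finitely many non-increasing words, so subtracting representatives from finitely many
blocks exhausts it and 𝒮 is the sum of the 𝒮_H. Standardness can be tested inside one finite block,
which gives the bases and, by inverting finite blocks, the dual bases.

That e_w lies in 𝒮 has two reasons: symmetrization cancels the diagonal poles
(`exists_laurent_symRec`), and the three points of a wheel form a cycle of zeros of ζ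
(`symRec_eq_zero_of_cycle`). -/

namespace QuiverShuffle

noncomputable section

universe u v

set_option linter.unusedSectionVars false
set_option linter.unusedVariables false

/-! ### Evaluation of Laurent polynomials -/

section LaurentEval

variable {k σ B B' : Type*} [CommRing k] [CommRing B] [Algebra k B] [CommRing B'] [Algebra k B']

/-- The evaluation of Laurent polynomials at a family of units. -/
def laurentEval (k : Type*) [CommRing k] [Algebra k B] (x : σ → Bˣ) :
    AddMonoidAlgebra k (σ →₀ ℤ) →ₐ[k] B :=
  AddMonoidAlgebra.lift k B (σ →₀ ℤ)
    { toFun := fun m => ((m.toAdd.prod fun p e => x p ^ e : Bˣ) : B)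
      map_one' := by simp
      map_mul' := by
        intro a b
        rw [← Units.val_mul, toAdd_mul,
          Finsupp.prod_add_index' (by simp) (by intro p e e'; exact zpow_add _ _ _)] }

lemma laurentEval_apply (x : σ → Bˣ) (P : AddMonoidAlgebra k (σ →₀ ℤ)) :
    laurentEval k x P = P.coeff.sum fun m c => c • ((m.prod fun p e => x p ^ e : Bˣ) : B) := by
  rw [laurentEval, AddMonoidAlgebra.lift_apply]
  rfl

lemma laurentEval_single (x : σ → Bˣ) (m : σ →₀ ℤ) (c : k) :
    laurentEval k x (.single m c) = c • ((m.prod fun p e => x p ^ e : Bˣ) : B) := by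
  rw [laurentEval, AddMonoidAlgebra.lift_single]
  rfl

/-- The variable of index `p`, as a unit of the ring of Laurent polynomials. -/
def laurentVar (k : Type*) [CommRing k] (p : σ) : (AddMonoidAlgebra k (σ →₀ ℤ))ˣ where
  val := .single (Finsupp.single p 1) 1
  inv := .single (Finsupp.single p (-1)) 1
  val_inv := by
    rw [AddMonoidAlgebra.single_mul_single, ← Finsupp.single_add]; simp; rfl
  inv_val := by
    rw [AddMonoidAlgebra.single_mul_single, ← Finsupp.single_add]; simp; rfl

@[simp] lemma laurentEval_laurentVar (x : σ → Bˣ) (p : σ) :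
    laurentEval k x (laurentVar k p) = x p := by
  simp [laurentVar, laurentEval_single]

lemma map_laurentEval (f : B →ₐ[k] B') (x : σ → Bˣ) (P : AddMonoidAlgebra k (σ →₀ ℤ)) :
    f (laurentEval k x P) = laurentEval k (fun p => Units.map (f : B →* B') (x p)) P := by
  rw [laurentEval_apply, laurentEval_apply, map_finsuppSum]
  refine Finsupp.sum_congr fun m _ => ?_
  rw [map_smul]
  congr 1
  simp only [Finsupp.prod, ← map_zpow, ← map_prod]
  rfl

/-- Clearing denominators by a monomial, which is a unit; this reduces statements on Laurent
polynomials to polynomials. -/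
lemma exists_laurent_mul_eq_polynomial (P : AddMonoidAlgebra k (σ →₀ ℤ)) :
    ∃ (m : σ →₀ ℤ) (p : MvPolynomial σ k),
      P * .single m 1 = MvPolynomial.aeval
        (fun q => ((laurentVar k q : (AddMonoidAlgebra k (σ →₀ ℤ))ˣ) :
          AddMonoidAlgebra k (σ →₀ ℤ))) p := by
  have mono : ∀ m : σ →₀ ℕ, MvPolynomial.aeval
        (fun q => ((laurentVar k q : (AddMonoidAlgebra k (σ →₀ ℤ))ˣ) :
          AddMonoidAlgebra k (σ →₀ ℤ))) (MvPolynomial.monomial m (1 : k)) =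
        .single (m.mapRange (fun a : ℕ => (a : ℤ)) rfl) 1 := by
    intro m
    induction m using Finsupp.induction_linear with
    | zero => simp; rfl
    | add a b ha hb =>
      rw [← one_mul (1 : k), ← MvPolynomial.monomial_mul, map_mul, ha, hb,
        AddMonoidAlgebra.single_mul_single, Finsupp.mapRange_add (by simp)]
    | single q n =>
      rw [MvPolynomial.aeval_monomial]
      simp only [map_one, one_mul, laurentVar, pow_zero, Finsupp.prod_single_index]
      rw [AddMonoidAlgebra.single_pow]
      simp
  induction P using AddMonoidAlgebra.induction_linear with
  | zero => exact ⟨0, 0, by simp⟩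
  | add P P' h h' =>
    obtain ⟨m, p, hp⟩ := h
    obtain ⟨m', p', hp'⟩ := h'
    let pos : (σ →₀ ℤ) → (σ →₀ ℕ) := fun m => m.mapRange Int.toNat rfl
    -- The positive and negative parts of m - m' bring the two denominators to a common one.
    have key : ∀ m : σ →₀ ℤ, ∃ a b : σ →₀ ℕ,
        m = a.mapRange (fun a : ℕ => (a : ℤ)) rfl - b.mapRange (fun a : ℕ => (a : ℤ)) rfl := by
      intro m
      refine ⟨m.mapRange Int.toNat rfl, (-m).mapRange Int.toNat rfl, ?_⟩
      ext q
      simp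
    obtain ⟨a, b, hab⟩ := key (m - m')
    have hm : m + b.mapRange (fun a : ℕ => (a : ℤ)) rfl =
        m' + a.mapRange (fun a : ℕ => (a : ℤ)) rfl := by
      rw [sub_eq_iff_eq_add] at hab
      rw [hab]; abel
    refine ⟨m + b.mapRange (fun a : ℕ => (a : ℤ)) rfl,
      p * MvPolynomial.monomial b 1 + p' * MvPolynomial.monomial a 1, ?_⟩
    rw [add_mul, map_add, map_mul, map_mul, mono, mono, ← hp, ← hp', mul_assoc, mul_assoc,
      AddMonoidAlgebra.single_mul_single, AddMonoidAlgebra.single_mul_single, hm, one_mul]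
  | single m c =>
    refine ⟨-m, MvPolynomial.C c, ?_⟩
    rw [AddMonoidAlgebra.single_mul_single, MvPolynomial.aeval_C]
    simp

/-- After multiplication by a monomial an element of the kernel is a polynomial relation between the
x_p, hence zero, and the monomial can be cancelled. -/
lemma laurentEval_injective_of_algebraicIndependent {x : σ → Bˣ}
    (hx : AlgebraicIndependent k fun p => (x p : B)) :
    Function.Injective (laurentEval k x) := by
  rw [injective_iff_map_eq_zero]
  intro P hP
  obtain ⟨m, p, hp⟩ := exists_laurent_mul_eq_polynomial P
  have h1 := congrArg (laurentEval k x) hp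
  rw [map_mul, hP, zero_mul, MvPolynomial.comp_aeval_apply] at h1
  have h2 : MvPolynomial.aeval (fun p => (x p : B)) p = 0 := by
    simpa using h1.symm
  have h3 : p = 0 := by
    exact (injective_iff_map_eq_zero _).1 hx p h2
  rw [h3, map_zero] at hp
  have h4 := congrArg (· * AddMonoidAlgebra.single (-m) (1 : k)) hp
  simpa [mul_assoc, AddMonoidAlgebra.single_mul_single, ← AddMonoidAlgebra.one_def] using h4

end LaurentEval

/-! ### Evaluation at points with non-zero coordinates. -/

section EvalAt

variable {I : Type u} [Quiver.{v} I] {A : Type*} [Field A] [Algebra (GroundField I) A]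

lemma evalAt_eq_laurentEval (x : Var I → A) (hx : ∀ p, x p ≠ 0) (P : LaurentPoly I) :
    evalAt x P = laurentEval (GroundField I) (fun p => Units.mk0 (x p) (hx p)) P := by
  rw [laurentEval_apply, evalAt]
  refine Finsupp.sum_congr fun m _ => ?_
  congr 1
  simp [Finsupp.prod]

lemma zVar_ne_zero (p : Var I) : (zVar p : RatFun I) ≠ 0 := by
  rw [zVar, Ne, map_eq_zero_iff _ (IsFractionRing.injective _ _)]
  exact MvPolynomial.X_ne_zero p

lemma zVar_injective : Function.Injective (zVar : Var I → RatFun I) :=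
  (IsFractionRing.injective (MvPolynomial (Var I) (GroundField I)) (RatFun I)).comp
    (MvPolynomial.X_injective (R := GroundField I))

lemma algebraicIndependent_zVar :
    AlgebraicIndependent (GroundField I) (zVar : Var I → RatFun I) := by
  have h := (MvPolynomial.algebraicIndependent_X (Var I) (GroundField I)).map'
    (f := IsScalarTower.toAlgHom (GroundField I) (MvPolynomial (Var I) (GroundField I)) (RatFun I))
    (IsFractionRing.injective _ _)
  exact h

/-- An identity checked among rational functions is thereby an identity of Laurent polynomials, and
can then be specialized at any point with non-zero coordinates, in any field over 𝔽. -/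
lemma evalAt_zVar_injective : Function.Injective (evalAt (zVar : Var I → RatFun I)) := by
  intro P P' h
  rw [evalAt_eq_laurentEval _ zVar_ne_zero, evalAt_eq_laurentEval _ zVar_ne_zero] at h
  exact laurentEval_injective_of_algebraicIndependent (by simpa using algebraicIndependent_zVar) h

lemma evalAt_mul {x : Var I → A} (hx : ∀ p, x p ≠ 0) (P P' : LaurentPoly I) :
    evalAt x (P * P') = evalAt x P * evalAt x P' := by
  simp only [evalAt_eq_laurentEval x hx, map_mul]

lemma evalAt_one (x : Var I → A) : evalAt x 1 = 1 := by
  simp [evalAt, AddMonoidAlgebra.one_def]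

lemma evalAt_sum {x : Var I → A} {ι : Type*} (s : Finset ι) (P : ι → LaurentPoly I) :
    evalAt x (∑ a ∈ s, P a) = ∑ a ∈ s, evalAt x (P a) := by
  classical
  induction s using Finset.induction_on with
  | empty => simp [evalAt_zero]
  | insert a s ha ih => rw [Finset.sum_insert ha, Finset.sum_insert ha, evalAt_add, ih]

lemma evalAt_prod {x : Var I → A} (hx : ∀ p, x p ≠ 0) {ι : Type*} (s : Finset ι)
    (P : ι → LaurentPoly I) :
    evalAt x (∏ a ∈ s, P a) = ∏ a ∈ s, evalAt x (P a) := by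
  simp only [evalAt_eq_laurentEval x hx, map_prod]

lemma evalAt_neg (x : Var I → A) (P : LaurentPoly I) : evalAt x (-P) = - evalAt x P := by
  rw [eq_neg_iff_add_eq_zero, ← evalAt_add, neg_add_cancel, evalAt_zero]

lemma evalAt_sub (x : Var I → A) (P P' : LaurentPoly I) :
    evalAt x (P - P') = evalAt x P - evalAt x P' := by
  rw [sub_eq_add_neg, sub_eq_add_neg, evalAt_add, evalAt_neg]

/-- The Laurent polynomial `z_p`. -/
abbrev lVar (p : Var I) : (LaurentPoly I)ˣ := laurentVar (GroundField I) p

lemma evalAt_lVar_zpow {x : Var I → A} (hx : ∀ p, x p ≠ 0) (p : Var I) (d : ℤ) :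
    evalAt x ((lVar p ^ d : (LaurentPoly I)ˣ) : LaurentPoly I) = x p ^ d := by
  rw [evalAt_eq_laurentEval x hx, ← AlgHom.coe_toMonoidHom, ← Units.coe_map, map_zpow]
  have : Units.map (laurentEval (GroundField I) fun p => Units.mk0 (x p) (hx p)).toMonoidHom
      (lVar p) = Units.mk0 (x p) (hx p) := by
    ext; simp
  erw [this]
  simp

lemma evalAt_lVar {x : Var I → A} (hx : ∀ p, x p ≠ 0) (p : Var I) :
    evalAt x (lVar p : LaurentPoly I) = x p := by
  simpa using evalAt_lVar_zpow hx p 1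

/-- Substitution of units for the variables of a Laurent polynomial. -/
def laurentSubst (y : Var I → (LaurentPoly I)ˣ) : LaurentPoly I →ₐ[GroundField I] LaurentPoly I :=
  laurentEval (GroundField I) y

lemma evalAt_laurentSubst {x : Var I → A} (hx : ∀ p, x p ≠ 0) (y : Var I → (LaurentPoly I)ˣ)
    (P : LaurentPoly I) :
    evalAt x (laurentSubst y P) = evalAt (fun p => evalAt x (y p : LaurentPoly I)) P := by
  have hy : ∀ p, evalAt x (y p : LaurentPoly I) ≠ 0 := by
    intro p
    rw [evalAt_eq_laurentEval x hx]
    exact (Units.map (laurentEval (GroundField I) fun p => Units.mk0 (x p) (hx p)).toMonoidHom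
      (y p)).ne_zero
  rw [evalAt_eq_laurentEval x hx, laurentSubst, map_laurentEval, evalAt_eq_laurentEval _ hy]
  congr 2
  ext p
  simp [evalAt_eq_laurentEval x hx]

/-- The unit `c z_p` of the ring of Laurent polynomials. -/
def scaledVar (c : (GroundField I)ˣ) (p : Var I) : (LaurentPoly I)ˣ :=
  Units.map (algebraMap (GroundField I) (LaurentPoly I)).toMonoidHom c * lVar p

lemma evalAt_scaledVar {x : Var I → A} (hx : ∀ p, x p ≠ 0) (c : (GroundField I)ˣ) (p : Var I) :
    evalAt x (scaledVar c p : LaurentPoly I) = (c : GroundField I) • x p := by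
  have h : (scaledVar c p : LaurentPoly I) = (c : GroundField I) • (lVar p : LaurentPoly I) := by
    rw [Algebra.smul_def]; rfl
  rw [h, evalAt_smul, evalAt_lVar hx]

/-- An identity `evalAt (c_p z_{π p}) P = evalAt (c'_p z_{π' p}) P'` between Laurent polynomials
holds at all non-zero points as soon as it holds for the variables. -/
lemma evalAt_scaled_eq_of_zVar {c c' : Var I → GroundField I} (hc : ∀ p, c p ≠ 0)
    (hc' : ∀ p, c' p ≠ 0) {π π' : Var I → Var I} {P P' : LaurentPoly I}
    (h : evalAt (fun p => c p • (zVar (π p) : RatFun I)) P =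
      evalAt (fun p => c' p • (zVar (π' p) : RatFun I)) P')
    {x : Var I → A} (hx : ∀ p, x p ≠ 0) :
    evalAt (fun p => c p • x (π p)) P = evalAt (fun p => c' p • x (π' p)) P' := by
  have key : laurentSubst (fun p => scaledVar (Units.mk0 (c p) (hc p)) (π p)) P =
      laurentSubst (fun p => scaledVar (Units.mk0 (c' p) (hc' p)) (π' p)) P' := by
    apply evalAt_zVar_injective
    rw [evalAt_laurentSubst zVar_ne_zero, evalAt_laurentSubst zVar_ne_zero]
    simpa only [evalAt_scaledVar zVar_ne_zero, Units.val_mk0] using h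
  have h2 := congrArg (evalAt x) key
  rw [evalAt_laurentSubst hx, evalAt_laurentSubst hx] at h2
  simpa only [evalAt_scaledVar hx, Units.val_mk0] using h2

lemma qPar_ne_zero : qPar I ≠ 0 := by
  rw [qPar, Ne, map_eq_zero_iff _ (IsFractionRing.injective _ _)]
  exact MvPolynomial.X_ne_zero _

lemma tPar_ne_zero {i j : I} (e : i ⟶ j) : tPar e ≠ 0 := by
  rw [tPar, Ne, map_eq_zero_iff _ (IsFractionRing.injective _ _)]
  exact MvPolynomial.X_ne_zero _

lemma evalAt_congr_of_inVariables {n : I → ℕ} {P : LaurentPoly I} (hP : InVariables n P)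
    {x x' : Var I → A} (h : ∀ p : Var I, p.2 < n p.1 → x p = x' p) : evalAt x P = evalAt x' P := by
  refine Finsupp.sum_congr fun m hm => ?_
  congr 1
  refine Finsupp.prod_congr fun p hp => ?_
  rw [h p (hP m (Finsupp.mem_support_iff.1 hm) p (Finsupp.mem_support_iff.1 hp))]

lemma IsSymmetric.evalAt_perm {n : I → ℕ} {P : LaurentPoly I} (hP : IsSymmetric n P)
    (σ : ∀ i, Equiv.Perm (Fin (n i))) {x : Var I → A} (hx : ∀ p, x p ≠ 0) :
    evalAt (fun p => x (permVar n σ p)) P = evalAt x P := by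
  have := evalAt_scaled_eq_of_zVar (A := A) (c := fun _ => 1) (c' := fun _ => 1) (by simp) (by simp)
    (π := permVar n σ) (π' := id) (P := P) (P' := P) (by simpa using hP σ) hx
  simpa using this

/-- Vanishing at the generic point of a wheel is an identity of Laurent polynomials after
substitution, so it persists at every non-zero point of that wheel. The wheel conditions can thus be
used inside fields of series. -/
lemma evalAt_update_update_eq_zero [DecidableEq I] {P : LaurentPoly I} {p p' r : Var I}
    {c c' : GroundField I} (hc : c ≠ 0) (hc' : c' ≠ 0)
    (h : evalAt (Function.update (Function.update (zVar : Var I → RatFun I) p (c • zVar r))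
      p' (c' • zVar r)) P = 0)
    {x : Var I → A} (hx : ∀ p, x p ≠ 0) (hxp : x p = c • x r) (hxp' : x p' = c' • x r) :
    evalAt x P = 0 := by
  have := evalAt_scaled_eq_of_zVar (A := A)
    (c := fun s => if s = p' then c' else if s = p then c else 1) (c' := fun _ => 1)
    (by intro s; split_ifs <;> simp [hc, hc']) (by simp)
    (π := fun s => if s = p' then r else if s = p then r else s) (π' := id) (P := P) (P' := 0)
    (by
      rw [evalAt_zero, ← h]
      congr 1
      ext s
      simp only [Function.update_apply]
      split_ifs <;> simp) hx
  rw [evalAt_zero] at this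
  rw [← this]
  congr 1
  ext s
  split_ifs with h2 h3
  · rw [h2, hxp']
  · rw [h3, hxp]
  · simp

/-- The first wheel condition at an arbitrary point. -/
lemma WheelConditions.eval_fst [DecidableEq I] {n : I → ℕ} {P : LaurentPoly I}
    (hP : WheelConditions n P) {x : Var I → A} (hx : ∀ p, x p ≠ 0) {i j : I} (e : i ⟶ j)
    {a b c : ℕ} (ha : a < n i) (hb : b < n j) (hc : c < n i) (hac : a ≠ c)
    (hij : i = j → a ≠ b ∧ b ≠ c) (h1 : x (i, a) = (qPar I / tPar e) • x (j, b))
    (h2 : x (i, c) = (tPar e)⁻¹ • x (j, b)) : evalAt x P = 0 := by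
  exact evalAt_update_update_eq_zero (div_ne_zero qPar_ne_zero (tPar_ne_zero e))
    (inv_ne_zero (tPar_ne_zero e)) ((hP i j e).1 a b c ha hb hc hac hij) hx h1 h2

/-- The second wheel condition at an arbitrary point. -/
lemma WheelConditions.eval_snd [DecidableEq I] {n : I → ℕ} {P : LaurentPoly I}
    (hP : WheelConditions n P) {x : Var I → A} (hx : ∀ p, x p ≠ 0) {i j : I} (e : i ⟶ j)
    {a b c : ℕ} (ha : a < n j) (hb : b < n i) (hc : c < n j) (hac : a ≠ c)
    (hij : i = j → a ≠ b ∧ b ≠ c) (h1 : x (j, a) = tPar e • x (i, b))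
    (h2 : x (j, c) = (tPar e / qPar I) • x (i, b)) : evalAt x P = 0 := by
  exact evalAt_update_update_eq_zero (tPar_ne_zero e)
    (div_ne_zero (tPar_ne_zero e) qPar_ne_zero) ((hP i j e).2 a b c ha hb hc hac hij) hx h1 h2

end EvalAt

/-! ### The poles of `1 / ζ` -/

section Poles

variable (I : Type u) [Quiver.{v} I]

/-- The linear factors in the numerators of the functions `ζ_{ij}`. -/
abbrev Pole : Type (max u v) := Option (Edge I × Bool)

variable {I}

/-- The constant `α` in the factor `1 - α x`. -/
def poleConst : Pole I → GroundField I
  | none => (qPar I)⁻¹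
  | some (e, false) => tPar e.2.2
  | some (e, true) => qPar I / tPar e.2.2

/-- The factor of index `o` occurs in `ζ_{ij}`. -/
def IsPole (i j : I) : Pole I → Prop
  | none => i = j
  | some (e, false) => e.1 = i ∧ e.2.1 = j
  | some (e, true) => e.1 = j ∧ e.2.1 = i

lemma poleConst_ne_zero (o : Pole I) : poleConst o ≠ 0 := by
  rcases o with _ | ⟨e, _ | _⟩
  · exact inv_ne_zero qPar_ne_zero
  · exact tPar_ne_zero _
  · exact div_ne_zero qPar_ne_zero (tPar_ne_zero _)

lemma algebraicIndependent_par :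
    AlgebraicIndependent ℚ fun o : Option (Edge I) =>
      (algebraMap (MvPolynomial (Option (Edge I)) ℚ) (GroundField I) (MvPolynomial.X o)) :=
  (MvPolynomial.algebraicIndependent_X (Option (Edge I)) ℚ).map'
    (f := IsScalarTower.toAlgHom ℚ (MvPolynomial (Option (Edge I)) ℚ) (GroundField I))
    (IsFractionRing.injective _ _)

/-- The parameters, as units of the ground field. -/
def parUnit (o : Option (Edge I)) : (GroundField I)ˣ :=
  Units.mk0 (algebraMap (MvPolynomial (Option (Edge I)) ℚ) (GroundField I) (MvPolynomial.X o)) (by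
    rw [Ne, map_eq_zero_iff _ (IsFractionRing.injective _ _)]
    exact MvPolynomial.X_ne_zero _)

/-- Distinct monomials in the parameters are distinct. -/
lemma parUnit_monomial_injective :
    Function.Injective fun m : Option (Edge I) →₀ ℤ => m.prod fun p e => parUnit p ^ e := by
  intro m m' h
  have h1 : laurentEval ℚ (B := GroundField I) parUnit (.single m 1) =
      laurentEval ℚ parUnit (.single m' 1) := by
    rw [laurentEval_single, laurentEval_single]
    exact congrArg _ (congrArg Units.val h)
  have h2 := laurentEval_injective_of_algebraicIndependent (k := ℚ) (x := parUnit (I := I))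
    algebraicIndependent_par h1
  exact (AddMonoidAlgebra.single_left_inj one_ne_zero).1 h2

open Classical in
/-- The exponents of the monomial `α_o`. -/
def poleExp : Pole I → Option (Edge I) →₀ ℤ
  | none => Finsupp.single none (-1)
  | some (e, false) => Finsupp.single (some e) 1
  | some (e, true) => Finsupp.single none 1 + Finsupp.single (some e) (-1)

lemma poleConst_mul_zpow (o : Pole I) (r : ℤ) :
    poleConst o * qPar I ^ r =
      (((poleExp o + Finsupp.single none r).prod fun p e => parUnit p ^ e : (GroundField I)ˣ) :
        GroundField I) := by
  rw [Finsupp.prod_add_index' (by simp) (by intro p e e'; exact zpow_add _ _ _)]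
  rcases o with _ | ⟨e, _ | _⟩
  · simp [poleExp, poleConst, parUnit, qPar, -Finsupp.single_neg]
  · simp [poleExp, poleConst, parUnit, qPar, tPar]
  · rw [poleExp, Finsupp.prod_add_index' (by simp) (by intro p e e'; exact zpow_add _ _ _)]
    simp [poleConst, parUnit, qPar, tPar, div_eq_mul_inv, -Finsupp.single_neg]

/-- The exponents of the t_e in the monomial α_o (none, +1 or -1 at one edge) determine o, and then
the power of q determines r. This genericity of the parameters is what keeps all poles simple later
on. -/
lemma poleConst_mul_zpow_inj {o o' : Pole I} {r r' : ℤ}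
    (h : poleConst o * qPar I ^ r = poleConst o' * qPar I ^ r') : o = o' ∧ r = r' := by
  rw [poleConst_mul_zpow, poleConst_mul_zpow, Units.val_inj] at h
  have h1 := parUnit_monomial_injective h
  have h2 : ∀ p : Option (Edge I), (poleExp o + Finsupp.single none r : Option (Edge I) →₀ ℤ) p = (poleExp o' + Finsupp.single none r' : Option (Edge I) →₀ ℤ) p :=
    fun p => by rw [h1]
  classical
  have hoo : o = o' := by
    rcases o with _ | ⟨e, _ | _⟩ <;> rcases o' with _ | ⟨e', _ | _⟩
    · rfl
    · have := h2 (some e'); simp [poleExp] at this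
    · have := h2 (some e'); simp [poleExp] at this
    · have := h2 (some e); simp [poleExp] at this
    · have := h2 (some e)
      by_cases he : e' = e
      · rw [he]
      · simp [poleExp, he] at this
    · have := h2 (some e)
      by_cases he : e' = e
      · simp [poleExp, he] at this
      · simp [poleExp, he] at this
    · have := h2 (some e); simp [poleExp] at this
    · have := h2 (some e)
      by_cases he : e' = e
      · simp [poleExp, he] at this
      · simp [poleExp, he] at this
    · have := h2 (some e)
      by_cases he : e' = e
      · rw [he]
      · simp [poleExp, he] at this
  subst hoo
  refine ⟨rfl, ?_⟩
  have := h2 none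
  simpa using this

variable [Fintype I] [DecidableEq I] [∀ i j : I, Fintype (i ⟶ j)]

open Classical in
/-- The indices of the factors of `ζ_{ij}`. -/
def poles (i j : I) : Finset (Pole I) := Finset.univ.filter (IsPole i j)

lemma mem_poles {i j : I} {o : Pole I} : o ∈ poles i j ↔ IsPole i j o := by
  simp [poles]

/-- The factor 1 - x/q and the edge factors are put on the same footing, so that `poles i j` lists
all the poles of 1/ζ. -/
lemma zeta_eq {A : Type*} [Field A] [Algebra (GroundField I) A] (i j : I) (x : A) :
    zeta i j x = (∏ o ∈ poles i j, (1 - algebraMap (GroundField I) A (poleConst o) * x)) *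
      (if i = j then (1 - x)⁻¹ else 1) := by
  classical
  have h : poles i j = ((if i = j then {none} else ∅) : Finset (Pole I)) ∪
      ((Finset.univ : Finset (i ⟶ j)).image (fun e => some (⟨i, j, e⟩, false)) ∪
        (Finset.univ : Finset (j ⟶ i)).image (fun e => some (⟨j, i, e⟩, true))) := by
    ext o
    rw [mem_poles]
    rcases o with _ | ⟨⟨i', j', e⟩, _ | _⟩
    · by_cases hij : i = j <;> simp [IsPole, hij]
    · have : (some ((⟨i', j', e⟩ : Edge I), false) : Pole I) ∉
          ((if i = j then {none} else ∅) : Finset (Pole I)) := by split_ifs <;> simp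
      simp only [Finset.mem_union, this, IsPole, Finset.mem_image]
      constructor
      · rintro ⟨rfl, rfl⟩
        simp
      · rintro (h | ⟨e', -, h⟩ | ⟨e', -, h⟩)
        · exact h.elim
        · simp only [Option.some.injEq, Prod.mk.injEq, Sigma.mk.injEq] at h
          exact ⟨h.1.1.symm, by
            obtain ⟨⟨rfl, h⟩, -⟩ := h
            simp only [heq_eq_eq, Sigma.mk.injEq] at h
            exact h.1.symm⟩
        · simp at h
    · have : (some ((⟨i', j', e⟩ : Edge I), true) : Pole I) ∉
          ((if i = j then {none} else ∅) : Finset (Pole I)) := by split_ifs <;> simp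
      simp only [Finset.mem_union, this, IsPole, Finset.mem_image]
      constructor
      · rintro ⟨rfl, rfl⟩
        simp
      · rintro (h | ⟨e', -, h⟩ | ⟨e', -, h⟩)
        · exact h.elim
        · simp at h
        · simp only [Option.some.injEq, Prod.mk.injEq, Sigma.mk.injEq] at h
          exact ⟨h.1.1.symm, by
            obtain ⟨⟨rfl, h⟩, -⟩ := h
            simp only [heq_eq_eq, Sigma.mk.injEq] at h
            exact h.1.symm⟩
  rw [h, Finset.prod_union, Finset.prod_union, Finset.prod_image, Finset.prod_image, zeta]
  · have h1 : (∏ o ∈ ((if i = j then {none} else ∅) : Finset (Pole I)),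
        (1 - algebraMap (GroundField I) A (poleConst o) * x)) =
        if i = j then 1 - x * algebraMap (GroundField I) A (qPar I)⁻¹ else 1 := by
      split_ifs <;> simp [poleConst, mul_comm]
    rw [h1]
    simp only [poleConst]
    split_ifs <;> ring
  · intro e _ e' _ h; simpa using h
  · intro e _ e' _ h; simpa using h
  · rw [Finset.disjoint_left]
    intro o h1 h2
    simp only [Finset.mem_image] at h1 h2
    obtain ⟨e, -, rfl⟩ := h1
    simp at h2
  · rw [Finset.disjoint_left]
    intro o h1 h2
    split_ifs at h1
    · simp only [Finset.mem_singleton] at h1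
      subst h1
      simp at h2
    · simp at h1

lemma map_zeta {A A' : Type*} [Field A] [Field A'] [Algebra (GroundField I) A]
    [Algebra (GroundField I) A'] (f : A →ₐ[GroundField I] A') (i j : I) (x : A) :
    f (zeta i j x) = zeta i j (f x) := by
  rw [zeta_eq, zeta_eq, map_mul, map_prod]
  simp only [map_sub, map_mul, map_one, AlgHom.commutes]
  split_ifs <;> simp

end Poles

/-! ### Recursive symmetrization -/

section SymRec

variable {I : Type u} {ι K : Type*} [DecidableEq ι] [DecidableEq I]

/-- The sum over all ways to distribute the elements of `s` over the letters of a word, in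
accordance with the vertices, of products of one weight `g` for each letter and one weight `k`
for each pair of letters. -/
def symRec [CommSemiring K] (col : ι → I) (g : Letter I → ι → K) (k : ι → ι → K) :
    Word I → Finset ι → K
  | [], s => if s = ∅ then 1 else 0
  | l :: w, s => ∑ a ∈ s with col a = l.vertex,
      g l a * (∏ b ∈ s.erase a, k a b) * symRec col g k w (s.erase a)

lemma map_symRec [CommSemiring K] {K' : Type*} [CommSemiring K'] (f : K →+* K') (col : ι → I)
    (g : Letter I → ι → K) (k : ι → ι → K) (w : Word I) (s : Finset ι) :
    f (symRec col g k w s) = symRec col (fun l a => f (g l a)) (fun a b => f (k a b)) w s := by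
  induction w generalizing s with
  | nil => simp only [symRec]; split_ifs <;> simp
  | cons l w ih => simp only [symRec, map_sum, map_mul, map_prod, ih]

lemma symRec_congr [CommSemiring K] {col col' : ι → I} {g g' : Letter I → ι → K} {k k' : ι → ι → K}
    {w : Word I} {s : Finset ι} (hcol : ∀ a ∈ s, col a = col' a)
    (hg : ∀ l, ∀ a ∈ s, g l a = g' l a)
    (hk : ∀ a ∈ s, ∀ b ∈ s, a ≠ b → k a b = k' a b) :
    symRec col g k w s = symRec col' g' k' w s := by
  induction w generalizing s with
  | nil => rfl
  | cons l w ih =>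
    simp only [symRec]
    have hf : (s.filter fun a => col a = l.vertex) = s.filter fun a => col' a = l.vertex :=
      Finset.filter_congr fun a ha => by rw [hcol a ha]
    rw [hf]
    refine Finset.sum_congr rfl fun a ha => ?_
    rw [Finset.mem_filter] at ha
    have hs := Finset.erase_subset a s
    rw [hg l a ha.1, ih (fun b hb => hcol b (hs hb)) (fun l b hb => hg l b (hs hb))
      (fun b hb c hc => hk b (hs hb) c (hs hc))]
    congr 2
    exact Finset.prod_congr rfl fun b hb =>
      hk a ha.1 b (hs hb) (Finset.ne_of_mem_erase hb).symm

lemma symRec_map [CommSemiring K] {ι' : Type*} [DecidableEq ι'] (θ : ι ↪ ι') (col : ι' → I)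
    (g : Letter I → ι' → K) (k : ι' → ι' → K) (w : Word I) (s : Finset ι) :
    symRec col g k w (s.map θ) =
      symRec (fun a => col (θ a)) (fun l a => g l (θ a)) (fun a b => k (θ a) (θ b)) w s := by
  induction w generalizing s with
  | nil => simp [symRec]
  | cons l w ih =>
    simp only [symRec, Finset.filter_map, Finset.sum_map]
    refine Finset.sum_congr rfl fun a _ => ?_
    rw [← Finset.map_erase, Finset.prod_map, ih]

/-- The symmetrization vanishes unless the vertices match. -/
lemma symRec_eq_zero [CommSemiring K] (col : ι → I) (g : Letter I → ι → K) (k : ι → ι → K)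
    {w : Word I} {s : Finset ι} {i : I}
    (h : (s.filter fun a => col a = i).card ≠ wordDegree w i) : symRec col g k w s = 0 := by
  induction w generalizing s with
  | nil =>
    rw [symRec, if_neg]
    rintro rfl
    simp [wordDegree] at h
  | cons l w ih =>
    rw [symRec]
    refine Finset.sum_eq_zero fun a ha => ?_
    rw [Finset.mem_filter] at ha
    rw [ih, mul_zero]
    intro h'
    apply h
    rw [Finset.filter_erase] at h'
    simp only [wordDegree, List.map_cons, List.count_cons] at h' ⊢
    by_cases hi : l.vertex = i
    · have hm : a ∈ s.filter fun a => col a = i := by simp [ha, hi]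
      rw [Finset.card_erase_of_mem hm] at h'
      have := Finset.card_pos.2 ⟨a, hm⟩
      simp [hi]
      omega
    · have hm : a ∉ s.filter fun a => col a = i := by simp [ha, hi]
      rw [Finset.erase_eq_of_notMem hm] at h'
      simp [hi, h']

end SymRec

/-! ### The words in the generators as rational functions -/

section VarSet

variable {I : Type u} [Fintype I]

/-- The set of the variables of a function of degree `n`. -/
def varSet (n : I → ℕ) : Finset (Var I) :=
  (Finset.univ.sigma fun i => Finset.range (n i)).map (Equiv.sigmaEquivProd I ℕ).toEmbedding

lemma mem_varSet {n : I → ℕ} {p : Var I} : p ∈ varSet n ↔ p.2 < n p.1 := by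
  simp only [varSet, Finset.mem_map_equiv, Finset.mem_sigma, Finset.mem_univ, true_and,
    Finset.mem_range]
  rfl

lemma prod_varSet {M : Type*} [CommMonoid M] (n : I → ℕ) (f : Var I → M) :
    ∏ p ∈ varSet n, f p = ∏ i, ∏ a ∈ Finset.range (n i), f (i, a) := by
  rw [varSet, Finset.prod_map, Finset.prod_sigma]
  rfl

variable [DecidableEq I]

lemma sum_varSet_filter {M : Type*} [AddCommMonoid M] (n : I → ℕ) (i : I) (f : Var I → M) :
    ∑ p ∈ varSet n with p.1 = i, f p = ∑ a ∈ Finset.range (n i), f (i, a) := by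
  symm
  refine Finset.sum_bij (fun a _ => (i, a)) ?_ ?_ ?_ ?_
  · intro a ha
    rw [Finset.mem_range] at ha
    simp [mem_varSet, ha]
  · intro a _ b _ h
    simpa using h
  · rintro ⟨j, b⟩ h
    rw [Finset.mem_filter, mem_varSet] at h
    obtain ⟨h1, rfl⟩ := h
    exact ⟨b, Finset.mem_range.2 h1, rfl⟩
  · intro a _; rfl

lemma permVar_fst (n : I → ℕ) (σ : ∀ i, Equiv.Perm (Fin (n i))) (p : Var I) :
    (permVar n σ p).1 = p.1 := rfl

lemma permVar_of_lt (n : I → ℕ) (σ : ∀ i, Equiv.Perm (Fin (n i))) {i : I} (a : Fin (n i)) :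
    permVar n σ (i, (a : ℕ)) = (i, (σ i a : ℕ)) := by
  rw [permVar, Equiv.prodCongrRight_apply]
  have := Equiv.Perm.extendDomain_apply_image (σ i) (Fin.equivSubtype (n := n i)) a
  simpa using this

lemma permVar_mem_varSet {n : I → ℕ} (σ : ∀ i, Equiv.Perm (Fin (n i))) {p : Var I}
    (hp : p ∈ varSet n) : permVar n σ p ∈ varSet n := by
  obtain ⟨i, a⟩ := p
  rw [mem_varSet] at hp
  have := permVar_of_lt n σ (⟨a, hp⟩ : Fin (n i))
  rw [mem_varSet]
  rw [Fin.val_mk] at this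
  rw [this]
  exact (σ i _).2

lemma varSet_map_permVar (n : I → ℕ) (σ : ∀ i, Equiv.Perm (Fin (n i))) :
    (varSet n).map (permVar n σ).toEmbedding = varSet n := by
  refine Finset.eq_of_subset_of_card_le ?_ (by simp)
  intro p hp
  rw [Finset.mem_map] at hp
  obtain ⟨r, hr, rfl⟩ := hp
  exact permVar_mem_varSet σ hr

end VarSet

/-! ### Symmetrization of functions that single out one variable. -/

section Symmetrize

variable {I : Type u} [Fintype I] [DecidableEq I] [Quiver.{v} I]

@[simp] lemma renameVar_zVar (φ : Var I ↪ Var I) (p : Var I) :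
    renameVar φ (zVar p) = zVar (φ p) := by
  rw [renameVar, zVar, IsFractionRing.liftAlgHom_apply, IsFractionRing.lift_algebraMap]
  simp [zVar]

/-- The renamed copy of T only depends on the image of one variable. Averaging over which variable
of colour i is singled out makes every summand, for a fixed permutation, run once through all
variables of that colour; the permutations then only contribute their number. -/
lemma mul_symmetrize_eq (n : I → ℕ) (i : I) (a₀ : Fin (n i)) (T : RatFun I) (h : Var I → RatFun I)
    (hT : ∀ σ : (∀ i, Equiv.Perm (Fin (n i))),
      renameVar (permVar n σ).toEmbedding T = h (permVar n σ (i, a₀))) :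
    (n i : RatFun I) * symmetrize n T =
      (∏ j, ((n j).factorial : RatFun I)) * ∑ p ∈ varSet n with p.1 = i, h p := by
  classical
  -- Composition with the transposition of a and a₀ reindexes the permutations, so a₀ may be
  -- replaced by any a.
  have h1 : ∀ a : Fin (n i), symmetrize n T =
      ∑ σ : (∀ i, Equiv.Perm (Fin (n i))), h (i, (σ i a : ℕ)) := by
    intro a
    rw [symmetrize]
    simp only [hT, permVar_of_lt]
    rw [← Equiv.sum_comp (Equiv.mulRight
      (Function.update (1 : ∀ i, Equiv.Perm (Fin (n i))) i (Equiv.swap a a₀)))]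
    refine Finset.sum_congr rfl fun σ _ => ?_
    simp
  have h2 : (n i : RatFun I) * symmetrize n T = ∑ a : Fin (n i), symmetrize n T := by simp
  rw [h2, Finset.sum_congr rfl fun a _ => h1 a, Finset.sum_comm]
  have h3 : ∀ σ : (∀ i, Equiv.Perm (Fin (n i))), ∑ a : Fin (n i), h (i, (σ i a : ℕ)) =
      ∑ p ∈ varSet n with p.1 = i, h p := by
    intro σ
    rw [sum_varSet_filter, Equiv.sum_comp (σ i) fun a : Fin (n i) => h (i, (a : ℕ)),
      Finset.sum_range]
  rw [Finset.sum_congr rfl fun σ _ => h3 σ, Finset.sum_const, Finset.card_univ, Fintype.card_pi]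
  simp [Fintype.card_perm]

end Symmetrize

section Words

variable {I : Type u} [Fintype I] [DecidableEq I] [Quiver.{v} I] [∀ i j : I, Fintype (i ⟶ j)]

section Kernels

variable {ι K : Type*} [DecidableEq ι] [Field K] [Algebra (GroundField I) K]

/-- The value of `e_w` at the points `x a`, `a ∈ s`. -/
def eVal (col : ι → I) (x : ι → K) (w : Word I) (s : Finset ι) : K :=
  symRec col (fun l a => x a ^ l.exponent) (fun a b => zeta (col a) (col b) (x a / x b)) w s

/-- The value of `f_w` at the points `x a`, `a ∈ s`. -/
def fVal (col : ι → I) (x : ι → K) (w : Word I) (s : Finset ι) : K :=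
  symRec col (fun l a => x a ^ (-l.exponent)) (fun a b => zeta (col b) (col a) (x b / x a)) w s

lemma eVal_cons (col : ι → I) (x : ι → K) (l : Letter I) (w : Word I) (s : Finset ι) :
    eVal col x (l :: w) s = ∑ a ∈ s with col a = l.vertex, x a ^ l.exponent *
      (∏ b ∈ s.erase a, zeta (col a) (col b) (x a / x b)) * eVal col x w (s.erase a) := rfl

lemma fVal_cons (col : ι → I) (x : ι → K) (l : Letter I) (w : Word I) (s : Finset ι) :
    fVal col x (l :: w) s = ∑ a ∈ s with col a = l.vertex, x a ^ (-l.exponent) *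
      (∏ b ∈ s.erase a, zeta (col b) (col a) (x b / x a)) * fVal col x w (s.erase a) := rfl

lemma map_eVal {K' : Type*} [Field K'] [Algebra (GroundField I) K'] (f : K →ₐ[GroundField I] K')
    (col : ι → I) (x : ι → K) (w : Word I) (s : Finset ι) :
    f (eVal col x w s) = eVal col (fun a => f (x a)) w s := by
  rw [eVal, ← RingHom.coe_coe, map_symRec]
  simp [eVal, map_zeta]

lemma map_fVal {K' : Type*} [Field K'] [Algebra (GroundField I) K'] (f : K →ₐ[GroundField I] K')
    (col : ι → I) (x : ι → K) (w : Word I) (s : Finset ι) :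
    f (fVal col x w s) = fVal col (fun a => f (x a)) w s := by
  rw [fVal, ← RingHom.coe_coe, map_symRec]
  simp [fVal, map_zeta]

end Kernels

lemma renameVar_eVal (φ : Var I ↪ Var I) (hφ : ∀ p, (φ p).1 = p.1) (w : Word I)
    (s : Finset (Var I)) :
    renameVar φ (eVal Prod.fst zVar w s) = eVal Prod.fst zVar w (s.map φ) := by
  rw [map_eVal]
  simp only [renameVar_zVar]
  rw [eVal, eVal, symRec_map]
  simp only [hφ]

lemma renameVar_fVal (φ : Var I ↪ Var I) (hφ : ∀ p, (φ p).1 = p.1) (w : Word I)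
    (s : Finset (Var I)) :
    renameVar φ (fVal Prod.fst zVar w s) = fVal Prod.fst zVar w (s.map φ) := by
  rw [map_fVal]
  simp only [renameVar_zVar]
  rw [fVal, fVal, symRec_map]
  simp only [hφ]

lemma prod_factorial_single (i : I) :
    ∏ j, (((Pi.single i 1 : I → ℕ) j).factorial : RatFun I) = 1 := by
  refine Finset.prod_eq_one fun j _ => ?_
  by_cases h : j = i
  · subst h; simp
  · simp [h]

lemma prod_factorial_add_single (n : I → ℕ) (i : I) :
    ∏ j, (((n + Pi.single i 1 : I → ℕ) j).factorial : RatFun I) =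
      ((n i + 1 : ℕ) : RatFun I) * ∏ j, ((n j).factorial : RatFun I) := by
  rw [← Finset.mul_prod_erase _ _ (Finset.mem_univ i),
    ← Finset.mul_prod_erase Finset.univ (fun j => ((n j).factorial : RatFun I)) (Finset.mem_univ i)]
  have h : ∀ j ∈ Finset.univ.erase i, (((n + Pi.single i 1 : I → ℕ) j).factorial : RatFun I) =
      ((n j).factorial : RatFun I) := by
    intro j hj
    simp [Finset.ne_of_mem_erase hj]
  rw [Finset.prod_congr rfl h]
  simp [Nat.factorial_succ, mul_assoc]

lemma varSet_erase_map_permVar (n : I → ℕ) (σ : ∀ i, Equiv.Perm (Fin (n i))) (p : Var I) :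
    ((varSet n).erase p).map (permVar n σ).toEmbedding =
      (varSet n).erase (permVar n σ p) := by
  rw [Finset.map_erase, varSet_map_permVar]
  rfl

instance {I : Type u} [Quiver.{v} I] : CharZero (RatFun I) :=
  charZero_of_injective_algebraMap (IsFractionRing.injective
    (MvPolynomial (Var I) (GroundField I)) (RatFun I))

lemma prod_factorial_ne_zero {I : Type u} [Fintype I] [Quiver.{v} I] (n : I → ℕ) : ∏ j, ((n j).factorial : RatFun I) ≠ 0 :=
  Finset.prod_ne_zero_iff.2 fun j _ => Nat.cast_ne_zero.2 (Nat.factorial_ne_zero _)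

lemma shiftVar_apply (n : I → ℕ) (p : Var I) : shiftVar n p = (p.1, n p.1 + p.2) := rfl

/-- The second factor is already symmetric, so only the variable given to the letter matters: the
sum over permutations collapses to a sum over that variable and the factorials cancel. -/
lemma shuffleComp_single_left (l : Letter I) (w : Word I) (n : I → ℕ) :
    shuffleComp (Pi.single l.vertex 1) n (zVar (l.vertex, 0) ^ l.exponent)
      (eVal Prod.fst zVar w (varSet n)) =
    eVal Prod.fst zVar (l :: w) (varSet (n + Pi.single l.vertex 1)) := by
  set i := l.vertex with hi
  set n' : I → ℕ := Pi.single i 1 + n with hn'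
  have hpos : 0 < n' i := by simp [hn']
  -- The shift vacates exactly the slot (i, 0), which the letter occupies.
  have hshift : (varSet n).map (shiftVar (Pi.single i 1)) = (varSet n').erase (i, 0) := by
    ext ⟨j, b⟩
    simp only [Finset.mem_map, Finset.mem_erase, mem_varSet, shiftVar_apply,
      Prod.exists, Prod.mk.injEq, ne_eq, not_and, hn', Pi.add_apply]
    constructor
    · rintro ⟨j', c, hc, rfl, rfl⟩
      refine ⟨?_, by simpa using hc⟩
      intro h
      rw [h]
      simp
    · rintro ⟨h1, h2⟩
      by_cases hj : j = i
      · rw [hj, Pi.single_eq_same] at h2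
        have := h1 hj
        exact ⟨j, b - 1, by rw [hj]; omega, rfl, by rw [hj, Pi.single_eq_same]; omega⟩
      · simp only [ne_eq, hj, not_false_eq_true, Pi.single_eq_of_ne, zero_add] at h2 ⊢
        exact ⟨j, b, h2, rfl, by simp [hj]⟩
  have hprod : (∏ i', ∏ j, ∏ a ∈ Finset.range ((Pi.single i 1 : I → ℕ) i'),
      ∏ b ∈ Finset.Ico ((Pi.single i 1 : I → ℕ) j) ((Pi.single i 1 : I → ℕ) j + n j),
        zeta i' j ((zVar (i', a) : RatFun I) / zVar (j, b))) =
      ∏ p ∈ (varSet n').erase (i, 0), zeta i p.1 (zVar (i, 0) / zVar p) := by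
    rw [← hshift, Finset.prod_map, prod_varSet, Finset.prod_eq_single i]
    · refine Finset.prod_congr rfl fun j _ => ?_
      simp only [Pi.single_eq_same, Finset.prod_range_one, shiftVar_apply]
      rw [Finset.prod_Ico_eq_prod_range]
      simp
    · intro j _ hj
      simp [hj]
    · simp
  rw [shuffleComp, renameVar_eVal _ (fun p => rfl), hshift, prod_factorial_single, hprod, one_mul]
  set C : RatFun I := ∏ j, ((n j).factorial : RatFun I) with hC
  have hC0 : C ≠ 0 := prod_factorial_ne_zero (I := I) n
  have key := mul_symmetrize_eq n' i ⟨0, hpos⟩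
    (zVar (i, 0) ^ l.exponent * eVal Prod.fst zVar w ((varSet n').erase (i, 0)) / C *
      ∏ p ∈ (varSet n').erase (i, 0), zeta i p.1 (zVar (i, 0) / zVar p))
    (fun a => zVar a ^ l.exponent * eVal Prod.fst zVar w ((varSet n').erase a) / C *
      ∏ p ∈ (varSet n').erase a, zeta i p.1 (zVar a / zVar p)) (by
      intro σ
      rw [map_mul, map_div₀, map_mul, map_zpow₀, renameVar_eVal _ (fun p => rfl),
        varSet_erase_map_permVar, map_prod, ← varSet_erase_map_permVar, Finset.prod_map]
      simp [map_zeta, hC, permVar_fst])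
  have h1 : ∏ j, ((n' j).factorial : RatFun I) = (n' i : RatFun I) * C := by
    rw [hn', add_comm, prod_factorial_add_single]
    simp [hC]
  rw [h1] at key
  have hn0 : (n' i : RatFun I) ≠ 0 := Nat.cast_ne_zero.2 hpos.ne'
  rw [mul_assoc] at key
  rw [mul_left_cancel₀ hn0 key, eVal_cons, Finset.mul_sum, add_comm n, ← hn']
  refine Finset.sum_congr rfl fun a ha => ?_
  rw [(Finset.mem_filter.1 ha).2, ← hi]
  field_simp

/-- The same collapse, but for the opposite product the letter stands on the right and occupies the
last slot (i, n i), with the arguments of ζ reversed. -/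
lemma shuffleComp_single_right (l : Letter I) (w : Word I) (n : I → ℕ) :
    shuffleComp n (Pi.single l.vertex 1) (fVal Prod.fst zVar w (varSet n))
      (zVar (l.vertex, 0) ^ (-l.exponent)) =
    fVal Prod.fst zVar (l :: w) (varSet (n + Pi.single l.vertex 1)) := by
  set i := l.vertex with hi
  set n' : I → ℕ := n + Pi.single i 1 with hn'
  have hni : n' i = n i + 1 := by simp [hn']
  have herase : (varSet n').erase (i, n i) = varSet n := by
    ext ⟨j, b⟩
    simp only [Finset.mem_erase, mem_varSet, ne_eq, Prod.mk.injEq, not_and, hn', Pi.add_apply]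
    by_cases hj : j = i
    · subst hj
      simp
      omega
    · simp [hj]
  have hprod : (∏ i', ∏ j, ∏ a ∈ Finset.range (n i'),
      ∏ b ∈ Finset.Ico (n j) (n j + (Pi.single i 1 : I → ℕ) j),
        zeta i' j ((zVar (i', a) : RatFun I) / zVar (j, b))) =
      ∏ p ∈ (varSet n').erase (i, n i), zeta p.1 i (zVar p / zVar (i, n i)) := by
    rw [herase, prod_varSet]
    refine Finset.prod_congr rfl fun i' _ => ?_
    rw [Finset.prod_eq_single i]
    · simp
    · intro j _ hj
      simp [hj]
    · simp
  rw [shuffleComp, prod_factorial_single, hprod, mul_one, ← herase]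
  set C : RatFun I := ∏ j, ((n j).factorial : RatFun I) with hC
  have hC0 : C ≠ 0 := prod_factorial_ne_zero (I := I) n
  have hz : renameVar (shiftVar n) (zVar (i, 0) ^ (-l.exponent)) =
      (zVar (i, n i) : RatFun I) ^ (-l.exponent) := by
    rw [map_zpow₀, renameVar_zVar]; rfl
  rw [hz]
  have key := mul_symmetrize_eq n' i ⟨n i, by omega⟩
    (fVal Prod.fst zVar w ((varSet n').erase (i, n i)) * zVar (i, n i) ^ (-l.exponent) / C *
      ∏ p ∈ (varSet n').erase (i, n i), zeta p.1 i (zVar p / zVar (i, n i)))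
    (fun a => fVal Prod.fst zVar w ((varSet n').erase a) * zVar a ^ (-l.exponent) / C *
      ∏ p ∈ (varSet n').erase a, zeta p.1 i (zVar p / zVar a)) (by
      intro σ
      rw [map_mul, map_div₀, map_mul, map_zpow₀, renameVar_fVal _ (fun p => rfl),
        varSet_erase_map_permVar, map_prod, ← varSet_erase_map_permVar, Finset.prod_map]
      simp [map_zeta, hC, permVar_fst])
  have h1 : ∏ j, ((n' j).factorial : RatFun I) = (n' i : RatFun I) * C := by
    rw [hn', prod_factorial_add_single]
    simp [hC]
  rw [h1] at key
  have hn0 : (n' i : RatFun I) ≠ 0 := Nat.cast_ne_zero.2 (by omega)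
  rw [mul_assoc] at key
  rw [mul_left_cancel₀ hn0 key, fVal_cons, Finset.mul_sum]
  refine Finset.sum_congr rfl fun a ha => ?_
  rw [(Finset.mem_filter.1 ha).2, ← hi]
  field_simp

lemma wordDegree_cons {I : Type u} [DecidableEq I] (l : Letter I) (w : Word I) :
    wordDegree (l :: w) = wordDegree w + Pi.single l.vertex 1 := by
  funext i
  simp only [wordDegree, List.map_cons, List.count_cons, Pi.add_apply, Pi.single_apply]
  by_cases h : l.vertex = i
  · simp [h]
  · simp [h, Ne.symm h]

end Words

/-! ### Closed formulas for the words. -/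

section EWord

variable {I : Type u} [Fintype I] [LinearOrder I] [Quiver.{v} I] [∀ i j : I, Fintype (i ⟶ j)]

lemma shuffleComp_zero_left (n n' : I → ℕ) (R : RatFun I) : shuffleComp n n' 0 R = 0 := by
  simp [shuffleComp, symmetrize]

lemma shuffleComp_zero_right (n n' : I → ℕ) (R : RatFun I) : shuffleComp n n' R 0 = 0 := by
  simp [shuffleComp, symmetrize]

lemma shuffleMul_single (n n' : I → ℕ) (R R' : RatFun I) :
    shuffleMul (Finsupp.single n R) (Finsupp.single n' R') =
      Finsupp.single (n + n') (shuffleComp n n' R R') := by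
  rw [shuffleMul, Finsupp.sum_single_index, Finsupp.sum_single_index]
  · rw [shuffleComp_zero_right, Finsupp.single_zero]
  · rw [Finsupp.sum_single_index] <;>
    simp [shuffleComp_zero_left]

lemma varSet_zero : varSet (0 : I → ℕ) = ∅ := by
  ext p; simp [mem_varSet]

lemma wordDegree_nil : wordDegree ([] : Word I) = 0 := by
  funext i; simp [wordDegree]

/-- The recursive sum makes sense at coloured points of any field, which the iterated shuffle
product does not; all evaluations below go through it. -/
lemma eWord_eq (w : Word I) :
    eWord w = Finsupp.single (wordDegree w) (eVal Prod.fst zVar w (varSet (wordDegree w))) := by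
  induction w with
  | nil => simp [eWord, shuffleOne, wordDegree_nil, varSet_zero, eVal, symRec]
  | cons l w ih =>
    rw [eWord, ih, oneVar, shuffleMul_single, shuffleComp_single_left, wordDegree_cons,
      add_comm (Pi.single _ _)]

lemma fWord_eq (w : Word I) :
    fWord w = Finsupp.single (wordDegree w) (fVal Prod.fst zVar w (varSet (wordDegree w))) := by
  induction w with
  | nil => simp [fWord, shuffleOne, wordDegree_nil, varSet_zero, fVal, symRec]
  | cons l w ih =>
    rw [fWord, ih, oneVar, shuffleOpMul, shuffleMul_single, shuffleComp_single_right,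
      wordDegree_cons]

end EWord

/-! ### Laurent polynomials out of symmetrization -/

section Divisibility

variable {I : Type u} [Quiver.{v} I]

lemma laurentSubst_lVar (P : LaurentPoly I) : laurentSubst lVar P = P := by
  apply evalAt_zVar_injective
  rw [evalAt_laurentSubst zVar_ne_zero]
  simp only [evalAt_lVar zVar_ne_zero]

/-- The pairs of units which are congruent modulo `r`. -/
def unitsCongruent {R : Type*} [CommRing R] (r : R) : Subgroup (Rˣ × Rˣ) where
  carrier := {u | r ∣ (u.1 : R) - u.2}
  one_mem' := by simp
  mul_mem' := by
    rintro ⟨u, u'⟩ ⟨v, v'⟩ h h'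
    have : ((u * v : Rˣ) : R) - (u' * v' : Rˣ) = (u - u') * v + u' * (v - v') := by
      push_cast; ring
    simp only [Set.mem_ofPred_eq, Prod.mk_mul_mk, this]
    exact dvd_add (h.mul_right _) (h'.mul_left _)
  inv_mem' := by
    rintro ⟨u, u'⟩ h
    have : ((u⁻¹ : Rˣ) : R) - (u'⁻¹ : Rˣ) = -((u⁻¹ : Rˣ) * (u'⁻¹ : Rˣ) * (u - u')) := by
      rw [mul_sub, mul_right_comm, Units.inv_mul, mul_assoc, Units.inv_mul]; ring
    simp only [Set.mem_ofPred_eq, Prod.inv_mk, this, dvd_neg]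
    exact Dvd.dvd.mul_left h _

lemma dvd_prod_zpow_sub {R σ : Type*} [CommRing R] {r : R} {y y' : σ → Rˣ}
    (h : ∀ p, r ∣ (y p : R) - y' p) (s : Finset σ) (m : σ → ℤ) :
    r ∣ ((∏ p ∈ s, y p ^ m p : Rˣ) : R) - (∏ p ∈ s, y' p ^ m p : Rˣ) := by
  have h1 : ∏ p ∈ s, ((y p, y' p) : Rˣ × Rˣ) ^ m p ∈ unitsCongruent r :=
    Subgroup.prod_mem _ fun p _ => Subgroup.zpow_mem _ (h p) _
  have h2 : ∏ p ∈ s, ((y p, y' p) : Rˣ × Rˣ) ^ m p =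
      (∏ p ∈ s, y p ^ m p, ∏ p ∈ s, y' p ^ m p) := by
    ext <;> simp [Prod.fst_prod, Prod.snd_prod]
  rw [h2] at h1
  exact h1

/-- Pairs of congruent units form a subgroup, so monomials with negative exponents respect
congruences as well. -/
lemma dvd_laurentSubst_sub {y y' : Var I → (LaurentPoly I)ˣ} {r : LaurentPoly I}
    (h : ∀ p, r ∣ (y p : LaurentPoly I) - y' p) (Q : LaurentPoly I) :
    r ∣ laurentSubst y Q - laurentSubst y' Q := by
  rw [laurentSubst, laurentSubst, laurentEval_apply, laurentEval_apply, Finsupp.sum,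
    Finsupp.sum, ← Finset.sum_sub_distrib]
  refine Finset.dvd_sum fun m _ => ?_
  rw [← smul_sub, Algebra.smul_def]
  refine Dvd.dvd.mul_left ?_ _
  exact dvd_prod_zpow_sub h m.support m

/-- The factor theorem: modulo z_a - z_b, the polynomial Q is congruent to its specialization z_a ↦
z_b, which is zero. -/
lemma sub_lVar_dvd [DecidableEq I] {a b : Var I} {Q : LaurentPoly I}
    (hQ : evalAt (Function.update (zVar : Var I → RatFun I) a (zVar b)) Q = 0) :
    (lVar a - lVar b : LaurentPoly I) ∣ Q := by
  set ρ : Var I → Var I := Function.update id a b with hρ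
  have h0 : laurentSubst (fun p => lVar (ρ p)) Q = 0 := by
    apply evalAt_zVar_injective
    rw [evalAt_laurentSubst zVar_ne_zero, evalAt_zero, ← hQ]
    congr 1
    ext p
    rw [evalAt_lVar zVar_ne_zero, hρ]
    by_cases h : p = a
    · subst h; simp
    · simp [h]
  have h1 := dvd_laurentSubst_sub (y := lVar) (y' := fun p => lVar (ρ p))
    (r := (lVar a - lVar b : LaurentPoly I)) (fun p => by
      by_cases h : p = a
      · subst h; simp [hρ]
      · simp [hρ, h]) Q
  rwa [laurentSubst_lVar, h0, sub_zero] at h1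

end Divisibility

/-! ### Elimination of the variables that do not belong to a degree. -/

section Restrict

variable {I : Type u} [Quiver.{v} I]

open Classical in
/-- Specialization of the variables outside of degree `n` to `1`. -/
def restrictVars (n : I → ℕ) (P : LaurentPoly I) : LaurentPoly I :=
  AddMonoidAlgebra.mapDomain (fun m => m.filter fun p => p.2 < n p.1) P

lemma inVariables_restrictVars (n : I → ℕ) (P : LaurentPoly I) :
    InVariables n (restrictVars n P) := by
  classical
  intro m hm p hp
  have h := Finsupp.mapDomain_support (Finsupp.mem_support_iff.2 hm)
  rw [Finset.mem_image] at h
  obtain ⟨m', -, rfl⟩ := h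
  by_contra hlt
  exact hp (Finsupp.filter_apply_neg _ _ hlt)

open Classical in
lemma evalAt_restrictVars {A : Type*} [Field A] [Algebra (GroundField I) A] (n : I → ℕ)
    (x : Var I → A) (P : LaurentPoly I) :
    evalAt x (restrictVars n P) = evalAt (fun p => if p.2 < n p.1 then x p else 1) P := by
  rw [evalAt, restrictVars, AddMonoidAlgebra.coeff_mapDomain,
    Finsupp.sum_mapDomain_index (by simp) (by intros; rw [add_smul]), evalAt]
  refine Finsupp.sum_congr fun m _ => ?_
  congr 1
  rw [Finsupp.prod_filter_index, Finsupp.prod, Finsupp.support_filter, Finset.prod_filter]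
  refine Finset.prod_congr rfl fun p _ => ?_
  split_ifs <;> simp

end Restrict

lemma eq_zero_of_mul_eq_neg_mul {K : Type*} [Field K] [CharZero K] {a b : K}
    (h : a * b = -(a * b)) (hb : b ≠ 0) : a = 0 := by
  have h2 : a * b = 0 := CharZero.eq_neg_self_iff.1 h
  exact (mul_eq_zero.1 h2).resolve_right hb

/-! ### Cancellation of the diagonal poles under symmetrization. -/

section Generic

variable {I : Type u} [DecidableEq I] [Quiver.{v} I]

/-- A point with non-zero coordinates, where the coordinates with index in `s` of the same color are
distinct. -/
structure IsGenericPoint {K ι : Type*} [Zero K] (col : ι → I) (x : ι → K) (s : Finset ι) :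
    Prop where
  ne_zero : ∀ p, x p ≠ 0
  ne : ∀ a ∈ s, ∀ b ∈ s, a ≠ b → col a = col b → x a ≠ x b

lemma IsGenericPoint.mono {K ι : Type*} [Zero K] {col : ι → I} {x : ι → K} {s t : Finset ι}
    (h : IsGenericPoint col x s) (hts : t ⊆ s) : IsGenericPoint col x t :=
  ⟨h.ne_zero, fun a ha b hb => h.ne a (hts ha) b (hts hb)⟩

/-- The pairs of variables of the same color. -/
def colorPairs (s : Finset (Var I)) : Finset (Var I × Var I) :=
  (s ×ˢ s).filter fun p => p.1.1 = p.2.1 ∧ p.1.2 < p.2.2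

lemma mem_colorPairs {s : Finset (Var I)} {a b : Var I} :
    (a, b) ∈ colorPairs s ↔ (a ∈ s ∧ b ∈ s) ∧ a.1 = b.1 ∧ a.2 < b.2 := by
  simp [colorPairs]

/-- The product of the Vandermonde determinants of the variables of each color. -/
def vandermonde (T : Finset (Var I × Var I)) : LaurentPoly I :=
  ∏ p ∈ T, ((lVar p.1 : LaurentPoly I) - lVar p.2)

lemma evalAt_vandermonde {K : Type*} [Field K] [Algebra (GroundField I) K] {x : Var I → K}
    (hx : ∀ p, x p ≠ 0) (T : Finset (Var I × Var I)) :
    evalAt x (vandermonde T) = ∏ p ∈ T, (x p.1 - x p.2) := by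
  simp only [vandermonde, evalAt_prod hx, evalAt_sub, evalAt_lVar hx]

lemma evalAt_vandermonde_ne_zero {K : Type*} [Field K] [Algebra (GroundField I) K] {x : Var I → K}
    {s : Finset (Var I)} (hx : IsGenericPoint Prod.fst x s) :
    evalAt x (vandermonde (colorPairs s)) ≠ 0 := by
  rw [evalAt_vandermonde hx.ne_zero, Finset.prod_ne_zero_iff]
  rintro ⟨a, b⟩ hab
  rw [mem_colorPairs] at hab
  exact sub_ne_zero.2 (hx.ne a hab.1.1 b hab.1.2 (by rintro rfl; exact lt_irrefl _ hab.2.2) hab.2.1)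

lemma exists_vandermonde_eq_mul (s : Finset (Var I)) {a : Var I} (ha : a ∈ s) :
    ∃ M : LaurentPoly I, vandermonde (colorPairs s) =
      (∏ b ∈ s.erase a with a.1 = b.1, ((lVar a : LaurentPoly I) - lVar b)) * M := by
  -- The pair is put in increasing order to lie in `colorPairs`; the sign this costs is irrelevant
  -- for divisibility.
  set f : Var I → Var I × Var I := fun b => if a.2 < b.2 then (a, b) else (b, a) with hf
  set t := (s.erase a).filter fun b => a.1 = b.1
  have ht : ∀ b ∈ t, b ∈ s ∧ b ≠ a ∧ a.1 = b.1 := by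
    intro b hb
    simp only [t, Finset.mem_filter, Finset.mem_erase] at hb
    exact ⟨hb.1.2, hb.1.1, hb.2⟩
  have hinj : Set.InjOn f t := by
    intro b hb c hc h
    have hb' := (ht b hb).2.1
    have hc' := (ht c hc).2.1
    simp only [hf] at h
    split_ifs at h with h1 h2 h2
    · exact (Prod.mk.inj h).2
    · exact absurd (Prod.mk.inj h).2 hb'
    · exact absurd (Prod.mk.inj h).1 hb'
    · exact (Prod.mk.inj h).1
  have hsub : t.image f ⊆ colorPairs s := by
    intro p hp
    rw [Finset.mem_image] at hp
    obtain ⟨b, hb, rfl⟩ := hp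
    obtain ⟨hbs, hba, hcol⟩ := ht b hb
    have hne : a.2 ≠ b.2 := fun h => hba (Prod.ext hcol.symm h.symm)
    simp only [hf]
    split_ifs with h
    · exact mem_colorPairs.2 ⟨⟨ha, hbs⟩, hcol, h⟩
    · exact mem_colorPairs.2 ⟨⟨hbs, ha⟩, hcol.symm, by omega⟩
  have h1 : ∏ b ∈ t, ((lVar a : LaurentPoly I) - lVar b) ∣
      ∏ p ∈ t.image f, ((lVar p.1 : LaurentPoly I) - lVar p.2) := by
    rw [Finset.prod_image hinj]
    refine Finset.prod_dvd_prod_of_dvd _ _ fun b _ => ?_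
    simp only [hf]
    split_ifs
    · rfl
    · exact (dvd_sub_comm).1 dvd_rfl
  exact h1.trans (Finset.prod_dvd_prod_of_subset _ _ _ hsub)

variable (g : ∀ (K : Type (max u v)) [Field K] [Algebra (GroundField I) K],
    (Var I → K) → Letter I → Var I → K)
  (k : ∀ (K : Type (max u v)) [Field K] [Algebra (GroundField I) K],
    (Var I → K) → Var I → Var I → K)

set_option maxHeartbeats 400000 in
/-- A symmetrization, where the pairwise weights have at most simple poles along the diagonals, is
a Laurent polynomial. -/
lemma exists_laurent_symRec (γ : Letter I → Var I → LaurentPoly I)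
    (κ : Var I → Var I → LaurentPoly I)
    (hγ : ∀ (K : Type (max u v)) [Field K] [Algebra (GroundField I) K] (x : Var I → K)
      (l : Letter I) (a : Var I), (∀ p, x p ≠ 0) → g K x l a = evalAt x (γ l a))
    (hκ : ∀ (K : Type (max u v)) [Field K] [Algebra (GroundField I) K] (x : Var I → K)
      (a b : Var I), (∀ p, x p ≠ 0) → (a.1 = b.1 → x a ≠ x b) →
      k K x a b * (if a.1 = b.1 then x a - x b else 1) = evalAt x (κ a b))
    (hgτ : ∀ (K : Type (max u v)) [Field K] [Algebra (GroundField I) K] (x : Var I → K)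
      (τ : Equiv.Perm (Var I)), (∀ p, (τ p).1 = p.1) → ∀ l a,
        g K (fun p => x (τ p)) l a = g K x l (τ a))
    (hkτ : ∀ (K : Type (max u v)) [Field K] [Algebra (GroundField I) K] (x : Var I → K)
      (τ : Equiv.Perm (Var I)), (∀ p, (τ p).1 = p.1) → ∀ a b,
        k K (fun p => x (τ p)) a b = k K x (τ a) (τ b))
    (w : Word I) (s : Finset (Var I)) :
    ∃ P : LaurentPoly I, ∀ (K : Type (max u v)) [Field K] [Algebra (GroundField I) K]
      (x : Var I → K), IsGenericPoint Prod.fst x s →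
        symRec Prod.fst (g K x) (k K x) w s = evalAt x P := by
  classical
  induction w generalizing s with
  | nil =>
    refine ⟨if s = ∅ then 1 else 0, fun K _ _ x hx => ?_⟩
    rw [symRec]
    split_ifs
    · rw [evalAt_one]
    · rw [evalAt_zero]
  | cons l w ih =>
    choose P hP using ih
    have hM : ∀ a : Var I, ∃ M : LaurentPoly I, a ∈ s → vandermonde (colorPairs s) =
        (∏ b ∈ s.erase a with a.1 = b.1, ((lVar a : LaurentPoly I) - lVar b)) * M := by
      intro a
      by_cases ha : a ∈ s
      · obtain ⟨M, hM⟩ := exists_vandermonde_eq_mul s ha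
        exact ⟨M, fun _ => hM⟩
      · exact ⟨0, fun h => absurd h ha⟩
    choose M hM using hM
    set N : LaurentPoly I := ∑ a ∈ s with a.1 = l.vertex,
      γ l a * (∏ b ∈ s.erase a, κ a b) * P (s.erase a) * M a with hN
    -- The Vandermonde product clears the simple poles of the outermost sum; N is the resulting
    -- numerator, and it remains to divide N by that product.
    have hND : ∀ (K : Type (max u v)) [Field K] [Algebra (GroundField I) K]
        (x : Var I → K), IsGenericPoint Prod.fst x s →
        symRec Prod.fst (g K x) (k K x) (l :: w) s * evalAt x (vandermonde (colorPairs s)) =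
          evalAt x N := by
      intro K _ _ x hx
      rw [symRec, Finset.sum_mul, hN, evalAt_sum]
      refine Finset.sum_congr rfl fun a ha => ?_
      have has := (Finset.mem_filter.1 ha).1
      simp only [evalAt_mul hx.ne_zero, evalAt_prod hx.ne_zero]
      rw [← hγ K x l a hx.ne_zero, hM a has, ← hP _ K x (hx.mono (Finset.erase_subset _ _)),
        evalAt_mul hx.ne_zero, evalAt_prod hx.ne_zero, Finset.prod_filter]
      have h1 : ∀ b ∈ s.erase a, evalAt x (κ a b) = k K x a b *
          (if a.1 = b.1 then evalAt x ((lVar a : LaurentPoly I) - lVar b) else 1) := by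
        intro b hb
        rw [← hκ K x a b hx.ne_zero
          (hx.ne a has b (Finset.mem_of_mem_erase hb) (Finset.ne_of_mem_erase hb).symm),
          evalAt_sub, evalAt_lVar hx.ne_zero, evalAt_lVar hx.ne_zero]
      rw [Finset.prod_congr rfl h1, Finset.prod_mul_distrib]
      ring
    have hgen : ∀ τ : Equiv.Perm (Var I),
        IsGenericPoint Prod.fst (fun p => (zVar (τ p) : RatFun I)) s := fun τ =>
      ⟨fun p => zVar_ne_zero _, fun a _ b _ hab _ h => hab (τ.injective (zVar_injective h))⟩
    -- N vanishes on each diagonal z_a = z_b, while the factors belonging to the other pairs do not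
    -- vanish there.
    have hzero : ∀ p ∈ colorPairs s,
        evalAt (Function.update (zVar : Var I → RatFun I) p.1 (zVar p.2)) N = 0 ∧
        ∀ T ⊆ colorPairs s, p ∉ T →
          evalAt (Function.update (zVar : Var I → RatFun I) p.1 (zVar p.2)) (vandermonde T) ≠ 0 := by
      rintro ⟨a, b⟩ hab
      have hab' := mem_colorPairs.1 hab
      set x₀ : Var I → RatFun I := Function.update zVar a (zVar b) with hx₀
      have hx₀0 : ∀ p, x₀ p ≠ 0 := by
        intro p
        by_cases h : p = a
        · subst h; simp [hx₀, zVar_ne_zero]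
        · simp [hx₀, h, zVar_ne_zero]
      have hD : ∀ T ⊆ colorPairs s, (a, b) ∉ T → evalAt x₀ (vandermonde T) ≠ 0 := by
        intro T hT haT
        rw [evalAt_vandermonde hx₀0, Finset.prod_ne_zero_iff]
        rintro ⟨c, d⟩ hcd
        have hcd' := mem_colorPairs.1 (hT hcd)
        have hne : c ≠ d := by rintro rfl; exact lt_irrefl _ hcd'.2.2
        refine sub_ne_zero.2 fun h => ?_
        dsimp only at h
        by_cases hca : c = a
        · by_cases hda : d = a
          · exact hne (hca.trans hda.symm)
          · rw [hca, hx₀, Function.update_self, Function.update_of_ne hda] at h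
            have := zVar_injective h
            subst this
            subst hca
            exact haT hcd
        · by_cases hda : d = a
          · rw [hda, hx₀, Function.update_self, Function.update_of_ne hca] at h
            have := zVar_injective h
            subst this
            subst hda
            have := hcd'.2.2
            have := hab'.2.2
            omega
          · rw [hx₀, Function.update_of_ne hda, Function.update_of_ne hca] at h
            exact hne (zVar_injective h)
      refine ⟨?_, hD⟩
      set τ := Equiv.swap a b with hτ
      have hτcol : ∀ p, (τ p).1 = p.1 := by
        intro p
        rw [hτ, Equiv.swap_apply_def]
        split_ifs with h1 h2
        · rw [h1, hab'.2.1]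
        · rw [h2, hab'.2.1]
        · rfl
      set D' := vandermonde ((colorPairs s).erase (a, b)) with hD'
      have hDD : vandermonde (colorPairs s) = ((lVar a : LaurentPoly I) - lVar b) * D' := by
        rw [hD', vandermonde, vandermonde, Finset.mul_prod_erase _
          (fun p : Var I × Var I => ((lVar p.1 : LaurentPoly I) - lVar p.2)) hab]
      have hsτ : s.map τ.toEmbedding = s := by
        refine Finset.eq_of_subset_of_card_le ?_ (by simp)
        intro p hp
        rw [Finset.mem_map_equiv, hτ, Equiv.symm_swap, Equiv.swap_apply_def] at hp
        split_ifs at hp with h1 h2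
        · rw [h1]; exact hab'.1.1
        · rw [h2]; exact hab'.1.2
        · exact hp
      -- The symmetrized sum is invariant under the transposition τ of two variables of the same
      -- colour.
      have hEτ : symRec Prod.fst (g (RatFun I) fun p => zVar (τ p))
          (k (RatFun I) fun p => zVar (τ p)) (l :: w) s =
          symRec Prod.fst (g (RatFun I) zVar) (k (RatFun I) zVar) (l :: w) s := by
        conv_rhs => rw [← hsτ, symRec_map]
        refine symRec_congr (fun p _ => (hτcol p).symm) ?_ ?_
        · intro l p _; exact hgτ _ _ τ hτcol _ _
        · intro p _ r _ _; exact hkτ _ _ τ hτcol _ _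
      set sw : LaurentPoly I → LaurentPoly I := fun P => laurentSubst (fun p => lVar (τ p)) P
        with hsw
      have hev : ∀ (x : Var I → RatFun I) (hx : ∀ p, x p ≠ 0) (P : LaurentPoly I),
          evalAt x (sw P) = evalAt (fun p => x (τ p)) P := by
        intro x hx P
        rw [hsw, evalAt_laurentSubst hx]
        simp only [evalAt_lVar hx]
      -- The sum N / ((z_a - z_b) D') is invariant under τ and z_a - z_b changes sign. On the
      -- diagonal τ acts trivially, so this gives N D' = -(N D') there, hence N = 0 as D' ≠ 0.
      have hid : N * sw D' = -(sw N * D') := by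
        apply evalAt_zVar_injective
        have h1 := hND (RatFun I) zVar (hgen 1)
        have h2 := hND (RatFun I) (fun p => zVar (τ p)) (hgen τ)
        rw [hDD, evalAt_mul zVar_ne_zero, evalAt_sub, evalAt_lVar zVar_ne_zero,
          evalAt_lVar zVar_ne_zero] at h1
        rw [hEτ, hDD, evalAt_mul (fun p => zVar_ne_zero _), evalAt_sub,
          evalAt_lVar (fun p => zVar_ne_zero _), evalAt_lVar (fun p => zVar_ne_zero _), hτ,
          Equiv.swap_apply_left, Equiv.swap_apply_right, ← hτ] at h2
        rw [evalAt_neg, evalAt_mul zVar_ne_zero, evalAt_mul zVar_ne_zero, hev _ zVar_ne_zero,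
          hev _ zVar_ne_zero, ← h1, ← h2]
        ring
      have hx₀τ : (fun p => x₀ (τ p)) = x₀ := by
        ext p
        have hba : b ≠ a := by
          rintro rfl
          exact lt_irrefl _ hab'.2.2
        rw [hτ, Equiv.swap_apply_def]
        split_ifs with h1 h2
        · rw [h1, hx₀, Function.update_self, Function.update_of_ne hba]
        · rw [h2, hx₀, Function.update_self, Function.update_of_ne hba]
        · rfl
      have h3 : evalAt x₀ (N * sw D') = evalAt x₀ (-(sw N * D')) := by rw [hid]
      rw [evalAt_neg, evalAt_mul hx₀0, evalAt_mul hx₀0, hev _ hx₀0, hev _ hx₀0, hx₀τ] at h3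
      have h4 : evalAt x₀ D' ≠ 0 := by
        rw [hD']
        refine hD _ (Finset.erase_subset _ _) ?_
        simp
      exact eq_zero_of_mul_eq_neg_mul h3 h4
    -- The linear factors are divided out one at a time: those already removed are non-zero on the
    -- next diagonal, so the quotient vanishes there.
    have hdvd : ∀ T ⊆ colorPairs s, vandermonde T ∣ N := by
      intro T
      induction T using Finset.induction_on with
      | empty => intro _; simp [vandermonde]
      | insert p T hp ihT =>
        intro hT
        have hTs := (Finset.subset_insert p T).trans hT
        obtain ⟨Q, hQ⟩ := ihT hTs
        obtain ⟨h1, h2⟩ := hzero p (hT (Finset.mem_insert_self _ _))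
        have h3 := h2 T hTs hp
        have hx₀0 : ∀ r, Function.update (zVar : Var I → RatFun I) p.1 (zVar p.2) r ≠ 0 := by
          intro r
          by_cases h : r = p.1
          · subst h; simp [zVar_ne_zero]
          · simp [h, zVar_ne_zero]
        rw [hQ, evalAt_mul hx₀0, mul_eq_zero] at h1
        obtain ⟨Q', hQ'⟩ := sub_lVar_dvd (h1.resolve_left h3)
        refine ⟨Q', ?_⟩
        rw [hQ, hQ', vandermonde, vandermonde, Finset.prod_insert hp]
        ring
    obtain ⟨Q, hQ⟩ := hdvd _ subset_rfl
    refine ⟨Q, fun K _ _ x hx => ?_⟩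
    have h1 := hND K x hx
    rw [hQ, evalAt_mul hx.ne_zero, mul_comm] at h1
    exact mul_left_cancel₀ (evalAt_vandermonde_ne_zero hx) h1

end Generic

/-! ### The words lie in the shuffle algebra -/

section Membership

variable {I : Type u} [Fintype I] [LinearOrder I] [Quiver.{v} I] [∀ i j : I, Fintype (i ⟶ j)]

/-- The product of the linear factors of `ζ_{ij}` at `z_a / z_b`. -/
def laurentFactors (i j : I) (a b : Var I) : LaurentPoly I :=
  ∏ o ∈ poles i j, (1 - poleConst o •
    ((lVar a : LaurentPoly I) * ((lVar b ^ (-1 : ℤ) : (LaurentPoly I)ˣ) : LaurentPoly I)))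

lemma evalAt_laurentFactors {K : Type*} [Field K] [Algebra (GroundField I) K] {x : Var I → K}
    (hx : ∀ p, x p ≠ 0) (i j : I) (a b : Var I) :
    evalAt x (laurentFactors i j a b) =
      ∏ o ∈ poles i j, (1 - algebraMap (GroundField I) K (poleConst o) * (x a / x b)) := by
  simp only [laurentFactors, evalAt_prod hx, evalAt_sub, evalAt_one, evalAt_smul, evalAt_mul hx,
    evalAt_lVar hx, evalAt_lVar_zpow hx]
  simp only [zpow_neg_one, Algebra.smul_def, div_eq_mul_inv]

lemma exists_laurent_eVal (w : Word I) (n : I → ℕ) :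
    ∃ P : LaurentPoly I, InVariables n P ∧
      ∀ (K : Type (max u v)) [Field K] [Algebra (GroundField I) K] (x : Var I → K),
        IsGenericPoint Prod.fst x (varSet n) → eVal Prod.fst x w (varSet n) = evalAt x P := by
  classical
  obtain ⟨P, hP⟩ := exists_laurent_symRec (I := I)
    (fun K _ _ x l a => x a ^ l.exponent)
    (fun K _ _ x a b => zeta a.1 b.1 (x a / x b))
    (fun l a => ((lVar a ^ l.exponent : (LaurentPoly I)ˣ) : LaurentPoly I))
    -- (z_a - z_b) / (1 - z_a/z_b) = -z_b.
    (fun a b => laurentFactors a.1 b.1 a b * (if a.1 = b.1 then -(lVar b : LaurentPoly I) else 1))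
    (fun K _ _ x l a hx => (evalAt_lVar_zpow hx a _).symm)
    (by
      intro K _ _ x a b hx hab
      rw [evalAt_mul hx, evalAt_laurentFactors hx, zeta_eq, mul_assoc]
      congr 1
      split_ifs with h
      · rw [evalAt_neg, evalAt_lVar hx]
        have h1 : 1 - x a / x b ≠ 0 := by
          rw [sub_ne_zero, ne_comm, Ne, div_eq_one_iff_eq (hx b)]
          exact hab h
        have := hx b
        rw [inv_mul_eq_iff_eq_mul₀ h1]
        field_simp
        ring
      · rw [evalAt_one, mul_one])
    (fun _ _ _ _ _ _ _ _ => rfl)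
    (by intro K _ _ x τ hτ a b; rw [hτ, hτ]) w (varSet n)
  -- The quotient could involve variables outside degree n; setting them to 1 does not affect the
  -- symmetrization.
  refine ⟨restrictVars n P, inVariables_restrictVars n P, fun K _ _ x hx => ?_⟩
  rw [evalAt_restrictVars]
  have hx' : IsGenericPoint Prod.fst (fun p : Var I => if p.2 < n p.1 then x p else 1)
      (varSet n) := by
    refine ⟨fun p => by split_ifs <;> simp [hx.ne_zero], fun a ha b hb hab h => ?_⟩
    rw [if_pos (mem_varSet.1 ha), if_pos (mem_varSet.1 hb)]
    exact hx.ne a ha b hb hab h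
  rw [← hP K _ hx', eVal]
  refine symRec_congr (fun _ _ => rfl) ?_ ?_
  · intro l a ha
    rw [if_pos (mem_varSet.1 ha)]
  · intro a ha b hb _
    rw [if_pos (mem_varSet.1 ha), if_pos (mem_varSet.1 hb)]

lemma exists_laurent_fVal (w : Word I) (n : I → ℕ) :
    ∃ P : LaurentPoly I,
      ∀ (K : Type (max u v)) [Field K] [Algebra (GroundField I) K] (x : Var I → K),
        IsGenericPoint Prod.fst x (varSet n) → fVal Prod.fst x w (varSet n) = evalAt x P := by
  classical
  exact exists_laurent_symRec (I := I)
    (fun K _ _ x l a => x a ^ (-l.exponent))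
    (fun K _ _ x a b => zeta b.1 a.1 (x b / x a))
    (fun l a => ((lVar a ^ (-l.exponent) : (LaurentPoly I)ˣ) : LaurentPoly I))
    -- (z_a - z_b) / (1 - z_b/z_a) = z_a.
    (fun a b => laurentFactors b.1 a.1 b a * (if a.1 = b.1 then (lVar a : LaurentPoly I) else 1))
    (fun K _ _ x l a hx => (evalAt_lVar_zpow hx a _).symm)
    (by
      intro K _ _ x a b hx hab
      rw [evalAt_mul hx, evalAt_laurentFactors hx, zeta_eq, mul_assoc]
      congr 1
      by_cases h : a.1 = b.1
      · rw [if_pos h, if_pos h, if_pos h.symm, evalAt_lVar hx]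
        have h1 : 1 - x b / x a ≠ 0 := by
          rw [sub_ne_zero, ne_comm, Ne, div_eq_one_iff_eq (hx a)]
          exact (hab h).symm
        have := hx a
        rw [inv_mul_eq_iff_eq_mul₀ h1]
        field_simp
      · rw [if_neg h, if_neg h, if_neg (Ne.symm h), evalAt_one, mul_one])
    (fun _ _ _ _ _ _ _ _ => rfl)
    (by intro K _ _ x τ hτ a b; rw [hτ, hτ]) w (varSet n)

/-- Whichever of the three points is assigned a letter first, its successor in the cycle a → c → b →
a is still present and contributes a zero factor. -/
lemma symRec_eq_zero_of_cycle {ι K : Type*} [DecidableEq ι] [CommSemiring K] (col : ι → I)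
    (g : Letter I → ι → K) (k : ι → ι → K) {a b c : ι} (hac : k a c = 0) (hcb : k c b = 0)
    (hba : k b a = 0) (h1 : a ≠ b) (h2 : b ≠ c) (h3 : a ≠ c) (w : Word I) {s : Finset ι}
    (ha : a ∈ s) (hb : b ∈ s) (hc : c ∈ s) : symRec col g k w s = 0 := by
  induction w generalizing s with
  | nil =>
    rw [symRec, if_neg]
    rintro rfl
    simp at ha
  | cons l w ih =>
    rw [symRec]
    refine Finset.sum_eq_zero fun p hp => ?_
    have key : ∀ r ∈ s.erase p, k p r = 0 →
        g l p * (∏ b ∈ s.erase p, k p b) * symRec col g k w (s.erase p) = 0 := by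
      intro r hr hk
      rw [Finset.prod_eq_zero hr hk, mul_zero, zero_mul]
    by_cases hpa : p = a
    · subst hpa
      exact key c (Finset.mem_erase.2 ⟨h3.symm, hc⟩) hac
    by_cases hpb : p = b
    · subst hpb
      exact key a (Finset.mem_erase.2 ⟨h1, ha⟩) hba
    by_cases hpc : p = c
    · subst hpc
      exact key b (Finset.mem_erase.2 ⟨h2, hb⟩) hcb
    rw [ih (Finset.mem_erase.2 ⟨Ne.symm hpa, ha⟩) (Finset.mem_erase.2 ⟨Ne.symm hpb, hb⟩)
      (Finset.mem_erase.2 ⟨Ne.symm hpc, hc⟩), mul_zero]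

lemma zeta_eq_zero {K : Type*} [Field K] [Algebra (GroundField I) K] {i j : I} {o : Pole I}
    (ho : IsPole i j o) {x : K} (hx : algebraMap (GroundField I) K (poleConst o) * x = 1) :
    zeta i j x = 0 := by
  rw [zeta_eq, Finset.prod_eq_zero (mem_poles.2 ho) (by rw [hx, sub_self]), zero_mul]

lemma smul_zVar_eq_zVar {c : GroundField I} (hc : c ≠ 0) {p r : Var I}
    (h : c • (zVar p : RatFun I) = zVar r) : p = r ∧ c = 1 := by
  have h1 : c • (lVar p : LaurentPoly I) = lVar r := by
    apply evalAt_zVar_injective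
    rw [evalAt_smul, evalAt_lVar zVar_ne_zero, evalAt_lVar zVar_ne_zero, h]
  have h2 : (AddMonoidAlgebra.single (Finsupp.single p (1 : ℤ)) c : LaurentPoly I) =
      AddMonoidAlgebra.single (Finsupp.single r (1 : ℤ)) 1 := by
    rw [← mul_one c, ← smul_eq_mul, ← AddMonoidAlgebra.smul_single]
    exact h1
  have h3 := congrArg (fun P : LaurentPoly I => P.coeff (Finsupp.single p (1 : ℤ))) h2
  simp only [AddMonoidAlgebra.coeff_single, Finsupp.single_eq_same] at h3
  by_cases hpr : p = r
  · subst hpr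
    simpa using h3
  · rw [Finsupp.single_eq_of_ne] at h3
    · exact absurd h3 hc
    · intro h
      exact hpr ((Finsupp.single_left_inj one_ne_zero).1 h)

/-- The two ratios c, c' and 1 are pairwise distinct, so a generic point of a wheel is off the
diagonals and the recursive sum still computes the Laurent polynomial there. -/
lemma isGenericPoint_update_update (n : I → ℕ) {A B C : Var I} (hAB : A ≠ B) (hBC : B ≠ C)
    (hAC : A ≠ C) {c c' : GroundField I} (hc0 : c ≠ 0) (hc0' : c' ≠ 0) (hc : c ≠ 1) (hc' : c' ≠ 1)
    (hcc : c ≠ c') :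
    IsGenericPoint Prod.fst (Function.update (Function.update (zVar : Var I → RatFun I)
      A (c • zVar B)) C (c' • zVar B)) (varSet n) := by
  have hz : ∀ (d : GroundField I), d ≠ 0 → d • (zVar B : RatFun I) ≠ 0 :=
    fun d hd => smul_ne_zero hd (zVar_ne_zero B)
  have hval : ∀ p : Var I, ∃ (r : Var I) (d : GroundField I), d ≠ 0 ∧
      Function.update (Function.update (zVar : Var I → RatFun I)
        A (c • zVar B)) C (c' • zVar B) p = d • zVar r ∧
      (r = p ∧ d = 1 ∧ p ≠ A ∧ p ≠ C ∨ p = A ∧ r = B ∧ d = c ∨ p = C ∧ r = B ∧ d = c') := by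
    intro p
    by_cases h1 : p = C
    · subst h1
      exact ⟨B, c', hc0', by simp, Or.inr (Or.inr ⟨rfl, rfl, rfl⟩)⟩
    by_cases h2 : p = A
    · subst h2
      exact ⟨B, c, hc0, by simp [h1], Or.inr (Or.inl ⟨rfl, rfl, rfl⟩)⟩
    exact ⟨p, 1, one_ne_zero, by simp [h1, h2], Or.inl ⟨rfl, rfl, h2, h1⟩⟩
  refine ⟨fun p => ?_, fun p _ p' _ hpp _ heq => ?_⟩
  · obtain ⟨r, d, hd, h, -⟩ := hval p
    rw [h]
    exact smul_ne_zero hd (zVar_ne_zero r)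
  · obtain ⟨r, d, hd, h, hr⟩ := hval p
    obtain ⟨r', d', hd', h', hr'⟩ := hval p'
    rw [h, h'] at heq
    have h1 : (d'⁻¹ * d) • (zVar r : RatFun I) = zVar r' := by
      rw [mul_smul, heq, inv_smul_smul₀ hd']
    obtain ⟨h2, h3⟩ := smul_zVar_eq_zVar (mul_ne_zero (inv_ne_zero hd') hd) h1
    have h4 : d = d' := by
      rwa [inv_mul_eq_one₀ hd', eq_comm] at h3
    rcases hr with ⟨rfl, rfl, k1, k2⟩ | ⟨rfl, rfl, rfl⟩ | ⟨rfl, rfl, rfl⟩ <;>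
    rcases hr' with ⟨rfl, rfl, k1', k2'⟩ | ⟨rfl, rfl, rfl⟩ | ⟨rfl, rfl, rfl⟩ <;>
    first
      | exact hpp h2
      | exact hpp rfl
      | exact hc h4
      | exact hc' h4
      | exact hc h4.symm
      | exact hc' h4.symm
      | exact hcc h4
      | exact hcc h4.symm

lemma poleConst_mul_zpow_ne_one {o : Pole I} {r : ℤ} (h : o ≠ none ∨ r ≠ 1) :
    poleConst o * qPar I ^ r ≠ 1 := by
  intro h1
  have h2 : poleConst (none : Pole I) * qPar I ^ (1 : ℤ) = 1 := by
    simp [poleConst, qPar_ne_zero]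
  obtain ⟨h3, h4⟩ := poleConst_mul_zpow_inj (h1.trans h2.symm)
  rcases h with h | h
  · exact h h3
  · exact h h4

lemma qPar_ne_one : qPar I ≠ 1 := by
  have := poleConst_mul_zpow_ne_one (I := I) (o := none) (r := 2) (Or.inr (by norm_num))
  intro h
  apply this
  rw [h]
  simp [poleConst, h]

lemma tPar_ne_one {i j : I} (e : i ⟶ j) : tPar e ≠ 1 := by
  have := poleConst_mul_zpow_ne_one (I := I) (o := some (⟨i, j, e⟩, false)) (r := 0)
    (Or.inl (by simp))
  simpa [poleConst] using this

lemma qPar_ne_tPar {i j : I} (e : i ⟶ j) : qPar I ≠ tPar e := by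
  have := poleConst_mul_zpow_ne_one (I := I) (o := some (⟨i, j, e⟩, true)) (r := 0)
    (Or.inl (by simp))
  intro h
  apply this
  simp [poleConst, h, tPar_ne_zero]

/-- On a wheel the ratio z_a/z_c equals q, and z_c/z_b, z_b/z_a are 1/t_e, t_e/q for the first
condition and t_e/q, 1/t_e for the second. All three are zeros of the corresponding ζ, which is a
cycle in the sense of `symRec_eq_zero_of_cycle`. -/
lemma wheelConditions_of_eVal {w : Word I} {n : I → ℕ} {P : LaurentPoly I}
    (hP : ∀ (x : Var I → RatFun I),
        IsGenericPoint Prod.fst x (varSet n) → eVal Prod.fst x w (varSet n) = evalAt x P) :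
    WheelConditions n P := by
  intro i j e
  have hq := qPar_ne_zero (I := I)
  have ht := tPar_ne_zero e
  have hq1 := qPar_ne_one (I := I)
  have ht1 := tPar_ne_one e
  have hqt := qPar_ne_tPar e
  have hAq : algebraMap (GroundField I) (RatFun I) (qPar I) ≠ 0 := by simpa using hq
  have hAt : algebraMap (GroundField I) (RatFun I) (tPar e) ≠ 0 := by simpa using ht
  refine ⟨fun a b c ha hb hc hac hij => ?_, fun a b c ha hb hc hac hij => ?_⟩
  · have hAB : ((i, a) : Var I) ≠ (j, b) := fun h => by
      obtain ⟨h1, h2⟩ := Prod.mk.inj h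
      exact (hij h1).1 h2
    have hBC : ((j, b) : Var I) ≠ (i, c) := fun h => by
      obtain ⟨h1, h2⟩ := Prod.mk.inj h
      exact (hij h1.symm).2 h2
    have hAC : ((i, a) : Var I) ≠ (i, c) := fun h => hac (Prod.mk.inj h).2
    have hzb : (zVar (j, b) : RatFun I) ≠ 0 := zVar_ne_zero _
    rw [← hP _ (isGenericPoint_update_update n hAB hBC hAC (div_ne_zero hq ht) (inv_ne_zero ht)
      (by rwa [Ne, div_eq_one_iff_eq ht]) (by rwa [Ne, inv_eq_one])
      (by rw [div_eq_mul_inv, Ne, mul_eq_right₀ (inv_ne_zero ht)]; exact hq1))]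
    refine symRec_eq_zero_of_cycle _ _ _ (a := (i, a)) (b := (j, b)) (c := (i, c)) ?_ ?_ ?_
      hAB hBC hAC _ (mem_varSet.2 ha) (mem_varSet.2 hb) (mem_varSet.2 hc)
    · refine zeta_eq_zero (o := none) rfl ?_
      simp only [Function.update_self, Function.update_of_ne hAC, poleConst, Algebra.smul_def,
        map_inv₀, map_div₀]
      field_simp
    · refine zeta_eq_zero (o := some (⟨i, j, e⟩, false)) ⟨rfl, rfl⟩ ?_
      simp only [Function.update_self, Function.update_of_ne hAB.symm, Function.update_of_ne hBC,
        poleConst, Algebra.smul_def, map_inv₀, map_div₀]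
      field_simp
    · refine zeta_eq_zero (o := some (⟨i, j, e⟩, true)) ⟨rfl, rfl⟩ ?_
      simp only [Function.update_self, Function.update_of_ne hAB.symm, Function.update_of_ne hBC,
        Function.update_of_ne hAC, poleConst, Algebra.smul_def, map_inv₀, map_div₀]
      field_simp
  · have hAB : ((j, a) : Var I) ≠ (i, b) := fun h => by
      obtain ⟨h1, h2⟩ := Prod.mk.inj h
      exact (hij h1.symm).1 h2
    have hBC : ((i, b) : Var I) ≠ (j, c) := fun h => by
      obtain ⟨h1, h2⟩ := Prod.mk.inj h
      exact (hij h1).2 h2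
    have hAC : ((j, a) : Var I) ≠ (j, c) := fun h => hac (Prod.mk.inj h).2
    have hzb : (zVar (i, b) : RatFun I) ≠ 0 := zVar_ne_zero _
    rw [← hP _ (isGenericPoint_update_update n hAB hBC hAC ht (div_ne_zero ht hq) ht1
      (by rw [Ne, div_eq_one_iff_eq hq]; exact hqt.symm)
      (by rw [Ne, eq_div_iff hq, mul_eq_left₀ ht]; exact hq1))]
    refine symRec_eq_zero_of_cycle _ _ _ (a := (j, a)) (b := (i, b)) (c := (j, c)) ?_ ?_ ?_
      hAB hBC hAC _ (mem_varSet.2 ha) (mem_varSet.2 hb) (mem_varSet.2 hc)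
    · refine zeta_eq_zero (o := none) rfl ?_
      simp only [Function.update_self, Function.update_of_ne hAC, poleConst, Algebra.smul_def,
        map_inv₀, map_div₀]
      field_simp
    · refine zeta_eq_zero (o := some (⟨i, j, e⟩, true)) ⟨rfl, rfl⟩ ?_
      simp only [Function.update_self, Function.update_of_ne hAB.symm, Function.update_of_ne hBC,
        poleConst, Algebra.smul_def, map_div₀]
      field_simp
    · refine zeta_eq_zero (o := some (⟨i, j, e⟩, false)) ⟨rfl, rfl⟩ ?_
      simp only [Function.update_self, Function.update_of_ne hAB.symm, Function.update_of_ne hBC,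
        Function.update_of_ne hAC, poleConst, Algebra.smul_def, map_div₀]
      field_simp

lemma isGenericPoint_zVar (s : Finset (Var I)) :
    IsGenericPoint Prod.fst (zVar : Var I → RatFun I) s :=
  ⟨zVar_ne_zero, fun _ _ _ _ hab _ h => hab (zVar_injective h)⟩

lemma eVal_comp_permVar (n : I → ℕ) (σ : ∀ i, Equiv.Perm (Fin (n i))) (w : Word I) {K : Type*}
    [Field K] [Algebra (GroundField I) K] (x : Var I → K) :
    eVal Prod.fst (fun p => x (permVar n σ p)) w (varSet n) = eVal Prod.fst x w (varSet n) := by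
  conv_rhs => rw [← varSet_map_permVar n σ, eVal, symRec_map]
  rfl

lemma eWord_mem (w : Word I) : eWord w ∈ shuffleAlgebra I := by
  intro n
  by_cases hn : wordDegree w = n
  · subst hn
    obtain ⟨P, h1, h2⟩ := exists_laurent_eVal w (wordDegree w)
    refine ⟨P, ⟨h1, fun σ => ?_, wheelConditions_of_eVal (h2 (RatFun I))⟩, ?_⟩
    · rw [← h2 _ _ (isGenericPoint_zVar _), ← h2 _ _, eVal_comp_permVar]
      exact ⟨fun p => zVar_ne_zero _, fun a _ b _ hab _ h =>
        hab ((permVar _ σ).injective (zVar_injective h))⟩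
    · rw [← h2 _ _ (isGenericPoint_zVar _), eWord_eq, Finsupp.single_eq_same]
  · obtain ⟨P, h⟩ := (shuffleAlgebra I).zero_mem n
    refine ⟨P, h.1, ?_⟩
    rw [h.2, eWord_eq, Finsupp.single_eq_of_ne (Ne.symm hn)]
    rfl

end Membership

/-! ### The duality between `𝒮` and the opposite algebra -/

/-- Applying the monomial involution y to a relation between the z_p turns it into the same relation
between the x_p. -/
lemma algebraicIndependent_of_involution {k σ B : Type*} [CommRing k] [CommRing B]
    [Algebra k B] {x z : σ → Bˣ} (hx : AlgebraicIndependent k fun p => (x p : B))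
    (hinj : Function.Injective (laurentEval k x)) (y : σ → (AddMonoidAlgebra k (σ →₀ ℤ))ˣ)
    (hy : ∀ p, laurentEval k y (y p) = laurentVar k p) (hz : ∀ p, laurentEval k x (y p) = z p) :
    AlgebraicIndependent k fun p => (z p : B) := by
  rw [algebraicIndependent_iff]
  intro P hP
  have h1 : laurentEval k x (MvPolynomial.aeval (fun p => (y p : AddMonoidAlgebra k (σ →₀ ℤ))) P) =
      MvPolynomial.aeval (fun p => (z p : B)) P := by
    rw [← AlgHom.comp_apply, MvPolynomial.comp_aeval]
    simp only [hz]
  rw [hP, map_eq_zero_iff _ hinj] at h1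
  have h2 := congrArg (laurentEval k y) h1
  rw [← AlgHom.comp_apply, MvPolynomial.comp_aeval, map_zero] at h2
  simp only [hy] at h2
  have h3 := congrArg (laurentEval k x) h2
  rw [← AlgHom.comp_apply, MvPolynomial.comp_aeval, map_zero] at h3
  simp only [laurentEval_laurentVar] at h3
  exact (algebraicIndependent_iff.1 hx) P h3

section Duality

variable {I : Type u} [Quiver.{v} I]

/-- The images of the parameters under `q ↦ q`, `t_e ↦ q / t_e`. -/
def dualPar : Option (Edge I) → (GroundField I)ˣ
  | none => parUnit none
  | some e => parUnit none * (parUnit (some e))⁻¹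

lemma algebraicIndependent_dualPar :
    AlgebraicIndependent ℚ fun o : Option (Edge I) => (dualPar o : GroundField I) := by
  refine algebraicIndependent_of_involution (x := parUnit (I := I)) algebraicIndependent_par
    (laurentEval_injective_of_algebraicIndependent algebraicIndependent_par)
    (fun o => match o with
      | none => laurentVar ℚ none
      | some e => laurentVar ℚ none * (laurentVar ℚ (some e))⁻¹) ?_ ?_
  · rintro (_ | e)
    · simp
    · simp only [Units.val_mul, map_mul, laurentEval_laurentVar]
      rw [← AlgHom.coe_toMonoidHom, ← Units.coe_map_inv, ← Units.val_mul]
      congr 1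
      rw [mul_inv_eq_iff_eq_mul]
      apply Units.ext
      simp only [Units.val_mul, Units.coe_map, MonoidHom.coe_coe, laurentEval_laurentVar]
      rw [mul_left_comm, Units.mul_inv, mul_one]
  · rintro (_ | e)
    · simp [dualPar]
    · simp only [Units.val_mul, map_mul, laurentEval_laurentVar]
      rw [← AlgHom.coe_toMonoidHom, ← Units.coe_map_inv, ← Units.val_mul]
      congr 1
      rw [dualPar]
      congr 2
      ext
      simp

lemma aeval_dualPar_injective : Function.Injective
    (MvPolynomial.aeval (R := ℚ) fun o : Option (Edge I) =>
      (dualPar o : GroundField I)).toRingHom :=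
  algebraicIndependent_dualPar

/-- The endomorphism `q ↦ q`, `t_e ↦ q / t_e` of `𝔽`. -/
def dualGround : GroundField I →+* GroundField I :=
  IsFractionRing.lift (A := MvPolynomial (Option (Edge I)) ℚ)
    (g := (MvPolynomial.aeval fun o : Option (Edge I) => (dualPar o : GroundField I)).toRingHom)
    aeval_dualPar_injective

lemma dualGround_qPar : dualGround (qPar I) = qPar I := by
  rw [dualGround, qPar, IsFractionRing.lift_algebraMap]
  simp [dualPar, parUnit]

lemma dualGround_tPar {i j : I} (e : i ⟶ j) : dualGround (tPar e) = qPar I / tPar e := by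
  rw [dualGround, tPar, IsFractionRing.lift_algebraMap]
  simp [dualPar, parUnit, qPar, div_eq_mul_inv]

lemma dualGround_dualGround (c : GroundField I) : dualGround (dualGround c) = c := by
  have h : (dualGround (I := I)).comp dualGround = RingHom.id _ := by
    refine IsLocalization.ringHom_ext (nonZeroDivisors (MvPolynomial (Option (Edge I)) ℚ)) ?_
    refine MvPolynomial.ringHom_ext (fun r => ?_) ?_
    · exact RingHom.congr_fun (RingHom.ext_rat ((RingHom.comp (RingHom.comp dualGround dualGround)
        (algebraMap _ _)).comp MvPolynomial.C) (((RingHom.id _).comp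
        (algebraMap _ _)).comp MvPolynomial.C)) r
    · rintro (_ | ⟨i, j, e⟩)
      · simp only [RingHom.comp_apply]
        change dualGround (dualGround (qPar I)) = qPar I
        rw [dualGround_qPar, dualGround_qPar]
      · change dualGround (dualGround (tPar e)) = tPar e
        rw [dualGround_tPar, map_div₀, dualGround_qPar, dualGround_tPar,
          div_div_cancel₀ qPar_ne_zero]
  exact RingHom.congr_fun h c

instance : RingHomInvPair (dualGround (I := I)) dualGround :=
  ⟨RingHom.ext dualGround_dualGround, RingHom.ext dualGround_dualGround⟩

lemma algebraicIndependent_zVar_inv :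
    AlgebraicIndependent (GroundField I) fun p => (zVar p : RatFun I)⁻¹ := by
  have := algebraicIndependent_of_involution
    (x := fun p => Units.mk0 (zVar p : RatFun I) (zVar_ne_zero p))
    (z := fun p => (Units.mk0 (zVar p : RatFun I) (zVar_ne_zero p))⁻¹)
    (by simpa using algebraicIndependent_zVar (I := I))
    (laurentEval_injective_of_algebraicIndependent (by simpa using algebraicIndependent_zVar (I := I)))
    (fun p => (lVar p)⁻¹) (fun p => ?_) (fun p => ?_)
  · simpa using this
  · rw [← AlgHom.coe_toMonoidHom, ← Units.coe_map_inv]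
    congr 1
    rw [inv_eq_iff_eq_inv]
    ext
    simp
  · rw [← AlgHom.coe_toMonoidHom, ← Units.coe_map_inv]
    congr 2
    ext
    simp

lemma aeval_zVar_inv_injective : Function.Injective
    ((MvPolynomial.aeval fun p : Var I => (zVar p : RatFun I)⁻¹).toRingHom.comp
      (MvPolynomial.map (dualGround (I := I)))) :=
  Function.Injective.comp (g := (MvPolynomial.aeval fun p : Var I => (zVar p : RatFun I)⁻¹))
    algebraicIndependent_zVar_inv (MvPolynomial.map_injective _ dualGround.injective)

/-- The endomorphism `z ↦ 1 / z`, `q ↦ q`, `t_e ↦ q / t_e` of the field of rational functions. -/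
def dualRat : RatFun I →+* RatFun I :=
  IsFractionRing.lift (A := MvPolynomial (Var I) (GroundField I))
    (g := (MvPolynomial.aeval fun p : Var I => (zVar p : RatFun I)⁻¹).toRingHom.comp
      (MvPolynomial.map dualGround))
    aeval_zVar_inv_injective

lemma dualRat_zVar (p : Var I) : dualRat (zVar p) = (zVar p)⁻¹ := by
  rw [dualRat, zVar, IsFractionRing.lift_algebraMap]
  simp [zVar]

lemma dualRat_algebraMap (c : GroundField I) :
    dualRat (algebraMap (GroundField I) (RatFun I) c) =
      algebraMap (GroundField I) (RatFun I) (dualGround c) := by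
  rw [IsScalarTower.algebraMap_apply (GroundField I) (MvPolynomial (Var I) (GroundField I))
    (RatFun I), dualRat, IsFractionRing.lift_algebraMap]
  simp [MvPolynomial.algebraMap_eq]

lemma dualRat_smul (c : GroundField I) (R : RatFun I) :
    dualRat (c • R) = dualGround c • dualRat R := by
  rw [Algebra.smul_def, map_mul, dualRat_algebraMap, Algebra.smul_def]

lemma dualRat_dualRat (R : RatFun I) : dualRat (dualRat R) = R := by
  have h : (dualRat (I := I)).comp dualRat = RingHom.id _ := by
    refine IsLocalization.ringHom_ext (nonZeroDivisors (MvPolynomial (Var I) (GroundField I))) ?_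
    refine MvPolynomial.ringHom_ext (fun r => ?_) (fun p => ?_)
    · change dualRat (dualRat (algebraMap _ (RatFun I) (algebraMap _ _ r))) =
        algebraMap _ (RatFun I) (algebraMap _ _ r)
      rw [← IsScalarTower.algebraMap_apply, dualRat_algebraMap, dualRat_algebraMap,
        dualGround_dualGround]
    · change dualRat (dualRat (zVar p)) = zVar p
      rw [dualRat_zVar, map_inv₀, dualRat_zVar, inv_inv]
  exact RingHom.congr_fun h R

/-- The semilinear involution of the space of families of rational functions. -/
def dualGraded : Graded I ≃ₛₗ[dualGround (I := I)] Graded I where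
  toFun R := R.mapRange dualRat (map_zero _)
  invFun R := R.mapRange dualRat (map_zero _)
  map_add' R R' := Finsupp.mapRange_add (map_add _) R R'
  map_smul' c R := by
    ext n
    simp [dualRat_smul]
  left_inv R := by
    ext n
    simp [dualRat_dualRat]
  right_inv R := by
    ext n
    simp [dualRat_dualRat]

lemma dualGraded_apply (R : Graded I) (n : I → ℕ) : dualGraded R n = dualRat (R n) := rfl

lemma dualGraded_single (n : I → ℕ) (R : RatFun I) :
    dualGraded (Finsupp.single n R) = Finsupp.single n (dualRat R) :=
  Finsupp.mapRange_single (hf := map_zero _)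

/-- The semilinear involution of the space of Laurent polynomials. -/
def dualLaurent (P : LaurentPoly I) : LaurentPoly I :=
  P.coeff.sum fun m c => .single (-m) (dualGround c)

lemma evalAt_single {A : Type*} [Field A] [Algebra (GroundField I) A] (x : Var I → A)
    (m : Var I →₀ ℤ) (c : GroundField I) :
    evalAt x (.single m c : LaurentPoly I) = c • m.prod fun p k => x p ^ k := by
  rw [evalAt, AddMonoidAlgebra.coeff_single, Finsupp.sum_single_index]
  simp

lemma evalAt_dualLaurent (x : Var I → RatFun I) (P : LaurentPoly I) :
    evalAt (fun p => (dualRat (x p))⁻¹) (dualLaurent P) = dualRat (evalAt x P) := by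
  rw [dualLaurent, Finsupp.sum, evalAt_sum, evalAt, Finsupp.sum, map_sum]
  refine Finset.sum_congr rfl fun m _ => ?_
  rw [evalAt_single, dualRat_smul, Finsupp.prod_neg_index (by simp), Finsupp.prod, Finsupp.prod,
    map_prod]
  simp

lemma inVariables_dualLaurent {n : I → ℕ} {P : LaurentPoly I} (hP : InVariables n P) :
    InVariables n (dualLaurent P) := by
  intro m hm p hp
  by_contra hlt
  apply hm
  rw [dualLaurent, Finsupp.sum, AddMonoidAlgebra.coeff_sum, Finsupp.finsetSum_apply]
  refine Finset.sum_eq_zero fun m' hm' => ?_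
  rw [AddMonoidAlgebra.coeff_single, Finsupp.single_eq_of_ne]
  rintro rfl
  exact hlt (hP m' (Finsupp.mem_support_iff.1 hm') p (by simpa using hp))

lemma isSymmetric_dualLaurent {n : I → ℕ} {P : LaurentPoly I} (hP : IsSymmetric n P) :
    IsSymmetric n (dualLaurent P) := by
  intro σ
  have h1 := evalAt_dualLaurent (fun p => zVar (permVar n σ p)) P
  have h2 := evalAt_dualLaurent zVar P
  simp only [dualRat_zVar, inv_inv] at h1 h2
  rw [h1, h2, hP σ]

lemma evalAt_dualLaurent_update [DecidableEq I] (P : LaurentPoly I) (p r s : Var I)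
    (c c' : GroundField I) :
    evalAt (Function.update (Function.update (zVar : Var I → RatFun I) p (c • zVar r)) s
      (c' • zVar r)) (dualLaurent P) =
    dualRat (evalAt (Function.update (Function.update (zVar : Var I → RatFun I) p
      ((dualGround c)⁻¹ • zVar r)) s ((dualGround c')⁻¹ • zVar r)) P) := by
  rw [← evalAt_dualLaurent]
  congr 1
  have key : ∀ d : GroundField I, d • (zVar r : RatFun I) =
      (dualRat ((dualGround d)⁻¹ • zVar r))⁻¹ := by
    intro d
    rw [dualRat_smul, map_inv₀, dualGround_dualGround, dualRat_zVar, Algebra.smul_def,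
      Algebra.smul_def, mul_inv, map_inv₀, inv_inv, inv_inv]
  ext x
  by_cases h1 : x = s
  · subst h1
    rw [Function.update_self, Function.update_self, key]
  rw [Function.update_of_ne h1, Function.update_of_ne h1]
  by_cases h2 : x = p
  · subst h2
    rw [Function.update_self, Function.update_self, key]
  rw [Function.update_of_ne h2, Function.update_of_ne h2, dualRat_zVar, inv_inv]

/-- Under z ↦ 1/z, t_e ↦ q/t_e the outer two points of each wheel trade places, so each condition is
carried to itself with a and c exchanged. -/
lemma wheelConditions_dualLaurent [DecidableEq I] {n : I → ℕ} {P : LaurentPoly I}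
    (hP : WheelConditions n P) : WheelConditions n (dualLaurent P) := by
  intro i j e
  have hq := qPar_ne_zero (I := I)
  have ht := tPar_ne_zero e
  have e1 : (dualGround (qPar I / tPar e))⁻¹ = (tPar e)⁻¹ := by
    rw [map_div₀, dualGround_qPar, dualGround_tPar]; field_simp
  have e2 : (dualGround (tPar e)⁻¹)⁻¹ = qPar I / tPar e := by
    rw [map_inv₀, dualGround_tPar, inv_inv]
  have e3 : (dualGround (tPar e))⁻¹ = tPar e / qPar I := by
    rw [dualGround_tPar]; field_simp
  have e4 : (dualGround (tPar e / qPar I))⁻¹ = tPar e := by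
    rw [map_div₀, dualGround_qPar, dualGround_tPar]; field_simp
  refine ⟨fun a b c ha hb hc hac hij => ?_, fun a b c ha hb hc hac hij => ?_⟩
  · rw [evalAt_dualLaurent_update, e1, e2, Function.update_comm
      (by simpa using hac), (hP i j e).1 c b a hc hb ha hac.symm
      (fun h => ⟨(hij h).2.symm, (hij h).1.symm⟩), map_zero]
  · rw [evalAt_dualLaurent_update, e3, e4, Function.update_comm
      (by simpa using hac), (hP i j e).2 c b a hc hb ha hac.symm
      (fun h => ⟨(hij h).2.symm, (hij h).1.symm⟩), map_zero]

lemma dualGraded_mem [DecidableEq I] {R : Graded I} (hR : R ∈ shuffleAlgebra I) :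
    dualGraded R ∈ shuffleAlgebra I := by
  intro n
  obtain ⟨P, ⟨h1, h2, h3⟩, h4⟩ := hR n
  refine ⟨dualLaurent P, ⟨inVariables_dualLaurent h1, isSymmetric_dualLaurent h2,
    wheelConditions_dualLaurent h3⟩, ?_⟩
  rw [dualGraded_apply, ← h4, ← evalAt_dualLaurent]
  simp only [dualRat_zVar, inv_inv]

lemma dualGraded_dualGraded (R : Graded I) : dualGraded (dualGraded R) = R :=
  dualGraded.left_inv R

lemma dualGraded_mem_iff [DecidableEq I] {R : Graded I} :
    dualGraded R ∈ shuffleAlgebra I ↔ R ∈ shuffleAlgebra I :=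
  ⟨fun h => by simpa only [dualGraded_dualGraded] using dualGraded_mem h, dualGraded_mem⟩

end Duality

/-! ### The involution exchanges the words of 𝒮 and 𝒮^op. -/

section Words

variable {I : Type u} [Fintype I] [LinearOrder I] [Quiver.{v} I] [∀ i j : I, Fintype (i ⟶ j)]

lemma dualGround_poleConst (o : Pole I) :
    dualGround (poleConst o) = poleConst (o.map fun p => (p.1, !p.2)) := by
  rcases o with _ | ⟨e, _ | _⟩
  · simp [poleConst, dualGround_qPar]
  · simp [poleConst, dualGround_tPar]
  · simp [poleConst, dualGround_tPar, dualGround_qPar, div_div_cancel₀ qPar_ne_zero]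

/-- Exchanging t_e with q/t_e matches the linear factors of ζ_ij with those of ζ_ji and fixes the
factor with q⁻¹. -/
lemma dualRat_zeta (i j : I) (x : RatFun I) : dualRat (zeta i j x) = zeta j i (dualRat x) := by
  have hprod : ∏ o ∈ poles i j, (1 - algebraMap (GroundField I) (RatFun I)
      (dualGround (poleConst o)) * dualRat x) =
      ∏ o ∈ poles j i, (1 - algebraMap (GroundField I) (RatFun I) (poleConst o) * dualRat x) := by
    refine Finset.prod_bij' (fun o _ => o.map fun p => (p.1, !p.2))
      (fun o _ => o.map fun p => (p.1, !p.2)) ?_ ?_ ?_ ?_ ?_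
    · intro o ho
      rw [mem_poles] at ho ⊢
      rcases o with _ | ⟨e, _ | _⟩ <;> simp_all [IsPole]
    · intro o ho
      rw [mem_poles] at ho ⊢
      rcases o with _ | ⟨e, _ | _⟩ <;> simp_all [IsPole]
    · rintro (_ | ⟨e, _ | _⟩) _ <;> rfl
    · rintro (_ | ⟨e, _ | _⟩) _ <;> rfl
    · intro o _
      rw [dualGround_poleConst]
  rw [zeta_eq, zeta_eq, map_mul, map_prod, ← hprod]
  congr 1
  · simp only [map_sub, map_one, map_mul, dualRat_algebraMap]
  · by_cases h : i = j
    · subst h; simp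
    · rw [if_neg h, if_neg (Ne.symm h), map_one]

/-- z^d becomes z^{-d} and ζ_ij(z_a/z_b) becomes ζ_ji(z_b/z_a). Statements on 𝒮^op are deduced from
those on 𝒮, and conversely, through this symmetry. -/
lemma dualGraded_eWord (w : Word I) : dualGraded (eWord w) = fWord w := by
  rw [eWord_eq, fWord_eq, dualGraded_single, eVal, map_symRec, fVal]
  congr 1
  refine symRec_congr (fun _ _ => rfl) ?_ ?_
  · intro l p _
    simp [dualRat_zVar]
  · intro p _ r _ _
    rw [dualRat_zeta, map_div₀, dualRat_zVar, dualRat_zVar, div_eq_mul_inv, inv_inv, mul_comm,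
      ← div_eq_mul_inv]

lemma fWord_mem (w : Word I) : fWord w ∈ shuffleAlgebra I := by
  rw [← dualGraded_eWord]
  exact dualGraded_mem (eWord_mem w)

end Words

/-! ### Straightening of words -/

section Letters

variable {I : Type u}

/-- The letter `i^(d)`. -/
def mkLetter (i : I) (d : ℤ) : Letter I := toLex (OrderDual.toDual d, i)

@[simp] lemma mkLetter_vertex (i : I) (d : ℤ) : (mkLetter i d).vertex = i := rfl

@[simp] lemma mkLetter_exponent (i : I) (d : ℤ) : (mkLetter i d).exponent = d := rfl

@[simp] lemma mkLetter_eta (l : Letter I) : mkLetter l.vertex l.exponent = l := rfl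

lemma letter_lt_iff [LinearOrder I] {l m : Letter I} :
    l < m ↔ m.exponent < l.exponent ∨ l.exponent = m.exponent ∧ l.vertex < m.vertex := by
  rw [Prod.Lex.lt_iff]
  rfl

lemma exists_descent_of_not_isNonIncreasing [LinearOrder I] {w : Word I}
    (h : ¬ IsNonIncreasing w) : ∃ u l m v, w = u ++ l :: m :: v ∧ l < m := by
  induction w with
  | nil => exact absurd List.Pairwise.nil h
  | cons l w ih =>
    by_cases hw : IsNonIncreasing w
    · rcases w with _ | ⟨m, v⟩
      · exact absurd (List.pairwise_singleton _ _) h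
      · refine ⟨[], l, m, v, rfl, ?_⟩
        by_contra hlm
        rw [not_lt] at hlm
        apply h
        refine List.pairwise_cons.2 ⟨fun a ha => ?_, hw⟩
        rcases List.mem_cons.1 ha with rfl | ha
        · exact hlm
        · exact le_trans ((List.pairwise_cons.1 hw).1 a ha) hlm
    · obtain ⟨u, l', m, v, rfl, hlt⟩ := ih hw
      exact ⟨l :: u, l', m, v, rfl, hlt⟩

end Letters

/-! ### Quadratic relations between the generators. -/

section Straightening

variable {I : Type u} [Fintype I] [LinearOrder I] [Quiver.{v} I] [∀ i j : I, Fintype (i ⟶ j)]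

/-- The numerator of `ζ_{ij}`. -/
def zetaPoly (i j : I) : Polynomial (GroundField I) :=
  ∏ o ∈ poles i j, (1 - Polynomial.C (poleConst o) * Polynomial.X)

lemma zetaPoly_coeff_zero (i j : I) : (zetaPoly i j).coeff 0 = 1 := by
  rw [Polynomial.coeff_zero_eq_eval_zero, zetaPoly, Polynomial.eval_prod]
  simp

lemma zeta_eq_zetaPoly {K : Type*} [Field K] [Algebra (GroundField I) K] (i j : I) (x : K) :
    zeta i j x = Polynomial.aeval x (zetaPoly i j) * (if i = j then (1 - x)⁻¹ else 1) := by
  rw [zeta_eq, zetaPoly, map_prod]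
  simp

/-- The numerator has constant term 1. Its other terms lower the exponent of x and raise that of y,
so if x belongs to the first letter they start with a larger letter. -/
lemma sum_zetaPoly {K : Type*} [Field K] [Algebra (GroundField I) K] (i j : I) {x y : K}
    (hx : x ≠ 0) (hy : y ≠ 0) (d e : ℤ) :
    x ^ d * y ^ e * Polynomial.aeval (y / x) (zetaPoly i j) =
      x ^ d * y ^ e + ∑ k ∈ Finset.range (zetaPoly i j).natDegree,
        (zetaPoly i j).coeff (k + 1) • (x ^ (d - (k + 1 : ℕ)) * y ^ (e + (k + 1 : ℕ))) := by
  rw [Polynomial.aeval_eq_sum_range, Finset.sum_range_succ', zetaPoly_coeff_zero, pow_zero,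
    one_smul, mul_add, mul_one, add_comm, Finset.mul_sum]
  congr 1
  refine Finset.sum_congr rfl fun k _ => ?_
  rw [mul_smul_comm]
  congr 1
  rw [zpow_sub₀ hx, zpow_add₀ hy, zpow_natCast, zpow_natCast, div_pow]
  field_simp

/-- The contribution of the pair of variables `(a, b)` to a product of two letters. -/
def letterTerm (p : Letter I × Letter I) (a b : Var I) : RatFun I :=
  if a.1 = p.1.vertex ∧ b.1 = p.2.vertex then
    zVar a ^ p.1.exponent * zVar b ^ p.2.exponent * zeta a.1 b.1 (zVar a / zVar b) else 0

/-- The pairs of letters that are larger than a given one, with the same vertices. -/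
def largerPairs (l m : Letter I) : Set (Letter I × Letter I) :=
  {p | ([l, m] : Word I) < [p.1, p.2] ∧ [p.1.vertex, p.2.vertex].Perm [l.vertex, m.vertex]}

lemma mem_largerPairs_of_lt {l m : Letter I} {p : Letter I × Letter I} (h : l < p.1)
    (h' : [p.1.vertex, p.2.vertex].Perm [l.vertex, m.vertex]) : p ∈ largerPairs l m :=
  ⟨List.cons_lt_cons_iff.2 (Or.inl h), h'⟩

/-- Multiplying the e_i e_j contribution by ζ_ji and the e_j e_i contribution by ζ_ij gives in both
cases the monomial times ζ_ij ζ_ji. Expanding the numerators, the word i^(d) j^(e) has coefficient 1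
and every other word starts with a larger letter. -/
lemma exists_relation_of_ne {i j : I} (hij : i ≠ j) {d e : ℤ} (h : mkLetter i d < mkLetter j e) :
    ∃ c ∈ Finsupp.supported (GroundField I) (GroundField I)
        (largerPairs (mkLetter i d) (mkLetter j e)),
      ∀ a b : Var I, a.1 = i → b.1 = j → letterTerm (mkLetter i d, mkLetter j e) a b +
        Finsupp.linearCombination (GroundField I)
          (fun p => letterTerm p a b + letterTerm p b a) c = 0 := by
  refine ⟨∑ k ∈ Finset.range (zetaPoly j i).natDegree,
      Finsupp.single (mkLetter i (d - (k + 1 : ℕ)), mkLetter j (e + (k + 1 : ℕ)))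
        ((zetaPoly j i).coeff (k + 1)) -
    (Finsupp.single (mkLetter j e, mkLetter i d) 1 +
    ∑ k ∈ Finset.range (zetaPoly i j).natDegree,
      Finsupp.single (mkLetter j (e - (k + 1 : ℕ)), mkLetter i (d + (k + 1 : ℕ)))
        ((zetaPoly i j).coeff (k + 1))), ?_, ?_⟩
  · refine Submodule.sub_mem _ (Submodule.sum_mem _ fun k _ =>
      Finsupp.single_mem_supported _ _ ?_) (Submodule.add_mem _
      (Finsupp.single_mem_supported _ _ ?_) (Submodule.sum_mem _ fun k _ =>
      Finsupp.single_mem_supported _ _ ?_))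
    · refine mem_largerPairs_of_lt (letter_lt_iff.2 (Or.inl ?_)) (by simp)
      simp only [mkLetter_exponent]; omega
    · exact mem_largerPairs_of_lt h (List.Perm.swap _ _ _)
    · refine mem_largerPairs_of_lt (h.trans_le' (le_refl _) |>.trans
        (letter_lt_iff.2 (Or.inl ?_))) (List.Perm.swap _ _ _)
      simp only [mkLetter_exponent]; omega
  · rintro a b rfl rfl
    have h1 : ∀ d e : ℤ, letterTerm (mkLetter a.1 d, mkLetter b.1 e) a b =
        zVar a ^ d * zVar b ^ e * zeta a.1 b.1 (zVar a / zVar b) := fun d e => by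
      simp [letterTerm]
    have h2 : ∀ d e : ℤ, letterTerm (mkLetter b.1 e, mkLetter a.1 d) b a =
        zVar b ^ e * zVar a ^ d * zeta b.1 a.1 (zVar b / zVar a) := fun d e => by
      simp [letterTerm]
    have h3 : ∀ d e : ℤ, letterTerm (mkLetter a.1 d, mkLetter b.1 e) b a = 0 := fun d e => by
      simp [letterTerm, hij]
    have h4 : ∀ d e : ℤ, letterTerm (mkLetter b.1 e, mkLetter a.1 d) a b = 0 := fun d e => by
      simp [letterTerm, hij]
    have e1 := sum_zetaPoly b.1 a.1 (zVar_ne_zero a) (zVar_ne_zero b) d e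
    have e2 := sum_zetaPoly a.1 b.1 (zVar_ne_zero b) (zVar_ne_zero a) e d
    rw [map_sub, map_add, map_sum, map_sum]
    simp only [Finsupp.linearCombination_single, h1, h2, h3, h4, add_zero, zero_add, one_smul]
    simp only [← smul_mul_assoc, ← Finset.sum_mul]
    rw [← sub_eq_iff_eq_add'] at e1 e2
    simp only [← smul_mul_assoc] at e1 e2
    rw [← e1, ← e2, zeta_eq_zetaPoly b.1 a.1, zeta_eq_zetaPoly a.1 b.1, if_neg hij,
      if_neg hij.symm]
    ring

/-- With p the numerator of ζ_ii, the symmetrization of x^d y^e p(y/x) ζ_ii(x/y) equals p(y/x)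
p(x/y) (x^d y^{e+1} - y^d x^{e+1}) / (y - x). It is antisymmetric under exchanging d and e + 1,
which gives the relation. -/
lemma exists_relation_of_lt {i : I} {d e : ℤ} (h : e < d) :
    ∃ c ∈ Finsupp.supported (GroundField I) (GroundField I)
        (largerPairs (mkLetter i d) (mkLetter i e)),
      ∀ a b : Var I, a ≠ b → a.1 = i → b.1 = i →
        letterTerm (mkLetter i d, mkLetter i e) a b +
        letterTerm (mkLetter i d, mkLetter i e) b a +
        Finsupp.linearCombination (GroundField I)
          (fun p => letterTerm p a b + letterTerm p b a) c = 0 := by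
  let c : ℤ → ℤ → (Letter I × Letter I) →₀ GroundField I := fun d e =>
    ∑ k ∈ Finset.range (zetaPoly i i).natDegree,
      Finsupp.single (mkLetter i (d - (k + 1 : ℕ)), mkLetter i (e + (k + 1 : ℕ)))
        ((zetaPoly i i).coeff (k + 1))
  have hc : ∀ d' ≤ d, ∀ e', c d' e' ∈ Finsupp.supported (GroundField I) (GroundField I)
        (largerPairs (mkLetter i d) (mkLetter i e)) := by
    intro d' hd' e'
    refine Submodule.sum_mem _ fun k _ => Finsupp.single_mem_supported _ _ ?_
    refine mem_largerPairs_of_lt (letter_lt_iff.2 (Or.inl ?_)) (by simp)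
    simp only [mkLetter_exponent]; omega
  have hsum : ∀ (d' e' : ℤ) (a b : Var I), a.1 = i → b.1 = i →
      letterTerm (mkLetter i d', mkLetter i e') a b + letterTerm (mkLetter i d', mkLetter i e') b a +
      Finsupp.linearCombination (GroundField I)
          (fun p => letterTerm p a b + letterTerm p b a) (c d' e') =
      zVar a ^ d' * zVar b ^ e' * Polynomial.aeval (zVar b / zVar a : RatFun I) (zetaPoly i i) *
        zeta i i (zVar a / zVar b) +
      zVar b ^ d' * zVar a ^ e' * Polynomial.aeval (zVar a / zVar b : RatFun I) (zetaPoly i i) *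
        zeta i i (zVar b / zVar a) := by
    intro d' e' a b ha hb
    have h1 : ∀ d e : ℤ, letterTerm (mkLetter i d, mkLetter i e) a b =
        zVar a ^ d * zVar b ^ e * zeta i i (zVar a / zVar b) := fun d e => by
      simp [letterTerm, ha, hb]
    have h2 : ∀ d e : ℤ, letterTerm (mkLetter i d, mkLetter i e) b a =
        zVar b ^ d * zVar a ^ e * zeta i i (zVar b / zVar a) := fun d e => by
      simp [letterTerm, ha, hb]
    have e1 := sum_zetaPoly i i (zVar_ne_zero a) (zVar_ne_zero b) d' e'
    have e2 := sum_zetaPoly i i (zVar_ne_zero b) (zVar_ne_zero a) d' e'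
    rw [map_sum]
    simp only [Finsupp.linearCombination_single, h1, h2, smul_add]
    simp only [← smul_mul_assoc, ← Finset.sum_mul, Finset.sum_add_distrib]
    rw [← sub_eq_iff_eq_add'] at e1 e2
    simp only [← smul_mul_assoc] at e1 e2
    rw [← e1, ← e2]
    ring
  have hz : ∀ a b : Var I, a ≠ b → (zVar b : RatFun I) - zVar a ≠ 0 := fun a b hab =>
    sub_ne_zero.2 fun h => hab (zVar_injective h).symm
  -- For d = e + 1 the antisymmetric expression is already zero; otherwise the expression for the
  -- exponents (e + 1, d - 1) is added, and its leading letter is larger because e + 1 < d.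
  by_cases hde : d = e + 1
  · refine ⟨c d e, hc d le_rfl e, fun a b hab ha hb => ?_⟩
    rw [hsum d e a b ha hb, zeta_eq_zetaPoly, zeta_eq_zetaPoly, if_pos rfl, if_pos rfl, hde]
    have h1 := zVar_ne_zero a
    have h2 := zVar_ne_zero b
    have h3 := hz a b hab
    have h4 := hz b a hab.symm
    rw [zpow_add_one₀ h1, zpow_add_one₀ h2, one_sub_div h1, one_sub_div h2, ← neg_sub (zVar b)]
    field_simp
    ring
  · have hlt : e + 1 < d := by omega
    refine ⟨c d e + (Finsupp.single (mkLetter i (e + 1), mkLetter i (d - 1)) 1 +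
      c (e + 1) (d - 1)), Submodule.add_mem _ (hc d le_rfl e) (Submodule.add_mem _
        (Finsupp.single_mem_supported _ _ (mem_largerPairs_of_lt
          (letter_lt_iff.2 (Or.inl ?_)) (by simp))) (hc _ (by omega) _)), fun a b hab ha hb => ?_⟩
    · simpa using hlt
    rw [map_add, map_add, Finsupp.linearCombination_single, one_smul, ← add_assoc, hsum d e a b ha hb,
      hsum (e + 1) (d - 1) a b ha hb, zeta_eq_zetaPoly, zeta_eq_zetaPoly, if_pos rfl, if_pos rfl]
    have h1 := zVar_ne_zero a
    have h2 := zVar_ne_zero b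
    have h3 := hz a b hab
    rw [zpow_add_one₀ h1, zpow_add_one₀ h2, zpow_sub_one₀ h1, zpow_sub_one₀ h2, one_sub_div h1,
      one_sub_div h2, ← neg_sub (zVar b)]
    field_simp
    ring

/-- Every term vanishes unless the colours of the two variables match the vertices of the letters;
if they do, one of the two preceding relations applies. The form symmetric in a and b frees it from
the colouring. -/
lemma exists_two_letter_relation {l m : Letter I} (h : l < m) :
    ∃ c ∈ Finsupp.supported (GroundField I) (GroundField I) (largerPairs l m),
      ∀ a b : Var I, a ≠ b → letterTerm (l, m) a b + letterTerm (l, m) b a +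
        Finsupp.linearCombination (GroundField I)
          (fun p => letterTerm p a b + letterTerm p b a) c = 0 := by
  have hzero : ∀ c ∈ Finsupp.supported (GroundField I) (GroundField I) (largerPairs l m),
      ∀ a b : Var I, ¬ [a.1, b.1].Perm [l.vertex, m.vertex] →
        letterTerm (l, m) a b + letterTerm (l, m) b a +
        Finsupp.linearCombination (GroundField I)
          (fun p => letterTerm p a b + letterTerm p b a) c = 0 := by
    intro c hc a b hab
    have hab' : ¬ [b.1, a.1].Perm [l.vertex, m.vertex] := fun h' =>
      hab ((List.Perm.swap _ _ _).trans h')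
    have key : ∀ p : Letter I × Letter I,
        [p.1.vertex, p.2.vertex].Perm [l.vertex, m.vertex] →
        letterTerm p a b + letterTerm p b a = 0 := by
      intro p hp
      rw [letterTerm, letterTerm, if_neg, if_neg, add_zero]
      · rintro ⟨h1, h2⟩
        rw [← h1, ← h2] at hp
        exact hab' hp
      · rintro ⟨h1, h2⟩
        rw [← h1, ← h2] at hp
        exact hab hp
    rw [key (l, m) (List.Perm.refl _), zero_add, Finsupp.linearCombination_apply, Finsupp.sum]
    refine Finset.sum_eq_zero fun p hp => ?_
    rw [key p (hc hp).2, smul_zero]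
  by_cases hv : l.vertex = m.vertex
  · obtain ⟨c, hc, h1⟩ := exists_relation_of_lt (i := l.vertex) (d := l.exponent)
      (e := m.exponent) (by
        rcases letter_lt_iff.1 h with h | h
        · exact h
        · exact absurd hv h.2.ne)
    have h2 : mkLetter l.vertex m.exponent = m := by rw [hv, mkLetter_eta]
    rw [mkLetter_eta, h2] at hc h1
    refine ⟨c, hc, fun a b hab => ?_⟩
    by_cases hp : [a.1, b.1].Perm [l.vertex, m.vertex]
    · have ha : a.1 = l.vertex := by
        have := hp.subset (List.mem_cons_self)
        simpa [← hv] using this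
      have hb : b.1 = l.vertex := by
        have := hp.subset (List.mem_cons_of_mem _ (List.mem_cons_self))
        simpa [← hv] using this
      exact h1 a b hab ha hb
    · exact hzero c hc a b hp
  · obtain ⟨c, hc, h1⟩ := exists_relation_of_ne hv (d := l.exponent) (e := m.exponent) h
    rw [mkLetter_eta, mkLetter_eta] at hc h1
    refine ⟨c, hc, fun a b hab => ?_⟩
    have hswap : ∀ a b : Var I, a.1 = l.vertex → b.1 = m.vertex → letterTerm (l, m) b a = 0 := by
      intro a b ha hb
      rw [letterTerm, if_neg]
      rintro ⟨h3, -⟩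
      exact hv (h3.symm.trans hb)
    by_cases hp : [a.1, b.1].Perm [l.vertex, m.vertex]
    · by_cases ha : a.1 = l.vertex
      · have hb : b.1 = m.vertex := by
          rw [ha, List.perm_cons] at hp
          simpa using hp
        rw [hswap a b ha hb, add_zero]
        exact h1 a b ha hb
      · have ha' : a.1 = m.vertex := by
          have := hp.subset (List.mem_cons_self)
          simpa [ha] using this
        have hb : b.1 = l.vertex := by
          have := (hp.trans (List.Perm.swap _ _ _))
          rw [ha', List.perm_cons] at this
          simpa using this
        rw [hswap b a hb ha', zero_add]
        have := h1 b a hb ha'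
        simpa only [add_comm (letterTerm _ b a)] using this
    · exact hzero c hc a b hp

lemma sum_sum_erase_comm {ι M : Type*} [DecidableEq ι] [AddCommMonoid M] (s : Finset ι)
    (f : ι → ι → M) : ∑ a ∈ s, ∑ b ∈ s.erase a, f a b = ∑ a ∈ s, ∑ b ∈ s.erase a, f b a := by
  refine Finset.sum_comm' fun a b => ?_
  simp only [Finset.mem_erase]
  tauto

/-- The contribution of a pair of variables to the remaining letters of a word. -/
def remainder (w : Word I) (s : Finset (Var I)) (a b : Var I) : RatFun I :=
  (∏ c ∈ (s.erase a).erase b, zeta a.1 c.1 (zVar a / zVar c)) *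
    (∏ c ∈ (s.erase a).erase b, zeta b.1 c.1 (zVar b / zVar c)) *
    eVal Prod.fst zVar w ((s.erase a).erase b)

/-- The contribution of the remaining letters is symmetric in the two variables, so only the
symmetrized two-letter term enters. The factor 2 permits summing over ordered pairs. -/
lemma two_mul_eVal (p : Letter I × Letter I) (w : Word I) (s : Finset (Var I)) :
    2 * eVal Prod.fst (zVar : Var I → RatFun I) (p.1 :: p.2 :: w) s =
      ∑ a ∈ s, ∑ b ∈ s.erase a, (letterTerm p a b + letterTerm p b a) * remainder w s a b := by
  have h1 : eVal Prod.fst (zVar : Var I → RatFun I) (p.1 :: p.2 :: w) s =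
      ∑ a ∈ s, ∑ b ∈ s.erase a, letterTerm p a b * remainder w s a b := by
    rw [eVal_cons, Finset.sum_filter]
    refine Finset.sum_congr rfl fun a ha => ?_
    split_ifs with h
    · rw [eVal_cons, Finset.sum_filter, Finset.mul_sum]
      refine Finset.sum_congr rfl fun b hb => ?_
      by_cases h' : b.1 = p.2.vertex
      · rw [if_pos h', letterTerm, if_pos ⟨h, h'⟩, remainder, ← Finset.mul_prod_erase _ _ hb]
        ring
      · rw [if_neg h', letterTerm, if_neg fun h => h' h.2, mul_zero, zero_mul]
    · symm
      refine Finset.sum_eq_zero fun b _ => ?_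
      rw [letterTerm, if_neg fun h' => h h'.1, zero_mul]
  have h2 : ∀ a b, remainder w s a b = remainder w s b a := by
    intro a b
    rw [remainder, remainder, Finset.erase_right_comm, mul_comm (∏ c ∈ _, zeta a.1 _ _)]
  rw [two_mul, h1]
  nth_rw 2 [sum_sum_erase_comm]
  rw [← Finset.sum_add_distrib]
  refine Finset.sum_congr rfl fun a _ => ?_
  rw [← Finset.sum_add_distrib]
  refine Finset.sum_congr rfl fun b _ => ?_
  rw [h2 b a]
  ring

/-- A relation between two letters may be multiplied on the right by v, by `two_mul_eVal`, and on
the left by u, one letter of the recursive sum at a time. -/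
lemma eVal_relation {l m : Letter I} {c : (Letter I × Letter I) →₀ GroundField I}
    (hc : ∀ a b : Var I, a ≠ b → letterTerm (l, m) a b + letterTerm (l, m) b a +
        Finsupp.linearCombination (GroundField I)
          (fun p => letterTerm p a b + letterTerm p b a) c = 0) (u v : Word I) (s : Finset (Var I)) :
    eVal Prod.fst (zVar : Var I → RatFun I) (u ++ l :: m :: v) s +
      Finsupp.linearCombination (GroundField I)
        (fun p => eVal Prod.fst (zVar : Var I → RatFun I) (u ++ p.1 :: p.2 :: v) s) c = 0 := by
  induction u generalizing s with
  | nil =>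
    simp only [List.nil_append]
    have h2 : (2 : RatFun I) ≠ 0 := two_ne_zero
    apply mul_left_cancel₀ h2
    rw [mul_zero, mul_add, two_mul_eVal (l, m), Finsupp.linearCombination_apply, Finsupp.sum,
      Finset.mul_sum]
    simp only [mul_smul_comm, two_mul_eVal, Finset.smul_sum]
    rw [Finset.sum_comm, ← Finset.sum_add_distrib]
    refine Finset.sum_eq_zero fun a _ => ?_
    rw [Finset.sum_comm, ← Finset.sum_add_distrib]
    refine Finset.sum_eq_zero fun b hb => ?_
    simp only [← smul_mul_assoc]
    rw [← Finset.sum_mul, ← add_mul]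
    have := hc a b (Finset.ne_of_mem_erase hb).symm
    rw [Finsupp.linearCombination_apply, Finsupp.sum] at this
    rw [this, zero_mul]
  | cons l' u ih =>
    simp only [List.cons_append, eVal_cons]
    rw [Finsupp.linearCombination_apply, Finsupp.sum]
    simp only [Finset.smul_sum]
    rw [Finset.sum_comm, ← Finset.sum_add_distrib]
    refine Finset.sum_eq_zero fun a _ => ?_
    simp only [← mul_smul_comm]
    rw [← Finset.mul_sum, ← mul_add]
    have := ih (s.erase a)
    rw [Finsupp.linearCombination_apply, Finsupp.sum] at this
    rw [this, mul_zero]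

lemma wordDegree_congr_perm {w w' : Word I} (h : (w.map Letter.vertex).Perm (w'.map Letter.vertex)) :
    wordDegree w = wordDegree w' := by
  funext i
  exact h.count_eq i

/-- Two adjacent letters l < m are replaced by larger pairs with the same vertices;
lexicographically the whole word becomes larger and its degree is unchanged. -/
lemma eWord_mem_span_of_not_isNonIncreasing {w : Word I} (h : ¬ IsNonIncreasing w) :
    eWord w ∈ Submodule.span (GroundField I)
      (eWord '' {w' : Word I | w < w' ∧ wordDegree w' = wordDegree w}) := by
  obtain ⟨u, l, m, v, rfl, hlm⟩ := exists_descent_of_not_isNonIncreasing h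
  obtain ⟨c, hc, hrel⟩ := exists_two_letter_relation hlm
  have hdeg : ∀ p ∈ largerPairs l m,
      wordDegree (u ++ p.1 :: p.2 :: v) = wordDegree (u ++ l :: m :: v) := by
    intro p hp
    apply wordDegree_congr_perm
    simp only [List.map_append, List.map_cons]
    exact (List.perm_append_left_iff _).2 (hp.2.append_right (v.map Letter.vertex))
  have h1 : eWord (u ++ l :: m :: v) = -∑ p ∈ c.support, c p • eWord (u ++ p.1 :: p.2 :: v) := by
    rw [eq_neg_iff_add_eq_zero]
    have h2 : ∑ p ∈ c.support, c p • eWord (u ++ p.1 :: p.2 :: v) =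
        ∑ p ∈ c.support, Finsupp.single (wordDegree (u ++ l :: m :: v))
          (c p • eVal Prod.fst zVar (u ++ p.1 :: p.2 :: v)
            (varSet (wordDegree (u ++ l :: m :: v)))) := by
      refine Finset.sum_congr rfl fun p hp => ?_
      rw [eWord_eq, hdeg p (hc hp), Finsupp.smul_single]
    rw [h2, ← Finsupp.single_finsetSum, eWord_eq, ← Finsupp.single_add]
    have := eVal_relation hrel u v (varSet (wordDegree (u ++ l :: m :: v)))
    rw [Finsupp.linearCombination_apply, Finsupp.sum] at this
    rw [this, Finsupp.single_zero]
  rw [h1]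
  refine Submodule.neg_mem _ (Submodule.sum_mem _ fun p hp => Submodule.smul_mem _ _
    (Submodule.subset_span ⟨_, ⟨?_, hdeg p (hc hp)⟩, rfl⟩))
  refine List.append_left_lt ?_
  rcases List.cons_lt_cons_iff.1 (hc hp).1 with h | ⟨h, h'⟩
  · exact List.cons_lt_cons_iff.2 (Or.inl h)
  · refine List.cons_lt_cons_iff.2 (Or.inr ⟨h, ?_⟩)
    rcases List.cons_lt_cons_iff.1 h' with h | ⟨_, h⟩
    · exact List.cons_lt_cons_iff.2 (Or.inl h)
    · exact absurd h (lt_irrefl _)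

end Straightening

/-! ### Constant terms of rational functions in one variable -/

section PartialFractions

open LaurentPolynomial

variable {K : Type*} [Field K]

lemma one_sub_C_mul_T_dvd {N : K[T;T⁻¹]} {c : K} (hc : c ≠ 0)
    (hN : eval₂ (RingHom.id K) (Units.mk0 c hc)⁻¹ N = 0) : (1 - C c * T 1) ∣ N := by
  obtain ⟨n, p, hp⟩ := exists_T_pow N
  have h1 : p.eval c⁻¹ = 0 := by
    have := congrArg (eval₂ (RingHom.id K) (Units.mk0 c hc)⁻¹) hp
    rw [map_mul, hN, zero_mul, eval₂_toLaurent] at this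
    simpa [Polynomial.eval₂_id] using this
  obtain ⟨g, hg⟩ := Polynomial.dvd_iff_isRoot.2 h1
  have h2 : (1 - C c * T 1 : K[T;T⁻¹]) * (-(C c⁻¹ * Polynomial.toLaurent g) * T (-n)) = N := by
    have h3 : N = Polynomial.toLaurent p * T (-n) := by
      rw [hp, mul_assoc, ← T_add, add_neg_cancel, T_zero, mul_one]
    rw [h3, hg, map_mul, map_sub, Polynomial.toLaurent_X, Polynomial.toLaurent_C]
    have h4 : (C c : K[T;T⁻¹]) * C c⁻¹ = 1 := by rw [← map_mul, mul_inv_cancel₀ hc, map_one]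
    linear_combination (T 1 * Polynomial.toLaurent g * T (-n)) * h4
  exact ⟨_, h2.symm⟩

variable {J : Type*} [DecidableEq J] (s : Finset J) (c : J → K)

/-- The residues of a rational function with simple poles `1 / c_j`. -/
def partialResidue (hc : ∀ j, c j ≠ 0) (N : K[T;T⁻¹]) (j : J) : K :=
  eval₂ (RingHom.id K) (Units.mk0 (c j) (hc j))⁻¹ N / ∏ k ∈ s.erase j, (1 - c k / c j)

/-- Subtracting the residue terms makes N vanish at every 1/c_j, and the factors 1 - c_j T are
pairwise coprime, so their product divides the difference. -/
lemma exists_partialFractions (hc : ∀ j, c j ≠ 0) (hinj : Set.InjOn c s) (N : K[T;T⁻¹]) :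
    ∃ Q : K[T;T⁻¹], N = Q * ∏ j ∈ s, (1 - C (c j) * T 1) +
      ∑ j ∈ s, C (partialResidue s c hc N j) * ∏ k ∈ s.erase j, (1 - C (c k) * T 1) := by
  set D := N - ∑ j ∈ s, C (partialResidue s c hc N j) * ∏ k ∈ s.erase j, (1 - C (c k) * T 1)
    with hD
  have heval : ∀ j k, eval₂ (RingHom.id K) (Units.mk0 (c j) (hc j))⁻¹ (1 - C (c k) * T 1) =
      1 - c k / c j := by
    intro j k
    rw [map_sub, map_one, map_mul, eval₂_C, eval₂_T]
    simp [div_eq_mul_inv]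
  have h1 : ∀ j ∈ s, (1 - C (c j) * T 1) ∣ D := by
    intro j hj
    apply one_sub_C_mul_T_dvd (hc j)
    rw [hD, map_sub, map_sum, Finset.sum_eq_single_of_mem j hj]
    · rw [map_mul, map_prod, eval₂_C, RingHom.id_apply, partialResidue]
      simp only [heval]
      rw [div_mul_cancel₀, sub_self]
      refine Finset.prod_ne_zero_iff.2 fun k hk => ?_
      rw [Ne, sub_eq_zero, eq_comm, div_eq_one_iff_eq (hc j)]
      exact fun h => (Finset.ne_of_mem_erase hk) (hinj (Finset.mem_of_mem_erase hk) hj h)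
    · intro k hk hkj
      rw [map_mul, map_prod, Finset.prod_eq_zero (Finset.mem_erase.2 ⟨hkj.symm, hj⟩), mul_zero]
      rw [heval, div_self (hc j), sub_self]
  have h2 : ∏ j ∈ s, (1 - C (c j) * T 1) ∣ D := by
    refine Finset.prod_dvd_of_coprime (fun j hj k hk hjk => ?_) h1
    have hne : c k - c j ≠ 0 := sub_ne_zero.2 fun h => hjk (hinj hj hk h.symm)
    -- Bézout coefficients from c_k (1 - c_j T) - c_j (1 - c_k T) = c_k - c_j.
    refine ⟨C (c k / (c k - c j)), C (-c j / (c k - c j)), ?_⟩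
    have e1 : (C (c k / (c k - c j)) : K[T;T⁻¹]) + C (-c j / (c k - c j)) = 1 := by
      rw [← map_add, ← add_div, ← sub_eq_add_neg, div_self hne, map_one]
    have e2 : (C (c k / (c k - c j)) : K[T;T⁻¹]) * C (c j) + C (-c j / (c k - c j)) * C (c k) = 0 := by
      rw [← map_mul, ← map_mul, ← map_add]
      have : c k / (c k - c j) * c j + -c j / (c k - c j) * c k = 0 := by field_simp; ring
      rw [this, map_zero]
    linear_combination e1 - T 1 * e2
  obtain ⟨Q, hQ⟩ := h2
  refine ⟨Q, ?_⟩
  rw [mul_comm Q, ← hQ, hD]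
  ring

variable {L : Type*} [Field L] (emb : K →+* L) (y : Lˣ)

lemma eval₂_div_prod_eq (hc : ∀ j, c j ≠ 0) {N Q : K[T;T⁻¹]}
    (hQ : N = Q * ∏ j ∈ s, (1 - C (c j) * T 1) +
      ∑ j ∈ s, C (partialResidue s c hc N j) * ∏ k ∈ s.erase j, (1 - C (c k) * T 1))
    (hne : ∀ j ∈ s, 1 - emb (c j) * y ≠ 0) :
    eval₂ emb y N / ∏ j ∈ s, (1 - emb (c j) * y) =
      eval₂ emb y Q + ∑ j ∈ s, emb (partialResidue s c hc N j) / (1 - emb (c j) * y) := by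
  have h1 : ∏ j ∈ s, (1 - emb (c j) * y) ≠ 0 := Finset.prod_ne_zero_iff.2 hne
  have heval : ∀ k, eval₂ emb y (1 - C (c k) * T 1) = 1 - emb (c k) * y := by
    intro k
    rw [map_sub, map_one, map_mul, eval₂_C, eval₂_T]
    simp
  rw [div_eq_iff h1]
  conv_lhs => rw [hQ]
  rw [map_add, map_mul, map_prod, map_sum, add_mul, Finset.sum_mul]
  congr 1
  · simp only [heval]
  · refine Finset.sum_congr rfl fun j hj => ?_
    rw [map_mul, map_prod, eval₂_C, ← Finset.mul_prod_erase s _ hj]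
    simp only [heval]
    rw [← mul_assoc, div_mul_cancel₀ _ (hne j hj)]

end PartialFractions

/-! ### Dependence of a constant term on the region of expansion. -/

section HahnConstantTerm

variable {Γ R : Type*} [AddCommGroup Γ] [LinearOrder Γ] [IsOrderedAddMonoid Γ] [Field R]

open HahnSeries

/-- A well-ordered support contains no infinite descending progression. -/
lemma exists_coeff_sub_nsmul_eq_zero (X : R⟦Γ⟧) {δ : Γ} (hδ : 0 < δ) (γ : Γ) :
    ∃ n : ℕ, X.coeff (γ - n • δ) = 0 := by
  by_contra! h
  have h1 := X.isWF_support
  have h2 : ∀ n : ℕ, γ - n • δ ∈ X.support := fun n => h n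
  rw [Set.isWF_iff_no_descending_seq] at h1
  refine h1 (fun n => γ - n • δ) ?_ h2
  intro n m hnm
  have := nsmul_lt_nsmul_left hδ hnm
  simpa using this

/-- If `X (1 - a t^δ) = G`, where `δ > 0` has degree one and the exponents of `G` have degree zero,
then the constant terms of `X` and `G` agree. -/
lemma coeff_zero_of_mul_one_sub_of_pos (π : Γ →+ ℤ) {X G : R⟦Γ⟧} {δ : Γ} {a : R}
    (hG : ∀ γ, G.coeff γ ≠ 0 → π γ = 0) (hδ : 0 < δ) (hπ : π δ = 1)
    (h : X * (1 - single δ a) = G) : X.coeff 0 = G.coeff 0 := by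
  have hrec : ∀ γ, X.coeff γ = G.coeff γ + X.coeff (γ - δ) * a := by
    intro γ
    rw [← h, mul_sub, mul_one, coeff_sub, coeff_mul_single]
    ring
  -- G has no exponents of negative degree, so the recursion can be iterated until it leaves the
  -- support of X.
  have hneg : ∀ (n : ℕ) (γ : Γ), π γ < 0 → X.coeff γ = X.coeff (γ - n • δ) * a ^ n := by
    intro n
    induction n with
    | zero => intro γ _; simp
    | succ n ih =>
      intro γ hγ
      have h0 : G.coeff γ = 0 := by
        by_contra h0
        exact hγ.ne (hG γ h0)
      rw [hrec γ, h0, zero_add, ih (γ - δ) (by rw [map_sub, hπ]; omega), pow_succ, mul_assoc,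
        add_smul, one_smul, sub_sub, add_comm δ]
  obtain ⟨n, hn⟩ := exists_coeff_sub_nsmul_eq_zero X hδ (0 - δ)
  rw [hrec 0, hneg n (0 - δ) (by rw [map_sub, hπ, map_zero]; norm_num), hn]
  ring

/-- For δ < 0 the geometric series runs in powers of t^{-δ}, starting with the first, so only
negative degrees occur. -/
lemma coeff_zero_of_mul_one_sub_of_neg (π : Γ →+ ℤ) {X G : R⟦Γ⟧} {δ : Γ} {a : R}
    (hG : ∀ γ, G.coeff γ ≠ 0 → π γ = 0) (hδ : δ < 0) (hπ : π δ = 1) (ha : a ≠ 0)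
    (h : X * (1 - single δ a) = G) : X.coeff 0 = 0 := by
  have hrec : ∀ γ, X.coeff γ = (X.coeff (γ + δ) - G.coeff (γ + δ)) * a⁻¹ := by
    intro γ
    rw [← h, mul_sub, mul_one, coeff_sub, coeff_mul_single, add_sub_cancel_right, sub_sub_cancel,
      mul_assoc, mul_inv_cancel₀ ha, mul_one]
  have hpos : ∀ (n : ℕ) (γ : Γ), 0 ≤ π γ → X.coeff γ = X.coeff (γ - n • (-δ)) * a⁻¹ ^ n := by
    intro n
    induction n with
    | zero => intro γ _; simp
    | succ n ih =>
      intro γ hγ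
      have h0 : G.coeff (γ + δ) = 0 := by
        by_contra h0
        have := hG _ h0
        rw [map_add, hπ] at this
        omega
      rw [hrec γ, h0, sub_zero, ih (γ + δ) (by rw [map_add, hπ]; omega), pow_succ, mul_assoc,
        add_smul, one_smul]
      congr 2
      abel
  obtain ⟨n, hn⟩ := exists_coeff_sub_nsmul_eq_zero X (neg_pos.2 hδ) 0
  rw [hpos n 0 (by rw [map_zero]), hn, zero_mul]

open LaurentPolynomial in
-- The embedded coefficients have degree zero, hence only the coefficient of T^0 can reach the
-- exponent 0.
lemma coeff_zero_mul_eval₂ {K : Type*} [Field K] (emb : K →+* R⟦Γ⟧) (π : Γ →+ ℤ)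
    (hemb : ∀ G γ, (emb G).coeff γ ≠ 0 → π γ = 0) {u : Γ} (hu : π u = 1) (y : (R⟦Γ⟧)ˣ)
    (hy : (y : R⟦Γ⟧) = single u 1) (G : K) (Q : K[T;T⁻¹]) :
    (emb G * eval₂ emb y Q).coeff 0 = (emb (G * Q.coeff 0)).coeff 0 := by
  induction Q using LaurentPolynomial.induction_on' with
  | add P Q hP hQ =>
    rw [map_add, mul_add, coeff_add, hP, hQ, AddMonoidAlgebra.coeff_add, Finsupp.add_apply, mul_add,
      map_add, coeff_add]
  | C_mul_T n a =>
    have hyn : ((y ^ n : (R⟦Γ⟧)ˣ) : R⟦Γ⟧) = single (n • u) 1 := by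
      rw [Units.val_zpow_eq_zpow_val, hy]
      rcases n with n | n
      · rw [Int.ofNat_eq_natCast, zpow_natCast, single_pow, one_pow, natCast_zsmul]
      · rw [zpow_negSucc, single_pow, one_pow, inv_single, inv_one, negSucc_zsmul]
    rw [eval₂_C_mul_T, ← mul_assoc, ← map_mul, hyn, coeff_mul_single, mul_one, zero_sub]
    have hc : (LaurentPolynomial.C a * LaurentPolynomial.T n : K[T;T⁻¹]).coeff 0 =
        if n = 0 then a else 0 := by
      rw [← single_eq_C_mul_T, AddMonoidAlgebra.coeff_single, Finsupp.single_apply]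
    rw [hc]
    split_ifs with h
    · subst h
      simp
    · rw [mul_zero, map_zero, coeff_zero]
      by_contra h0
      have := hemb _ _ h0
      rw [map_neg, map_zsmul, hu, smul_eq_mul, mul_one, neg_eq_zero] at this
      exact h this

/-- In partial fractions a simple pole contributes its residue to the constant term when δ > 0 and
nothing when δ < 0. Adding the residues with δ < 0 gives an expression that no longer depends on the
expansion. -/
lemma coeff_zero_mul_div_add_residues_aux {K : Type*} [Field K] (emb : K →+* R⟦Γ⟧) (π : Γ →+ ℤ)
    (hemb : ∀ G γ, (emb G).coeff γ ≠ 0 → π γ = 0) {u : Γ} (hu : π u = 1) (y : (R⟦Γ⟧)ˣ)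
    (hy : (y : R⟦Γ⟧) = single u 1) {J : Type*} [DecidableEq J] (s : Finset J) (c : J → K)
    (hc : ∀ j, c j ≠ 0) (δ : J → Γ) (a : J → R) (ha : ∀ j ∈ s, a j ≠ 0)
    (hδ : ∀ j ∈ s, δ j ≠ 0) (hπ : ∀ j ∈ s, π (δ j) = 1)
    (hcy : ∀ j ∈ s, emb (c j) * y = single (δ j) (a j)) (G : K) {N Q : LaurentPolynomial K}
    (hQ : N = Q * ∏ j ∈ s, (1 - LaurentPolynomial.C (c j) * LaurentPolynomial.T 1) +
      ∑ j ∈ s, LaurentPolynomial.C (partialResidue s c hc N j) *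
        ∏ k ∈ s.erase j, (1 - LaurentPolynomial.C (c k) * LaurentPolynomial.T 1)) :
    (emb G * (LaurentPolynomial.eval₂ emb y N / ∏ j ∈ s, (1 - emb (c j) * y))).coeff 0 +
      ∑ j ∈ s with δ j < 0, (emb (G * partialResidue s c hc N j)).coeff 0 =
    (emb (G * (∑ j ∈ s, partialResidue s c hc N j + Q.coeff 0))).coeff 0 := by
  have hne : ∀ j ∈ s, 1 - emb (c j) * y ≠ 0 := by
    intro j hj h
    rw [hcy j hj, sub_eq_zero] at h
    have := congrArg (fun X => HahnSeries.coeff X (δ j)) h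
    simp only [coeff_single_same] at this
    rw [coeff_one, if_neg (hδ j hj)] at this
    exact ha j hj this.symm
  have h3 : ∀ j ∈ s, (emb G * (emb (partialResidue s c hc N j) / (1 - emb (c j) * y))).coeff 0 =
      if δ j < 0 then 0 else (emb (G * partialResidue s c hc N j)).coeff 0 := by
    intro j hj
    have h4 : (emb G * (emb (partialResidue s c hc N j) / (1 - emb (c j) * y))) *
        (1 - single (δ j) (a j)) = emb (G * partialResidue s c hc N j) := by
      rw [← hcy j hj, mul_assoc, div_mul_cancel₀ _ (hne j hj), map_mul]
    split_ifs with h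
    · exact coeff_zero_of_mul_one_sub_of_neg π (hemb _) h (hπ j hj) (ha j hj) h4
    · exact coeff_zero_of_mul_one_sub_of_pos π (hemb _)
        (lt_of_le_of_ne (not_lt.1 h) (hδ j hj).symm) (hπ j hj) h4
  rw [eval₂_div_prod_eq s c emb y hc hQ hne, mul_add, coeff_add,
    coeff_zero_mul_eval₂ emb π hemb hu y hy, Finset.mul_sum, coeff_sum,
    Finset.sum_congr rfl h3, mul_add, map_add, coeff_add, Finset.mul_sum, map_sum, coeff_sum,
    Finset.sum_filter, add_assoc, ← Finset.sum_add_distrib, add_comm]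
  congr 1
  refine Finset.sum_congr rfl fun j _ => ?_
  split_ifs <;> simp

/-- The variable of the field of Laurent series. -/
def seriesVar (K : Type*) [Field K] : (K⟦ℤ⟧)ˣ :=
  Units.mk0 (single 1 1) (single_ne_zero one_ne_zero)

/-- The constant term of a rational function in the variable `y`, expanded in a field of Hahn
series, in terms of the constant term of its expansion at `0` and of the poles that are passed. -/
lemma coeff_zero_mul_div_add_residues {K : Type*} [Field K] (emb : K →+* R⟦Γ⟧) (π : Γ →+ ℤ)
    (hemb : ∀ G γ, (emb G).coeff γ ≠ 0 → π γ = 0) {u : Γ} (hu : π u = 1) (y : (R⟦Γ⟧)ˣ)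
    (hy : (y : R⟦Γ⟧) = single u 1) {J : Type*} [DecidableEq J] (s : Finset J) (c : J → K)
    (hc : ∀ j, c j ≠ 0) (hinj : Set.InjOn c s) (δ : J → Γ) (a : J → R) (ha : ∀ j ∈ s, a j ≠ 0)
    (hδ : ∀ j ∈ s, δ j ≠ 0) (hπ : ∀ j ∈ s, π (δ j) = 1)
    (hcy : ∀ j ∈ s, emb (c j) * y = single (δ j) (a j)) (G : K) (N : LaurentPolynomial K) :
    (emb G * (LaurentPolynomial.eval₂ emb y N / ∏ j ∈ s, (1 - emb (c j) * y))).coeff 0 +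
      ∑ j ∈ s with δ j < 0, (emb (G * partialResidue s c hc N j)).coeff 0 =
    (emb (G * (LaurentPolynomial.eval₂ (HahnSeries.C : K →+* K⟦ℤ⟧) (seriesVar K) N /
      ∏ j ∈ s, (1 - HahnSeries.C (c j) * (seriesVar K : K⟦ℤ⟧))).coeff 0)).coeff 0 := by
  obtain ⟨Q, hQ⟩ := exists_partialFractions s c hc hinj N
  rw [coeff_zero_mul_div_add_residues_aux emb π hemb hu y hy s c hc δ a ha hδ hπ hcy G hQ]
  -- The same identity for the expansion at 0, where every pole has exponent 1 and no residue has to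
  -- be added.
  have h := coeff_zero_mul_div_add_residues_aux (HahnSeries.C : K →+* K⟦ℤ⟧) (AddMonoidHom.id ℤ)
    (fun G γ hγ => by
      by_contra h
      exact hγ (coeff_single_of_ne h)) (u := 1) rfl (seriesVar K) rfl s c hc
    (fun _ => 1) c (fun j _ => hc j) (fun _ _ => one_ne_zero) (fun _ _ => rfl)
    (fun j _ => by
      rw [seriesVar, Units.val_mk0, C_apply, single_mul_single, zero_add, mul_one]) 1 hQ
  rw [Finset.filter_false_of_mem (fun _ _ => by norm_num), Finset.sum_empty, add_zero, map_one,
    one_mul, one_mul, C_apply, coeff_single_same] at h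
  rw [h]

end HahnConstantTerm

/-! ### The constant term in one of the variables -/

section HahnMap

open HahnSeries

lemma algebraMap_series {k B : Type*} [CommRing k] [CommRing B] [Algebra k B] (c : k) :
    algebraMap k B⟦ℤ⟧ c = C (algebraMap k B c) := by
  rw [HahnSeries.algebraMap_apply', PowerSeries.algebraMap_apply, ofPowerSeries_C]

/-- The ring homomorphism between rings of Laurent series induced by a homomorphism of the
coefficients. -/
def seriesMap {k B B' : Type*} [CommRing k] [CommRing B] [CommRing B'] [Algebra k B] [Algebra k B']
    (f : B →ₐ[k] B') : B⟦ℤ⟧ →ₐ[k] B'⟦ℤ⟧ where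
  toFun X := X.map f
  map_zero' := by ext; simp
  map_one' := by
    ext a
    simp only [coeff_one, map_coeff]
    split_ifs <;> simp
  map_add' X Y := by ext; simp
  map_mul' X Y := by
    have hX : (X.map f).support ⊆ X.support := fun a ha h => ha (by
      rw [map_coeff, h, map_zero])
    have hY : (Y.map f).support ⊆ Y.support := fun a ha h => ha (by
      rw [map_coeff, h, map_zero])
    ext a
    rw [map_coeff, coeff_mul, map_sum, coeff_mul]
    symm
    refine Finset.sum_subset_zero_on_sdiff ?_ ?_ ?_
    · rintro ⟨b, c⟩ h
      rw [Finset.mem_antidiagonal] at h ⊢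
      exact ⟨hX h.1, hY h.2.1, h.2.2⟩
    · rintro ⟨b, c⟩ h
      rw [Finset.mem_sdiff, Finset.mem_antidiagonal, Finset.mem_antidiagonal] at h
      rw [map_mul]
      by_contra h0
      refine h.2 ⟨fun h1 => h0 ?_, fun h1 => h0 ?_, h.1.2.2⟩
      · rw [map_coeff] at h1
        dsimp only at h1 ⊢
        rw [h1, zero_mul]
      · rw [map_coeff] at h1
        dsimp only at h1 ⊢
        rw [h1, mul_zero]
    · intro p _
      simp
  commutes' c := by
    rw [algebraMap_series, algebraMap_series, C_apply, C_apply]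
    ext a
    rw [map_coeff, coeff_single, coeff_single]
    split_ifs <;> simp

lemma seriesMap_coeff {k B B' : Type*} [CommRing k] [CommRing B] [CommRing B'] [Algebra k B]
    [Algebra k B'] (f : B →ₐ[k] B') (X : B⟦ℤ⟧) (a : ℤ) :
    (seriesMap f X).coeff a = f (X.coeff a) := rfl

lemma seriesMap_single {k B B' : Type*} [CommRing k] [CommRing B] [CommRing B'] [Algebra k B]
    [Algebra k B'] (f : B →ₐ[k] B') (a : ℤ) (b : B) :
    seriesMap f (single a b) = single a (f b) := by
  ext c
  rw [seriesMap_coeff, coeff_single, coeff_single]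
  split_ifs <;> simp

lemma exists_inverse_one_sub {B : Type*} [CommRing B] (c : B) :
    ∃ U : B⟦ℤ⟧, (1 - single 1 c) * U = 1 := by
  refine ⟨(SummableFamily.powers (single (1 : ℤ) c)).hsum,
    SummableFamily.one_sub_self_mul_hsum_powers ?_⟩
  exact lt_of_lt_of_le (by exact_mod_cast Int.zero_lt_one) orderTop_single_le

end HahnMap

/-! ### The constant term in one variable preserves symmetry and the wheel conditions. -/

section ConstantTerm

open HahnSeries

variable {I : Type u} [Fintype I] [LinearOrder I] [Quiver.{v} I] [∀ i j : I, Fintype (i ⟶ j)]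

/-- The point with coordinate `z` at the index `p` and constant coordinates otherwise. -/
def seriesPoint {K : Type*} [Field K] (p : Var I) (x : Var I → K) : Var I → K⟦ℤ⟧ :=
  Function.update (fun r => C (x r)) p (seriesVar K)

lemma seriesPoint_ne_zero {K : Type*} [Field K] (p : Var I) {x : Var I → K} (hx : ∀ r, x r ≠ 0)
    (r : Var I) : seriesPoint p x r ≠ 0 := by
  by_cases h : r = p
  · subst h
    rw [seriesPoint, Function.update_self]
    exact Units.ne_zero _
  · rw [seriesPoint, Function.update_of_ne h]
    exact C_ne_zero (hx r)

/-- The constant term, in the variable `z` of index `(i, n i)`, of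
`z^{-d} P / ∏ ζ_{i j}(z / z_{jb})`. -/
def constantTerm {K : Type*} [Field K] [Algebra (GroundField I) K] (n : I → ℕ) (i : I) (d : ℤ)
    (P : LaurentPoly I) (x : Var I → K) : K :=
  (evalAt (seriesPoint (i, n i) x) P * (seriesVar K : K⟦ℤ⟧) ^ (-d) /
    ∏ b ∈ varSet n, zeta i b.1 ((seriesVar K : K⟦ℤ⟧) / C (x b))).coeff 0

/-- At z = 0 every 1/ζ(z/z_b) is a power series in z with Laurent polynomial coefficients in z_b.
The expansion is done once over the ring of Laurent polynomials and specialized coefficientwise. -/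
lemma exists_laurent_constantTerm_aux (n : I → ℕ) (i : I) (d : ℤ) (P : LaurentPoly I) :
    ∃ P' : LaurentPoly I, ∀ (K : Type (max u v)) [Field K] [Algebra (GroundField I) K]
      (x : Var I → K), (∀ p, x p ≠ 0) → evalAt x P' = constantTerm n i d P x := by
  choose U hU using exists_inverse_one_sub (B := LaurentPoly I)
  let z : ((LaurentPoly I)⟦ℤ⟧)ˣ :=
    ⟨single 1 1, single (-1) 1, by rw [single_mul_single]; simp, by rw [single_mul_single]; simp⟩
  let inv : Var I → LaurentPoly I := fun b => ((lVar b ^ (-1 : ℤ) : (LaurentPoly I)ˣ) : LaurentPoly I)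
  -- The coefficients do not form a field, so 1/ζ is assembled from the geometric series `U`.
  let E : (LaurentPoly I)⟦ℤ⟧ :=
    laurentEval (GroundField I) (Function.update (fun r => Units.map
      (C : LaurentPoly I →+* (LaurentPoly I)⟦ℤ⟧).toMonoidHom (lVar r)) (i, n i) z) P *
      ((z ^ (-d) : ((LaurentPoly I)⟦ℤ⟧)ˣ) : (LaurentPoly I)⟦ℤ⟧) *
      ∏ b ∈ varSet n, ((∏ o ∈ poles i b.1, U (poleConst o • inv b)) *
        (if i = b.1 then 1 - single 1 (inv b) else 1))
  refine ⟨E.coeff 0, fun K _ _ x hx => ?_⟩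
  let f : LaurentPoly I →ₐ[GroundField I] K :=
    laurentEval (GroundField I) (fun p => Units.mk0 (x p) (hx p))
  have hf : ∀ Q, evalAt x Q = f Q := fun Q => evalAt_eq_laurentEval x hx Q
  rw [hf, ← seriesMap_coeff, constantTerm]
  congr 1
  have hz : Units.map (seriesMap f).toMonoidHom z = seriesVar K := by
    ext1
    change seriesMap f (single 1 1) = single 1 1
    rw [seriesMap_single, map_one]
  have hinv : ∀ b, f (inv b) = (x b)⁻¹ := by
    intro b
    rw [← hf, evalAt_lVar_zpow hx, zpow_neg_one]
  have hzx : ∀ b, (seriesVar K : K⟦ℤ⟧) / C (x b) = single 1 (x b)⁻¹ := by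
    intro b
    rw [seriesVar, Units.val_mk0, C_apply, single_div_single, sub_zero, one_div]
  rw [map_mul, map_mul, div_eq_mul_inv]
  congr 1
  · congr 1
    · rw [map_laurentEval, evalAt_eq_laurentEval _ (seriesPoint_ne_zero _ hx)]
      congr 2
      ext1 p
      apply Units.ext
      by_cases h : p = (i, n i)
      · subst h
        rw [Function.update_self, Units.val_mk0, seriesPoint, Function.update_self]
        exact congrArg Units.val hz
      · rw [Function.update_of_ne h, Units.val_mk0, seriesPoint, Function.update_of_ne h]
        change seriesMap f (C _) = _
        rw [C_apply, seriesMap_single, C_apply]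
        congr 1
        rw [← hf, evalAt_lVar hx]
    · rw [← Units.val_zpow_eq_zpow_val, ← hz, ← map_zpow]
      rfl
  · rw [map_prod, ← Finset.prod_inv_distrib]
    refine Finset.prod_congr rfl fun b _ => ?_
    rw [zeta_eq, mul_inv, map_mul, map_prod, ← Finset.prod_inv_distrib, hzx]
    congr 1
    · refine Finset.prod_congr rfl fun o _ => ?_
      refine eq_inv_of_mul_eq_one_right ?_
      · have h1 := congrArg (seriesMap f) (hU (poleConst o • inv b))
        rw [map_mul, map_sub, map_one, seriesMap_single, map_smul, hinv] at h1
        rw [algebraMap_series, C_apply, single_mul_single, zero_add, ← Algebra.smul_def]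
        exact h1
    · split_ifs
      · rw [map_sub, map_one, seriesMap_single, hinv, inv_inv]
      · simp

lemma constantTerm_congr {K : Type*} [Field K] [Algebra (GroundField I) K] {n : I → ℕ} {i : I}
    {d : ℤ} {P : LaurentPoly I} (hP : InVariables (n + Pi.single i 1) P) {x x' : Var I → K}
    (h : ∀ p ∈ varSet n, x p = x' p) : constantTerm n i d P x = constantTerm n i d P x' := by
  rw [constantTerm, constantTerm, evalAt_congr_of_inVariables hP
    (x' := seriesPoint (i, n i) x'), Finset.prod_congr rfl fun b hb => by rw [h b hb]]
  rintro ⟨j, a⟩ hp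
  by_cases h1 : ((j, a) : Var I) = (i, n i)
  · rw [h1, seriesPoint, seriesPoint, Function.update_self, Function.update_self]
  · rw [seriesPoint, seriesPoint, Function.update_of_ne h1, Function.update_of_ne h1, h]
    rw [mem_varSet]
    by_cases hj : j = i
    · subst hj
      simp only [Pi.add_apply, Pi.single_eq_same] at hp
      have : a ≠ n j := fun h => h1 (by rw [h])
      dsimp only
      omega
    · simpa [hj] using hp

lemma IsSymmetric.evalAt_comp {n : I → ℕ} {P : LaurentPoly I} (hP : IsSymmetric n P)
    (hP' : InVariables n P) {θ : Equiv.Perm (Var I)} (hθ : ∀ p, (θ p).1 = p.1)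
    (hθ' : ∀ p ∈ varSet n, θ p ∈ varSet n) {A : Type*} [Field A] [Algebra (GroundField I) A]
    {x : Var I → A} (hx : ∀ p, x p ≠ 0) : evalAt (fun p => x (θ p)) P = evalAt x P := by
  have h1 : ∀ (j : I) (a : Fin (n j)), (θ (j, (a : ℕ))).2 < n j := by
    intro j a
    have := mem_varSet.1 (hθ' (j, (a : ℕ)) (mem_varSet.2 a.2))
    rwa [hθ] at this
  let σ : ∀ j, Equiv.Perm (Fin (n j)) := fun j => Equiv.ofBijective
    (fun a => ⟨(θ (j, (a : ℕ))).2, h1 j a⟩) (Finite.injective_iff_bijective.1 (by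
      intro a b hab
      have h2 : (θ (j, (a : ℕ))) = θ (j, (b : ℕ)) :=
        Prod.ext (by rw [hθ, hθ]) (by simpa using hab)
      have := θ.injective h2
      exact Fin.ext (Prod.mk.inj this).2))
  rw [← hP.evalAt_perm σ hx]
  refine evalAt_congr_of_inVariables hP' ?_
  rintro ⟨j, a⟩ ha
  have := permVar_of_lt n σ (⟨a, ha⟩ : Fin (n j))
  rw [Fin.val_mk] at this
  rw [this]
  congr 1
  exact Prod.ext (hθ _) rfl

/-- Extraction of the constant term in one of the variables. -/
lemma exists_laurent_constantTerm (n : I → ℕ) (i : I) (d : ℤ) {P : LaurentPoly I}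
    (hP1 : InVariables (n + Pi.single i 1) P) (hP2 : IsSymmetric (n + Pi.single i 1) P)
    (hP3 : WheelConditions (n + Pi.single i 1) P) :
    ∃ P' : LaurentPoly I, (InVariables n P' ∧ IsSymmetric n P' ∧ WheelConditions n P') ∧
      ∀ (K : Type (max u v)) [Field K] [Algebra (GroundField I) K]
      (x : Var I → K), (∀ p, x p ≠ 0) → evalAt x P' = constantTerm n i d P x := by
  obtain ⟨P', hP'⟩ := exists_laurent_constantTerm_aux n i d P
  have hlt : ∀ {j a}, a < n j → a < (n + Pi.single i 1 : I → ℕ) j := fun h =>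
    lt_of_lt_of_le h (Nat.le_add_right _ _)
  have key : ∀ (K : Type (max u v)) [Field K] [Algebra (GroundField I) K]
      (x : Var I → K), (∀ p, x p ≠ 0) → evalAt x (restrictVars n P') = constantTerm n i d P x := by
    intro K _ _ x hx
    rw [evalAt_restrictVars, hP' K _ (fun p => by split_ifs <;> simp [hx])]
    exact constantTerm_congr hP1 fun p hp => if_pos (mem_varSet.1 hp)
  have hslot : ∀ {j a}, a < n j → ((j, a) : Var I) ≠ (i, n i) := by
    intro j a ha h
    obtain ⟨rfl, rfl⟩ := Prod.mk.inj h
    exact lt_irrefl _ ha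
  refine ⟨restrictVars n P', ⟨inVariables_restrictVars n P', fun σ => ?_, fun j k e => ?_⟩, key⟩
  -- Permutations in degree n fix the slot (i, n i) of the series variable, so symmetry of P under
  -- the larger group restricts to them.
  · rw [key _ _ (fun p => zVar_ne_zero _), key _ _ zVar_ne_zero, constantTerm, constantTerm]
    have h0 : permVar n σ (i, n i) = (i, n i) := by
      rw [permVar, Equiv.prodCongrRight_apply]
      congr 1
      exact Equiv.Perm.extendDomain_apply_not_subtype _ _ (by simp)
    have h1 : seriesPoint (i, n i) (fun p => (zVar (permVar n σ p) : RatFun I)) =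
        fun p => seriesPoint (i, n i) (zVar : Var I → RatFun I) (permVar n σ p) := by
      ext1 p
      by_cases h : p = (i, n i)
      · subst h
        rw [h0, seriesPoint, seriesPoint, Function.update_self, Function.update_self]
      · have h' : permVar n σ p ≠ (i, n i) := fun h' => h ((permVar n σ).injective (h'.trans h0.symm))
        rw [seriesPoint, seriesPoint, Function.update_of_ne h, Function.update_of_ne h']
    have h2 : evalAt (seriesPoint (i, n i) (fun p => (zVar (permVar n σ p) : RatFun I))) P =
        evalAt (seriesPoint (i, n i) (zVar : Var I → RatFun I)) P := by
      rw [h1]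
      refine hP2.evalAt_comp hP1 (fun p => rfl) (fun p hp => ?_) (seriesPoint_ne_zero _ zVar_ne_zero)
      by_cases hp' : p ∈ varSet n
      · have := permVar_mem_varSet σ hp'
        rw [mem_varSet] at this ⊢
        exact hlt this
      · have : permVar n σ p = p := by
          obtain ⟨j, a⟩ := p
          rw [permVar, Equiv.prodCongrRight_apply]
          congr 1
          exact Equiv.Perm.extendDomain_apply_not_subtype _ _ (by simpa [mem_varSet] using hp')
        rwa [this]
    have h3 : ∏ b ∈ varSet n, zeta i b.1 ((seriesVar (RatFun I) : (RatFun I)⟦ℤ⟧) /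
          C (zVar (permVar n σ b))) =
        ∏ b ∈ varSet n, zeta i b.1 ((seriesVar (RatFun I) : (RatFun I)⟦ℤ⟧) / C (zVar b)) := by
      conv_rhs => rw [← varSet_map_permVar n σ, Finset.prod_map]
      rfl
    rw [h2, h3]
  · have hzero : ∀ x : Var I → RatFun I, evalAt (seriesPoint (i, n i) x) P = 0 →
        (∀ p, x p ≠ 0) → evalAt x (restrictVars n P') = 0 := by
      intro x h hx
      rw [key _ x hx, constantTerm, h, zero_mul, zero_div, coeff_zero]
    have hq := qPar_ne_zero (I := I)
    have ht := tPar_ne_zero e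
    have hne : ∀ {p r r' : Var I} {c c' : GroundField I}, c ≠ 0 → c' ≠ 0 → ∀ s,
        Function.update (Function.update (zVar : Var I → RatFun I) p (c • zVar r))
          r' (c' • zVar r) s ≠ 0 := by
      intro p r r' c c' hc hc' s
      by_cases h : s = r'
      · subst h; simpa using ⟨hc', zVar_ne_zero r⟩
      by_cases h' : s = p
      · subst h'; simpa [h] using ⟨hc, zVar_ne_zero r⟩
      · simpa [h, h'] using zVar_ne_zero s
    have hC : ∀ (c : GroundField I) (r : RatFun I), (C (c • r) : (RatFun I)⟦ℤ⟧) =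
        algebraMap (GroundField I) _ c * C r := by
      intro c r
      rw [Algebra.smul_def, map_mul, algebraMap_series]
    refine ⟨fun a b c ha hb hc hac hij => ?_, fun a b c ha hb hc hac hij => ?_⟩
    · have hAB : ((k, b) : Var I) ≠ (j, a) := fun h => by
        obtain ⟨h1, h2⟩ := Prod.mk.inj h
        exact (hij h1.symm).1 h2.symm
      have hBC : ((k, b) : Var I) ≠ (j, c) := fun h => by
        obtain ⟨h1, h2⟩ := Prod.mk.inj h
        exact (hij h1.symm).2 h2
      have hAC : ((j, a) : Var I) ≠ (j, c) := fun h => hac (Prod.mk.inj h).2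
      refine hzero _ (hP3.eval_fst (seriesPoint_ne_zero _ (hne ?_ ?_)) e (hlt ha) (hlt hb) (hlt hc)
        hac hij ?_ ?_) (hne ?_ ?_)
      · exact div_ne_zero hq ht
      · exact inv_ne_zero ht
      · simp only [seriesPoint, Function.update_of_ne (hslot ha), Function.update_of_ne (hslot hb),
          Function.update_self, Function.update_of_ne hAC, Function.update_of_ne hAB,
          Function.update_of_ne hBC, hC]
        exact (Algebra.smul_def _ _).symm
      · simp only [seriesPoint, Function.update_of_ne (hslot hc), Function.update_of_ne (hslot hb),
          Function.update_self, Function.update_of_ne hAB, Function.update_of_ne hBC, hC]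
        exact (Algebra.smul_def _ _).symm
      · exact div_ne_zero hq ht
      · exact inv_ne_zero ht
    · have hAB : ((j, b) : Var I) ≠ (k, a) := fun h => by
        obtain ⟨h1, h2⟩ := Prod.mk.inj h
        exact (hij h1).1 h2.symm
      have hBC : ((j, b) : Var I) ≠ (k, c) := fun h => by
        obtain ⟨h1, h2⟩ := Prod.mk.inj h
        exact (hij h1).2 h2
      have hAC : ((k, a) : Var I) ≠ (k, c) := fun h => hac (Prod.mk.inj h).2
      refine hzero _ (hP3.eval_snd (seriesPoint_ne_zero _ (hne ?_ ?_)) e (hlt ha) (hlt hb) (hlt hc)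
        hac hij ?_ ?_) (hne ?_ ?_)
      · exact ht
      · exact div_ne_zero ht hq
      · simp only [seriesPoint, Function.update_of_ne (hslot ha), Function.update_of_ne (hslot hb),
          Function.update_self, Function.update_of_ne hAC, Function.update_of_ne hAB,
          Function.update_of_ne hBC, hC]
        exact (Algebra.smul_def _ _).symm
      · simp only [seriesPoint, Function.update_of_ne (hslot hc), Function.update_of_ne (hslot hb),
          Function.update_self, Function.update_of_ne hAB, Function.update_of_ne hBC, hC]
        exact (Algebra.smul_def _ _).symm
      · exact ht
      · exact div_ne_zero ht hq

end ConstantTerm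

/-! ### Moving a variable through the poles -/

open HahnSeries

section KerInv

variable {I : Type u} [Fintype I] [LinearOrder I] [Quiver.{v} I] [∀ i j : I, Fintype (i ⟶ j)]

open Classical in
/-- The inverse, with the value `1` at `0`. -/
def regInv {A : Type*} [Field A] (a : A) : A := if a = 0 then 1 else a⁻¹

lemma regInv_of_ne_zero {A : Type*} [Field A] {a : A} (h : a ≠ 0) : regInv a = a⁻¹ := if_neg h

lemma regInv_zero {A : Type*} [Field A] : regInv (0 : A) = 1 := if_pos rfl

lemma map_regInv {A A' : Type*} [Field A] [Field A'] (f : A →+* A') (a : A) :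
    f (regInv a) = regInv (f a) := by
  by_cases h : a = 0
  · rw [h, regInv_zero, map_zero, regInv_zero, map_one]
  · rw [regInv_of_ne_zero h, regInv_of_ne_zero ((map_ne_zero f).2 h), map_inv₀]

/-- The function `1 / ζ_{ij}`, regularized at its poles by omitting the factors that vanish. -/
def kerInv {A : Type*} [Field A] [Algebra (GroundField I) A] (i j : I) (x : A) : A :=
  (∏ o ∈ poles i j, regInv (1 - algebraMap (GroundField I) A (poleConst o) * x)) *
    (if i = j then 1 - x else 1)

lemma kerInv_eq {A : Type*} [Field A] [Algebra (GroundField I) A] {i j : I} {x : A}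
    (h : ∀ o ∈ poles i j, algebraMap (GroundField I) A (poleConst o) * x ≠ 1) :
    kerInv i j x = (zeta i j x)⁻¹ := by
  rw [kerInv, zeta_eq, mul_inv, ← Finset.prod_inv_distrib]
  congr 1
  · exact Finset.prod_congr rfl fun o ho => regInv_of_ne_zero (sub_ne_zero.2 (h o ho).symm)
  · split_ifs <;> simp

lemma map_kerInv {A A' : Type*} [Field A] [Field A'] [Algebra (GroundField I) A]
    [Algebra (GroundField I) A'] (f : A →ₐ[GroundField I] A') (i j : I) (x : A) :
    f (kerInv i j x) = kerInv i j (f x) := by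
  rw [kerInv, kerInv, map_mul, map_prod]
  congr 1
  · refine Finset.prod_congr rfl fun o _ => ?_
    rw [← AlgHom.coe_toRingHom, map_regInv, AlgHom.coe_toRingHom, map_sub, map_mul, map_one,
      AlgHom.commutes]
  · split_ifs <;> simp

/-- The integrand of `constantTerm`, regularized at its poles, as a function of the additional
variable. -/
def insertVal {A : Type*} [Field A] [Algebra (GroundField I) A] (n : I → ℕ) (i : I) (d : ℤ)
    (P : LaurentPoly I) (x : Var I → A) (z : A) : A :=
  evalAt (Function.update x (i, n i) z) P * z ^ (-d) *
    ∏ b ∈ varSet n, kerInv i b.1 (z / x b)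

end KerInv

section LaurentEv

open LaurentPolynomial

variable {k K B : Type*} [CommRing k] [Field K] [Algebra k K] [CommRing B] [Algebra k B]

/-- The evaluation of Laurent polynomials in one variable as a homomorphism of algebras. -/
def laurentEv (f : K →+* B) (hf : ∀ c, f (algebraMap k K c) = algebraMap k B c) (u : Bˣ) :
    K[T;T⁻¹] →ₐ[k] B where
  __ := eval₂ f u
  commutes' c := by
    change eval₂ f u (algebraMap k K[T;T⁻¹] c) = _
    rw [← hf, IsScalarTower.algebraMap_apply k K K[T;T⁻¹], LaurentPolynomial.algebraMap_apply,
      eval₂_C, Algebra.algebraMap_self_apply]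

/-- The variable as a unit. -/
def unitT (K : Type*) [Field K] : (K[T;T⁻¹])ˣ :=
  ⟨T 1, T (-1), by rw [← T_add]; simp, by rw [← T_add]; simp⟩

end LaurentEv

/-! ### Residues of the integrand at its simple poles. -/

section Move

open LaurentPolynomial

variable {I : Type u} [Fintype I] [LinearOrder I] [Quiver.{v} I] [∀ i j : I, Fintype (i ⟶ j)]
variable {K : Type*} [Field K] [Algebra (GroundField I) K]

/-- The numerator of the integrand of `constantTerm`. -/
def insertNum (n : I → ℕ) (i : I) (d : ℤ) (P : LaurentPoly I) (x : Var I → K)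
    (hx : ∀ p, x p ≠ 0) : K[T;T⁻¹] :=
  laurentEval (GroundField I) (Function.update (fun r => Units.map
      (LaurentPolynomial.C : K →+* K[T;T⁻¹]).toMonoidHom (Units.mk0 (x r) (hx r)))
      (i, n i) (unitT K)) P *
    ((unitT K ^ (-d) : (K[T;T⁻¹])ˣ) : K[T;T⁻¹]) *
    ∏ b ∈ varSet n, (if i = b.1 then 1 - LaurentPolynomial.C (x b)⁻¹ * T 1 else 1)

lemma eval_insertNum {B : Type*} [Field B] [Algebra (GroundField I) B] (f : K →+* B)
    (hf : ∀ c, f (algebraMap (GroundField I) K c) = algebraMap (GroundField I) B c) (u : Bˣ)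
    (n : I → ℕ) (i : I) (d : ℤ) (P : LaurentPoly I) (x : Var I → K) (hx : ∀ p, x p ≠ 0) :
    eval₂ f u (insertNum n i d P x hx) =
      evalAt (Function.update (fun r => f (x r)) (i, n i) (u : B)) P * (u : B) ^ (-d) *
        ∏ b ∈ varSet n, (if i = b.1 then 1 - u / f (x b) else 1) := by
  have hne : ∀ p, Function.update (fun r => f (x r)) (i, n i) (u : B) p ≠ 0 := by
    intro p
    by_cases h : p = (i, n i)
    · subst h
      rw [Function.update_self]
      exact u.ne_zero
    · rw [Function.update_of_ne h]
      exact (map_ne_zero f).2 (hx p)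
  have hT : Units.map (laurentEv f hf u).toMonoidHom (unitT K) = u := by
    ext1
    change eval₂ f u (T 1) = u
    simp
  change laurentEv f hf u _ = _
  rw [insertNum, map_mul, map_mul, map_laurentEval, evalAt_eq_laurentEval _ hne, map_prod]
  congr 1
  · congr 1
    · congr 2
      ext1 p
      apply Units.ext
      by_cases h : p = (i, n i)
      · subst h
        rw [Function.update_self, Units.val_mk0, Function.update_self]
        exact congrArg Units.val hT
      · rw [Function.update_of_ne h, Units.val_mk0, Function.update_of_ne h]
        change eval₂ f u (LaurentPolynomial.C (x p)) = _
        rw [eval₂_C]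
    · rw [← Units.val_zpow_eq_zpow_val]
      conv_rhs => rw [← hT, ← map_zpow]
      rfl
  · refine Finset.prod_congr rfl fun b _ => ?_
    split_ifs
    · change eval₂ f u _ = _
      rw [map_sub, map_one, map_mul, eval₂_C, eval₂_T, map_inv₀, zpow_one, div_eq_mul_inv,
        mul_comm]
    · rw [map_one]

variable {Γ R : Type*} [AddCommGroup Γ] [LinearOrder Γ] [IsOrderedAddMonoid Γ] [Field R]
  [Algebra (GroundField I) R⟦Γ⟧]

/-- The indices of the poles of the integrand of `constantTerm`. -/
def insertPoles (n : I → ℕ) (i : I) : Finset (Σ _ : Var I, Pole I) :=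
  (varSet n).sigma fun b => poles i b.1

lemma mem_insertPoles {n : I → ℕ} {i : I} {j : Σ _ : Var I, Pole I} :
    j ∈ insertPoles n i ↔ j.1 ∈ varSet n ∧ j.2 ∈ poles i j.1.1 := by
  rw [insertPoles, Finset.mem_sigma]

lemma prod_insertPoles {B : Type*} [Field B] [Algebra (GroundField I) B] (f : K →+* B)
    (hf : ∀ c, f (algebraMap (GroundField I) K c) = algebraMap (GroundField I) B c) (n : I → ℕ)
    (i : I) (x : Var I → K) (z : B) :
    (∏ b ∈ varSet n, (if i = b.1 then 1 - z / f (x b) else 1)) / ∏ j ∈ insertPoles n i,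
      (1 - f (algebraMap (GroundField I) K (poleConst j.2) / x j.1) * z) =
    (∏ b ∈ varSet n, zeta i b.1 (z / f (x b)))⁻¹ := by
  rw [insertPoles, Finset.prod_sigma, ← Finset.prod_div_distrib, ← Finset.prod_inv_distrib]
  refine Finset.prod_congr rfl fun b _ => ?_
  rw [zeta_eq, mul_inv, mul_comm, div_eq_mul_inv]
  congr 1
  · split_ifs <;> simp
  · congr 1
    refine Finset.prod_congr rfl fun o _ => ?_
    rw [map_div₀, hf, div_mul_eq_mul_div, mul_div_assoc]

/-- The change of expansion is applied to the integrand. As the poles are distinct, the residue at z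
= x_b/α is the value of the integrand there with the vanishing factor left out, which is what
`insertVal` computes. -/
lemma coeff_zero_insertVal (emb : K →ₐ[GroundField I] R⟦Γ⟧) (π : Γ →+ ℤ)
    (hemb : ∀ G γ, (emb G).coeff γ ≠ 0 → π γ = 0) {u : Γ} (hu : π u = 1) (y : (R⟦Γ⟧)ˣ)
    (hy : (y : R⟦Γ⟧) = single u 1) (n : I → ℕ) (i : I) (d : ℤ) (P : LaurentPoly I)
    {x : Var I → K} (hx : ∀ p, x p ≠ 0)
    (hinj : ∀ j ∈ insertPoles n i, ∀ k ∈ insertPoles n i,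
      algebraMap (GroundField I) K (poleConst j.2) / x j.1 =
        algebraMap (GroundField I) K (poleConst k.2) / x k.1 → j = k)
    (δ : (Σ _ : Var I, Pole I) → Γ) (a : (Σ _ : Var I, Pole I) → R)
    (ha : ∀ j ∈ insertPoles n i, a j ≠ 0)
    (hcy : ∀ j ∈ insertPoles n i,
      emb (algebraMap (GroundField I) K (poleConst j.2) / x j.1) * y = single (δ j) (a j)) (G : K) :
    (emb G * insertVal n i d P (fun p => emb (x p)) (y : R⟦Γ⟧)).coeff 0 +
      ∑ j ∈ insertPoles n i with δ j < 0, (emb (G * insertVal n i d P x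
        (x j.1 / algebraMap (GroundField I) K (poleConst j.2)))).coeff 0 =
    (emb (G * constantTerm n i d P x)).coeff 0 := by
  let _ : DecidableEq (Σ _ : Var I, Pole I) := Classical.decEq _
  have hα : ∀ o : Pole I, algebraMap (GroundField I) K (poleConst o) ≠ 0 := fun o =>
    (map_ne_zero _).2 (poleConst_ne_zero o)
  set c : (Σ _ : Var I, Pole I) → K := fun j =>
    algebraMap (GroundField I) K (poleConst j.2) / x j.1 with hc
  have hc0 : ∀ j, c j ≠ 0 := fun j => div_ne_zero (hα _) (hx _)
  -- The image of c_j has degree zero, so the degree of c_j y is that of y.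
  have hπ : ∀ j ∈ insertPoles n i, π (δ j) = 1 := by
    intro j hj
    have h1 : emb (c j) = single (δ j - u) (a j) := by
      have h2 := hcy j hj
      rw [hy] at h2
      have h3 := congrArg (· * single (-u) (1 : R)) h2
      rw [mul_assoc, single_mul_single, single_mul_single, add_neg_cancel, mul_one, mul_one,
        ← sub_eq_add_neg] at h3
      exact (mul_one _).symm.trans h3
    have h2 := hemb (c j) (δ j - u) (by rw [h1, coeff_single_same]; exact ha j hj)
    rw [map_sub, hu] at h2
    omega
  have hδ : ∀ j ∈ insertPoles n i, δ j ≠ 0 := by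
    intro j hj h
    have := hπ j hj
    rw [h, map_zero] at this
    omega
  have key := coeff_zero_mul_div_add_residues (emb : K →+* R⟦Γ⟧) π hemb hu y hy (insertPoles n i)
    c hc0 (fun j hj k hk h => hinj j hj k hk h) δ a ha hδ hπ hcy G (insertNum n i d P x hx)
  rw [eval_insertNum (emb : K →+* R⟦Γ⟧) (fun c => emb.commutes c),
    eval_insertNum (HahnSeries.C : K →+* K⟦ℤ⟧) (fun c => (algebraMap_series c).symm)] at key
  have h2 : ∀ j ∈ insertPoles n i, (1 - emb (c j) * (y : R⟦Γ⟧)) ≠ 0 := by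
    intro j hj h
    rw [hcy j hj, sub_eq_zero] at h
    have := congrArg (fun X => HahnSeries.coeff X (δ j)) h
    simp only [coeff_single_same] at this
    rw [coeff_one, if_neg (hδ j hj)] at this
    exact ha j hj this.symm
  rw [mul_div_assoc,
    prod_insertPoles (emb : K →+* R⟦Γ⟧) (fun c => emb.commutes c), mul_div_assoc,
    prod_insertPoles (HahnSeries.C : K →+* K⟦ℤ⟧) (fun c => (algebraMap_series c).symm)] at key
  rw [constantTerm, div_eq_mul_inv, seriesPoint]
  refine Eq.trans (congrArg₂ (· + ·) ?_ ?_) key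
  · rw [insertVal, ← Finset.prod_inv_distrib]
    congr 3
    refine Finset.prod_congr rfl fun b hb => kerInv_eq fun o ho h => ?_
    refine h2 ⟨b, o⟩ (mem_insertPoles.2 ⟨hb, ho⟩) ?_
    rw [hc, sub_eq_zero, ← h]
    simp [mul_div_assoc, div_mul_eq_mul_div]
  · refine Finset.sum_congr rfl fun j hj => ?_
    replace hj := (Finset.mem_filter.1 hj).1
    refine congrArg (fun t => (emb (G * t)).coeff 0) ?_
    have hz : ((Units.mk0 (c j) (hc0 j))⁻¹ : Kˣ) =
        Units.mk0 (x j.1 / algebraMap (GroundField I) K (poleConst j.2))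
          (div_ne_zero (hx _) (hα _)) := by
      ext1
      simp [hc]
    rw [partialResidue, hz, eval_insertNum (RingHom.id K) (fun c => rfl), insertVal, mul_div_assoc]
    congr 1
    simp only [Units.val_mk0, RingHom.id_apply]
    set z := x j.1 / algebraMap (GroundField I) K (poleConst j.2) with hz'
    -- The factor with k = j is zero and `regInv` turns it into 1, so the product over the other
    -- poles becomes a product over all of them.
    have h3 : ∏ k ∈ (insertPoles n i).erase j, (1 - c k / c j) =
        (∏ k ∈ insertPoles n i, regInv (1 - c k / c j))⁻¹ := by
      rw [← Finset.mul_prod_erase _ _ hj, div_self (hc0 j), sub_self, regInv_zero, one_mul,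
        ← Finset.prod_inv_distrib]
      refine Finset.prod_congr rfl fun k hk => ?_
      rw [regInv_of_ne_zero, inv_inv]
      rw [Ne, sub_eq_zero, eq_comm, div_eq_one_iff_eq (hc0 j)]
      exact fun h => Finset.ne_of_mem_erase hk (hinj k (Finset.mem_of_mem_erase hk) j hj h)
    rw [h3, div_inv_eq_mul, insertPoles, Finset.prod_sigma, ← Finset.prod_mul_distrib]
    refine Finset.prod_congr rfl fun b _ => ?_
    rw [kerInv, mul_comm]
    congr 1
    refine Finset.prod_congr rfl fun o _ => ?_
    congr 2
    have := hα o
    have := hα j.2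
    have := hx b
    have := hx j.1
    rw [hc, hz']
    field_simp

end Move

/-! ### Enumerations of coloured points -/

section Enum

variable {I : Type u} [Fintype I] [LinearOrder I] [Quiver.{v} I] [∀ i j : I, Fintype (i ⟶ j)]
variable {ι : Type*} {A : Type*} [Field A] [Algebra (GroundField I) A]

/-- `θ` enumerates the set `s` of coloured points by the variables of a function of degree `n`. -/
def IsEnum (n : I → ℕ) (col : ι → I) (s : Finset ι) (θ : {p // p ∈ varSet n} ≃ {a // a ∈ s}) :
    Prop :=
  ∀ p, col (θ p) = (p : Var I).1

/-- Two enumerations of the same points differ by a permutation that preserves colours, and P is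
symmetric. -/
lemma IsEnum.evalAt_eq {n : I → ℕ} {P : LaurentPoly I} (hP1 : InVariables n P)
    (hP2 : IsSymmetric n P) {col : ι → I} {s : Finset ι} {θ θ' : {p // p ∈ varSet n} ≃ {a // a ∈ s}}
    (hθ : IsEnum n col s θ) (hθ' : IsEnum n col s θ') {x x' : Var I → A} (hx' : ∀ p, x' p ≠ 0)
    {y : ι → A} (h : ∀ p : {p // p ∈ varSet n}, x p = y (θ p))
    (h' : ∀ p : {p // p ∈ varSet n}, x' p = y (θ' p)) :
    evalAt x P = evalAt x' P := by
  let σ : Equiv.Perm {p // p ∈ varSet n} := θ.trans θ'.symm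
  have hσ : ∀ p : {p // p ∈ varSet n}, θ' (σ p) = θ p := fun p => θ'.apply_symm_apply (θ p)
  have hσ1 : ∀ p : {p // p ∈ varSet n}, ((σ p : Var I)).1 = (p : Var I).1 := by
    intro p
    rw [← hθ', hσ, hθ]
  rw [← hP2.evalAt_comp hP1 (θ := Equiv.Perm.ofSubtype σ) ?_ ?_ hx']
  · refine evalAt_congr_of_inVariables hP1 fun p hp => ?_
    replace hp := mem_varSet.2 hp
    rw [h ⟨p, hp⟩, Equiv.Perm.ofSubtype_apply_of_mem _ hp, h', hσ]
  · intro p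
    by_cases hp : p ∈ varSet n
    · rw [Equiv.Perm.ofSubtype_apply_of_mem _ hp, hσ1]
    · rw [Equiv.Perm.ofSubtype_apply_of_not_mem _ hp]
  · intro p hp
    rw [Equiv.Perm.ofSubtype_apply_of_mem _ hp]
    exact (σ ⟨p, hp⟩).2

lemma exists_isEnum_self {n : I → ℕ} {θ : Var I → Var I} (h1 : Set.InjOn θ (varSet n))
    (h2 : ∀ p ∈ varSet n, θ p ∈ varSet n) (h3 : ∀ p ∈ varSet n, (θ p).1 = p.1) :
    ∃ θ', IsEnum n Prod.fst (varSet n) θ' ∧ ∀ p : {p // p ∈ varSet n}, (θ' p : Var I) = θ p :=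
  have h : Set.BijOn θ (varSet n) (varSet n) :=
    ⟨fun p hp => h2 p hp, h1, Finset.surjOn_of_injOn_of_card_le _ (fun p hp => h2 p hp) h1 le_rfl⟩
  ⟨h.equiv θ, fun p => h3 _ p.2, fun _ => rfl⟩

end Enum

/-! ### Iterated residues, one variable at a time -/

section IterEmb

open HahnSeries

variable {R : Type*} [Field R] {n : ℕ}

/-- The insertion of an exponent `0` at the position `p`. -/
def insertZero (p : Fin (n + 1)) : Lex (Fin n → ℤ) →+ Lex (Fin (n + 1) → ℤ) where
  toFun v := toLex (p.insertNth (α := fun _ => ℤ) 0 (ofLex v))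
  map_zero' := by
    refine congrArg toLex (funext ?_)
    rw [Fin.forall_iff_succAbove p]
    refine ⟨by rw [Fin.insertNth_apply_same], fun j => ?_⟩
    rw [Fin.insertNth_apply_succAbove]; rfl
  map_add' v w := by
    refine ofLex.injective (funext ?_)
    rw [Fin.forall_iff_succAbove p]
    simp only [ofLex_add, Pi.add_apply, ofLex_toLex, Fin.insertNth_apply_same,
      Fin.insertNth_apply_succAbove, add_zero, implies_true, and_self]

lemma insertZero_same (p : Fin (n + 1)) (v : Lex (Fin n → ℤ)) : ofLex (insertZero p v) p = 0 :=
  Fin.insertNth_apply_same (α := fun _ => ℤ) _ _ _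

lemma insertZero_succAbove (p : Fin (n + 1)) (v : Lex (Fin n → ℤ)) (j : Fin n) :
    ofLex (insertZero p v) (p.succAbove j) = ofLex v j :=
  Fin.insertNth_apply_succAbove (α := fun _ => ℤ) _ _ _ _

lemma insertZero_injective (p : Fin (n + 1)) : Function.Injective (insertZero p) := by
  intro v w h
  refine ofLex.injective (funext fun j => ?_)
  rw [← insertZero_succAbove p, h, insertZero_succAbove]

lemma insertZero_strictMono (p : Fin (n + 1)) : StrictMono (insertZero p) := by
  rintro v w ⟨i, h1, h2⟩
  refine ⟨p.succAbove i, ?_, ?_⟩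
  · rw [Fin.forall_iff_succAbove p]
    refine ⟨fun _ => (insertZero_same p v).trans (insertZero_same p w).symm, fun j hj => ?_⟩
    refine (insertZero_succAbove p v j).trans (Eq.trans ?_ (insertZero_succAbove p w j).symm)
    exact h1 j (by simpa using hj)
  · exact lt_of_eq_of_lt (insertZero_succAbove p v i)
      (lt_of_lt_of_eq h2 (insertZero_succAbove p w i).symm)

lemma insertZero_single (p : Fin (n + 1)) (j : Fin n) (a : ℤ) :
    insertZero p (toLex (Pi.single j a)) = toLex (Pi.single (p.succAbove j) a) := by
  refine ofLex.injective (funext ?_)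
  rw [Fin.forall_iff_succAbove p]
  refine ⟨?_, fun k => ?_⟩
  · rw [insertZero_same]
    exact (Pi.single_eq_of_ne (M := fun _ => ℤ) (Fin.succAbove_ne p j).symm _).symm
  · rw [insertZero_succAbove]
    change Pi.single (M := fun _ => ℤ) j a k = Pi.single (M := fun _ => ℤ) (p.succAbove j) a _
    by_cases h : k = j
    · subst h
      rw [Pi.single_eq_same, Pi.single_eq_same]
    · rw [Pi.single_eq_of_ne h, Pi.single_eq_of_ne]
      exact fun h' => h (Fin.succAbove_right_injective h')

/-- The inclusion of the field of iterated Laurent series that leaves out the variable of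
index `p`. -/
def insertEmb (R : Type*) [Field R] (p : Fin (n + 1)) :
    R⟦Lex (Fin n → ℤ)⟧ →+* R⟦Lex (Fin (n + 1) → ℤ)⟧ :=
  embDomainRingHom (insertZero p) (insertZero_injective p)
    (fun _ _ => (insertZero_strictMono p).le_iff_le)

lemma insertEmb_single (p : Fin (n + 1)) (v : Lex (Fin n → ℤ)) (r : R) :
    insertEmb R p (single v r) = single (insertZero p v) r :=
  embDomain_single

lemma insertEmb_coeff (p : Fin (n + 1)) (X : R⟦Lex (Fin n → ℤ)⟧) (v : Lex (Fin n → ℤ)) :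
    (insertEmb R p X).coeff (insertZero p v) = X.coeff v :=
  embDomain_mk_coeff (insertZero_injective p) fun _ _ => (insertZero_strictMono p).le_iff_le

lemma insertEmb_coeff_zero (p : Fin (n + 1)) (X : R⟦Lex (Fin n → ℤ)⟧) :
    (insertEmb R p X).coeff 0 = X.coeff 0 := by
  rw [← insertEmb_coeff p, map_zero]

/-- The exponent of the variable of index `p`. -/
def exponentAt (p : Fin n) : Lex (Fin n → ℤ) →+ ℤ where
  toFun v := ofLex v p
  map_zero' := rfl
  map_add' _ _ := rfl

lemma exponentAt_single (p : Fin n) (a : ℤ) : exponentAt p (toLex (Pi.single p a)) = a :=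
  Pi.single_eq_same (M := fun _ => ℤ) p a

lemma exponentAt_eq_zero_of_insertEmb (p : Fin (n + 1)) (X : R⟦Lex (Fin n → ℤ)⟧)
    (γ : Lex (Fin (n + 1) → ℤ)) (h : (insertEmb R p X).coeff γ ≠ 0) : exponentAt p γ = 0 := by
  by_contra h0
  refine h (embDomain_of_notMem_range ?_)
  rintro ⟨v, rfl⟩
  exact h0 (insertZero_same p v)

end IterEmb

/-! ### Splitting off the innermost variable of an iterated residue. -/

section PlugIn

variable {I : Type u} [Fintype I] [LinearOrder I] [Quiver.{v} I] [∀ i j : I, Fintype (i ⟶ j)]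

/-- The inclusion of the field of iterated Laurent series in all the variables but the first. -/
def tailEmb (I : Type u) [Quiver.{v} I] (n : ℕ) :
    IterLaurent I n →ₐ[GroundField I] IterLaurent I (n + 1) where
  __ := insertEmb (GroundField I) 0
  commutes' c := by
    rw [HahnSeries.algebraMap_apply, HahnSeries.algebraMap_apply]
    exact HahnSeries.embDomainRingHom_C

lemma tailEmb_iterVar {n : ℕ} (a : Fin n) :
    tailEmb I n (iterVar a) = iterVar a.succ := by
  refine (insertEmb_single _ _ _).trans ?_
  rw [insertZero_single, Fin.succAbove_zero]
  rfl

lemma iterVar_ne_zero {n : ℕ} (a : Fin n) : (iterVar a : IterLaurent I n) ≠ 0 :=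
  HahnSeries.single_ne_zero one_ne_zero

lemma plugIn_ne_zero (w : Word I) (p : Var I) : plugIn w p ≠ 0 := by
  unfold plugIn
  split
  · exact iterVar_ne_zero _
  · exact one_ne_zero

/-- The positions of a vertex in a word. -/
def positions (w : Word I) (i : I) : List (Fin w.length) :=
  (List.finRange w.length).filter fun a => (w.get a).vertex = i

lemma positions_cons (l : Letter I) (w : Word I) (i : I) :
    positions (l :: w) i =
      (if l.vertex = i then [0] else []) ++ (positions w i).map Fin.succ := by
  unfold positions
  change (List.finRange (w.length + 1)).filter _ = _
  rw [List.finRange_succ, List.filter_cons, List.filter_map]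
  by_cases h : l.vertex = i
  · simp [h, Function.comp_def]
  · simp [h, Function.comp_def]

lemma length_positions (w : Word I) (i : I) : (positions w i).length = wordDegree w i := by
  induction w with
  | nil => rfl
  | cons l w ih =>
    rw [positions_cons, wordDegree_cons, List.length_append, List.length_map, ih, Pi.add_apply,
      add_comm]
    by_cases h : l.vertex = i
    · subst h; simp
    · rw [if_neg h, Pi.single_eq_of_ne (Ne.symm h)]; rfl

lemma plugIn_eq (w : Word I) (p : Var I) :
    plugIn w p = ((positions w p.1)[p.2]?).elim 1 iterVar := by
  unfold plugIn positions
  split <;> rename_i h <;> rw [h] <;> rfl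

lemma plugIn_cons_zero (l : Letter I) (w : Word I) :
    plugIn (l :: w) (l.vertex, 0) = iterVar (0 : Fin (w.length + 1)) := by
  rw [plugIn_eq, positions_cons, if_pos rfl]
  rfl

lemma tailEmb_plugIn (w : Word I) (p : Var I) : tailEmb I w.length (plugIn w p) =
    (((positions w p.1).map Fin.succ)[p.2]?).elim 1 iterVar := by
  rw [plugIn_eq, List.getElem?_map]
  cases (positions w p.1)[p.2]? with
  | none => exact map_one _
  | some a => exact tailEmb_iterVar a

lemma plugIn_cons_succ (l : Letter I) (w : Word I) (a : ℕ) :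
    plugIn (l :: w) (l.vertex, a + 1) = tailEmb I w.length (plugIn w (l.vertex, a)) := by
  rw [plugIn_eq, tailEmb_plugIn, positions_cons, if_pos rfl]
  rfl

lemma plugIn_cons_of_ne (l : Letter I) (w : Word I) {p : Var I} (h : l.vertex ≠ p.1) :
    plugIn (l :: w) p = tailEmb I w.length (plugIn w p) := by
  rw [plugIn_eq, tailEmb_plugIn, positions_cons, if_neg h]
  rfl

/-- Listing the positions of each vertex gives a bijection between the variables and the positions;
this is the form in which `plugIn` is used. -/
lemma exists_position (w : Word I) : ∃ e : ∀ p ∈ varSet (wordDegree w), Fin w.length,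
    (∀ p hp p' hp', e p hp = e p' hp' → p = p') ∧ (∀ a, ∃ p hp, e p hp = a) ∧
    (∀ p hp, (w.get (e p hp)).vertex = p.1) ∧ (∀ p hp, plugIn w p = iterVar (e p hp)) := by
  have hlen : ∀ p ∈ varSet (wordDegree w), p.2 < (positions w p.1).length := by
    intro p hp
    rw [length_positions]
    exact mem_varSet.1 hp
  have hv : ∀ p (hp : p ∈ varSet (wordDegree w)),
      (w.get ((positions w p.1)[p.2]'(hlen p hp))).vertex = p.1 := by
    intro p hp
    have := List.getElem_mem (hlen p hp)
    exact of_decide_eq_true (List.mem_filter.1 this).2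
  refine ⟨fun p hp => (positions w p.1)[p.2]'(hlen p hp), ?_, ?_, hv, ?_⟩
  · rintro ⟨i, a⟩ hp ⟨j, b⟩ hp' h
    have h1 : i = j := by
      have h2 := hv _ hp
      have h3 := hv _ hp'
      exact h2.symm.trans ((congrArg (fun c => (w.get c).vertex) h).trans h3)
    subst h1
    have : (positions w i).Nodup := (List.nodup_finRange _).filter _
    exact congrArg (Prod.mk i) ((this.getElem_inj_iff).1 h)
  · intro a
    have ha : a ∈ positions w (w.get a).vertex := by
      simp [positions]
    obtain ⟨k, hk, h⟩ := List.getElem_of_mem ha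
    refine ⟨((w.get a).vertex, k), ?_, h⟩
    rw [mem_varSet, ← length_positions]
    exact hk
  · intro p hp
    rw [plugIn_eq, List.getElem?_eq_getElem (hlen p hp)]
    rfl

lemma prod_plugIn {M : Type*} [CommMonoid M] (w : Word I) (f : I → IterLaurent I w.length → M) :
    ∏ p ∈ varSet (wordDegree w), f p.1 (plugIn w p) =
      ∏ a : Fin w.length, f (w.get a).vertex (iterVar a) := by
  obtain ⟨e, h1, h2, h3, h4⟩ := exists_position w
  refine Finset.prod_bij e (fun _ _ => Finset.mem_univ _) (fun p hp p' hp' h => h1 p hp p' hp' h)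
    (fun a _ => ?_) (fun p hp => by rw [h3, h4 p hp])
  obtain ⟨p, hp, h⟩ := h2 a
  exact ⟨p, hp, h⟩

/-- The index of the variable that is left after a shift by one at the vertex `i`, among the
variables of degree `n + 1` at `i`. -/
def cycleVar (n : I → ℕ) (i : I) (p : Var I) : Var I :=
  if p.1 = i then (if p.2 = 0 then (i, n i) else (i, p.2 - 1)) else p

lemma exists_isEnum_cycleVar (n : I → ℕ) (i : I) :
    ∃ θ, IsEnum (n + Pi.single i 1) Prod.fst (varSet (n + Pi.single i 1)) θ ∧
      ∀ p : {p // p ∈ varSet (n + Pi.single i 1)}, (θ p : Var I) = cycleVar n i p := by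
  refine exists_isEnum_self ?_ ?_ ?_
  · rintro ⟨j, a⟩ hp ⟨k, b⟩ hq h
    rw [Finset.mem_coe, mem_varSet] at hp hq
    unfold cycleVar at h
    dsimp only [Pi.add_apply] at h hp hq
    split_ifs at h with h1 h2 h3 h4 h5 h6 h7 h8 <;> simp only [Prod.mk.injEq] at h ⊢ <;>
      first
      | (subst h1; subst h3; simp at hp hq; omega)
      | (simp_all; try omega)
  · rintro ⟨j, a⟩ hp
    rw [mem_varSet] at hp ⊢
    unfold cycleVar
    split_ifs with h1 h2
    · simp
    · dsimp only at h1
      subst h1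
      simp only [Pi.add_apply, Pi.single_eq_same] at hp ⊢
      omega
    · exact hp
  · rintro ⟨j, a⟩ hp
    unfold cycleVar
    split_ifs with h1 h2
    · exact h1.symm
    · exact h1.symm
    · rfl

/-- `plugIn` places the first variable in the slot 0 of its colour whereas `constantTerm` uses the
last slot; the symmetry of P absorbs the cyclic shift. -/
lemma evalAt_plugIn_cons (l : Letter I) (w : Word I) {P : LaurentPoly I}
    (hP1 : InVariables (wordDegree (l :: w)) P) (hP2 : IsSymmetric (wordDegree (l :: w)) P) :
    evalAt (plugIn (l :: w)) P =
      evalAt (Function.update (fun p => tailEmb I w.length (plugIn w p))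
        (l.vertex, wordDegree w l.vertex) (iterVar (0 : Fin (w.length + 1)))) P := by
  rw [wordDegree_cons] at hP1 hP2
  obtain ⟨θ, hθ, hθ'⟩ := exists_isEnum_cycleVar (wordDegree w) l.vertex
  refine hθ.evalAt_eq hP1 hP2 (θ' := Equiv.refl _) (fun _ => rfl) ?_ (y := Function.update
      (fun p => tailEmb I w.length (plugIn w p))
        (l.vertex, wordDegree w l.vertex) (iterVar (0 : Fin (w.length + 1)))) ?_ (fun _ => rfl)
  · intro p
    by_cases h : p = (l.vertex, wordDegree w l.vertex)
    · subst h
      rw [Function.update_self]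
      exact iterVar_ne_zero _
    · rw [Function.update_of_ne h]
      exact (map_ne_zero _).2 (plugIn_ne_zero w p)
  · rintro ⟨⟨j, a⟩, hp⟩
    rw [hθ']
    rw [mem_varSet] at hp
    unfold cycleVar
    split_ifs with h1 h2
    · dsimp only at h1 h2
      subst h1 h2
      rw [Function.update_self, plugIn_cons_zero]
    · dsimp only at h1 h2
      subst h1
      obtain ⟨a, rfl⟩ := Nat.exists_eq_succ_of_ne_zero h2
      simp only [Pi.add_apply, Pi.single_eq_same] at hp
      rw [Function.update_of_ne, plugIn_cons_succ]
      · rfl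
      · intro h
        have := (Prod.mk.inj h).2
        dsimp only at this
        omega
    · rw [Function.update_of_ne, plugIn_cons_of_ne l w (Ne.symm h1)]
      exact fun h => h1 (Prod.mk.inj h).1

lemma zeta_single_ne_zero {Γ : Type*} [AddCommGroup Γ] [LinearOrder Γ] [IsOrderedAddMonoid Γ]
    (i j : I) {γ : Γ} (hγ : γ ≠ 0) :
    (zeta i j (HahnSeries.single γ 1 : HahnSeries Γ (GroundField I))) ≠ 0 := by
  have h : ∀ c : GroundField I, (1 - HahnSeries.single γ c : HahnSeries Γ (GroundField I)) ≠ 0 := by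
    intro c h
    have := congrArg (fun X => HahnSeries.coeff X 0) h
    simp [HahnSeries.coeff_single_of_ne hγ.symm] at this
  rw [zeta_eq]
  refine mul_ne_zero (Finset.prod_ne_zero_iff.2 fun o _ => ?_) ?_
  · rw [HahnSeries.algebraMap_apply, HahnSeries.C_apply, HahnSeries.single_mul_single]
    simpa using h _
  · split_ifs
    · exact inv_ne_zero (h 1)
    · exact one_ne_zero

/-- The factor of the integrand of `residuePairing` that depends only on the word. -/
def wordKernel (w : Word I) : IterLaurent I w.length :=
  (∏ a : Fin w.length, (iterVar a : IterLaurent I w.length) ^ (-(w.get a).exponent)) /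
    ∏ a : Fin w.length, ∏ b ∈ Finset.Ioi a, zeta (w.get a).vertex (w.get b).vertex
        ((iterVar a : IterLaurent I w.length) / iterVar b)

lemma residuePairing_eq (P : LaurentPoly I) (w : Word I) :
    residuePairing P w = (wordKernel w * evalAt (plugIn w) P).coeff 0 := by
  rw [residuePairing, wordKernel, div_mul_eq_mul_div]

lemma tailEmb_wordKernel (w : Word I) : tailEmb I w.length (wordKernel w) =
    (∏ a : Fin w.length, (iterVar a.succ : IterLaurent I (w.length + 1)) ^ (-(w.get a).exponent)) /
      ∏ a : Fin w.length, ∏ b ∈ Finset.Ioi a, zeta (w.get a).vertex (w.get b).vertex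
        ((iterVar a.succ : IterLaurent I (w.length + 1)) / iterVar b.succ) := by
  simp only [wordKernel, map_div₀, map_prod, map_zpow₀, tailEmb_iterVar, map_zeta]

lemma prod_Ioi_fin {M : Type*} [CommMonoid M] (n : ℕ) (f : Fin (n + 1) → Fin (n + 1) → M) :
    ∏ a : Fin (n + 1), ∏ b ∈ Finset.Ioi a, f a b =
      (∏ b : Fin n, f 0 b.succ) * ∏ a : Fin n, ∏ b ∈ Finset.Ioi a, f a.succ b.succ := by
  rw [Fin.prod_univ_succ, Fin.prod_Ioi_zero]
  simp only [Fin.prod_Ioi_succ]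

lemma wordKernel_cons (l : Letter I) (w : Word I) :
    wordKernel (l :: w) = ((iterVar (0 : Fin (w.length + 1)) : IterLaurent I (w.length + 1)) ^
      (-l.exponent) * (∏ b ∈ varSet (wordDegree w), zeta l.vertex b.1
        ((iterVar 0 : IterLaurent I (w.length + 1)) / tailEmb I w.length (plugIn w b)))⁻¹) *
      tailEmb I w.length (wordKernel w) := by
  rw [tailEmb_wordKernel, prod_plugIn w (fun i X => zeta l.vertex i
    ((iterVar 0 : IterLaurent I (w.length + 1)) / tailEmb I w.length X))]
  refine (congrArg₂ (· / ·) (Fin.prod_univ_succ (n := w.length)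
    (fun a => (iterVar a : IterLaurent I (w.length + 1)) ^ (-((l :: w).get a).exponent)))
    (prod_Ioi_fin w.length (fun a b => zeta ((l :: w).get a).vertex ((l :: w).get b).vertex
        ((iterVar a : IterLaurent I (w.length + 1)) / iterVar b)))).trans ?_
  simp only [tailEmb_iterVar, List.get_cons_zero, List.get_cons_succ']
  rw [div_eq_mul_inv, div_eq_mul_inv, mul_inv]
  exact mul_mul_mul_comm _ _ _ _

lemma single_sub_single_pos {n : ℕ} (a : Fin n) : (0 : Lex (Fin (n + 1) → ℤ)) <
    toLex (Pi.single 0 1) - toLex (Pi.single a.succ 1) := by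
  rw [sub_pos]
  refine ⟨0, fun j hj => absurd hj (Fin.not_lt_zero j), ?_⟩
  change Pi.single (M := fun _ => ℤ) a.succ 1 0 < Pi.single (M := fun _ => ℤ) 0 1 0
  rw [Pi.single_eq_same, Pi.single_eq_of_ne (Fin.succ_ne_zero a).symm]
  exact one_pos

lemma single_inj {Γ R : Type*} [PartialOrder Γ] [Zero R] {a b : Γ} {r s : R} (hr : r ≠ 0)
    (h : HahnSeries.single a r = HahnSeries.single b s) : a = b ∧ r = s := by
  have h1 := congrArg (fun X => HahnSeries.coeff X a) h
  rw [HahnSeries.coeff_single_same] at h1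
  by_cases hab : a = b
  · subst hab
    rw [HahnSeries.coeff_single_same] at h1
    exact ⟨rfl, h1⟩
  · rw [HahnSeries.coeff_single_of_ne hab] at h1
    exact absurd h1 hr

lemma algebraMap_div_iterVar {n : ℕ} (o : Pole I) (a : Fin n) :
    algebraMap (GroundField I) (IterLaurent I n) (poleConst o) / iterVar a =
      HahnSeries.single (-toLex (Pi.single a 1)) (poleConst o) := by
  rw [HahnSeries.algebraMap_apply, iterVar, HahnSeries.C_apply]
  refine (HahnSeries.single_div_single _ _ _ _).trans ?_
  rw [zero_sub, div_one]
  rfl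

lemma tailEmb_single {n : ℕ} (v : Lex (Fin n → ℤ)) (r : GroundField I) :
    tailEmb I n (HahnSeries.single v r) = HahnSeries.single (insertZero 0 v) r :=
  insertEmb_single _ _ _

/-- The first variable is infinitely smaller than all others, so integrating over it is taking the
constant term of the expansion at 0. -/
lemma residuePairing_cons (l : Letter I) (w : Word I) {P P' : LaurentPoly I}
    (hP1 : InVariables (wordDegree (l :: w)) P) (hP2 : IsSymmetric (wordDegree (l :: w)) P)
    (hP' : evalAt (plugIn w) P' =
      constantTerm (wordDegree w) l.vertex l.exponent P (plugIn w)) :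
    residuePairing P (l :: w) = residuePairing P' w := by
  obtain ⟨e, he1, -, -, he4⟩ := exists_position w
  let Y : (IterLaurent I (w.length + 1))ˣ := Units.mk0 (iterVar 0) (iterVar_ne_zero 0)
  have hδ : ∀ j ∈ insertPoles (wordDegree w) l.vertex,
      ∃ δ : Lex (Fin (w.length + 1) → ℤ), 0 < δ ∧
        tailEmb I w.length (algebraMap (GroundField I) _ (poleConst j.2) / plugIn w j.1) * Y =
          HahnSeries.single δ (poleConst j.2) := by
    intro j hj
    rw [mem_insertPoles] at hj
    refine ⟨_, single_sub_single_pos (e j.1 hj.1), ?_⟩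
    rw [he4 _ hj.1, algebraMap_div_iterVar, tailEmb_single, Units.val_mk0, iterVar,
      HahnSeries.single_mul_single, map_neg, insertZero_single, mul_one, Fin.succAbove_zero,
      neg_add_eq_sub]
  choose! δ hδ1 hδ2 using hδ
  have key := coeff_zero_insertVal (tailEmb I w.length) (exponentAt 0)
    (fun G γ h => exponentAt_eq_zero_of_insertEmb 0 G γ h) (u := toLex (Pi.single 0 1))
    (exponentAt_single 0 1) Y rfl (wordDegree w) l.vertex l.exponent P
    (x := plugIn w) (plugIn_ne_zero w) (fun j hj k hk h => ?_) δ (fun j => poleConst j.2)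
    (fun j _ => poleConst_ne_zero _) hδ2 (wordKernel w)
  -- All exponents δ are positive, so the two expansions agree and no pole is crossed.
  · rw [Finset.filter_false_of_mem fun j hj => (hδ1 j hj).not_gt, Finset.sum_empty,
      add_zero] at key
    rw [residuePairing_eq, residuePairing_eq, hP', evalAt_plugIn_cons l w hP1 hP2,
      wordKernel_cons]
    refine Eq.trans (congrArg (fun X => HahnSeries.coeff X 0) ?_)
      (key.trans (insertEmb_coeff_zero 0 _))
    rw [insertVal, ← Finset.prod_inv_distrib]
    have h2 : ∏ b ∈ varSet (wordDegree w), kerInv l.vertex b.1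
        ((Y : IterLaurent I (w.length + 1)) / tailEmb I w.length (plugIn w b)) =
        ∏ b ∈ varSet (wordDegree w), (zeta l.vertex b.1
          ((iterVar 0 : IterLaurent I (w.length + 1)) / tailEmb I w.length (plugIn w b)))⁻¹ := by
      refine Finset.prod_congr rfl fun b hb => kerInv_eq fun o ho h => ?_
      have h3 := hδ2 ⟨b, o⟩ (mem_insertPoles.2 ⟨hb, ho⟩)
      rw [map_div₀, AlgHom.commutes, div_mul_eq_mul_div, mul_div_assoc, h] at h3
      exact (hδ1 ⟨b, o⟩ (mem_insertPoles.2 ⟨hb, ho⟩)).ne (single_inj one_ne_zero h3).1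
    rw [h2, Units.val_mk0]
    ring
  · rw [mem_insertPoles] at hj hk
    rw [he4 _ hj.1, he4 _ hk.1, algebraMap_div_iterVar, algebraMap_div_iterVar] at h
    obtain ⟨h1, h2⟩ := single_inj (poleConst_ne_zero _) h
    have h3 : e j.1 hj.1 = e k.1 hk.1 := by
      by_contra hne
      have h4 := congrArg (exponentAt (e j.1 hj.1)) (neg_injective h1)
      change Pi.single (M := fun _ => ℤ) _ 1 _ = Pi.single (M := fun _ => ℤ) _ 1 _ at h4
      rw [Pi.single_eq_same, Pi.single_eq_of_ne hne] at h4
      exact one_ne_zero h4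
    have h4 : j.2 = k.2 := (poleConst_mul_zpow_inj (r := 0) (r' := 0) (by rw [h2])).1
    exact Sigma.ext (he1 _ _ _ _ h3) (heq_of_eq h4)

end PlugIn

/-! ### The expansion of the parameters -/

open HahnSeries

section Expansion

variable {I : Type u} [Quiver.{v} I]

/-- A copy of the ground field, without its structure of an algebra over the ground field. -/
def Coef (I : Type u) [Quiver.{v} I] : Type (max u v) := GroundField I

instance : Field (Coef I) := inferInstanceAs (Field (GroundField I))

instance : CharZero (Coef I) :=
  inferInstanceAs (CharZero (GroundField I))

/-- The identity. -/
def toCoef (I : Type u) [Quiver.{v} I] : GroundField I →+* Coef I := RingHom.id (GroundField I)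

/-- The field of iterated Laurent series in the variables `T, y_1, …, y_m`. -/
abbrev ClusterField (I : Type u) [Quiver.{v} I] (m : ℕ) : Type (max u v) :=
  (Coef I)⟦Lex (Fin (m + 1) → ℤ)⟧

/-- The weight of a parameter. -/
def parWeight : Option (Edge I) → ℤ
  | none => 2
  | some _ => 1

/-- The parameter of index `o` as an element of the ground field. -/
def par (o : Option (Edge I)) : GroundField I :=
  algebraMap (MvPolynomial (Option (Edge I)) ℚ) (GroundField I) (MvPolynomial.X o)

lemma par_ne_zero (o : Option (Edge I)) : (par o : GroundField I) ≠ 0 := by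
  rw [par, Ne, map_eq_zero_iff _ (IsFractionRing.injective _ _)]
  exact MvPolynomial.X_ne_zero _

/-- The expansion `q ↦ q T^2`, `t_e ↦ t_e T` on polynomials. -/
def expandPoly (I : Type u) [Quiver.{v} I] (m : ℕ) :
    MvPolynomial (Option (Edge I)) ℚ →+* ClusterField I m :=
  MvPolynomial.eval₂Hom (algebraMap ℚ (ClusterField I m))
    fun o => single (toLex (Pi.single 0 (parWeight o))) (toCoef I (par o))

/-- The weights only attach powers of T; setting T = 1 recovers the original polynomial. -/
lemma expandPoly_injective (m : ℕ) : Function.Injective (expandPoly I m) := by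
  -- T = 1 cannot be substituted in a Hahn series, so the expansion is factored through polynomials
  -- in T.
  let φ : MvPolynomial (Option (Edge I)) ℚ →+* Polynomial (Coef I) :=
    MvPolynomial.eval₂Hom (algebraMap ℚ _)
      fun o => Polynomial.C (toCoef I (par o)) * Polynomial.X ^ (parWeight o).toNat
  have hφ : Function.Injective φ := by
    have h : (Polynomial.evalRingHom 1).comp φ =
        (toCoef I).comp (algebraMap (MvPolynomial (Option (Edge I)) ℚ) (GroundField I)) := by
      refine MvPolynomial.ringHom_ext' (Subsingleton.elim _ _) fun o => ?_
      simp [φ, par]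
    have h' : Function.Injective ((Polynomial.evalRingHom 1).comp φ) := by
      rw [h]
      exact (toCoef I).injective.comp (IsFractionRing.injective _ _)
    exact Function.Injective.of_comp h'
  let ρ : Polynomial (Coef I) →+* ClusterField I m :=
    Polynomial.eval₂RingHom C (single (toLex (Pi.single 0 1)) 1)
  have hρX : ∀ k : ℕ, (single (toLex (Pi.single 0 1)) 1 : ClusterField I m) ^ k =
      single (toLex (Pi.single 0 (k : ℤ))) 1 := by
    intro k
    induction k with
    | zero => simp
    | succ k ih =>
      rw [pow_succ, ih, single_mul_single, mul_one, ← toLex_add, ← Pi.single_add]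
      simp
  have hρ : Function.Injective ρ := by
    rw [injective_iff_map_eq_zero]
    intro p hp
    ext k
    have h1 : HahnSeries.coeff (ρ p) (toLex (Pi.single 0 (k : ℤ))) = p.coeff k := by
      change HahnSeries.coeff (Polynomial.eval₂ (C : Coef I →+* ClusterField I m) _ p) _ = _
      rw [Polynomial.eval₂_eq_sum, Polynomial.sum, coeff_sum, Finset.sum_eq_single k]
      · rw [hρX, C_apply, single_mul_single, zero_add, mul_one, coeff_single_same]
      · intro j _ hjk
        rw [hρX, C_apply, single_mul_single, zero_add, coeff_single_of_ne]
        intro h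
        have h2 := congrArg (exponentAt 0) h
        rw [exponentAt_single, exponentAt_single] at h2
        exact hjk (by exact_mod_cast h2.symm)
      · intro h
        rw [Polynomial.notMem_support_iff.1 h, map_zero, zero_mul, coeff_zero]
    rw [← h1, hp, coeff_zero, Polynomial.coeff_zero]
  have h : expandPoly I m = ρ.comp φ := by
    refine MvPolynomial.ringHom_ext' (Subsingleton.elim _ _) fun o => ?_
    have h2 : ((parWeight o).toNat : ℤ) = parWeight o := by
      cases o <;> rfl
    simp only [expandPoly, MvPolynomial.coe_eval₂Hom, MvPolynomial.eval₂_X, RingHom.comp_apply, φ,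
      map_mul, map_pow]
    change _ = Polynomial.eval₂ (C : Coef I →+* ClusterField I m) _ _ *
      Polynomial.eval₂ (C : Coef I →+* ClusterField I m) _ _ ^ _
    rw [Polynomial.eval₂_C, Polynomial.eval₂_X, hρX, C_apply, single_mul_single, zero_add, mul_one,
      h2]
  rw [h]
  exact hρ.comp hφ

/-- The expansion of the ground field in the field of iterated Laurent series, with
`q ↦ q T^2`, `t_e ↦ t_e T`. -/
def expand (I : Type u) [Quiver.{v} I] (m : ℕ) : GroundField I →+* ClusterField I m :=
  IsFractionRing.lift (expandPoly_injective m)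

/-- The parameters act through their expansions, not as constants: this is what encodes that q and
t_e are small. -/
instance (m : ℕ) : Algebra (GroundField I) (ClusterField I m) := (expand I m).toAlgebra

lemma algebraMap_par (m : ℕ) (o : Option (Edge I)) :
    algebraMap (GroundField I) (ClusterField I m) (par o) =
      single (toLex (Pi.single 0 (parWeight o))) (toCoef I (par o)) := by
  change expand I m (algebraMap _ _ _) = _
  rw [expand, IsFractionRing.lift_algebraMap, expandPoly, MvPolynomial.coe_eval₂Hom,
    MvPolynomial.eval₂_X]

lemma single_zpow {m : ℕ} (γ : Lex (Fin m → ℤ)) {r : Coef I} (hr : r ≠ 0) (k : ℤ) :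
    (single γ r : (Coef I)⟦Lex (Fin m → ℤ)⟧) ^ k = single (k • γ) (r ^ k) := by
  have hn : ∀ k : ℕ, (single γ r : (Coef I)⟦Lex (Fin m → ℤ)⟧) ^ k = single (k • γ) (r ^ k) := by
    intro k
    rw [single_pow]
  obtain ⟨k, rfl | rfl⟩ := k.eq_nat_or_neg
  · rw [zpow_natCast, hn, natCast_zsmul, zpow_natCast]
  · rw [zpow_neg, zpow_natCast, hn, inv_single, neg_smul, natCast_zsmul, zpow_neg, zpow_natCast]

lemma zsmul_single {m : ℕ} (j : Fin m) (a k : ℤ) :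
    k • (toLex (Pi.single j a) : Lex (Fin m → ℤ)) = toLex (Pi.single j (k * a)) := by
  refine congrArg toLex ?_
  rw [← smul_eq_mul, Pi.single_smul]
  rfl

/-- The weight of a pole. -/
def poleWeight : Pole I → ℤ
  | none => -2
  | some _ => 1

lemma algebraMap_qPar_zpow (m : ℕ) (k : ℤ) :
    algebraMap (GroundField I) (ClusterField I m) (qPar I ^ k) =
      single (toLex (Pi.single 0 (2 * k))) (toCoef I (qPar I ^ k)) := by
  rw [map_zpow₀]
  refine (congrArg (fun X : ClusterField I m => X ^ k) (algebraMap_par m none)).trans ?_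
  rw [single_zpow _ ((map_ne_zero _).2 (par_ne_zero none)), zsmul_single, mul_comm]
  exact congrArg (single _) (map_zpow₀ (toCoef I) (qPar I) k).symm

/-- Both t_e and q/t_e have weight 1 and q⁻¹ has weight -2. Between points of weight zero the edge
factors of 1/ζ are thus expanded in positive powers of z and the factor 1 - z/(q x) in negative
ones. -/
lemma algebraMap_poleConst (m : ℕ) (o : Pole I) :
    algebraMap (GroundField I) (ClusterField I m) (poleConst o) =
      single (toLex (Pi.single 0 (poleWeight o))) (toCoef I (poleConst o)) := by
  rcases o with _ | ⟨e, _ | _⟩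
  · have := algebraMap_qPar_zpow (I := I) m (-1)
    rwa [zpow_neg_one] at this
  · exact algebraMap_par m (some e)
  · have h1 : algebraMap (GroundField I) (ClusterField I m) (qPar I) =
        single (toLex (Pi.single 0 2)) (toCoef I (qPar I)) := algebraMap_par m none
    have h2 : algebraMap (GroundField I) (ClusterField I m) (tPar e.2.2) =
        single (toLex (Pi.single 0 1)) (toCoef I (tPar e.2.2)) := algebraMap_par m (some e)
    change algebraMap (GroundField I) (ClusterField I m) (qPar I / tPar e.2.2) = _
    rw [map_div₀, h1, h2, single_div_single, ← toLex_sub, ← Pi.single_sub, ← map_div₀]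
    rfl

/-- The inclusion that leaves out the variable `y_p`. -/
def clusterEmb (I : Type u) [Quiver.{v} I] {m : ℕ} (p : Fin (m + 1)) :
    ClusterField I m →ₐ[GroundField I] ClusterField I (m + 1) where
  __ := insertEmb (Coef I) p.succ
  commutes' c := by
    change ((insertEmb (Coef I) p.succ).comp (expand I m)) c = expand I (m + 1) c
    refine congrArg (fun f : GroundField I →+* ClusterField I (m + 1) => f c) ?_
    refine IsLocalization.ringHom_ext (nonZeroDivisors (MvPolynomial (Option (Edge I)) ℚ)) ?_
    refine MvPolynomial.ringHom_ext' (Subsingleton.elim _ _) fun o => ?_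
    change insertEmb (Coef I) p.succ (algebraMap (GroundField I) (ClusterField I m) (par o)) =
      algebraMap (GroundField I) (ClusterField I (m + 1)) (par o)
    rw [algebraMap_par, algebraMap_par, insertEmb_single, insertZero_single,
      Fin.succ_succAbove_zero]

end Expansion

/-! ### Strings of points with successive ratio q. -/

section Clusters

variable {I : Type u} [Fintype I] [LinearOrder I] [Quiver.{v} I] [∀ i j : I, Fintype (i ⟶ j)]

/-- The points `q^r y_s` of the clusters. -/
def clusterPoint (I : Type u) [Quiver.{v} I] (m : ℕ) (a : Fin m × ℕ) : ClusterField I m :=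
  single (toLex (Pi.single 0 (2 * (a.2 : ℤ)) + Pi.single a.1.succ 1)) (toCoef I (qPar I ^ a.2))

lemma clusterPoint_ne_zero {m : ℕ} (a : Fin m × ℕ) : clusterPoint I m a ≠ 0 :=
  single_ne_zero ((map_ne_zero _).2 (pow_ne_zero _ qPar_ne_zero))

lemma clusterPoint_succ {m : ℕ} (s : Fin m) (r : ℕ) :
    clusterPoint I m (s, r + 1) =
      algebraMap (GroundField I) (ClusterField I m) (qPar I) * clusterPoint I m (s, r) := by
  have := algebraMap_qPar_zpow (I := I) m 1
  rw [zpow_one] at this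
  rw [this, clusterPoint, clusterPoint, single_mul_single, ← map_mul, ← toLex_add, ← add_assoc,
    ← Pi.single_add, pow_succ']
  rw [show 2 * ((r + 1 : ℕ) : ℤ) = 2 * 1 + 2 * r by push_cast; ring]

lemma clusterEmb_clusterPoint {m : ℕ} (p : Fin (m + 1)) (s : Fin m) (r : ℕ) :
    clusterEmb I p (clusterPoint I m (s, r)) = clusterPoint I (m + 1) (p.succAbove s, r) := by
  refine (insertEmb_single _ _ _).trans ?_
  rw [toLex_add, map_add, insertZero_single, insertZero_single, Fin.succ_succAbove_zero,
    Fin.succ_succAbove_succ]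
  rfl

end Clusters

/-! ### Symmetric functions on coloured points -/

section Plug

variable {I : Type u} [Fintype I] [LinearOrder I] [Quiver.{v} I] [∀ i j : I, Fintype (i ⟶ j)]
variable {ι : Type*} {A : Type*} [Field A] [Algebra (GroundField I) A]

/-- The coordinates of `y` are non-zero, and those with an index in `varSet n` are the values of
`x` on the coloured points `s`. -/
def Plug (n : I → ℕ) (col : ι → I) (x : ι → A) (s : Finset ι) (y : Var I → A) : Prop :=
  (∀ p, y p ≠ 0) ∧ ∃ θ, IsEnum n col s θ ∧ ∀ p : {p // p ∈ varSet n}, y p = x (θ p)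

open Classical in
/-- The value of a symmetric Laurent polynomial on a set of coloured points. -/
def evalOn (n : I → ℕ) (P : LaurentPoly I) (col : ι → I) (x : ι → A) (s : Finset ι) : A :=
  if h : ∃ y, Plug n col x s y then evalAt h.choose P else 0

lemma Plug.evalOn_eq {n : I → ℕ} {P : LaurentPoly I} (hP1 : InVariables n P)
    (hP2 : IsSymmetric n P) {col : ι → I} {x : ι → A} {s : Finset ι} {y : Var I → A}
    (hy : Plug n col x s y) : evalOn n P col x s = evalAt y P := by
  have h : ∃ y, Plug n col x s y := ⟨y, hy⟩
  rw [evalOn, dif_pos h]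
  obtain ⟨-, θ, hθ, hyθ⟩ := h.choose_spec
  obtain ⟨hy0, θ', hθ', hyθ'⟩ := hy
  exact hθ.evalAt_eq hP1 hP2 hθ' hy0 hyθ hyθ'

lemma exists_plug {n : I → ℕ} {col : ι → I} {x : ι → A} {s : Finset ι} (hx : ∀ a ∈ s, x a ≠ 0)
    (h : ∀ i, (s.filter fun a => col a = i).card = n i) : ∃ y, Plug n col x s y := by
  have e : ∀ i, Nonempty (Fin (n i) ≃ {a // a ∈ s.filter fun a => col a = i}) := fun i =>
    ⟨Fintype.equivOfCardEq (by rw [Fintype.card_fin, Fintype.card_coe, h])⟩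
  let e := fun i => (e i).some
  have hs : ∀ {i a}, a ∈ s.filter (fun a => col a = i) → a ∈ s ∧ col a = i := fun h =>
    Finset.mem_filter.1 h
  let f : {p // p ∈ varSet n} → {a // a ∈ s} := fun p =>
    ⟨e p.1.1 ⟨p.1.2, mem_varSet.1 p.2⟩, (hs (e p.1.1 ⟨p.1.2, mem_varSet.1 p.2⟩).2).1⟩
  have hf : ∀ p, col (f p) = p.1.1 := fun p => (hs (e p.1.1 ⟨p.1.2, mem_varSet.1 p.2⟩).2).2
  have hbij : Function.Bijective f := by
    constructor
    · rintro ⟨⟨i, a⟩, hp⟩ ⟨⟨j, b⟩, hq⟩ hpq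
      have h1 : i = j := by
        have := hf ⟨⟨i, a⟩, hp⟩
        rw [hpq, hf] at this
        exact this.symm
      subst h1
      have h2 := (e i).injective (Subtype.ext (congrArg (fun c : {a // a ∈ s} => (c : ι)) hpq))
      have h3 : a = b := congrArg Fin.val h2
      subst h3
      rfl
    · rintro ⟨a, ha⟩
      have ha' : a ∈ s.filter fun b => col b = col a := Finset.mem_filter.2 ⟨ha, rfl⟩
      obtain ⟨k, hk⟩ := (e (col a)).surjective ⟨a, ha'⟩
      exact ⟨⟨(col a, k), mem_varSet.2 k.2⟩, 
        Subtype.ext (congrArg (fun c : {b // b ∈ s.filter fun b => col b = col a} => (c : ι)) hk)⟩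
  let θ := Equiv.ofBijective f hbij
  refine ⟨fun p => if hp : p ∈ varSet n then x (θ ⟨p, hp⟩) else 1, fun p => ?_, θ, hf,
    fun p => dif_pos p.2⟩
  dsimp only
  by_cases hp : p ∈ varSet n
  · rw [dif_pos hp]
    exact hx _ (θ ⟨p, hp⟩).2
  · rw [dif_neg hp]
    exact one_ne_zero

variable [DecidableEq ι]

/-- The colours either have the multiplicities of the degree of w or leave nothing to sum, so the
default value of `evalOn` never matters where it is multiplied by f_w. -/
lemma fVal_eq_zero_or_plug (w : Word I) {col : ι → I} {x : ι → A} {s : Finset ι}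
    (hx : ∀ a ∈ s, x a ≠ 0) :
    fVal col x w s = 0 ∨ ∃ y, Plug (wordDegree w) col x s y := by
  by_cases h : ∀ i, (s.filter fun a => col a = i).card = wordDegree w i
  · exact Or.inr (exists_plug hx h)
  · push Not at h
    obtain ⟨i, hi⟩ := h
    exact Or.inl (symRec_eq_zero col _ _ hi)

lemma Plug.prod_eq {M : Type*} [CommMonoid M] {n : I → ℕ} {col : ι → I} {x : ι → A} {s : Finset ι}
    {y : Var I → A} (hy : Plug n col x s y) (f : I → A → M) :
    ∏ b ∈ varSet n, f b.1 (y b) = ∏ a ∈ s, f (col a) (x a) := by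
  obtain ⟨-, θ, hθ, hyθ⟩ := hy
  rw [← Finset.prod_coe_sort, ← Finset.prod_coe_sort s]
  exact Fintype.prod_equiv θ _ _ fun p => by rw [hθ, hyθ]

lemma mem_varSet_add_single {n : I → ℕ} {i : I} {p : Var I} :
    p ∈ varSet (n + Pi.single i 1) ↔ p ∈ varSet n ∨ p = (i, n i) := by
  obtain ⟨j, a⟩ := p
  rw [mem_varSet, mem_varSet, Pi.add_apply]
  by_cases h : j = i
  · subst h
    rw [Pi.single_eq_same]
    simp only [Prod.mk.injEq, true_and]
    omega
  · rw [Pi.single_eq_of_ne h]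
    simp [h]

lemma Plug.insertPoint {n : I → ℕ} {col : ι → I} {x : ι → A} {s : Finset ι}
    {y : Var I → A} (hy : Plug n col x s y) {a : ι} (ha : a ∉ s) (hxa : x a ≠ 0) :
    Plug (n + Pi.single (col a) 1) col x (insert a s)
      (Function.update y (col a, n (col a)) (x a)) := by
  obtain ⟨hy0, θ, hθ, hyθ⟩ := hy
  have hlast : ∀ p ∈ varSet n, p ≠ (col a, n (col a)) := by
    rintro p hp rfl
    exact lt_irrefl _ (mem_varSet.1 hp)
  refine ⟨fun p => ?_, ?_⟩
  · by_cases h : p = (col a, n (col a))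
    · subst h
      rwa [Function.update_self]
    · rw [Function.update_of_ne h]
      exact hy0 p
  let f : {p // p ∈ varSet (n + Pi.single (col a) 1)} → {b // b ∈ insert a s} := fun p =>
    if hp : p.1 ∈ varSet n then ⟨θ ⟨p.1, hp⟩, Finset.mem_insert_of_mem (θ ⟨p.1, hp⟩).2⟩
    else ⟨a, Finset.mem_insert_self _ _⟩
  have hf1 : ∀ p (hp : p.1 ∈ varSet n), (f p : ι) = θ ⟨p.1, hp⟩ := fun p hp => by
    simp only [f, dif_pos hp]
  have hf2 : ∀ p, p.1 ∉ varSet n → (f p : ι) = a := fun p hp => by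
    simp only [f, dif_neg hp]
  have hp' : ∀ p : {p // p ∈ varSet (n + Pi.single (col a) 1)}, p.1 ∉ varSet n →
      p.1 = (col a, n (col a)) := fun p hp => (mem_varSet_add_single.1 p.2).resolve_left hp
  have hbij : Function.Bijective f := by
    constructor
    · intro p q hpq
      replace hpq := congrArg Subtype.val hpq
      by_cases hp : p.1 ∈ varSet n <;> by_cases hq : q.1 ∈ varSet n
      · rw [hf1 p hp, hf1 q hq] at hpq
        exact Subtype.ext (congrArg (fun c : {p // p ∈ varSet n} => (c : Var I))
          (θ.injective (Subtype.ext hpq)))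
      · rw [hf1 p hp, hf2 q hq] at hpq
        exact absurd (hpq ▸ (θ ⟨p.1, hp⟩).2) ha
      · rw [hf2 p hp, hf1 q hq] at hpq
        exact absurd (hpq ▸ (θ ⟨q.1, hq⟩).2) ha
      · exact Subtype.ext ((hp' p hp).trans (hp' q hq).symm)
    · rintro ⟨b, hb⟩
      obtain rfl | hb' := Finset.mem_insert.1 hb
      · refine ⟨⟨(col b, n (col b)), mem_varSet_add_single.2 (Or.inr rfl)⟩, Subtype.ext (hf2 _ ?_)⟩
        exact fun h => hlast _ h rfl
      · refine ⟨⟨θ.symm ⟨b, hb'⟩, mem_varSet_add_single.2 (Or.inl (θ.symm ⟨b, hb'⟩).2)⟩,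
          Subtype.ext ((hf1 _ (θ.symm ⟨b, hb'⟩).2).trans ?_)⟩
        rw [Subtype.coe_eta, Equiv.apply_symm_apply]
  refine ⟨Equiv.ofBijective f hbij, fun p => ?_, fun p => ?_⟩
  · rw [Equiv.ofBijective_apply]
    by_cases hp : p.1 ∈ varSet n
    · rw [hf1 p hp, hθ]
    · rw [hf2 p hp, hp' p hp]
  · rw [Equiv.ofBijective_apply]
    by_cases hp : p.1 ∈ varSet n
    · rw [hf1 p hp, Function.update_of_ne (hlast _ hp)]
      exact hyθ ⟨p.1, hp⟩
    · rw [hf2 p hp, hp' p hp, Function.update_self]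

lemma Plug.mapPoints {A' : Type*} [Field A'] [Algebra (GroundField I) A'] (f : A →ₐ[GroundField I] A')
    {ι' : Type*} (φ : ι ↪ ι') {n : I → ℕ} {col : ι → I} {x : ι → A} {s : Finset ι}
    {y : Var I → A} (hy : Plug n col x s y) {col' : ι' → I} {x' : ι' → A'}
    (hcol : ∀ a ∈ s, col' (φ a) = col a) (hx : ∀ a ∈ s, x' (φ a) = f (x a)) :
    Plug n col' x' (s.map φ) fun p => f (y p) := by
  obtain ⟨hy0, θ, hθ, hyθ⟩ := hy
  have e : ∀ a : {a // a ∈ s}, φ a ∈ s.map φ := fun a => Finset.mem_map_of_mem φ a.2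
  let e : {a // a ∈ s} ≃ {b // b ∈ s.map φ} := Equiv.ofBijective (fun a => ⟨φ a, e a⟩) (by
    constructor
    · intro a b h
      exact Subtype.ext (φ.injective (congrArg Subtype.val h))
    · rintro ⟨b, hb⟩
      obtain ⟨a, ha, rfl⟩ := Finset.mem_map.1 hb
      exact ⟨⟨a, ha⟩, rfl⟩)
  refine ⟨fun p => (map_ne_zero _).2 (hy0 p), θ.trans e, fun p => ?_, fun p => ?_⟩
  · exact (hcol _ (θ p).2).trans (hθ p)
  · exact (congrArg f (hyθ p)).trans (hx _ (θ p).2).symm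

/-- The product of the regularized functions `1 / ζ` over all pairs of points. -/
def weightOn (col : ι → I) (x : ι → A) (s : Finset ι) : A :=
  ∏ a ∈ s, ∏ b ∈ s.erase a, kerInv (col a) (col b) (x a / x b)

lemma map_weightOn {A' : Type*} [Field A'] [Algebra (GroundField I) A']
    (f : A →ₐ[GroundField I] A') (col : ι → I) (x : ι → A) (s : Finset ι) :
    f (weightOn col x s) = weightOn col (fun a => f (x a)) s := by
  simp only [weightOn, map_prod, map_kerInv, map_div₀]

lemma weightOn_map {ι' : Type*} [DecidableEq ι'] (φ : ι ↪ ι') (col : ι' → I) (x : ι' → A)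
    (s : Finset ι) :
    weightOn col x (s.map φ) = weightOn (fun a => col (φ a)) (fun a => x (φ a)) s := by
  rw [weightOn, weightOn, Finset.prod_map]
  refine Finset.prod_congr rfl fun a _ => ?_
  rw [← Finset.map_erase φ, Finset.prod_map]

lemma weightOn_insert (col : ι → I) (x : ι → A) {s : Finset ι} {a : ι} (ha : a ∉ s) :
    weightOn col x (insert a s) = (∏ b ∈ s, kerInv (col a) (col b) (x a / x b)) *
      (∏ b ∈ s, kerInv (col b) (col a) (x b / x a)) * weightOn col x s := by
  unfold weightOn
  rw [Finset.prod_insert ha, Finset.erase_insert ha, mul_assoc]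
  refine congrArg _ ?_
  rw [← Finset.prod_mul_distrib]
  refine Finset.prod_congr rfl fun b hb => ?_
  have hab : a ≠ b := fun h => ha (h ▸ hb)
  rw [Finset.erase_insert_of_ne hab, Finset.prod_insert]
  exact fun h => ha (Finset.mem_of_mem_erase h)

lemma kerInv_mul_zeta {i j : I} {x : A}
    (h : ∀ o ∈ poles i j, algebraMap (GroundField I) A (poleConst o) * x ≠ 1) (h' : x ≠ 1) :
    kerInv i j x * zeta i j x = 1 := by
  rw [kerInv_eq h]
  refine inv_mul_cancel₀ ?_
  rw [zeta_eq]
  refine mul_ne_zero (Finset.prod_ne_zero_iff.2 fun o ho => sub_ne_zero.2 (h o ho).symm) ?_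
  split_ifs
  · exact inv_ne_zero (sub_ne_zero.2 h'.symm)
  · exact one_ne_zero

/-- The contribution of the assignment of the first letter to the point `a`. -/
def firstTerm (P : LaurentPoly I) (l : Letter I) (w : Word I) (col : ι → I) (x : ι → A)
    (s : Finset ι) (a : ι) : A :=
  evalOn (wordDegree w + Pi.single l.vertex 1) P col x s * (x a ^ (-l.exponent) *
    ∏ b ∈ s.erase a, kerInv (col a) (col b) (x a / x b)) *
    (weightOn col x (s.erase a) * fVal col x w (s.erase a))

/-- The weight contains 1/ζ for both orders of each pair. The factors ζ(x_b/x_a) of f_{l w} cancel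
one half of those that involve a; the other half is the kernel of the constant term for the first
letter. -/
lemma firstTerm_eq {P : LaurentPoly I} {l : Letter I} {w : Word I} {col : ι → I} {x : ι → A}
    {s : Finset ι} {a : ι} (ha : a ∈ s) (h : ∀ b ∈ s.erase a, x b / x a ≠ 1 ∧
      ∀ o ∈ poles (col b) (col a), algebraMap (GroundField I) A (poleConst o) * (x b / x a) ≠ 1) :
    evalOn (wordDegree w + Pi.single l.vertex 1) P col x s * (weightOn col x s *
      (x a ^ (-l.exponent) * (∏ b ∈ s.erase a, zeta (col b) (col a) (x b / x a)) *
        fVal col x w (s.erase a))) = firstTerm P l w col x s a := by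
  have h1 : (∏ b ∈ s.erase a, kerInv (col b) (col a) (x b / x a)) *
      ∏ b ∈ s.erase a, zeta (col b) (col a) (x b / x a) = 1 := by
    rw [← Finset.prod_mul_distrib]
    exact Finset.prod_eq_one fun b hb => kerInv_mul_zeta (h b hb).2 (h b hb).1
  have h2 := weightOn_insert col x (Finset.notMem_erase a s)
  rw [Finset.insert_erase ha] at h2
  rw [h2, firstTerm]
  linear_combination (evalOn (wordDegree w + Pi.single l.vertex 1) P col x s *
    (∏ b ∈ s.erase a, kerInv (col a) (col b) (x a / x b)) * weightOn col x (s.erase a) *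
    x a ^ (-l.exponent) * fVal col x w (s.erase a)) * h1

lemma firstTerm_insert {P : LaurentPoly I} {l : Letter I} {w : Word I}
    (hP1 : InVariables (wordDegree w + Pi.single l.vertex 1) P)
    (hP2 : IsSymmetric (wordDegree w + Pi.single l.vertex 1) P)
    {col : ι → I} {x : ι → A} {s : Finset ι} {y : Var I → A} (hy : Plug (wordDegree w) col x s y)
    {a : ι} (ha : a ∉ s) (hxa : x a ≠ 0) (hcol : col a = l.vertex) :
    firstTerm P l w col x (insert a s) a =
      weightOn col x s * fVal col x w s *
        insertVal (wordDegree w) l.vertex l.exponent P y (x a) := by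
  have h := hy.insertPoint ha hxa
  rw [hcol] at h
  rw [firstTerm, Finset.erase_insert ha, insertVal, h.evalOn_eq hP1 hP2,
    hy.prod_eq (fun j t => kerInv l.vertex j (x a / t)), hcol]
  ring

lemma firstTerm_eq_zero {P : LaurentPoly I} {l : Letter I} {w : Word I}
    {col : ι → I} {x : ι → A} {s : Finset ι} {a : ι} (h : fVal col x w (s.erase a) = 0) :
    firstTerm P l w col x s a = 0 := by
  rw [firstTerm, h, mul_zero, mul_zero]

end Plug

/-! ### Sums over configurations of clusters -/

open HahnSeries

section ClusterSum

variable {I : Type u} [Fintype I] [LinearOrder I] [Quiver.{v} I] [∀ i j : I, Fintype (i ⟶ j)]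

/-- The points of a configuration: the cluster `s` consists of the points `(s, r)` with
`r ≤ (c s).2`, of colour `(c s).1`. -/
def clusterSet {m : ℕ} (c : Fin m → I × ℕ) : Finset (Fin m × ℕ) := varSet fun s => (c s).2 + 1

/-- The colour of a point. -/
def clusterCol {m : ℕ} (c : Fin m → I × ℕ) (a : Fin m × ℕ) : I := (c a.1).1

lemma mem_clusterSet {m : ℕ} {c : Fin m → I × ℕ} {a : Fin m × ℕ} :
    a ∈ clusterSet c ↔ a.2 ≤ (c a.1).2 := by
  rw [clusterSet, mem_varSet, Nat.lt_succ_iff]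

/-- The top point of a cluster. -/
def topPoint {m : ℕ} (c : Fin m → I × ℕ) (s : Fin m) : Fin m × ℕ := (s, (c s).2)

lemma topPoint_mem {m : ℕ} (c : Fin m → I × ℕ) (s : Fin m) : topPoint c s ∈ clusterSet c :=
  mem_clusterSet.2 le_rfl

lemma algebraMap_poleConst_div (m : ℕ) (o : Pole I) (a : Fin m × ℕ) :
    algebraMap (GroundField I) (ClusterField I m) (poleConst o) / clusterPoint I m a =
      single (toLex (Pi.single 0 (poleWeight o - 2 * (a.2 : ℤ)) - Pi.single a.1.succ 1))
        (toCoef I (poleConst o * qPar I ^ (-(a.2 : ℤ)))) := by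
  rw [algebraMap_poleConst, clusterPoint, single_div_single, ← map_div₀, ← toLex_sub, zpow_neg,
    zpow_natCast, div_eq_mul_inv, Pi.single_sub, sub_sub]

lemma exponentAt_toLex_sub {n : ℕ} (j : Fin (n + 1)) (s t : Fin n) (k : ℤ) :
    exponentAt j (toLex (Pi.single 0 k - Pi.single s.succ 1)) =
      (if j = 0 then k else 0) - if j = s.succ then 1 else 0 := by
  change (Pi.single (M := fun _ => ℤ) 0 k j - Pi.single (M := fun _ => ℤ) s.succ 1 j) = _
  rw [Pi.single_apply, Pi.single_apply]

/-- The exponent of the y variables recognizes the cluster, and the coefficient, a monomial in the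
parameters, recognizes the pole and the power of q. -/
lemma eq_of_poleConst_div_eq {m : ℕ} {o o' : Pole I} {a a' : Fin m × ℕ}
    (h : algebraMap (GroundField I) (ClusterField I m) (poleConst o) / clusterPoint I m a =
      algebraMap (GroundField I) (ClusterField I m) (poleConst o') / clusterPoint I m a') :
    o = o' ∧ a = a' := by
  rw [algebraMap_poleConst_div, algebraMap_poleConst_div] at h
  obtain ⟨h1, h2⟩ := single_inj ((map_ne_zero _).2
    (mul_ne_zero (poleConst_ne_zero o) (zpow_ne_zero _ qPar_ne_zero))) h
  obtain ⟨h3, h4⟩ := poleConst_mul_zpow_inj ((toCoef I).injective h2)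
  have h5 := congrArg (exponentAt a.1.succ) h1
  rw [exponentAt_toLex_sub _ _ a.1, exponentAt_toLex_sub _ _ a.1, if_neg (Fin.succ_ne_zero _),
    if_neg (Fin.succ_ne_zero _), if_pos rfl] at h5
  refine ⟨h3, Prod.ext ?_ (by omega)⟩
  by_contra hne
  rw [if_neg (fun h => hne (Fin.succ_injective _ h))] at h5
  omega

lemma clusterPoint_injective (m : ℕ) : Function.Injective (clusterPoint I m) := by
  intro a a' h
  exact (eq_of_poleConst_div_eq (o := none) (o' := none) (by rw [h])).2

/-- By genericity the linear factors vanish only for the pole q⁻¹ between successive points of one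
cluster. -/
lemma poleConst_mul_div_ne_one {m : ℕ} {o : Pole I} {a b : Fin m × ℕ}
    (h : o = none → b ≠ (a.1, a.2 + 1)) :
    algebraMap (GroundField I) (ClusterField I m) (poleConst o) *
      (clusterPoint I m b / clusterPoint I m a) ≠ 1 := by
  intro h1
  have hq : algebraMap (GroundField I) (ClusterField I m) (qPar I) ≠ 0 :=
    (map_ne_zero _).2 qPar_ne_zero
  have hb := clusterPoint_ne_zero (I := I) b
  have ha := clusterPoint_ne_zero (I := I) a
  have h2 := eq_of_poleConst_div_eq (o := o) (o' := none) (a := (a.1, a.2 + 1)) (a' := b) (by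
    rw [clusterPoint_succ]
    change _ = algebraMap (GroundField I) (ClusterField I m) (qPar I)⁻¹ / _
    rw [map_inv₀]
    rw [← mul_div_assoc, div_eq_one_iff_eq ha] at h1
    field_simp
    exact h1)
  exact h h2.1 h2.2.symm

/-- The contribution of a configuration. -/
def clusterTerm (P : LaurentPoly I) (w : Word I) {m : ℕ} (c : Fin m → I × ℕ) : Coef I :=
  (evalOn (wordDegree w) P (clusterCol c) (clusterPoint I m) (clusterSet c) *
    (weightOn (clusterCol c) (clusterPoint I m) (clusterSet c) *
      fVal (clusterCol c) (clusterPoint I m) w (clusterSet c))).coeff 0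

/-- The contribution of a configuration and of the assignment of the first letter to the top of a
cluster. -/
def clusterTopTerm (P : LaurentPoly I) (l : Letter I) (w : Word I) {m : ℕ} (c : Fin m → I × ℕ)
    (s : Fin m) : Coef I :=
  (firstTerm P l w (clusterCol c) (clusterPoint I m) (clusterSet c) (topPoint c s)).coeff 0

/-- A first letter placed below the top of a cluster meets the zero of ζ at q from the next point,
so only the tops of clusters remain. -/
lemma clusterTerm_cons (P : LaurentPoly I) (l : Letter I) (w : Word I) {m : ℕ}
    (c : Fin m → I × ℕ) :
    clusterTerm P (l :: w) c =
      ∑ s : Fin m with (c s).1 = l.vertex, clusterTopTerm P l w c s := by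
  rw [clusterTerm, wordDegree_cons, fVal_cons, Finset.mul_sum, Finset.mul_sum, coeff_sum]
  symm
  refine Finset.sum_of_injOn (topPoint c) ?_ ?_ ?_ ?_
  · intro s _ t _ h
    exact congrArg Prod.fst h
  · intro s hs
    exact Finset.mem_coe.2 (Finset.mem_filter.2 ⟨topPoint_mem c s, (Finset.mem_filter.1 hs).2⟩)
  · rintro ⟨s, r⟩ ha hna
    obtain ⟨h1, h2⟩ := Finset.mem_filter.1 ha
    have h3 : r < (c s).2 := by
      refine lt_of_le_of_ne (mem_clusterSet.1 h1) fun h => hna ?_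
      exact ⟨s, Finset.mem_coe.2 (Finset.mem_filter.2 ⟨Finset.mem_univ _, h2⟩), by
        rw [topPoint, ← h]⟩
    have hb : (s, r + 1) ∈ (clusterSet c).erase (s, r) :=
      Finset.mem_erase.2 ⟨by simp, mem_clusterSet.2 h3⟩
    rw [Finset.prod_eq_zero hb]
    · simp
    · refine zeta_eq_zero (o := none) rfl ?_
      rw [clusterPoint_succ, mul_div_cancel_right₀ _ (clusterPoint_ne_zero _)]
      change algebraMap (GroundField I) _ (qPar I)⁻¹ * _ = 1
      rw [← map_mul, inv_mul_cancel₀ qPar_ne_zero, map_one]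
  · intro s hs
    -- Above a top there is no next point, so the factors cancelled by `firstTerm_eq` are non-zero.
    rw [clusterTopTerm, firstTerm_eq (topPoint_mem c s)]
    rintro ⟨t, r⟩ hb
    obtain ⟨h1, h2⟩ := Finset.mem_erase.1 hb
    refine ⟨fun h => h1 (clusterPoint_injective (I := I) m ?_), fun o _ => poleConst_mul_div_ne_one ?_⟩
    · rwa [div_eq_one_iff_eq (clusterPoint_ne_zero _)] at h
    · rintro - h
      obtain ⟨rfl, rfl⟩ := Prod.mk.inj h
      exact absurd (mem_clusterSet.1 h2) (by simp [topPoint])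

/-- The configuration with an additional cluster that consists of one point. -/
def addCluster {m : ℕ} (p : Fin (m + 1)) (i : I) (c : Fin m → I × ℕ) : Fin (m + 1) → I × ℕ :=
  p.insertNth (α := fun _ => I × ℕ) (i, 0) c

/-- The configuration in which the cluster `s` has an additional point. -/
def growCluster {m : ℕ} (c : Fin m → I × ℕ) (s : Fin m) : Fin m → I × ℕ :=
  Function.update c s ((c s).1, (c s).2 + 1)

/-- The map of points that corresponds to an additional cluster. -/
def liftPoint {m : ℕ} (p : Fin (m + 1)) : Fin m × ℕ ↪ Fin (m + 1) × ℕ :=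
  ⟨fun a => (p.succAbove a.1, a.2), fun a b h => by
    obtain ⟨h1, h2⟩ := Prod.mk.inj h
    exact Prod.ext (Fin.succAbove_right_injective h1) h2⟩

lemma clusterSet_addCluster {m : ℕ} (p : Fin (m + 1)) (i : I) (c : Fin m → I × ℕ) :
    clusterSet (addCluster p i c) = insert (p, 0) ((clusterSet c).map (liftPoint p)) := by
  ext ⟨s, r⟩
  rw [mem_clusterSet, Finset.mem_insert, Finset.mem_map]
  constructor
  · intro h
    obtain rfl | ⟨s, rfl⟩ := Fin.eq_self_or_eq_succAbove p s
    · rw [addCluster, Fin.insertNth_apply_same] at h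
      exact Or.inl (congrArg (Prod.mk s) (Nat.le_zero.1 h))
    · rw [addCluster, Fin.insertNth_apply_succAbove] at h
      exact Or.inr ⟨(s, r), mem_clusterSet.2 h, rfl⟩
  · rintro (h | ⟨⟨t, k⟩, hb, h⟩)
    · obtain ⟨rfl, rfl⟩ := Prod.mk.inj h
      exact Nat.zero_le _
    · obtain ⟨rfl, rfl⟩ := Prod.mk.inj h
      rw [addCluster, Fin.insertNth_apply_succAbove]
      exact mem_clusterSet.1 hb

lemma clusterSet_growCluster {m : ℕ} (c : Fin m → I × ℕ) (s : Fin m) :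
    clusterSet (growCluster c s) = insert (s, (c s).2 + 1) (clusterSet c) := by
  ext ⟨t, r⟩
  rw [mem_clusterSet, Finset.mem_insert, mem_clusterSet, growCluster]
  by_cases h : t = s
  · subst h
    rw [Function.update_self]
    simp only [Prod.mk.injEq, true_and]
    omega
  · rw [Function.update_of_ne h]
    simp [h]

lemma clusterCol_growCluster {m : ℕ} (c : Fin m → I × ℕ) (s : Fin m) :
    clusterCol (growCluster c s) = clusterCol c := by
  funext a
  rw [clusterCol, clusterCol, growCluster]
  by_cases h : a.1 = s
  · rw [h, Function.update_self]
  · rw [Function.update_of_ne h]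

lemma clusterTopTerm_addCluster {P : LaurentPoly I} {l : Letter I} {w : Word I}
    (hP1 : InVariables (wordDegree w + Pi.single l.vertex 1) P)
    (hP2 : IsSymmetric (wordDegree w + Pi.single l.vertex 1) P) {m : ℕ} (c : Fin m → I × ℕ)
    {y : Var I → ClusterField I m}
    (hy : Plug (wordDegree w) (clusterCol c) (clusterPoint I m) (clusterSet c) y)
    (p : Fin (m + 1)) :
    clusterTopTerm P l w (addCluster p l.vertex c) p =
      (clusterEmb I p (weightOn (clusterCol c) (clusterPoint I m) (clusterSet c) *
          fVal (clusterCol c) (clusterPoint I m) w (clusterSet c)) *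
        insertVal (wordDegree w) l.vertex l.exponent P (fun r => clusterEmb I p (y r))
          (clusterPoint I (m + 1) (p, 0))).coeff 0 := by
  have h1 : ∀ a, clusterCol (addCluster p l.vertex c) (liftPoint p a) = clusterCol c a := fun a =>
    congrArg Prod.fst (Fin.insertNth_apply_succAbove (α := fun _ => I × ℕ) p _ c a.1)
  have h2 : ∀ a, clusterPoint I (m + 1) (liftPoint p a) = clusterEmb I p (clusterPoint I m a) :=
    fun a => (clusterEmb_clusterPoint p a.1 a.2).symm
  have h3 : topPoint (addCluster p l.vertex c) p = (p, 0) := by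
    rw [topPoint, addCluster, Fin.insertNth_apply_same]
  have h4 : (p, 0) ∉ (clusterSet c).map (liftPoint p) := by
    intro h
    obtain ⟨a, -, ha⟩ := Finset.mem_map.1 h
    exact Fin.succAbove_ne p a.1 (congrArg Prod.fst ha)
  rw [clusterTopTerm, h3, clusterSet_addCluster, firstTerm_insert hP1 hP2
    (hy.mapPoints (clusterEmb I p) (liftPoint p) (fun a _ => h1 a) (fun a _ => h2 a)) h4
    (clusterPoint_ne_zero _)
    (congrArg Prod.fst (Fin.insertNth_apply_same (α := fun _ => I × ℕ) p _ c)), weightOn_map, fVal,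
    symRec_map, map_mul, map_weightOn, map_fVal]
  simp only [h1, h2]
  rfl

lemma clusterTopTerm_growCluster {P : LaurentPoly I} {l : Letter I} {w : Word I}
    (hP1 : InVariables (wordDegree w + Pi.single l.vertex 1) P)
    (hP2 : IsSymmetric (wordDegree w + Pi.single l.vertex 1) P) {m : ℕ} (c : Fin m → I × ℕ)
    {y : Var I → ClusterField I m}
    (hy : Plug (wordDegree w) (clusterCol c) (clusterPoint I m) (clusterSet c) y)
    {s : Fin m} (hs : (c s).1 = l.vertex) :
    clusterTopTerm P l w (growCluster c s) s =
      (weightOn (clusterCol c) (clusterPoint I m) (clusterSet c) *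
          fVal (clusterCol c) (clusterPoint I m) w (clusterSet c) *
        insertVal (wordDegree w) l.vertex l.exponent P y
          (clusterPoint I m (s, (c s).2 + 1))).coeff 0 := by
  have h3 : topPoint (growCluster c s) s = (s, (c s).2 + 1) := by
    rw [topPoint, growCluster, Function.update_self]
  have h4 : (s, (c s).2 + 1) ∉ clusterSet c := fun h => by
    have := mem_clusterSet.1 h
    dsimp only at this
    omega
  rw [clusterTopTerm, h3, clusterSet_growCluster, clusterCol_growCluster, firstTerm_insert hP1 hP2 hy h4
    (clusterPoint_ne_zero _) hs]

end ClusterSum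

/-! ### The residues that do not vanish -/

open HahnSeries

section Vanishing

variable {I : Type u} [Fintype I] [LinearOrder I] [Quiver.{v} I] [∀ i j : I, Fintype (i ⟶ j)]
variable {A : Type*} [Field A] [Algebra (GroundField I) A]

/-- The denominator 1 - x of ζ_ii is a zero of 1/ζ_ii on the diagonal. -/
lemma insertVal_eq_zero_of_none {n : I → ℕ} (i : I) (d : ℤ) (P : LaurentPoly I) {x : Var I → A}
    {b : Var I} (hb : b ∈ varSet n) (hi : i = b.1) (hx : x b ≠ 0) :
    insertVal n i d P x (x b) = 0 := by
  rw [insertVal, Finset.prod_eq_zero hb, mul_zero]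
  rw [kerInv, if_pos hi, div_self hx, sub_self, mul_zero]

/-- With z = x_b/α the two existing points are αz and αz/q. For α = t_e this is a wheel of the
second kind, for α = q/t_e one of the first kind. -/
lemma insertVal_eq_zero_of_wheel {n : I → ℕ} {i : I} (d : ℤ) {P : LaurentPoly I}
    (hP : WheelConditions (n + Pi.single i 1) P) {x : Var I → A} (hx : ∀ p, x p ≠ 0)
    {b b' : Var I} (hb : b ∈ varSet n) (hb' : b' ∈ varSet n) (hbb : b ≠ b') (hcol : b.1 = b'.1)
    (hq : x b = algebraMap (GroundField I) A (qPar I) * x b') {o : Pole I} (ho : IsPole i b.1 o)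
    (ho' : o ≠ none) :
    insertVal n i d P x (x b / algebraMap (GroundField I) A (poleConst o)) = 0 := by
  obtain ⟨j, β⟩ := b
  obtain ⟨j', γ⟩ := b'
  dsimp only at hcol ho
  subst hcol
  set z := x (j, β) / algebraMap (GroundField I) A (poleConst o) with hz
  have hα : algebraMap (GroundField I) A (poleConst o) ≠ 0 :=
    (map_ne_zero _).2 (poleConst_ne_zero o)
  have hz0 : z ≠ 0 := div_ne_zero (hx _) hα
  have hxz : x (j, β) = algebraMap (GroundField I) A (poleConst o) * z := by
    rw [hz, mul_div_cancel₀ _ hα]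
  have hxz' : x (j, γ) = algebraMap (GroundField I) A (poleConst o / qPar I) * z := by
    have hq0 : algebraMap (GroundField I) A (qPar I) ≠ 0 := (map_ne_zero _).2 qPar_ne_zero
    rw [map_div₀, div_mul_eq_mul_div, ← hxz, hq, mul_div_cancel_left₀ _ hq0]
  have hlast : ∀ {k a}, (k, a) ∈ varSet n → ((k, a) : Var I) ≠ (i, n i) := by
    rintro k a hp h
    rw [h, mem_varSet] at hp
    exact lt_irrefl _ hp
  have hlt : ∀ {k a}, (k, a) ∈ varSet n → a < (n + Pi.single i 1 : I → ℕ) k := fun h =>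
    lt_of_lt_of_le (mem_varSet.1 h) (Nat.le_add_right _ _)
  have hlt' : n i < (n + Pi.single i 1 : I → ℕ) i := by simp
  have hy0 : ∀ p, Function.update x (i, n i) z p ≠ 0 := by
    intro p
    by_cases h : p = (i, n i)
    · subst h
      rwa [Function.update_self]
    · rw [Function.update_of_ne h]
      exact hx p
  have hne : β ≠ γ := fun h => hbb (by rw [h])
  have hij : ∀ {a}, (j, a) ∈ varSet n → j = i → a ≠ n i := by
    rintro a ha rfl h
    exact hlast ha (by rw [h])
  have key : evalAt (Function.update x (i, n i) z) P = 0 := by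
    rcases o with _ | ⟨⟨i', j', e⟩, _ | _⟩
    · exact absurd rfl ho'
    · obtain ⟨rfl, rfl⟩ := ho
      refine hP.eval_snd hy0 e (hlt hb) hlt' (hlt hb') hne
        (fun h => ⟨hij hb h.symm, (hij hb' h.symm).symm⟩) ?_ ?_
      · rw [Function.update_of_ne (hlast hb), Function.update_self, hxz, Algebra.smul_def]
        rfl
      · rw [Function.update_of_ne (hlast hb'), Function.update_self, hxz', Algebra.smul_def]
        rfl
    · obtain ⟨rfl, rfl⟩ := ho
      refine hP.eval_fst hy0 e (hlt hb) hlt' (hlt hb') hne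
        (fun h => ⟨hij hb h, (hij hb' h).symm⟩) ?_ ?_
      · rw [Function.update_of_ne (hlast hb), Function.update_self, hxz, Algebra.smul_def]
        rfl
      · rw [Function.update_of_ne (hlast hb'), Function.update_self, hxz', Algebra.smul_def]
        congr 2
        change qPar I / tPar e / qPar I = (tPar e)⁻¹
        rw [div_div_cancel_left' qPar_ne_zero]
  rw [insertVal, key, zero_mul, zero_mul]

end Vanishing

section Move

variable {I : Type u} [Fintype I] [LinearOrder I] [Quiver.{v} I] [∀ i j : I, Fintype (i ⟶ j)]

lemma toLex_neg_iff {n : ℕ} {v : Fin (n + 1) → ℤ} (h : v 0 ≠ 0) : toLex v < 0 ↔ v 0 < 0 := by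
  constructor
  · rintro ⟨i, h1, h2⟩
    obtain rfl | hi := eq_or_ne i 0
    · exact h2
    · exact absurd (h1 0 (Fin.pos_of_ne_zero hi)) h
  · intro h1
    exact ⟨0, fun j hj => absurd hj (Fin.not_lt_zero j), h1⟩

/-- The weight of an edge pole is odd and that of q⁻¹ is negative. The power of T alone therefore
decides on which side of the contour a pole lies, whatever the order of the y variables. -/
lemma poleWeight_sub_ne_zero (o : Pole I) (r : ℕ) : poleWeight o - 2 * (r : ℤ) ≠ 0 := by
  rcases o with _ | o
  · change (-2 : ℤ) - 2 * r ≠ 0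
    omega
  · change (1 : ℤ) - 2 * r ≠ 0
    omega

lemma clusterPoint_zero {m : ℕ} (p : Fin m) :
    clusterPoint I m (p, 0) = single (toLex (Pi.single p.succ 1)) 1 := by
  rw [clusterPoint, pow_zero, map_one]
  simp

lemma clusterEmb_poleConst_div {m : ℕ} (p : Fin (m + 1)) (o : Pole I) (a : Fin m × ℕ) :
    clusterEmb I p (algebraMap (GroundField I) (ClusterField I m) (poleConst o) /
        clusterPoint I m a) * clusterPoint I (m + 1) (p, 0) =
      single (toLex (Pi.single 0 (poleWeight o - 2 * (a.2 : ℤ)) -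
          Pi.single (p.succAbove a.1).succ 1 + Pi.single p.succ 1))
        (toCoef I (poleConst o * qPar I ^ (-(a.2 : ℤ)))) := by
  rw [algebraMap_poleConst_div, clusterPoint_zero]
  refine (congrArg (· * _) (insertEmb_single _ _ _)).trans ?_
  rw [single_mul_single, mul_one, toLex_sub, map_sub, insertZero_single, insertZero_single,
    Fin.succ_succAbove_zero, Fin.succ_succAbove_succ, ← toLex_sub, ← toLex_add]

/-- The heart of the argument: moving a variable from 0 to the common contour next to existing
clusters. What remains is the integral over a new one-point cluster and, for each cluster of the
right colour, the residue that adds a point at its top. -/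
lemma coeff_zero_move {P : LaurentPoly I} {l : Letter I} {w : Word I}
    (hP3 : WheelConditions (wordDegree w + Pi.single l.vertex 1) P) {m : ℕ} (c : Fin m → I × ℕ)
    {y : Var I → ClusterField I m}
    (hy : Plug (wordDegree w) (clusterCol c) (clusterPoint I m) (clusterSet c) y)
    (p : Fin (m + 1)) (G : ClusterField I m) :
    (clusterEmb I p G * insertVal (wordDegree w) l.vertex l.exponent P
        (fun r => clusterEmb I p (y r)) (clusterPoint I (m + 1) (p, 0))).coeff 0 +
      ∑ s : Fin m with (c s).1 = l.vertex, (G * insertVal (wordDegree w) l.vertex l.exponent P y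
          (clusterPoint I m (s, (c s).2 + 1))).coeff 0 =
    (G * constantTerm (wordDegree w) l.vertex l.exponent P y).coeff 0 := by
  obtain ⟨hy0, θ, hθ, hyθ⟩ := hy
  have hθ' : ∀ b (hb : b ∈ varSet (wordDegree w)), y b = clusterPoint I m (θ ⟨b, hb⟩) :=
    fun b hb => hyθ ⟨b, hb⟩
  have hδ : ∀ j ∈ insertPoles (wordDegree w) l.vertex, ∃ (δ : Lex (Fin (m + 1 + 1) → ℤ))
      (a : Coef I), a ≠ 0 ∧ (clusterEmb I p (algebraMap (GroundField I) (ClusterField I m)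
        (poleConst j.2) / y j.1) * clusterPoint I (m + 1) (p, 0) = single δ a) ∧
      ∀ hb : j.1 ∈ varSet (wordDegree w),
        (δ < 0 ↔ poleWeight j.2 - 2 * ((θ ⟨j.1, hb⟩ : Fin m × ℕ).2 : ℤ) < 0) := by
    intro j hj
    rw [mem_insertPoles] at hj
    refine ⟨_, _, ?_, by rw [hθ' _ hj.1]; exact clusterEmb_poleConst_div p j.2 _, fun hb => ?_⟩
    · exact (map_ne_zero _).2 (mul_ne_zero (poleConst_ne_zero _) (zpow_ne_zero _ qPar_ne_zero))
    · have h0 : (Pi.single 0 (poleWeight j.2 - 2 * ((θ ⟨j.1, hb⟩ : Fin m × ℕ).2 : ℤ)) -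
          Pi.single (p.succAbove (θ ⟨j.1, hb⟩ : Fin m × ℕ).1).succ 1 + Pi.single p.succ 1 :
            Fin (m + 1 + 1) → ℤ) 0 = poleWeight j.2 - 2 * ((θ ⟨j.1, hb⟩ : Fin m × ℕ).2 : ℤ) := by
        rw [Pi.add_apply, Pi.sub_apply, Pi.single_eq_same,
          Pi.single_eq_of_ne (Fin.succ_ne_zero _).symm,
          Pi.single_eq_of_ne (Fin.succ_ne_zero _).symm, sub_zero, add_zero]
      rw [toLex_neg_iff (by rw [h0]; exact poleWeight_sub_ne_zero _ _), h0]
  choose! δ a ha hcy hneg using hδ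
  have key := coeff_zero_insertVal (clusterEmb I p) (exponentAt p.succ)
    (fun G γ h => exponentAt_eq_zero_of_insertEmb p.succ G γ h)
    (u := toLex (Pi.single p.succ 1)) (exponentAt_single _ _)
    (Units.mk0 (clusterPoint I (m + 1) (p, 0)) (clusterPoint_ne_zero _)) (clusterPoint_zero p)
    (wordDegree w) l.vertex l.exponent P hy0 (fun j hj k hk h => ?_) δ a ha hcy G
  · refine Eq.trans (congrArg₂ (· + ·) rfl ?_) (key.trans (insertEmb_coeff_zero _ _))
    have htop : ∀ s : Fin m, ∃ b : Var I, ∃ hb : b ∈ varSet (wordDegree w),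
        (θ ⟨b, hb⟩ : Fin m × ℕ) = topPoint c s := fun s =>
      ⟨θ.symm ⟨topPoint c s, topPoint_mem c s⟩, (θ.symm ⟨topPoint c s, topPoint_mem c s⟩).2, by
        rw [Subtype.coe_eta, Equiv.apply_symm_apply]⟩
    choose b hb hbθ using htop
    have hyb : ∀ s, y (b s) = clusterPoint I m (s, (c s).2) := fun s => by
      rw [hθ' _ (hb s), hbθ]; rfl
    have hbcol : ∀ s, (b s).1 = (c s).1 := fun s => by
      rw [← hθ ⟨b s, hb s⟩, hbθ]; rfl
    have hnone : algebraMap (GroundField I) (ClusterField I m) (poleConst none) =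
        (algebraMap (GroundField I) (ClusterField I m) (qPar I))⁻¹ := map_inv₀ _ _
    -- Among the crossed poles only z = q · top can contribute.
    refine Finset.sum_of_injOn (fun s => ⟨b s, none⟩) ?_ ?_ ?_ ?_
    · intro s _ t _ h
      have h1 : b s = b t := congrArg Sigma.fst h
      have h2 := hyb s
      rw [h1, hyb] at h2
      exact (congrArg Prod.fst (clusterPoint_injective m h2)).symm
    · intro s hs
      have hs' := (Finset.mem_filter.1 (Finset.mem_coe.1 hs)).2
      have hj : (⟨b s, none⟩ : Σ _ : Var I, Pole I) ∈ insertPoles (wordDegree w) l.vertex :=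
        mem_insertPoles.2 ⟨hb s, mem_poles.2 ((hbcol s).trans hs').symm⟩
      refine Finset.mem_coe.2 (Finset.mem_filter.2 ⟨hj, (hneg _ hj (hb s)).2 ?_⟩)
      change (-2 : ℤ) - _ < 0
      omega
    · rintro ⟨b', o⟩ hj hnj
      obtain ⟨hj1, hj2⟩ := Finset.mem_filter.1 hj
      obtain ⟨hb', ho⟩ := mem_insertPoles.1 hj1
      rw [mem_poles] at ho
      have hlarge := (hneg _ hj1 hb').1 hj2
      have hcol := hθ ⟨b', hb'⟩
      obtain ⟨⟨⟨s, r⟩, hmem⟩, hsr⟩ : ∃ t, t = θ ⟨b', hb'⟩ := ⟨_, rfl⟩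
      rw [← hsr] at hcol hlarge
      have hyb' : y b' = clusterPoint I m (s, r) := by rw [hθ' _ hb', ← hsr]
      dsimp only at hlarge ho hb' ⊢
      suffices insertVal (wordDegree w) l.vertex l.exponent P y
          (y b' / algebraMap (GroundField I) (ClusterField I m) (poleConst o)) = 0 by
        rw [this, mul_zero, map_zero, coeff_zero]
      have hprev : ∀ r', (s, r') ∈ clusterSet c → ∃ b'', b'' ∈ varSet (wordDegree w) ∧
          b''.1 = b'.1 ∧ y b'' = clusterPoint I m (s, r') := by
        intro r' hr'
        refine ⟨θ.symm ⟨(s, r'), hr'⟩, (θ.symm ⟨(s, r'), hr'⟩).2, ?_, ?_⟩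
        · rw [← hθ, Equiv.apply_symm_apply, ← hcol]
          rfl
        · rw [hyθ, Equiv.apply_symm_apply]
      -- A pole z = q x below the top of a cluster lands on the next point of the same colour, a
      -- diagonal zero. A crossed edge pole has weight 1 - 2r < 0, so r ≥ 1 and the previous point
      -- x/q exists, which completes a wheel.
      by_cases hon : o = none
      · subst hon
        have hr : r < (c s).2 := by
          refine lt_of_le_of_ne (mem_clusterSet.1 hmem) fun h => hnj ?_
          have hbb : b s = b' := by
            have h1 : θ ⟨b s, hb s⟩ = θ ⟨b', hb'⟩ := by
              rw [← hsr]
              refine Subtype.ext ((hbθ s).trans ?_)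
              rw [topPoint, ← h]
            exact congrArg (fun t : {p // p ∈ varSet (wordDegree w)} => (t : Var I))
              (θ.injective h1)
          refine ⟨s, Finset.mem_coe.2 (Finset.mem_filter.2 ⟨Finset.mem_univ _, ?_⟩), ?_⟩
          · rw [← hbcol, hbb]
            exact ho.symm
          · exact congrArg (fun t => (⟨t, none⟩ : Σ _ : Var I, Pole I)) hbb
        obtain ⟨b'', hb'', hcol'', hyb''⟩ := hprev (r + 1) (mem_clusterSet.2 hr)
        rw [hnone, div_inv_eq_mul, hyb', mul_comm, ← clusterPoint_succ, ← hyb'']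
        exact insertVal_eq_zero_of_none _ _ _ hb'' (ho.trans hcol''.symm) (hy0 _)
      · obtain ⟨r, rfl⟩ : ∃ r', r = r' + 1 := by
          rcases o with _ | o
          · exact absurd rfl hon
          · change (1 : ℤ) - 2 * (r : ℤ) < 0 at hlarge
            exact ⟨r - 1, by omega⟩
        obtain ⟨b'', hb'', hcol'', hyb''⟩ := hprev r
          (mem_clusterSet.2 (le_trans (Nat.le_succ r) (mem_clusterSet.1 hmem)))
        refine insertVal_eq_zero_of_wheel _ hP3 hy0 hb' hb'' ?_ hcol''.symm ?_ ho hon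
        · rintro rfl
          have := congrArg Prod.snd (clusterPoint_injective m (hyb'.symm.trans hyb''))
          dsimp only at this
          omega
        · rw [hyb', hyb'', clusterPoint_succ]
    · intro s hs
      dsimp only
      refine (insertEmb_coeff_zero p.succ _).symm.trans ?_
      rw [hnone, div_inv_eq_mul, hyb, mul_comm (clusterPoint I m _), ← clusterPoint_succ]
      rfl
  · rw [mem_insertPoles] at hj hk
    rw [hθ' _ hj.1, hθ' _ hk.1] at h
    obtain ⟨h1, h2⟩ := eq_of_poleConst_div_eq h
    have h3 := congrArg (fun t : {p // p ∈ varSet (wordDegree w)} => (t : Var I))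
      (θ.injective (Subtype.ext h2))
    exact Sigma.ext h3 (heq_of_eq h1)

end Move

/-! ### The pairing with the opposite words as a sum over clusters -/

open HahnSeries

section Configurations

variable {I : Type u} [Fintype I] [LinearOrder I]

/-- The configurations of `m` clusters with `N` points. -/
def configs (I : Type u) [Fintype I] [LinearOrder I] (N m : ℕ) : Finset (Fin m → I × ℕ) :=
  (Fintype.piFinset fun _ => Finset.univ ×ˢ Finset.range N).filter
    fun c => ∑ s, ((c s).2 + 1) = N

lemma mem_configs {N m : ℕ} {c : Fin m → I × ℕ} :
    c ∈ configs I N m ↔ ∑ s, ((c s).2 + 1) = N := by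
  rw [configs, Finset.mem_filter, and_iff_right_iff_imp]
  intro h
  rw [Fintype.mem_piFinset]
  intro s
  rw [Finset.mem_product]
  refine ⟨Finset.mem_univ _, Finset.mem_range.2 ?_⟩
  have := Finset.single_le_sum (f := fun s => (c s).2 + 1) (fun _ _ => Nat.zero_le _)
    (Finset.mem_univ s)
  omega

lemma configs_eq_empty {N m : ℕ} (h : N < m) : configs I N m = ∅ := by
  rw [Finset.eq_empty_iff_forall_notMem]
  intro c hc
  rw [mem_configs, Finset.sum_add_distrib] at hc
  simp at hc
  omega

lemma addCluster_mem_configs {N m : ℕ} {c : Fin m → I × ℕ} (p : Fin (m + 1)) (i : I) :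
    addCluster p i c ∈ configs I (N + 1) (m + 1) ↔ c ∈ configs I N m := by
  rw [mem_configs, mem_configs, Fin.sum_univ_succAbove _ p]
  simp only [addCluster, Fin.insertNth_apply_same, Fin.insertNth_apply_succAbove]
  omega

lemma growCluster_mem_configs {N m : ℕ} {c : Fin m → I × ℕ} (s : Fin m) :
    growCluster c s ∈ configs I (N + 1) m ↔ c ∈ configs I N m := by
  rw [mem_configs, mem_configs, ← Finset.add_sum_erase _ _ (Finset.mem_univ s),
    ← Finset.add_sum_erase _ (fun t => (c t).2 + 1) (Finset.mem_univ s)]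
  have : ∑ t ∈ Finset.univ.erase s, ((growCluster c s t).2 + 1) =
      ∑ t ∈ Finset.univ.erase s, ((c t).2 + 1) := by
    refine Finset.sum_congr rfl fun t ht => ?_
    rw [growCluster, Function.update_of_ne (Finset.ne_of_mem_erase ht)]
  rw [this, growCluster, Function.update_self]
  dsimp only
  omega

variable {M : Type*} [AddCommMonoid M]

/-- A marked cluster with a single point can be deleted; its place among the others is the only lost
information. -/
lemma sum_configs_add (T : ∀ m, (Fin m → I × ℕ) → Fin m → M) (N m : ℕ) (i : I) :
    ∑ c ∈ configs I (N + 1) (m + 1), ∑ s : Fin (m + 1) with (c s).1 = i ∧ (c s).2 = 0,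
        T (m + 1) c s =
      ∑ c ∈ configs I N m, ∑ p : Fin (m + 1), T (m + 1) (addCluster p i c) p := by
  simp only [Finset.sum_filter]
  rw [Finset.sum_comm, Finset.sum_comm (s := configs I N m)]
  refine Finset.sum_congr rfl fun p _ => ?_
  rw [← Finset.sum_filter]
  symm
  refine Finset.sum_nbij' (fun c => addCluster p i c) (fun c => p.removeNth c) ?_ ?_ ?_ ?_ ?_
  · intro c hc
    refine Finset.mem_filter.2 ⟨(addCluster_mem_configs p i).2 hc, ?_⟩
    simp [addCluster]
  · intro c hc
    obtain ⟨h1, h2, h3⟩ := Finset.mem_filter.1 hc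
    rw [← addCluster_mem_configs p i]
    convert h1
    rw [addCluster, ← h2, ← h3]
    exact Fin.insertNth_self_removeNth p c
  · intro c _
    exact Fin.removeNth_insertNth (α := fun _ => I × ℕ) p _ c
  · intro c hc
    obtain ⟨h1, h2, h3⟩ := Finset.mem_filter.1 hc
    rw [addCluster, ← h2, ← h3]
    exact Fin.insertNth_self_removeNth p c
  · intro c _
    rfl

/-- A marked cluster with at least two points can be shortened by its top, which keeps the number of
clusters. -/
lemma sum_configs_grow (T : ∀ m, (Fin m → I × ℕ) → Fin m → M) (N m : ℕ) (i : I) :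
    ∑ c ∈ configs I (N + 1) m, ∑ s : Fin m with (c s).1 = i ∧ (c s).2 ≠ 0, T m c s =
      ∑ c ∈ configs I N m, ∑ s : Fin m with (c s).1 = i, T m (growCluster c s) s := by
  simp only [Finset.sum_filter]
  rw [Finset.sum_comm, Finset.sum_comm (s := configs I N m)]
  refine Finset.sum_congr rfl fun s _ => ?_
  rw [← Finset.sum_filter, ← Finset.sum_filter]
  symm
  have hgrow : ∀ c : Fin m → I × ℕ, (c s).2 ≠ 0 →
      growCluster (Function.update c s ((c s).1, (c s).2 - 1)) s = c := by
    intro c hc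
    rw [growCluster, Function.update_self, Function.update_idem]
    dsimp only
    rw [Nat.sub_add_cancel (Nat.one_le_iff_ne_zero.2 hc), Prod.mk.eta, Function.update_eq_self]
  refine Finset.sum_nbij' (fun c => growCluster c s)
    (fun c => Function.update c s ((c s).1, (c s).2 - 1)) ?_ ?_ ?_ ?_ ?_
  · intro c hc
    obtain ⟨h1, h2⟩ := Finset.mem_filter.1 hc
    refine Finset.mem_filter.2 ⟨(growCluster_mem_configs s).2 h1, ?_⟩
    rw [growCluster, Function.update_self]
    exact ⟨h2, Nat.succ_ne_zero _⟩
  · intro c hc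
    obtain ⟨h1, h2, h3⟩ := Finset.mem_filter.1 hc
    refine Finset.mem_filter.2 ⟨?_, ?_⟩
    · rw [← growCluster_mem_configs s, hgrow c h3]
      exact h1
    · rw [Function.update_self]
      exact h2
  · intro c _
    rw [growCluster, Function.update_self, Function.update_idem]
    dsimp only
    rw [Nat.add_sub_cancel, Prod.mk.eta, Function.update_eq_self]
  · intro c hc
    obtain ⟨h1, h2, h3⟩ := Finset.mem_filter.1 hc
    exact hgrow c h3
  · intro c _
    rfl

end Configurations

/-! ### The recursion for the sum over clusters. -/

section ClusterSum

variable {I : Type u} [Fintype I] [LinearOrder I] [Quiver.{v} I] [∀ i j : I, Fintype (i ⟶ j)]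

/-- The sum of the contributions of all configurations. -/
def clusterSum (P : LaurentPoly I) (w : Word I) : Coef I :=
  ∑ m ∈ Finset.range (w.length + 1), ((m.factorial : ℕ) : Coef I)⁻¹ *
    ∑ c ∈ configs I w.length m, clusterTerm P w c

/-- The move holds for each of the m + 1 places at which the new variable may stand in the order of
the y variables. Summing over all places matches the configurations, in which the clusters are
numbered. -/
lemma sum_clusterTopTerm {P P' : LaurentPoly I} {l : Letter I} {w : Word I}
    (hP1 : InVariables (wordDegree w + Pi.single l.vertex 1) P)
    (hP2 : IsSymmetric (wordDegree w + Pi.single l.vertex 1) P)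
    (hP3 : WheelConditions (wordDegree w + Pi.single l.vertex 1) P)
    (hP1' : InVariables (wordDegree w) P') (hP2' : IsSymmetric (wordDegree w) P')
    (hP' : ∀ (K : Type (max u v)) [Field K] [Algebra (GroundField I) K] (x : Var I → K),
      (∀ p, x p ≠ 0) → evalAt x P' = constantTerm (wordDegree w) l.vertex l.exponent P x)
    {m : ℕ} (c : Fin m → I × ℕ) :
    ∑ p : Fin (m + 1), clusterTopTerm P l w (addCluster p l.vertex c) p + ((m + 1 : ℕ) : Coef I) *
      ∑ s : Fin m with (c s).1 = l.vertex, clusterTopTerm P l w (growCluster c s) s =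
    ((m + 1 : ℕ) : Coef I) * clusterTerm P' w c := by
  obtain h | ⟨y, hy⟩ := fVal_eq_zero_or_plug w (col := clusterCol c) (x := clusterPoint I m)
    (s := clusterSet c) (fun a _ => clusterPoint_ne_zero a)
  · have h1 : ∀ p : Fin (m + 1), clusterTopTerm P l w (addCluster p l.vertex c) p = 0 := by
      intro p
      have h3 : topPoint (addCluster p l.vertex c) p = (p, 0) := by
        rw [topPoint, addCluster, Fin.insertNth_apply_same]
      have h4 : (p, 0) ∉ (clusterSet c).map (liftPoint p) := by
        intro h
        obtain ⟨a, -, ha⟩ := Finset.mem_map.1 h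
        exact Fin.succAbove_ne p a.1 (congrArg Prod.fst ha)
      rw [clusterTopTerm, firstTerm_eq_zero, coeff_zero]
      rw [h3, clusterSet_addCluster, Finset.erase_insert h4, fVal, symRec_map]
      have h5 := congrArg (clusterEmb I p) h
      rw [map_zero, map_fVal] at h5
      have h6 : ∀ a, clusterCol (addCluster p l.vertex c) (liftPoint p a) = clusterCol c a := fun a =>
        congrArg Prod.fst (Fin.insertNth_apply_succAbove (α := fun _ => I × ℕ) p _ c a.1)
      have h7 : ∀ a, clusterPoint I (m + 1) (liftPoint p a) =
          clusterEmb I p (clusterPoint I m a) := fun a => (clusterEmb_clusterPoint p a.1 a.2).symm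
      simp only [h6, h7]
      exact h5
    have h2 : ∀ s : Fin m, clusterTopTerm P l w (growCluster c s) s = 0 := by
      intro s
      have h3 : topPoint (growCluster c s) s = (s, (c s).2 + 1) := by
        rw [topPoint, growCluster, Function.update_self]
      have h4 : (s, (c s).2 + 1) ∉ clusterSet c := fun h => by
        have := mem_clusterSet.1 h
        dsimp only at this
        omega
      rw [clusterTopTerm, firstTerm_eq_zero, coeff_zero]
      rw [h3, clusterSet_growCluster, Finset.erase_insert h4, clusterCol_growCluster, h]
    simp [h1, h2, clusterTerm, h]
  · have hterm : clusterTerm P' w c = (weightOn (clusterCol c) (clusterPoint I m) (clusterSet c) *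
        fVal (clusterCol c) (clusterPoint I m) w (clusterSet c) *
        constantTerm (wordDegree w) l.vertex l.exponent P y).coeff 0 := by
      rw [clusterTerm, hy.evalOn_eq hP1' hP2', hP' _ _ hy.1, mul_comm]
    have h1 := fun p : Fin (m + 1) => coeff_zero_move hP3 c hy p
      (weightOn (clusterCol c) (clusterPoint I m) (clusterSet c) *
        fVal (clusterCol c) (clusterPoint I m) w (clusterSet c))
    have h2 : ∑ s : Fin m with (c s).1 = l.vertex, clusterTopTerm P l w (growCluster c s) s =
        ∑ s : Fin m with (c s).1 = l.vertex,
          (weightOn (clusterCol c) (clusterPoint I m) (clusterSet c) *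
            fVal (clusterCol c) (clusterPoint I m) w (clusterSet c) *
            insertVal (wordDegree w) l.vertex l.exponent P y
              (clusterPoint I m (s, (c s).2 + 1))).coeff 0 :=
      Finset.sum_congr rfl fun s hs =>
        clusterTopTerm_growCluster hP1 hP2 c hy (Finset.mem_filter.1 hs).2
    have h3 : ∀ p, clusterTopTerm P l w (addCluster p l.vertex c) p +
        ∑ s : Fin m with (c s).1 = l.vertex, clusterTopTerm P l w (growCluster c s) s =
        clusterTerm P' w c := by
      intro p
      rw [hterm, h2, clusterTopTerm_addCluster hP1 hP2 c hy p]
      exact h1 p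
    have h4 := Finset.sum_congr rfl fun (p : Fin (m + 1)) (_ : p ∈ Finset.univ) => h3 p
    rw [Finset.sum_add_distrib, Finset.sum_const, Finset.sum_const, Finset.card_univ,
      Fintype.card_fin, nsmul_eq_mul, nsmul_eq_mul] at h4
    exact h4

/-- The cluster carrying the first letter at its top is either a single point, to be deleted, or
longer, to be shortened. Both cases reassemble to the move for w, the factor 1/m! accounting for the
m + 1 places of a new cluster. -/
lemma clusterSum_cons {P P' : LaurentPoly I} {l : Letter I} {w : Word I}
    (hP1 : InVariables (wordDegree w + Pi.single l.vertex 1) P)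
    (hP2 : IsSymmetric (wordDegree w + Pi.single l.vertex 1) P)
    (hP3 : WheelConditions (wordDegree w + Pi.single l.vertex 1) P)
    (hP1' : InVariables (wordDegree w) P') (hP2' : IsSymmetric (wordDegree w) P')
    (hP' : ∀ (K : Type (max u v)) [Field K] [Algebra (GroundField I) K] (x : Var I → K),
      (∀ p, x p ≠ 0) → evalAt x P' = constantTerm (wordDegree w) l.vertex l.exponent P x) :
    clusterSum P (l :: w) = clusterSum P' w := by
  set N := w.length with hN
  let T : ∀ m, (Fin m → I × ℕ) → Fin m → Coef I := fun m c s => clusterTopTerm P l w c s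
  have h1 : clusterSum P (l :: w) = ∑ m ∈ Finset.range (N + 1 + 1), ((m.factorial : ℕ) : Coef I)⁻¹ *
      (∑ c ∈ configs I (N + 1) m, ∑ s : Fin m with (c s).1 = l.vertex ∧ (c s).2 = 0, T m c s +
        ∑ c ∈ configs I N m, ∑ s : Fin m with (c s).1 = l.vertex, T m (growCluster c s) s) := by
    rw [clusterSum, List.length_cons]
    refine Finset.sum_congr rfl fun m _ => ?_
    rw [← sum_configs_grow T, ← Finset.sum_add_distrib]
    congr 1
    refine Finset.sum_congr rfl fun c _ => ?_
    rw [clusterTerm_cons, ← Finset.filter_filter, ← Finset.filter_filter,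
      Finset.sum_filter_add_sum_filter_not]
  rw [h1]
  simp only [mul_add]
  -- Deletion takes m + 1 clusters to m and shortening keeps m. After the shift of index the first
  -- sum loses m = 0, where nothing can be marked, and the second m = N + 1, where there are more
  -- clusters than points.
  rw [Finset.sum_add_distrib, Finset.sum_range_succ' _ (N + 1), Finset.sum_range_succ _ (N + 1),
    configs_eq_empty (Nat.lt_succ_self N), Finset.sum_empty, mul_zero, add_zero]
  have h2 : ∑ c ∈ configs I (N + 1) 0, ∑ s : Fin 0 with (c s).1 = l.vertex ∧ (c s).2 = 0, T 0 c s =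
      0 := Finset.sum_eq_zero fun c _ => by simp
  rw [h2, mul_zero, add_zero, ← Finset.sum_add_distrib, clusterSum]
  refine Finset.sum_congr rfl fun m _ => ?_
  have hm : ((m + 1 : ℕ) : Coef I) ≠ 0 := Nat.cast_ne_zero.2 (Nat.succ_ne_zero m)
  have hm' : ((m.factorial : ℕ) : Coef I) ≠ 0 := Nat.cast_ne_zero.2 (Nat.factorial_ne_zero m)
  have h3 : ∑ c ∈ configs I N m, clusterTerm P' w c = ((m + 1 : ℕ) : Coef I)⁻¹ *
      (∑ c ∈ configs I (N + 1) (m + 1), ∑ s : Fin (m + 1) with (c s).1 = l.vertex ∧ (c s).2 = 0,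
        T (m + 1) c s) +
      ∑ c ∈ configs I N m, ∑ s : Fin m with (c s).1 = l.vertex, T m (growCluster c s) s := by
    rw [sum_configs_add T, eq_comm, ← mul_right_inj' hm, mul_add, mul_inv_cancel_left₀ hm,
      Finset.mul_sum, Finset.mul_sum, ← Finset.sum_add_distrib]
    exact Finset.sum_congr rfl fun c _ => sum_clusterTopTerm hP1 hP2 hP3 hP1' hP2' hP' c
  rw [h3, Nat.factorial_succ, Nat.cast_mul, mul_inv]
  ring

end ClusterSum

/-! ### The relations between the opposite words are in the kernel of the pairing -/

open HahnSeries

section Relations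

variable {I : Type u} [Fintype I] [LinearOrder I] [Quiver.{v} I] [∀ i j : I, Fintype (i ⟶ j)]

lemma sum_wordDegree (w : Word I) : ∑ i, wordDegree w i = w.length := by
  induction w with
  | nil => simp [wordDegree_nil]
  | cons l w ih =>
    rw [wordDegree_cons, List.length_cons, ← ih]
    simp [Finset.sum_add_distrib]

lemma Plug.fVal_eq {ι : Type*} [DecidableEq ι] {A : Type*} [Field A] [Algebra (GroundField I) A]
    {n : I → ℕ} {col : ι → I} {x : ι → A} {s : Finset ι} {y : Var I → A} (hy : Plug n col x s y)
    (w : Word I) : fVal col x w s = fVal Prod.fst y w (varSet n) := by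
  obtain ⟨-, θ, hθ, hθ'⟩ := hy
  have h1 : s.attach = (varSet n).attach.map θ.toEmbedding := by
    ext a
    simp only [Finset.mem_attach, Finset.mem_map, true_and, true_iff]
    exact ⟨θ.symm a, θ.apply_symm_apply a⟩
  rw [← Finset.attach_map_val (s := s), h1, fVal, symRec_map, symRec_map]
  conv_rhs => rw [← Finset.attach_map_val (s := varSet n), fVal, symRec_map]
  simp only [Function.Embedding.subtype_apply, Equiv.coe_toEmbedding, hθ' _]
  have h2 : ∀ p : {p // p ∈ varSet n}, col (θ p) = (p : Var I).1 := hθ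
  simp only [h2]

lemma Plug.isGenericPoint {ι : Type*} {A : Type*} [Field A] [Algebra (GroundField I) A]
    {n : I → ℕ} {col : ι → I} {x : ι → A} {s : Finset ι} {y : Var I → A} (hy : Plug n col x s y)
    (hx : Function.Injective x) : IsGenericPoint Prod.fst y (varSet n) := by
  obtain ⟨h0, θ, hθ, hθ'⟩ := hy
  refine ⟨h0, fun a ha b hb hab _ h => hab ?_⟩
  rw [hθ' ⟨a, ha⟩, hθ' ⟨b, hb⟩] at h
  exact congrArg (fun t : {p // p ∈ varSet n} => (t : Var I)) (θ.injective (Subtype.ext (hx h)))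

lemma evalOn_smul {ι : Type*} {A : Type*} [Field A] [Algebra (GroundField I) A] (n : I → ℕ)
    (a : GroundField I) (P : LaurentPoly I) (col : ι → I) (x : ι → A) (s : Finset ι) :
    evalOn n (a • P) col x s = a • evalOn n P col x s := by
  rw [evalOn, evalOn]
  split_ifs
  · rw [evalAt_smul]
  · rw [smul_zero]

lemma residuePairing_smul (a : GroundField I) (P : LaurentPoly I) (w : Word I) :
    residuePairing (a • P) w = a * residuePairing P w := by
  rw [residuePairing_eq, residuePairing_eq, evalAt_smul, mul_smul_comm, coeff_smul, smul_eq_mul]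

lemma residuePairing_add (P P' : LaurentPoly I) (w : Word I) :
    residuePairing (P + P') w = residuePairing P w + residuePairing P' w := by
  rw [residuePairing_eq, residuePairing_eq, residuePairing_eq, evalAt_add, mul_add, coeff_add]

lemma evalAt_of_inVariables_zero {A : Type*} [Field A] [Algebra (GroundField I) A]
    {P : LaurentPoly I} (hP : InVariables 0 P) (x : Var I → A) :
    evalAt x P = algebraMap (GroundField I) A (P.coeff 0) := by
  have h : P = .single 0 (P.coeff 0) := by
    refine AddMonoidAlgebra.ext (Finsupp.ext fun m => ?_)
    by_cases hm : m = 0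
    · subst hm
      simp
    · rw [AddMonoidAlgebra.coeff_single, Finsupp.single_eq_of_ne hm]
      by_contra h
      refine hm (Finsupp.ext fun p => ?_)
      by_contra hp
      exact absurd (hP m h p hp) (Nat.not_lt_zero _)
  rw [h, evalAt_single]
  simp [Algebra.algebraMap_eq_smul_one]

/-- Both sides obey the same recursion: removing the first letter replaces P by its constant term.
Since the parameters are expanded in T, the right-hand side is only the T^0 coefficient of the
residue. -/
lemma clusterSum_eq (w : Word I) {P : LaurentPoly I} (hP1 : InVariables (wordDegree w) P)
    (hP2 : IsSymmetric (wordDegree w) P) (hP3 : WheelConditions (wordDegree w) P) :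
    clusterSum P w = (algebraMap (GroundField I) (ClusterField I 0) (residuePairing P w)).coeff 0 := by
  induction w generalizing P with
  | nil =>
    rw [wordDegree_nil] at hP1 hP2 hP3
    have h1 : residuePairing P ([] : Word I) = P.coeff 0 := by
      rw [residuePairing, evalAt_of_inVariables_zero hP1]
      simp [HahnSeries.algebraMap_apply]
    have h2 : configs I 0 0 = {default} := by
      ext c
      rw [mem_configs, Finset.mem_singleton]
      simp [Subsingleton.elim c default]
    have h3 : clusterSet (default : Fin 0 → I × ℕ) = ∅ := by
      ext a
      exact a.1.elim0
    rw [h1, clusterSum]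
    simp only [List.length_nil, zero_add, Finset.range_one, Finset.sum_singleton, h2, clusterTerm, h3,
      wordDegree_nil]
    obtain ⟨y, hy⟩ := exists_plug (n := 0) (col := clusterCol (default : Fin 0 → I × ℕ))
      (x := clusterPoint I 0) (s := ∅) (by simp) (by simp)
    rw [hy.evalOn_eq hP1 hP2, evalAt_of_inVariables_zero hP1, weightOn, fVal, symRec]
    simp
  | cons l w ih =>
    have h := wordDegree_cons l w
    rw [h] at hP1 hP2 hP3
    obtain ⟨P', ⟨h1, h2, h3⟩, h4⟩ := exists_laurent_constantTerm (wordDegree w) l.vertex l.exponent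
      hP1 hP2 hP3
    rw [clusterSum_cons hP1 hP2 hP3 h1 h2 h4, ih h1 h2 h3, residuePairing_cons l w
      (by rwa [h]) (by rwa [h]) (h4 _ _ (plugIn_ne_zero w))]

/-- The f_w are Laurent polynomials, so a relation at the generic point holds at every point off the
diagonals, in particular at cluster points, where some ζ vanish. -/
lemma sum_smul_fVal_eq_zero {n : I → ℕ} {T : Finset (Word I)} {a : Word I → GroundField I}
    (h : ∑ w ∈ T, a w • fVal Prod.fst (zVar : Var I → RatFun I) w (varSet n) = 0)
    {K : Type (max u v)} [Field K] [Algebra (GroundField I) K] {y : Var I → K}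
    (hy : IsGenericPoint Prod.fst y (varSet n)) :
    ∑ w ∈ T, a w • fVal Prod.fst y w (varSet n) = 0 := by
  choose P hP using fun w : Word I => exists_laurent_fVal w n
  have h1 : ∑ w ∈ T, a w • P w = 0 := by
    refine evalAt_zVar_injective ?_
    rw [evalAt_sum, evalAt_zero, ← h]
    refine Finset.sum_congr rfl fun w _ => ?_
    rw [evalAt_smul, hP w _ _ (isGenericPoint_zVar _)]
  have h2 := congrArg (evalAt y) h1
  rw [evalAt_sum, evalAt_zero] at h2
  rw [← h2]
  refine Finset.sum_congr rfl fun w _ => ?_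
  rw [evalAt_smul, hP w _ _ hy]

lemma inVariables_smul {n : I → ℕ} {P : LaurentPoly I} (c : GroundField I) (h1 : InVariables n P) :
    InVariables n (c • P) := by
  intro m hm
  refine h1 m fun h' => hm ?_
  rw [AddMonoidAlgebra.coeff_smul, Finsupp.smul_apply, h', smul_zero]

lemma isSymmetric_smul {n : I → ℕ} {P : LaurentPoly I} (c : GroundField I) (h : IsSymmetric n P) :
    IsSymmetric n (c • P) := by
  intro σ
  rw [evalAt_smul, evalAt_smul, h σ]

lemma wheelConditions_smul {n : I → ℕ} {P : LaurentPoly I} (c : GroundField I)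
    (h : WheelConditions n P) : WheelConditions n (c • P) := by
  intro i j e
  refine ⟨?_, ?_⟩
  · intro a b d ha hb hd had hij
    rw [evalAt_smul, (h i j e).1 a b d ha hb hd had hij, smul_zero]
  · intro a b d ha hb hd had hij
    rw [evalAt_smul, (h i j e).2 a b d ha hb hd had hij, smul_zero]

/-- The linear relations between the `f_w` are satisfied by the iterated residues. -/
lemma sum_residuePairing_eq_zero {n : I → ℕ} {P : LaurentPoly I} (hP1 : InVariables n P)
    (hP2 : IsSymmetric n P) (hP3 : WheelConditions n P) {T : Finset (Word I)}
    {a : Word I → GroundField I} (hT : ∀ w ∈ T, wordDegree w = n)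
    (h : ∑ w ∈ T, a w • fVal Prod.fst (zVar : Var I → RatFun I) w (varSet n) = 0) :
    ∑ w ∈ T, a w * residuePairing P w = 0 := by
  by_contra hX
  set X := ∑ w ∈ T, a w * residuePairing P w with hXdef
  have hlen : ∀ w ∈ T, w.length = ∑ i, n i := fun w hw => by rw [← sum_wordDegree, hT w hw]
  -- A T^0 coefficient does not determine X, and extracting it is not 𝔽-linear. Scaling by X⁻¹ makes
  -- the total equal to 1, and the scalars are put into P, where they are expanded as well.
  have h1 : ∑ w ∈ T, clusterSum (a w • X⁻¹ • P) w = 1 := by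
    have h2 : ∀ w ∈ T, clusterSum (a w • X⁻¹ • P) w =
        (algebraMap (GroundField I) (ClusterField I 0) (X⁻¹ * (a w * residuePairing P w))).coeff 0 := by
      intro w hw
      rw [clusterSum_eq w, residuePairing_smul, residuePairing_smul, mul_left_comm]
      all_goals rw [hT w hw, smul_smul]
      · exact inVariables_smul _ hP1
      · exact isSymmetric_smul _ hP2
      · exact wheelConditions_smul _ hP3
    rw [Finset.sum_congr rfl h2, ← coeff_sum, ← map_sum, ← Finset.mul_sum, ← hXdef,
      inv_mul_cancel₀ hX, map_one, coeff_one, if_pos rfl]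
  refine zero_ne_one (α := Coef I) ?_
  rw [← h1]
  symm
  have h3 : ∀ w ∈ T, clusterSum (a w • X⁻¹ • P) w = ∑ m ∈ Finset.range (∑ i, n i + 1),
      ∑ c ∈ configs I (∑ i, n i) m, ((m.factorial : ℕ) : Coef I)⁻¹ *
        clusterTerm (a w • X⁻¹ • P) w c := by
    intro w hw
    rw [clusterSum, hlen w hw]
    simp only [Finset.mul_sum]
  rw [Finset.sum_congr rfl h3, Finset.sum_comm]
  refine Finset.sum_eq_zero fun m _ => ?_
  rw [Finset.sum_comm]
  refine Finset.sum_eq_zero fun c _ => ?_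
  rw [← Finset.mul_sum]
  refine mul_eq_zero_of_right _ ?_
  have h4 : ∀ w ∈ T, clusterTerm (a w • X⁻¹ • P) w c =
      ((evalOn n (X⁻¹ • P) (clusterCol c) (clusterPoint I m) (clusterSet c) *
        weightOn (clusterCol c) (clusterPoint I m) (clusterSet c)) *
        (a w • fVal (clusterCol c) (clusterPoint I m) w (clusterSet c))).coeff 0 := by
    intro w hw
    rw [clusterTerm, hT w hw, evalOn_smul _ (a w), smul_mul_assoc, mul_smul_comm, mul_assoc]
  rw [Finset.sum_congr rfl h4, ← coeff_sum, ← Finset.mul_sum]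
  -- For a fixed configuration everything except f_w is independent of w, so the given relation
  -- appears as a factor.
  rw [show ∑ w ∈ T, a w • fVal (clusterCol c) (clusterPoint I m) w (clusterSet c) = 0 from ?_,
    mul_zero, coeff_zero]
  by_cases hp : ∃ y, Plug n (clusterCol c) (clusterPoint I m) (clusterSet c) y
  · obtain ⟨y, hy⟩ := hp
    simp only [hy.fVal_eq]
    exact sum_smul_fVal_eq_zero h (hy.isGenericPoint (clusterPoint_injective m))
  · refine Finset.sum_eq_zero fun w hw => ?_
    obtain h5 | h5 := fVal_eq_zero_or_plug w (col := clusterCol c) (x := clusterPoint I m)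
      (s := clusterSet c) (fun a _ => clusterPoint_ne_zero a)
    · rw [h5, smul_zero]
    · rw [hT w hw] at h5
      exact absurd h5 hp

end Relations

/-! ### Linear algebra of a pairing between two triangular families of vectors -/

section LinearAlgebra

open Submodule

variable {F V W J : Type*} [Field F] [AddCommGroup V] [Module F V]

/-- A linear functional that kills the relations between the `f w` factors through their span. -/
lemma exists_bilinear_of_relations (f : W → V) (lam : W → V →ₗ[F] F) (S : Submodule F V)
    (h : ∀ R ∈ S, ∀ a : W →₀ F, Finsupp.linearCombination F f a = 0 →
      Finsupp.linearCombination F (fun w => lam w R) a = 0) :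
    ∃ B : V →ₗ[F] V →ₗ[F] F, ∀ R ∈ S, ∀ w, B R (f w) = lam w R := by
  let L : (W →₀ F) →ₗ[F] (S →ₗ[F] F) :=
    Finsupp.linearCombination F fun w => (lam w).domRestrict S
  let G : (W →₀ F) →ₗ[F] V := Finsupp.linearCombination F f
  have hL : ∀ a (R : S), L a R = Finsupp.linearCombination F (fun w => lam w R) a := by
    intro a R
    rw [Finsupp.linearCombination_apply, Finsupp.linearCombination_apply, Finsupp.sum,
      LinearMap.sum_apply]
    rfl
  have hker : G.ker ≤ L.ker := by
    intro a ha
    refine LinearMap.mem_ker.2 (LinearMap.ext fun R => ?_)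
    rw [hL, h R R.2 a (LinearMap.mem_ker.1 ha), LinearMap.zero_apply]
  obtain ⟨g, hg⟩ := LinearMap.exists_extend
    ((G.ker.liftQ L hker).comp G.quotKerEquivRange.symm.toLinearMap)
  have hgf : ∀ w, g (f w) = (lam w).domRestrict S := by
    intro w
    have h1 : G (Finsupp.single w 1) = f w := by
      rw [Finsupp.linearCombination_single, one_smul]
    have h2 := LinearMap.congr_fun hg (⟨G (Finsupp.single w 1), LinearMap.mem_range_self _ _⟩)
    rw [← h1]
    refine h2.trans ?_
    rw [LinearMap.comp_apply, LinearEquiv.coe_coe, LinearMap.quotKerEquivRange_symm_apply_image,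
      mkQ_apply, liftQ_apply, Finsupp.linearCombination_single, one_smul]
  obtain ⟨B, hB⟩ := LinearMap.exists_extend g.flip
  refine ⟨B, fun R hR w => ?_⟩
  have h1 := LinearMap.congr_fun (LinearMap.congr_fun hB ⟨R, hR⟩) (f w)
  rw [LinearMap.comp_apply, subtype_apply, LinearMap.flip_apply, hgf] at h1
  exact h1

/-- Vectors that are not combinations of the larger ones are linearly independent. -/
lemma linearIndepOn_of_notMem_span [LinearOrder W] (g : W → V) :
    LinearIndepOn F g {v | g v ∉ span F (g '' {w | w > v})} := by
  rw [linearIndepOn_iff]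
  intro a ha h0
  by_contra hne
  have hs : a.support.Nonempty := Finsupp.support_nonempty_iff.2 hne
  have hm := a.support.min'_mem hs
  set v := a.support.min' hs with hv
  refine (Finsupp.mem_supported _ _).1 ha hm ?_
  rw [Finsupp.linearCombination_apply, Finsupp.sum, ← Finset.add_sum_erase _ _ hm] at h0
  have h1 : a v • g v ∈ span F (g '' {w | w > v}) := by
    rw [eq_neg_of_add_eq_zero_left h0]
    refine neg_mem (sum_mem fun w hw => smul_mem _ _ (subset_span ⟨w, ?_, rfl⟩))
    obtain ⟨hne, hw⟩ := Finset.mem_erase.1 hw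
    exact lt_of_le_of_ne (a.support.min'_le w hw) (Ne.symm hne)
  exact (smul_mem_iff _ (Finsupp.mem_support_iff.1 hm)).1 h1

/-- The dual basis for a pairing whose matrix is block diagonal with finite blocks. -/
lemma exists_dual_basis {U ι : Type*} [DecidableEq ι] [AddCommGroup U] [Module F U] (B : U →ₗ[F] V →ₗ[F] F)
    (x : Module.Basis ι F U) (y : Module.Basis ι F V) (κ : ι → J)
    (hκ : ∀ h, {u | κ u = h}.Finite) (horth : ∀ u w, B (x u) (y w) ≠ 0 → κ u = κ w)
    (hnd : ∀ R, (∀ w, B R (y w) = 0) → R = 0) :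
    ∃! b : Module.Basis ι F U, ∀ u w, B (b u) (y w) = if u = w then 1 else 0 := by
  have hblock : ∀ v : ι, ∃ R : U, ∀ w, B R (y w) = if v = w then 1 else 0 := by
    intro v
    have : Finite {u // κ u = κ v} := (hκ (κ v)).to_subtype
    have := Fintype.ofFinite {u // κ u = κ v}
    let T : ({u // κ u = κ v} → F) →ₗ[F] ({u // κ u = κ v} → F) :=
      LinearMap.pi fun w => ((B.flip (y w)).comp
        (Fintype.linearCombination F fun u : {u // κ u = κ v} => x u))
    have hT : ∀ a w, T a w = B (∑ u, a u • x u) (y w) := fun a w => by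
      rw [LinearMap.pi_apply, LinearMap.comp_apply, Fintype.linearCombination_apply,
        LinearMap.flip_apply]
    have hout : ∀ (a : {u // κ u = κ v} → F) w, κ w ≠ κ v → B (∑ u, a u • x u) (y w) = 0 := by
      intro a w hw
      rw [map_sum, LinearMap.sum_apply]
      refine Finset.sum_eq_zero fun u _ => ?_
      rw [map_smul, LinearMap.smul_apply]
      by_contra h
      exact hw ((horth u w fun h' => h (by rw [h', smul_zero])).symm.trans u.2)
    -- A vector of the block killed by the y w of its own block is killed by all of them, by
    -- orthogonality, and hence zero; injectivity of the finite square block gives the dual vectors.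
    have hinj : Function.Injective T := by
      rw [injective_iff_map_eq_zero]
      intro a ha
      have h0 : ∑ u, a u • x u = 0 := by
        refine hnd _ fun w => ?_
        by_cases hw : κ w = κ v
        · rw [← hT a ⟨w, hw⟩, ha, Pi.zero_apply]
        · exact hout a w hw
      have hli := x.linearIndependent.comp (Subtype.val : {u // κ u = κ v} → ι)
        Subtype.val_injective
      exact funext (Fintype.linearIndependent_iff.1 hli a h0)
    obtain ⟨a, ha⟩ := LinearMap.injective_iff_surjective.1 hinj
      (fun w => if v = w then 1 else 0)
    refine ⟨∑ u, a u • x u, fun w => ?_⟩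
    by_cases hw : κ w = κ v
    · rw [← hT a ⟨w, hw⟩, ha]
    · rw [hout a w hw, if_neg]
      rintro rfl
      exact hw rfl
  choose b hb using hblock
  have hcomb : ∀ (a : ι →₀ F) w, B (Finsupp.linearCombination F b a) (y w) = a w := by
    intro a w
    rw [Finsupp.linearCombination_apply, Finsupp.sum, map_sum, LinearMap.sum_apply]
    simp only [map_smul, LinearMap.smul_apply, hb, smul_eq_mul, mul_ite, mul_one, mul_zero,
      Finset.sum_ite_eq', Finsupp.mem_support_iff]
    split_ifs with h
    · rfl
    · exact (Finsupp.notMem_support_iff.1 h).symm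
  -- Only the finitely many finite blocks that meet the coordinates of R can pair with it.
  have hfin : ∀ R, {w | B R (y w) ≠ 0}.Finite := by
    intro R
    refine ((x.repr R).support.finite_toSet.biUnion fun u _ => hκ (κ u)).subset fun w hw => ?_
    rw [Set.mem_ofPred_eq, ← x.linearCombination_repr R, Finsupp.linearCombination_apply,
      Finsupp.sum, map_sum, LinearMap.sum_apply] at hw
    obtain ⟨u, hu, h⟩ := Finset.exists_ne_zero_of_sum_ne_zero hw
    rw [map_smul, LinearMap.smul_apply] at h
    exact Set.mem_biUnion hu (horth u w fun h' => h (by rw [h', smul_zero])).symm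
  have hspan : ∀ R, R = Finsupp.linearCombination F b
      (Finsupp.ofSupportFinite (fun w => B R (y w)) (hfin R)) := by
    intro R
    refine sub_eq_zero.1 (hnd _ fun w => ?_)
    rw [map_sub, LinearMap.sub_apply, hcomb]
    exact sub_self _
  have hli : LinearIndependent F b := by
    rw [linearIndependent_iff]
    intro a ha
    ext w
    rw [← hcomb a w, ha, map_zero, LinearMap.zero_apply, Finsupp.zero_apply]
  refine ⟨Module.Basis.mk hli fun R _ => ?_, fun u w => ?_, fun b' hb' => ?_⟩
  · rw [hspan R]
    exact Finsupp.mem_span_range_iff_exists_finsupp.2 ⟨_, rfl⟩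
  · rw [Module.Basis.mk_apply, hb]
  · refine Module.Basis.eq_of_apply_eq fun u => sub_eq_zero.1 (hnd _ fun w => ?_)
    rw [map_sub, LinearMap.sub_apply, hb', Module.Basis.mk_apply, hb, sub_self]

/-- The properties of the pairing between the families `e` and `f` that determine the structure of
the space `S`. -/
structure IsTriangularPairing [LinearOrder W] {φ : F →+* F} [RingHomInvPair φ φ] (Φ : V ≃ₛₗ[φ] V)
    (S : Submodule F V) (e f : W → V) (N : Set W) (κ : W → J) (B : V →ₗ[F] V →ₗ[F] F) :
    Prop where
  dual : ∀ w, Φ (e w) = f w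
  dual_mem : ∀ R, Φ R ∈ S ↔ R ∈ S
  mem : ∀ w, e w ∈ S
  straighten : ∀ w ∉ N, f w ∈ span F (f '' {u | u > w})
  exists_max : ∀ R ∈ S, ∀ Z ⊆ {w | B R (f w) ≠ 0}, Z.Nonempty → ∃ w ∈ Z, ∀ u ∈ Z, u ≤ w
  nondeg : ∀ R ∈ S, (∀ w, B R (f w) = 0) → R = 0
  finite_support : ∀ R ∈ S, {w | w ∈ N ∧ B R (f w) ≠ 0}.Finite
  orth : ∀ v ∈ N, ∀ w ∈ N, B (e v) (f w) ≠ 0 → κ v = κ w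
  finite : ∀ h, {w | w ∈ N ∧ κ w = h}.Finite

namespace IsTriangularPairing

variable [LinearOrder W] {φ : F →+* F} [RingHomInvPair φ φ] {Φ : V ≃ₛₗ[φ] V}
    {S : Submodule F V} {e f : W → V} {N : Set W} {κ : W → J} {B : V →ₗ[F] V →ₗ[F] F}

/-- The span of the vectors `g w` for `w ∈ N` in a block. -/
def piece (g : W → V) (N : Set W) (κ : W → J) (h : J) : Submodule F V :=
  span F (g '' {w | w ∈ N ∧ κ w = h})

/-- The standard indices. -/
def standard (F : Type*) [Field F] [Module F V] (g : W → V) : Set W :=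
  {v | g v ∉ span F (g '' {w | w > v})}

variable (H : IsTriangularPairing Φ S e f N κ B)
include H

lemma map_span (U : Set W) : (span F (e '' U)).map (Φ : V →ₛₗ[φ] V) = span F (f '' U) := by
  rw [LinearMap.map_span, Set.image_image]
  congr 1
  exact Set.image_congr fun w _ => H.dual w

lemma mem_span_iff (w : W) (U : Set W) : e w ∈ span F (e '' U) ↔ f w ∈ span F (f '' U) := by
  rw [← H.map_span, ← H.dual]
  exact ((mem_map_equiv _).trans (by rw [LinearEquiv.symm_apply_apply])).symm

lemma standard_eq : standard F e = standard F f :=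
  Set.ext fun w => not_congr (H.mem_span_iff w _)

lemma standard_subset : standard F f ⊆ N := by
  intro w hw
  by_contra h
  exact hw (H.straighten w h)

lemma piece_le (h : J) : piece e N κ h ≤ S := by
  rw [piece, span_le]
  rintro _ ⟨w, -, rfl⟩
  exact H.mem w

lemma apply_eq_zero_of_mem_span {R X : V} {U : Set W} (hX : X ∈ span F (f '' U))
    (hU : ∀ u ∈ U, B R (f u) = 0) : B R X = 0 := by
  have : span F (f '' U) ≤ LinearMap.ker (B R) := by
    rw [span_le]
    rintro _ ⟨w, hw, rfl⟩
    exact hU w hw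
  exact this hX

lemma apply_eq_zero_of_mem_span_left {R X : V} {U : Set W} (hR : R ∈ span F (e '' U))
    (hU : ∀ u ∈ U, B (e u) X = 0) : B R X = 0 := by
  have : span F (e '' U) ≤ LinearMap.ker (B.flip X) := by
    rw [span_le]
    rintro _ ⟨w, hw, rfl⟩
    exact hU w hw
  exact this hR

/-- The values on the large indices are determined by those on the large indices in `N`. -/
lemma apply_eq_zero_of_gt {R : V} (hR : R ∈ S) {U : Set W} (hU : ∀ u ∈ U, ∀ v, u < v → v ∈ U)
    (h : ∀ u ∈ U, u ∈ N → B R (f u) = 0) : ∀ u ∈ U, B R (f u) = 0 := by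
  by_contra! hne
  obtain ⟨u, hu, hne⟩ := hne
  obtain ⟨w, ⟨hwU, hw⟩, hmax⟩ := H.exists_max R hR {w | w ∈ U ∧ B R (f w) ≠ 0} (fun w hw => hw.2)
    ⟨u, hu, hne⟩
  by_cases hwN : w ∈ N
  · exact hw (h w hwU hwN)
  · refine hw (H.apply_eq_zero_of_mem_span (H.straighten w hwN) fun v hv => ?_)
    by_contra hv'
    exact absurd (hmax v ⟨hU w hwU v hv, hv'⟩) (not_le.2 hv)

lemma eq_zero {R : V} (hR : R ∈ S) (h : ∀ w ∈ N, B R (f w) = 0) : R = 0 :=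
  H.nondeg R hR fun w => H.apply_eq_zero_of_gt hR (U := Set.univ) (fun _ _ _ _ => trivial)
    (fun u _ hu => h u hu) w trivial

lemma apply_eq_zero {h h' : J} (hne : h ≠ h') {R X : V} (hR : R ∈ piece e N κ h (F := F))
    (hX : X ∈ piece f N κ h' (F := F)) : B R X = 0 :=
  H.apply_eq_zero_of_mem_span hX fun w hw => H.apply_eq_zero_of_mem_span_left hR fun v hv => by
    by_contra hne'
    exact hne (by rw [← hv.2, ← hw.2, H.orth v hv.1 w hw.1 hne'])

lemma eq_zero_of_mem_piece {h : J} {R : V} (hR : R ∈ piece e N κ h (F := F))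
    (h0 : ∀ X ∈ piece f N κ h (F := F), B R X = 0) : R = 0 := by
  refine H.eq_zero (H.piece_le h hR) fun w hw => ?_
  by_cases hw' : h = κ w
  · exact h0 _ (subset_span ⟨w, ⟨hw, hw'.symm⟩, rfl⟩)
  · exact H.apply_eq_zero hw' hR (subset_span ⟨w, ⟨hw, rfl⟩, rfl⟩)

lemma finiteDimensional_piece (g : W → V) (h : J) : FiniteDimensional F (piece g N κ h (F := F)) :=
  FiniteDimensional.span_of_finite F ((H.finite h).image g)

lemma map_piece (h : J) :
    (piece e N κ h).map (Φ : V →ₛₗ[φ] V) = piece f N κ h (F := F) := H.map_span _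

/-- Φ is linear up to the automorphism φ of the field, and such a bijection preserves dimensions. -/
lemma finrank_piece (h : J) : Module.finrank F (piece e N κ h (F := F)) =
    Module.finrank F (piece f N κ h (F := F)) := by
  have hmem : ∀ R, Φ R ∈ piece f N κ h (F := F) ↔ R ∈ piece e N κ h (F := F) := by
    intro R
    rw [← H.map_piece]
    exact (mem_map_equiv _).trans (by rw [LinearEquiv.symm_apply_apply])
  let j : piece e N κ h (F := F) ≃+ piece f N κ h (F := F) :=
    { toFun := fun R => ⟨Φ R, (hmem R).2 R.2⟩
      invFun := fun X => ⟨Φ.symm X, (hmem _).1 (by rw [LinearEquiv.apply_symm_apply]; exact X.2)⟩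
      left_inv := fun R => Subtype.ext (Φ.symm_apply_apply R)
      right_inv := fun X => Subtype.ext (Φ.apply_symm_apply X)
      map_add' := fun R R' => Subtype.ext (map_add Φ _ _) }
  refine congrArg Cardinal.toNat (rank_eq_of_equiv_equiv φ j ?_ fun c R =>
    Subtype.ext (map_smulₛₗ Φ c _))
  exact Function.bijective_iff_has_inverse.2
    ⟨φ, fun x => RingHomInvPair.comp_apply_eq, fun x => RingHomInvPair.comp_apply_eq⟩

/-- The pairing of the two pieces has no left kernel and their finite dimensions agree, so it is
perfect. -/
lemma exists_represent (h : J) (g : V →ₗ[F] F) : ∃ R ∈ piece e N κ h (F := F),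
    ∀ X ∈ piece f N κ h (F := F), B R X = g X := by
  have := H.finiteDimensional_piece e h
  have := H.finiteDimensional_piece f h
  let T : piece e N κ h (F := F) →ₗ[F] Module.Dual F (piece f N κ h (F := F)) :=
    (piece f N κ h).subtype.dualMap ∘ₗ B ∘ₗ (piece e N κ h).subtype
  have hinj : Function.Injective T := by
    rw [injective_iff_map_eq_zero]
    intro R hR
    exact Subtype.ext (H.eq_zero_of_mem_piece R.2 fun X hX =>
      LinearMap.congr_fun hR (⟨X, hX⟩ : piece f N κ h (F := F)))
  have hsurj := (LinearMap.injective_iff_surjective_of_finrank_eq_finrank (f := T) (by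
    rw [Subspace.dual_finrank_eq, H.finrank_piece])).1 hinj
  obtain ⟨R, hR⟩ := hsurj (g.comp (piece f N κ h).subtype)
  exact ⟨R, R.2, fun X hX => LinearMap.congr_fun hR (⟨X, hX⟩ : piece f N κ h (F := F))⟩

/-- In each of the finitely many blocks that R meets, the functional B R is represented by an
element of the piece. After subtracting these, nothing in N pairs with the rest, which is therefore
zero. -/
lemma mem_iSup_piece {R : V} (hR : R ∈ S) :
    R ∈ ⨆ h ∈ κ '' {w | w ∈ N ∧ B R (f w) ≠ 0}, piece e N κ h (F := F) := by
  have hfin := (H.finite_support R hR).image κ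
  choose r hr hr' using fun h => H.exists_represent h (B R)
  have h0 : R - ∑ h ∈ hfin.toFinset, r h = 0 := by
    refine H.eq_zero (sub_mem hR (sum_mem fun h _ => H.piece_le h (hr h))) fun w hw => ?_
    have hfw : f w ∈ piece f N κ (κ w) (F := F) := subset_span ⟨w, ⟨hw, rfl⟩, rfl⟩
    rw [map_sub, LinearMap.sub_apply, map_sum, LinearMap.sum_apply]
    by_cases hmem : κ w ∈ hfin.toFinset
    · rw [Finset.sum_eq_single_of_mem _ hmem fun h _ hne => H.apply_eq_zero hne (hr h) hfw,
        hr' _ _ hfw, sub_self]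
    · rw [Finset.sum_eq_zero fun h hh => H.apply_eq_zero (fun heq : h = κ w => hmem (heq ▸ hh)) (hr h) hfw,
        sub_zero]
      by_contra hne
      exact hmem (hfin.mem_toFinset.2 ⟨w, ⟨hw, hne⟩, rfl⟩)
  have h1 : ∑ h ∈ hfin.toFinset, r h ∈
      ⨆ h ∈ κ '' {w | w ∈ N ∧ B R (f w) ≠ 0}, piece e N κ h (F := F) :=
    sum_mem fun h hh => mem_iSup_of_mem h (mem_iSup_of_mem (hfin.mem_toFinset.1 hh) (hr h))
  rwa [← sub_eq_zero.1 h0] at h1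

lemma iSupIndep_piece : iSupIndep fun h => piece e N κ h (F := F) := by
  rw [iSupIndep_def]
  intro h
  rw [disjoint_def]
  intro R hR hR'
  refine H.eq_zero_of_mem_piece hR fun X hX => ?_
  have : (⨆ j, ⨆ (_ : j ≠ h), piece e N κ j) ≤ LinearMap.ker (B.flip X) :=
    iSup₂_le fun j hj R hR => H.apply_eq_zero hj hR hX
  exact this hR'

/-- Every functional on the f-piece is a pairing with some R, and functionals separate points. -/
lemma eq_zero_of_mem_piece_right {h : J} {X : V} (hX : X ∈ piece f N κ h (F := F))
    (h0 : ∀ R ∈ piece e N κ h (F := F), B R X = 0) : X = 0 := by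
  rw [← Module.forall_dual_apply_eq_zero_iff F]
  intro g
  obtain ⟨R, hR, hR'⟩ := H.exists_represent h g
  rw [← hR' X hX, h0 R hR]

lemma iSupIndep_piece_right : iSupIndep fun h => piece f N κ h (F := F) := by
  rw [iSupIndep_def]
  intro h
  rw [disjoint_def]
  intro X hX hX'
  refine H.eq_zero_of_mem_piece_right hX fun R hR => ?_
  have : (⨆ j, ⨆ (_ : j ≠ h), piece f N κ j) ≤ LinearMap.ker (B R) :=
    iSup₂_le fun j hj X hX => H.apply_eq_zero hj.symm hR hX
  exact this hX'

/-- A functional separating f w from the larger vectors of its own block is represented by an R in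
the piece. This R kills the larger vectors of other blocks by orthogonality and those outside N by
straightening, so it separates f w from all larger vectors. -/
lemma mem_standard {w : W} (hw : w ∈ N)
    (h : f w ∉ span F (f '' {u | (u ∈ N ∧ κ u = κ w) ∧ u > w})) : w ∈ standard F f := by
  obtain ⟨g, hg, hg'⟩ := exists_le_ker_of_notMem h
  obtain ⟨R, hR, hR'⟩ := H.exists_represent (κ w) g
  have h1 : ∀ u ∈ {u | u > w}, B R (f u) = 0 := by
    refine H.apply_eq_zero_of_gt (H.piece_le _ hR) (fun u hu v huv => lt_trans hu huv)
      fun u hu huN => ?_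
    have hfu : f u ∈ piece f N κ (κ u) (F := F) := subset_span ⟨u, ⟨huN, rfl⟩, rfl⟩
    by_cases hκ : κ w = κ u
    · rw [hR' _ (hκ ▸ hfu)]
      exact hg' (subset_span ⟨u, ⟨⟨huN, hκ.symm⟩, hu⟩, rfl⟩)
    · exact H.apply_eq_zero hκ hR hfu
  intro hmem
  refine hg ?_
  rw [← hR' _ (subset_span ⟨w, ⟨hw, rfl⟩, rfl⟩)]
  exact H.apply_eq_zero_of_mem_span hmem h1

/-- Descending induction in the finite block: a non-standard f w is a combination of larger vectors
of the same block. -/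
lemma span_standard_right (h : J) :
    span F (f '' {w | w ∈ standard F f ∧ κ w = h}) = piece f N κ h := by
  refine le_antisymm (span_mono (Set.image_mono fun w hw => ⟨H.standard_subset hw.1, hw.2⟩)) ?_
  rw [piece, span_le]
  rintro _ ⟨w, hw, rfl⟩
  have hwf : Set.WellFoundedOn {w | w ∈ N ∧ κ w = h} (· > ·) := (H.finite h).wellFoundedOn
  refine hwf.induction (P := fun w => f w ∈ span F (f '' {w | w ∈ standard F f ∧ κ w = h})) hw
    fun w hw ih => ?_
  by_cases hs : w ∈ standard F f
  · exact subset_span ⟨w, ⟨hs, hw.2⟩, rfl⟩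
  · have h1 : f w ∈ span F (f '' {u | (u ∈ N ∧ κ u = κ w) ∧ u > w}) := by
      by_contra h
      exact hs (H.mem_standard hw.1 h)
    refine span_le.2 ?_ h1
    rintro _ ⟨u, ⟨hu, huw⟩, rfl⟩
    rw [hw.2] at hu
    exact ih u hu huw

lemma span_standard (h : J) :
    span F (e '' {w | w ∈ standard F f ∧ κ w = h}) = piece e N κ h := by
  refine map_injective_of_injective (f := (Φ : V →ₛₗ[φ] V)) Φ.injective ?_
  rw [H.map_piece, H.map_span, H.span_standard_right]

lemma span_eq : span F (e '' standard F f) = S := by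
  refine le_antisymm ?_ fun R hR => ?_
  · rw [span_le]
    rintro _ ⟨w, -, rfl⟩
    exact H.mem w
  · have hle : ∀ h ∈ κ '' {w | w ∈ N ∧ B R (f w) ≠ 0}, piece e N κ h ≤
        span F (e '' standard F f) := fun h _ => by
      rw [← H.span_standard]
      exact span_mono (Set.image_mono fun w hw => hw.1)
    exact iSup₂_le hle (H.mem_iSup_piece hR)

lemma map_eq : S.map (Φ : V →ₛₗ[φ] V) = S := by
  ext X
  rw [← Φ.apply_symm_apply X, H.dual_mem]
  exact (mem_map_equiv _).trans (by rw [LinearEquiv.symm_apply_apply])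

lemma span_eq_right : span F (f '' standard F f) = S := by
  rw [← H.map_span, H.span_eq, H.map_eq]

omit H in
lemma exists_basis {P : W → Prop} {g : W → V} (hli : LinearIndepOn F g {w | P w})
    (hspan : span F (g '' {w | P w}) = S) :
    ∃ b : Module.Basis {w // P w} F S, ∀ w, (b w : V) = g w := by
  have hrange : span F (Set.range fun w : {w // P w} => g w) = S := by
    rw [← hspan, Set.image_eq_range]
    rfl
  have hli' : LinearIndependent F fun w : {w // P w} => g w := hli
  exact ⟨(Module.Basis.span (v := fun w : {w // P w} => g w) hli').map (LinearEquiv.ofEq _ _ hrange),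
    fun w => by rw [Module.Basis.map_apply, LinearEquiv.coe_ofEq_apply, Module.Basis.span_apply]⟩

lemma exists_dual_bases {P : W → Prop} (hP : ∀ w, P w ↔ w ∈ standard F f) (hf : ∀ w, f w ∈ S) :
    (∃! b : Module.Basis {w // P w} F S,
      ∀ v w : {w // P w}, B (b v) (f w.1) = if v = w then 1 else 0) ∧
    (∃! b : Module.Basis {w // P w} F S,
      ∀ v w : {w // P w}, B (e v.1) (b w) = if v = w then 1 else 0) := by
  have hPset : {w | P w} = standard F f := Set.ext hP
  obtain ⟨x, hx⟩ := exists_basis (S := S) (P := P) (g := e)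
    (by rw [hPset, ← H.standard_eq]; exact linearIndepOn_of_notMem_span e)
    (by rw [hPset]; exact H.span_eq)
  obtain ⟨y, hy⟩ := exists_basis (S := S) (P := P) (g := f)
    (by rw [hPset]; exact linearIndepOn_of_notMem_span f)
    (by rw [hPset]; exact H.span_eq_right)
  let BS : S →ₗ[F] S →ₗ[F] F := (B.domRestrict S).flip.domRestrict S |>.flip
  have hBS : ∀ R X : S, BS R X = B R X := fun R X => rfl
  have hN : ∀ w : {w // P w}, (w : W) ∈ N := fun w => H.standard_subset ((hP _).1 w.2)
  have hfin : ∀ h, {w : {w // P w} | κ w = h}.Finite := fun h =>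
    Set.Finite.of_finite_image ((H.finite h).subset (by
      rintro _ ⟨w, hw, rfl⟩
      exact ⟨hN w, hw⟩)) Subtype.val_injective.injOn
  have horth : ∀ v w, BS (x v) (y w) ≠ 0 → κ v = κ w := fun v w h => by
    rw [hBS, hx, hy] at h
    exact H.orth v (hN v) w (hN w) h
  have hnd : ∀ R, (∀ w, BS R (y w) = 0) → R = 0 := by
    intro R hR
    refine Subtype.ext (H.eq_zero R.2 fun w hw => ?_)
    refine H.apply_eq_zero_of_mem_span (U := standard F f) ?_ fun u hu => ?_
    · rw [H.span_eq_right]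
      exact hf w
    · have := hR ⟨u, (hP u).2 hu⟩
      rwa [hBS, hy] at this
  obtain ⟨b, hb, hb'⟩ := exists_dual_basis BS x y (fun w => κ w) hfin horth hnd
  -- Non-degeneracy on the right follows from the dual basis just obtained, whose pairings are the
  -- coordinates in the basis y.
  have hnd' : ∀ X, (∀ v, BS.flip X (x v) = 0) → X = 0 := by
    intro X hX
    have h1 : BS.flip X = 0 := x.ext fun v => by rw [hX, LinearMap.zero_apply]
    have h2 : ∀ w, BS (b w) = y.coord w := fun w => y.ext fun u => by
      rw [hb, Module.Basis.coord_apply, Module.Basis.repr_self, Finsupp.single_apply]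
      exact if_congr eq_comm rfl rfl
    refine y.ext_elem fun w => ?_
    rw [← Module.Basis.coord_apply, ← h2, map_zero, Finsupp.zero_apply]
    exact LinearMap.congr_fun h1 (b w)
  obtain ⟨b₂, hb₂, hb₂'⟩ := exists_dual_basis BS.flip y x (fun w => κ w) hfin
    (fun u w h => (horth w u h).symm) hnd'
  refine ⟨⟨b, fun v w => ?_, fun b' h => hb' b' fun v w => ?_⟩,
    ⟨b₂, fun v w => ?_, fun b' h => hb₂' b' fun v w => ?_⟩⟩
  · rw [← hb v w, hBS, hy]
  · exact Eq.trans (by rw [hBS, hy]) (h v w)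
  · refine Eq.trans ?_ ((hb₂ w v).trans (if_congr eq_comm rfl rfl))
    rw [LinearMap.flip_apply, hBS, hx]
  · refine Eq.trans ?_ ((h w v).trans (if_congr eq_comm rfl rfl))
    rw [LinearMap.flip_apply, hBS, hx]

end IsTriangularPairing

end LinearAlgebra

/-! ### The connected components of the graph of exponents are finite -/

section ExponentGraph

/-- The sum of the first `k` exponents. -/
def prefixSum {n : ℕ} (d : Fin n → ℤ) (k : ℕ) : ℤ := ∑ a ∈ Finset.univ.filter (fun a : Fin n => (a : ℕ) < k), d a

/-- The inversions of σ and of σ⁻¹ correspond, with the roles of the two indices exchanged; this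
also exchanges the two sums. -/
lemma ExponentEdge.symm {m : ℤ} {n : ℕ} {d d' : Fin n →o ℤ} (h : ExponentEdge m d d') :
    ExponentEdge m d' d := by
  obtain ⟨σ, hσ, c, hc, h⟩ := h
  refine ⟨σ⁻¹, inv_ne_one.2 hσ, fun p p' => c (σ⁻¹ p') (σ⁻¹ p), fun p p' hp hp' => ?_, fun p => ?_⟩
  · exact hc _ _ hp' (by simpa using hp)
  · have h1 := h (σ⁻¹ p)
    have hp : σ (σ⁻¹ p) = p := σ.apply_symm_apply p
    rw [hp] at h1
    have h2 : ∑ s with s < σ⁻¹ p ∧ p < σ s, c s (σ⁻¹ p) =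
        ∑ t with p < t ∧ σ⁻¹ t < σ⁻¹ p, c (σ⁻¹ t) (σ⁻¹ p) := by
      refine Finset.sum_equiv σ (fun s => ?_) fun s _ => ?_
      · simp [and_comm]
      · simp
    have h3 : ∑ t with σ⁻¹ p < t ∧ σ t < p, c (σ⁻¹ p) t =
        ∑ s with s < p ∧ σ⁻¹ p < σ⁻¹ s, c (σ⁻¹ p) (σ⁻¹ s) := by
      refine Finset.sum_equiv σ (fun s => ?_) fun s _ => ?_
      · simp [and_comm]
      · simp
    rw [h2, h3] at h1
    rw [h1]
    ring

/-- The sum over a set of `r` indices `≥ k` is at least the sum over the first such indices. -/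
lemma prefixSum_sub_le {n : ℕ} {d : Fin n → ℤ} (hd : Monotone d) (k : ℕ) (A : Finset (Fin n))
    (hA : ∀ a ∈ A, k ≤ a) : prefixSum d (k + A.card) - prefixSum d k ≤ ∑ a ∈ A, d a := by
  induction A using Finset.induction_on_max with
  | empty => simp
  | insert a A hmax ih =>
    have ha : a ∉ A := fun h => lt_irrefl _ (hmax a h)
    have hk : k ≤ a := hA a (Finset.mem_insert_self _ _)
    have hcard : k + A.card ≤ a := by
      have h1 : A.map Fin.valEmbedding ⊆ Finset.Ico k a := by
        intro b hb
        obtain ⟨b, hb', rfl⟩ := Finset.mem_map.1 hb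
        exact Finset.mem_Ico.2 ⟨hA b (Finset.mem_insert_of_mem hb'), hmax b hb'⟩
      have h2 := Finset.card_le_card h1
      rw [Finset.card_map, Nat.card_Ico] at h2
      omega
    rw [Finset.sum_insert ha, Finset.card_insert_of_notMem ha, ← add_assoc]
    have h3 : prefixSum d (k + A.card + 1) = d ⟨k + A.card, hcard.trans_lt a.2⟩ +
        prefixSum d (k + A.card) := by
      rw [prefixSum, prefixSum, ← Finset.sum_insert (by simp)]
      refine Finset.sum_congr (Finset.ext fun b => ?_) fun _ _ => rfl
      simp only [Finset.mem_filter, Finset.mem_univ, true_and, Finset.mem_insert, Fin.ext_iff]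
      omega
    have h4 := hd (show (⟨k + A.card, hcard.trans_lt a.2⟩ : Fin n) ≤ a from hcard)
    have h5 := ih fun b hb => hA b (Finset.mem_insert_of_mem hb)
    rw [h3]
    linarith

/-- Each inversion enters with opposite signs at its two ends, so only those with exactly one end
among the first k indices survive. -/
lemma prefixSum_edge {n : ℕ} {d d' : Fin n → ℤ} {σ : Equiv.Perm (Fin n)}
    {c : Fin n → Fin n → ℤ}
    (h : ∀ a, d' a = d (σ a) - (∑ s with s < a ∧ σ a < σ s, c s a) +
      ∑ t with a < t ∧ σ t < σ a, c a t) (k : ℕ) :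
    prefixSum d' k = ∑ a ∈ Finset.univ.filter (fun a : Fin n => (a : ℕ) < k), d (σ a) +
      ∑ p : Fin n × Fin n with p.1.val < k ∧ k ≤ p.2.val ∧ σ p.2 < σ p.1, c p.1 p.2 := by
  have h1 : ∑ a ∈ Finset.univ.filter (fun a : Fin n => (a : ℕ) < k), ∑ s with s < a ∧ σ a < σ s, c s a =
      ∑ p : Fin n × Fin n, if (p.1 < p.2 ∧ σ p.2 < σ p.1) ∧ (p.2 : ℕ) < k then c p.1 p.2 else 0 := by
    rw [Fintype.sum_prod_type_right, Finset.sum_filter]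
    refine Finset.sum_congr rfl fun a _ => ?_
    rw [Finset.sum_filter]
    split_ifs with hak <;> simp [hak]
  have h2 : ∑ a ∈ Finset.univ.filter (fun a : Fin n => (a : ℕ) < k), ∑ t with a < t ∧ σ t < σ a, c a t =
      ∑ p : Fin n × Fin n, if (p.1 < p.2 ∧ σ p.2 < σ p.1) ∧ (p.1 : ℕ) < k then c p.1 p.2 else 0 := by
    rw [Fintype.sum_prod_type, Finset.sum_filter]
    refine Finset.sum_congr rfl fun a _ => ?_
    rw [Finset.sum_filter]
    split_ifs with hak <;> simp [hak]
  rw [prefixSum, Finset.sum_congr rfl fun a _ => h a, Finset.sum_add_distrib,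
    Finset.sum_sub_distrib, h1, h2, sub_add, ← Finset.sum_sub_distrib, Finset.sum_filter
      (s := (Finset.univ : Finset (Fin n × Fin n))), sub_eq_add_neg, ← Finset.sum_neg_distrib]
  congr 1
  refine Finset.sum_congr rfl fun p _ => ?_
  by_cases h3 : σ p.2 < σ p.1 <;> by_cases h4 : (p.1 : ℕ) < k <;> by_cases h5 : (p.2 : ℕ) < k <;>
    by_cases h6 : p.1 < p.2 <;> simp [h3, h4, h5, h6, not_le.2, not_lt.1] <;>
    simp only [Fin.lt_def] at h6 <;> omega

/-- A lower bound of the sums of the first exponents that is preserved along the edges. -/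
lemma le_prefixSum_edge {m : ℤ} (hm : 0 ≤ m) {n : ℕ} {d d' : Fin n →o ℤ} (h : ExponentEdge m d d')
    {M : ℤ} (hd : ∀ k ≤ n, m * n ^ 2 * k ^ 2 - M ≤ prefixSum d k) :
    ∀ k ≤ n, m * n ^ 2 * k ^ 2 - M ≤ prefixSum d' k := by
  obtain ⟨σ, -, c, hc, h⟩ := h
  intro k hk
  rw [prefixSum_edge h]
  set A : Finset (Fin n) := (Finset.univ.filter fun a : Fin n => (a : ℕ) < k).map σ.toEmbedding
    with hAdef
  have hA : ∑ a ∈ Finset.univ.filter (fun a : Fin n => (a : ℕ) < k), d (σ a) = ∑ a ∈ A, d a := by rw [Finset.sum_map]; rfl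
  have hcard : A.card = k := by
    rw [Finset.card_map]
    rw [Fin.card_filter_val_lt, min_eq_right hk]
  set A₁ := A.filter fun a : Fin n => (a : ℕ) < k
  set A₂ := A.filter fun a : Fin n => ¬ (a : ℕ) < k
  have h1 := prefixSum_sub_le d.monotone 0 A₁ (fun _ _ => Nat.zero_le _)
  have h2 := prefixSum_sub_le d.monotone k A₂ (fun a ha => not_lt.1 (Finset.mem_filter.1 ha).2)
  have h3 : ∑ a ∈ A₁, d a + ∑ a ∈ A₂, d a = ∑ a ∈ A, d a := Finset.sum_filter_add_sum_filter_not _ _ _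
  have h4 : A₁.card + A₂.card = k := by rw [Finset.card_filter_add_card_filter_not, hcard]
  have h5 := prefixSum_sub_le d.monotone 0 A (fun _ _ => Nat.zero_le _)
  have h0 : prefixSum d 0 = 0 := by simp [prefixSum]
  have h6 : k + A₂.card ≤ n := by
    have h := Finset.card_filter_add_card_filter_not (s := (Finset.univ : Finset (Fin n)))
      (fun a : Fin n => (a : ℕ) < k)
    rw [Fin.card_filter_val_lt, min_eq_right hk, Finset.card_univ, Fintype.card_fin] at h
    refine le_trans (Nat.add_le_add_left (Finset.card_le_card
      (Finset.filter_subset_filter _ (Finset.subset_univ _))) _) h.le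
  rw [hA]
  obtain h7 | h7 := Nat.eq_zero_or_pos A₂.card
  -- If σ preserves the first k indices then no inversion straddles k and the bound is inherited by
  -- monotonicity.
  · have hsub : A ⊆ Finset.univ.filter fun a : Fin n => (a : ℕ) < k := by
      intro a ha
      by_contra h
      refine Finset.notMem_empty a ?_
      rw [← Finset.card_eq_zero.1 h7]
      exact Finset.mem_filter.2 ⟨ha, fun h' => h (Finset.mem_filter.2 ⟨Finset.mem_univ _, h'⟩)⟩
    have hAeq := Finset.eq_of_subset_of_card_le hsub (by
      rw [hcard, Fin.card_filter_val_lt, min_eq_right hk])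
    rw [Finset.filter_false_of_mem, Finset.sum_empty, add_zero]
    · rw [hcard, zero_add, h0, sub_zero] at h5
      exact (hd k hk).trans h5
    · rintro ⟨a, t⟩ - ⟨hak, hkt, hat⟩
      have ha : σ a ∈ A := Finset.mem_map.2 ⟨a, by simpa using hak, rfl⟩
      have ht : σ t ∉ A := by
        intro ht
        obtain ⟨b, hb, hbt⟩ := Finset.mem_map.1 ht
        obtain rfl := σ.injective hbt
        exact absurd (Finset.mem_filter.1 hb).2 (not_lt.2 hkt)
      rw [hAeq, Finset.mem_filter] at ha ht
      exact ht ⟨Finset.mem_univ _, lt_trans hat ha.2⟩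
  -- Let r ≥ 1 indices leave. Monotonicity bounds twice the sum over A below by the prefix sums for
  -- k - r and k + r. As (k - r)² + (k + r)² = 2k² + 2r², this gains m n² r² ≥ m n², enough to pay
  -- for at most n² inversions of cost m.
  · have h8 : -(m * n ^ 2) ≤
        ∑ p : Fin n × Fin n with p.1.val < k ∧ k ≤ p.2.val ∧ σ p.2 < σ p.1, c p.1 p.2 := by
      refine le_trans ?_ (Finset.card_nsmul_le_sum _ _ (-m) fun p hp => ?_)
      · rw [nsmul_eq_mul, mul_neg, neg_le_neg_iff, mul_comm]
        refine mul_le_mul_of_nonneg_left ?_ hm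
        refine (Nat.cast_le.2 (Finset.card_filter_le _ _)).trans ?_
        simp [sq]
      · obtain ⟨-, h1, h2, h3⟩ := Finset.mem_filter.1 hp
        exact hc _ _ (Fin.lt_def.2 (h1.trans_le h2)) h3
    have h9 := hd _ h6
    have h10 := hd A₁.card (by omega)
    have h11 : (k : ℤ) = A₁.card + A₂.card := by exact_mod_cast h4.symm
    have h12 : (1 : ℤ) ≤ A₂.card := by exact_mod_cast h7
    rw [hcard, zero_add, h0, sub_zero] at h5
    rw [zero_add, h0, sub_zero] at h1
    have h13 : m * n ^ 2 * 1 ≤ m * n ^ 2 * (A₂.card : ℤ) ^ 2 := by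
      refine mul_le_mul_of_nonneg_left ?_ (by positivity)
      nlinarith
    push_cast at h9
    rw [h11] at h9 ⊢
    nlinarith

lemma prefixSum_total_edge {m : ℤ} {n : ℕ} {d d' : Fin n →o ℤ} (h : ExponentEdge m d d') :
    prefixSum d' n = prefixSum d n := by
  obtain ⟨σ, -, c, hc, h⟩ := h
  rw [prefixSum_edge h, Finset.filter_false_of_mem (s := (Finset.univ : Finset (Fin n × Fin n))),
    Finset.sum_empty, add_zero, prefixSum, Finset.filter_true_of_mem fun (a : Fin n) _ => a.2]
  · exact Equiv.sum_comp σ d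
  · rintro ⟨a, t⟩ - ⟨-, h, -⟩
    exact absurd t.2 (not_lt.2 h)

/-- Finitely many non-decreasing sequences have a given sum and a given lower bound. -/
lemma finite_setOf_le_of_prefixSum_eq (n : ℕ) (b s : ℤ) :
    {d : Fin n →o ℤ | (∀ a, b ≤ d a) ∧ prefixSum d n ≤ s}.Finite := by
  refine Set.Finite.of_finite_image (f := fun d : Fin n →o ℤ => (d : Fin n → ℤ))
    ((Set.Finite.pi fun _ : Fin n => Set.finite_Icc b (s - (n - 1) * b)).subset ?_)
    DFunLike.coe_injective.injOn
  rintro _ ⟨d, ⟨h1, h2⟩, rfl⟩ a -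
  refine ⟨h1 a, ?_⟩
  rw [prefixSum, Finset.filter_true_of_mem fun (a : Fin n) _ => a.2,
    ← Finset.add_sum_erase _ _ (Finset.mem_univ a)] at h2
  have h3 := Finset.card_nsmul_le_sum (Finset.univ.erase a) d b fun x _ => h1 x
  rw [Finset.card_erase_of_mem (Finset.mem_univ a), Finset.card_univ, Fintype.card_fin,
    nsmul_eq_mul, Nat.cast_sub (Nat.one_le_iff_ne_zero.2 (by rintro rfl; exact a.elim0))] at h3
  push_cast at h3
  dsimp only
  linarith

variable (I : Type u) [Fintype I] [Quiver.{v} I] [∀ i j : I, Fintype (i ⟶ j)]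

lemma exponentGraph_adj {n : ℕ} {d d' : Fin n →o ℤ} : (exponentGraph I n).Adj d d' ↔
    d ≠ d' ∧ ExponentEdge (2 * (Fintype.card (Edge I) : ℤ)) d d' := by
  rw [exponentGraph, SimpleGraph.fromRel_adj]
  exact and_congr_right fun _ => ⟨fun h => h.elim id ExponentEdge.symm, Or.inl⟩

/-- Along a component the total is constant and the quadratic bound persists, with M chosen to fit
one vertex. Its case k = 1 bounds the smallest exponent from below, and a fixed total then leaves
finitely many sequences. -/
lemma finite_supp {n : ℕ} (H : (exponentGraph I n).ConnectedComponent) : H.supp.Finite := by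
  obtain ⟨d₀, rfl⟩ := H.exists_rep
  set m : ℤ := 2 * (Fintype.card (Edge I) : ℤ) with hm
  have hm0 : 0 ≤ m := by positivity
  obtain ⟨M, hM⟩ : ∃ M : ℤ, ∀ k ∈ Finset.range (n + 1),
      m * n ^ 2 * k ^ 2 - prefixSum d₀ k ≤ M := by
    obtain ⟨M, hM⟩ := ((Finset.range (n + 1)).image fun k : ℕ =>
      m * n ^ 2 * k ^ 2 - prefixSum d₀ k).bddAbove
    exact ⟨M, fun k hk => hM (Finset.mem_coe.2 (Finset.mem_image_of_mem _ hk))⟩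
  have h1 : ∀ d, (exponentGraph I n).Reachable d₀ d →
      (∀ k ≤ n, m * n ^ 2 * k ^ 2 - M ≤ prefixSum d k) ∧ prefixSum d n = prefixSum d₀ n := by
    intro d hd
    induction (SimpleGraph.reachable_iff_reflTransGen _ _).1 hd with
    | refl =>
      refine ⟨fun k hk => ?_, rfl⟩
      have := hM k (Finset.mem_range.2 (Nat.lt_succ_of_le hk))
      linarith
    | tail h h' ih =>
      obtain ⟨-, h2⟩ := (exponentGraph_adj I).1 h'
      obtain ⟨ih1, ih2⟩ := ih ((SimpleGraph.reachable_iff_reflTransGen _ _).2 h)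
      exact ⟨le_prefixSum_edge hm0 h2 ih1, (prefixSum_total_edge h2).trans ih2⟩
  refine (finite_setOf_le_of_prefixSum_eq n (m * n ^ 2 - M) (prefixSum d₀ n)).subset fun d hd => ?_
  obtain ⟨h2, h3⟩ := h1 d (SimpleGraph.ConnectedComponent.exact hd).symm
  refine ⟨fun a => ?_, h3.le⟩
  have hn : 0 < n := Nat.pos_of_ne_zero (by rintro rfl; exact a.elim0)
  have h4 := h2 1 hn
  have h5 : prefixSum d 1 = d ⟨0, hn⟩ := by
    rw [prefixSum, Finset.sum_eq_single_of_mem (⟨0, hn⟩ : Fin n) (by simp)]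
    intro b hb hne
    exact absurd (Fin.ext (Nat.lt_one_iff.1 (Finset.mem_filter.1 hb).2)) hne
  have h6 := d.monotone (show (⟨0, hn⟩ : Fin n) ≤ a from Nat.zero_le _)
  rw [h5] at h4
  push_cast at h4
  linarith

end ExponentGraph

/-! ### Supports of the expansions of the kernels -/

open HahnSeries

section Supports

variable {R : Type*} [Field R]

lemma support_one_subset {Γ : Type*} [AddCommGroup Γ] [LinearOrder Γ] [IsOrderedAddMonoid Γ] :
    (1 : R⟦Γ⟧).support ⊆ {0} := support_single_subset

lemma support_finset_sum_subset {Γ : Type*} [AddCommGroup Γ] [LinearOrder Γ]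
    [IsOrderedAddMonoid Γ] {ι : Type*} (s : Finset ι) {X : ι → R⟦Γ⟧} {A : Set Γ}
    (h : ∀ a ∈ s, (X a).support ⊆ A) : (∑ a ∈ s, X a).support ⊆ A := by
  intro γ hγ
  rw [mem_support, coeff_sum] at hγ
  obtain ⟨a, ha, hne⟩ := Finset.exists_ne_zero_of_sum_ne_zero hγ
  exact h a ha hne

lemma support_mul_subset_of {Γ : Type*} [AddCommGroup Γ] [LinearOrder Γ] [IsOrderedAddMonoid Γ]
    {X Y : R⟦Γ⟧} {A B C : Set Γ} (hX : X.support ⊆ A) (hY : Y.support ⊆ B)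
    (h : ∀ a ∈ A, ∀ b ∈ B, a + b ∈ C) : (X * Y).support ⊆ C := by
  intro γ hγ
  obtain ⟨a, ha, b, hb, rfl⟩ := Set.mem_add.1 (support_mul_subset hγ)
  exact h a (hX ha) b (hY hb)

lemma support_prod_subset_submonoid {Γ : Type*} [AddCommGroup Γ] [LinearOrder Γ]
    [IsOrderedAddMonoid Γ] {ι : Type*} (s : Finset ι) {X : ι → R⟦Γ⟧} (A : AddSubmonoid Γ)
    (h : ∀ a ∈ s, (X a).support ⊆ A) : (∏ a ∈ s, X a).support ⊆ A := by
  refine Finset.prod_induction X (fun Y => Y.support ⊆ A)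
    (fun X Y hX hY => support_mul_subset_of hX hY fun a ha b hb => A.add_mem ha hb) ?_ h
  exact support_one_subset.trans (Set.singleton_subset_iff.2 A.zero_mem)

lemma support_mul_subset_Ici {X Y : R⟦ℤ⟧} {a b : ℤ} (hX : X.support ⊆ Set.Ici a)
    (hY : Y.support ⊆ Set.Ici b) : (X * Y).support ⊆ Set.Ici (a + b) :=
  support_mul_subset_of hX hY fun _ hx _ hy =>
    Set.mem_Ici.2 (add_le_add (Set.mem_Ici.1 hx) (Set.mem_Ici.1 hy))

lemma support_one_sub_subset_Ici {a : ℤ} (ha : a ≤ 0) {X : R⟦ℤ⟧} (hX : X.support ⊆ Set.Ici a) :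
    (1 - X).support ⊆ Set.Ici a := by
  refine (support_sub_subset _ _).trans (Set.union_subset (support_one_subset.trans ?_) hX)
  exact Set.singleton_subset_iff.2 ha

lemma support_inv_one_sub {c : R} :
    ((1 - single 1 c : R⟦ℤ⟧)⁻¹).support ⊆ Set.Ici (0 : ℤ) := by
  have h0 : (1 - single 1 c : R⟦ℤ⟧).coeff 0 = 1 := by
    rw [coeff_sub, coeff_one, if_pos rfl, coeff_single_of_ne (by decide), sub_zero]
  have hne : (1 - single 1 c : R⟦ℤ⟧) ≠ 0 := by
    intro h
    rw [h, coeff_zero] at h0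
    exact zero_ne_one h0
  have h1 : (1 - single 1 c : R⟦ℤ⟧).order ≤ 0 :=
    order_le_of_coeff_ne_zero (by rw [h0]; exact one_ne_zero)
  have h2 := order_mul hne (inv_ne_zero hne)
  rw [mul_inv_cancel₀ hne, order_one] at h2
  intro γ hγ
  have h3 := order_le_of_coeff_ne_zero hγ
  exact Set.mem_Ici.2 (by omega)

/-- The expansion of a rational function at a small monomial. -/
def powEmb (R : Type*) [Field R] {Γ : Type*} [AddCommGroup Γ] [LinearOrder Γ]
    [IsOrderedAddMonoid Γ] {γ : Γ} (hγ : 0 < γ) : R⟦ℤ⟧ →+* R⟦Γ⟧ :=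
  embDomainRingHom ((zmultiplesHom Γ) γ) (zsmul_left_strictMono hγ).injective
    fun _ _ => (zsmul_left_strictMono hγ).le_iff_le

lemma powEmb_single {Γ : Type*} [AddCommGroup Γ] [LinearOrder Γ]
    [IsOrderedAddMonoid Γ] {γ : Γ} (hγ : 0 < γ) (k : ℤ) (r : R) :
    powEmb R hγ (single k r) = single (k • γ) r := embDomain_single

lemma support_powEmb {Γ : Type*} [AddCommGroup Γ] [LinearOrder Γ]
    [IsOrderedAddMonoid Γ] {γ : Γ} (hγ : 0 < γ) {X : R⟦ℤ⟧} {m : ℤ} (hX : X.support ⊆ Set.Ici m) :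
    (powEmb R hγ X).support ⊆ {δ | ∃ k, m ≤ k ∧ δ = k • γ} := by
  refine support_embDomain_subset.trans ?_
  rintro _ ⟨k, hk, rfl⟩
  exact ⟨k, hX hk, rfl⟩

end Supports

/-! ### Orders of ζ and 1/ζ. -/

section Zeta

variable {I : Type u} [Fintype I] [LinearOrder I] [Quiver.{v} I] [∀ i j : I, Fintype (i ⟶ j)]

lemma card_poles_le (i j : I) : ((poles i j).card : ℤ) ≤
    2 * (Fintype.card (Edge I) : ℤ) + if i = j then 1 else 0 := by
  let _ : DecidableEq (Pole I) := Classical.decEq _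
  have h : poles i j ⊆ (if i = j then {none} else ∅) ∪
      (Finset.univ : Finset (Edge I × Bool)).map Function.Embedding.some := by
    intro o ho
    rw [mem_poles] at ho
    cases o with
    | none => exact Finset.mem_union_left _ (by rw [if_pos (show i = j from ho)]; simp)
    | some o => exact Finset.mem_union_right _ (by simp)
  have h1 := (Finset.card_le_card h).trans (Finset.card_union_le _ _)
  rw [Finset.card_map, Finset.card_univ, Fintype.card_prod, Fintype.card_bool] at h1
  have h2 : (if i = j then ({none} : Finset (Pole I)) else ∅).card = if i = j then 1 else 0 := by
    split_ifs <;> rfl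
  rw [h2] at h1
  split_ifs at h1 ⊢ <;> omega

lemma zeta_seriesVar (i j : I) :
    zeta i j (seriesVar (GroundField I) : (GroundField I)⟦ℤ⟧) =
      (∏ o ∈ poles i j, (1 - single 1 (poleConst o))) *
        (if i = j then (1 - single 1 1)⁻¹ else 1) := by
  rw [zeta_eq, seriesVar, Units.val_mk0]
  congr 1
  refine Finset.prod_congr rfl fun o _ => ?_
  rw [algebraMap_series, Algebra.algebraMap_self_apply, C_apply, single_mul_single, zero_add,
    mul_one]

lemma support_inv_zeta (i j : I) :
    ((zeta i j (seriesVar (GroundField I) : (GroundField I)⟦ℤ⟧))⁻¹).support ⊆ Set.Ici (0 : ℤ) := by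
  rw [zeta_seriesVar, mul_inv, ← Finset.prod_inv_distrib]
  refine (support_mul_subset_Ici (a := 0) (b := 0) ?_ ?_).trans (by rw [add_zero])
  · refine Finset.prod_induction _ (fun Y : (GroundField I)⟦ℤ⟧ => Y.support ⊆ Set.Ici (0 : ℤ))
      (fun X Y hX hY => (support_mul_subset_Ici hX hY).trans (by rw [add_zero]))
      (support_one_subset.trans (by simp)) fun o _ => support_inv_one_sub
  · split_ifs
    · rw [inv_inv]
      exact support_one_sub_subset_Ici le_rfl
        (support_single_subset.trans (by simp))
    · rw [inv_one]
      exact support_one_subset.trans (by simp)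

/-- The origin of the constant 2|E|: at infinity the numerator of ζ_ij has degree at most 2|E| +
δ_ij and the denominator removes δ_ij. -/
lemma support_zeta_inv (i j : I) :
    (zeta i j (seriesVar (GroundField I) : (GroundField I)⟦ℤ⟧)⁻¹).support ⊆
      Set.Ici (-(2 * (Fintype.card (Edge I) : ℤ))) := by
  have hx : ((seriesVar (GroundField I) : (GroundField I)⟦ℤ⟧))⁻¹ = single (-1) 1 := by
    rw [seriesVar, Units.val_mk0, inv_single, inv_one]
  rw [zeta_eq, hx]
  have h1 : ∀ s : Finset (Pole I), (∏ o ∈ s, (1 - algebraMap (GroundField I) (GroundField I)⟦ℤ⟧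
      (poleConst o) * single (-1) 1)).support ⊆ Set.Ici (-(s.card : ℤ)) := by
    intro s
    induction s using Finset.cons_induction with
    | empty => exact support_one_subset.trans (by simp)
    | cons o s hs ih =>
      rw [Finset.prod_cons, Finset.card_cons]
      refine (support_mul_subset_Ici (a := -1) (support_one_sub_subset_Ici (by omega) ?_) ih).trans
        (Set.Ici_subset_Ici.2 (by push_cast; omega))
      rw [algebraMap_series, C_apply, single_mul_single, zero_add]
      exact support_single_subset.trans (by simp)
  have h2 : (if i = j then (1 - single (-1) 1 : (GroundField I)⟦ℤ⟧)⁻¹ else 1).support ⊆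
      Set.Ici (if i = j then 1 else 0 : ℤ) := by
    split_ifs
    · have h : (1 - single (-1) 1 : (GroundField I)⟦ℤ⟧)⁻¹ =
          single 1 (-1) * (1 - single 1 1 : (GroundField I)⟦ℤ⟧)⁻¹ := by
        have h3 : (1 - single (-1) 1 : (GroundField I)⟦ℤ⟧) =
            single (-1) (-1) * (1 - single 1 1) := by
          rw [mul_sub, mul_one, single_mul_single, neg_add_cancel, mul_one, single_neg,
            single_neg, sub_neg_eq_add, neg_add_eq_sub]
          rfl
        rw [h3, mul_inv, inv_single]
        norm_num
      rw [h]
      exact (support_mul_subset_Ici (a := 1) (support_single_subset.trans (by simp))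
        support_inv_one_sub).trans (by rw [add_zero])
    · exact support_one_subset.trans (by simp)
  refine (support_mul_subset_Ici (h1 _) h2).trans (Set.Ici_subset_Ici.2 ?_)
  have := card_poles_le i j
  linarith

variable {n : ℕ}

/-- The exponent of `z_a / z_b`. -/
def ratioExp (a b : Fin n) : Lex (Fin n → ℤ) := toLex (Pi.single a 1 - Pi.single b 1)

lemma ratioExp_pos {a b : Fin n} (h : a < b) : 0 < ratioExp a b := by
  refine ⟨a, fun j hj => ?_, ?_⟩
  · change 0 = Pi.single (M := fun _ => ℤ) a 1 j - Pi.single (M := fun _ => ℤ) b 1 j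
    rw [Pi.single_eq_of_ne hj.ne, Pi.single_eq_of_ne (hj.trans h).ne, sub_zero]
  · change 0 < Pi.single (M := fun _ => ℤ) a 1 a - Pi.single (M := fun _ => ℤ) b 1 a
    rw [Pi.single_eq_same, Pi.single_eq_of_ne h.ne, sub_zero]
    exact one_pos

lemma iterVar_div (a b : Fin n) :
    (iterVar a : IterLaurent I n) / iterVar b = single (ratioExp a b) 1 := by
  rw [iterVar, iterVar, single_div_single, div_one]
  rfl

lemma powEmb_zeta {γ : Lex (Fin n → ℤ)} (hγ : 0 < γ) (i j : I)
    (x : (GroundField I)⟦ℤ⟧) :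
    powEmb (GroundField I) hγ (zeta i j x) =
      (zeta i j (powEmb (GroundField I) hγ x) : IterLaurent I n) := by
  let f : (GroundField I)⟦ℤ⟧ →ₐ[GroundField I] IterLaurent I n :=
    { powEmb (GroundField I) hγ with
      commutes' := fun c => by
        rw [algebraMap_series, HahnSeries.algebraMap_apply]
        exact HahnSeries.embDomainRingHom_C }
  exact map_zeta f i j x

lemma powEmb_seriesVar {a b : Fin n} (h : a < b) :
    powEmb (GroundField I) (ratioExp_pos h) (seriesVar (GroundField I) : (GroundField I)⟦ℤ⟧) =
      iterVar a / iterVar b := by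
  rw [seriesVar, Units.val_mk0, powEmb_single, one_zsmul, iterVar_div]

lemma support_inv_zeta_div (i j : I) {a b : Fin n} (h : a < b) :
    ((zeta i j ((iterVar a : IterLaurent I n) / iterVar b))⁻¹).support ⊆
      {δ | ∃ k : ℤ, 0 ≤ k ∧ δ = k • ratioExp a b} := by
  rw [← powEmb_seriesVar h, ← powEmb_zeta, ← map_inv₀]
  exact support_powEmb _ (support_inv_zeta i j)

lemma support_zeta_div_zeta (i j : I) {a b : Fin n} (h : a < b) :
    (zeta j i ((iterVar b : IterLaurent I n) / iterVar a) *
      (zeta i j ((iterVar a : IterLaurent I n) / iterVar b))⁻¹).support ⊆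
      {δ | ∃ k : ℤ, -(2 * (Fintype.card (Edge I) : ℤ)) ≤ k ∧ δ = k • ratioExp a b} := by
  rw [← inv_div (iterVar a : IterLaurent I n), ← powEmb_seriesVar h, ← map_inv₀, ← powEmb_zeta,
    ← powEmb_zeta, ← map_inv₀, ← map_mul]
  refine support_powEmb _ ?_
  exact (support_mul_subset_Ici (support_zeta_inv j i) (support_inv_zeta i j)).trans
    (by rw [add_zero])

end Zeta

/-! ### The iterated residues as coefficients -/

open HahnSeries

section Residues

variable {I : Type u} [Fintype I] [LinearOrder I] [Quiver.{v} I] [∀ i j : I, Fintype (i ⟶ j)]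
variable {n : ℕ}

/-- The product of the `ζ(z_a / z_b)` over the pairs `a < b` of a set of positions. -/
def orderedKernel (col : Fin n → I) (s : Finset (Fin n)) : IterLaurent I n :=
  ∏ a ∈ s, ∏ b ∈ s with a < b, zeta (col a) (col b) (iterVar a / iterVar b)

lemma zeta_iterVar_ne_zero (i j : I) {a b : Fin n} (h : a ≠ b) :
    zeta i j ((iterVar a : IterLaurent I n) / iterVar b) ≠ 0 := by
  rw [iterVar_div]
  refine zeta_single_ne_zero i j fun h0 => ?_
  obtain h | h := h.lt_or_gt
  · exact (ratioExp_pos h).ne' h0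
  · refine (ratioExp_pos h).ne' ?_
    rw [← neg_eq_zero, ← h0, ratioExp, ratioExp, ← toLex_neg, neg_sub]

lemma orderedKernel_ne_zero (col : Fin n → I) (s : Finset (Fin n)) : orderedKernel col s ≠ 0 :=
  Finset.prod_ne_zero_iff.2 fun _ _ => Finset.prod_ne_zero_iff.2 fun _ hb =>
    zeta_iterVar_ne_zero _ _ (Finset.mem_filter.1 hb).2.ne

lemma orderedKernel_eq (col : Fin n → I) {s : Finset (Fin n)} {a : Fin n} (ha : a ∈ s) :
    orderedKernel col s = (∏ b ∈ s.erase a with b < a, zeta (col b) (col a) (iterVar b / iterVar a)) *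
      (∏ b ∈ s.erase a with a < b, zeta (col a) (col b) (iterVar a / iterVar b)) *
      orderedKernel col (s.erase a) := by
  have h1 : (s.filter fun b => a < b) = (s.erase a).filter fun b => a < b := by
    ext b
    simp only [Finset.mem_filter, Finset.mem_erase]
    exact ⟨fun h => ⟨⟨h.2.ne', h.1⟩, h.2⟩, fun h => ⟨h.1.2, h.2⟩⟩
  have h2 : ∀ b ∈ s.erase a, ∏ c ∈ s with b < c, zeta (col b) (col c)
      ((iterVar b : IterLaurent I n) / iterVar c) =
      (if b < a then zeta (col b) (col a) (iterVar b / iterVar a) else 1) *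
      ∏ c ∈ s.erase a with b < c, zeta (col b) (col c) (iterVar b / iterVar c) := by
    intro b _
    rw [Finset.prod_filter, ← Finset.mul_prod_erase _ _ ha, ← Finset.prod_filter]
  rw [orderedKernel, ← Finset.mul_prod_erase _ _ ha, h1, Finset.prod_congr rfl h2,
    Finset.prod_mul_distrib, ← Finset.prod_filter, orderedKernel]
  ring

lemma prod_iterVar_zpow (g : Fin n → ℤ) :
    ∏ a, (iterVar a : IterLaurent I n) ^ g a = single (toLex g) 1 := by
  have h1 : ∀ (γ : Lex (Fin n → ℤ)) (k : ℤ),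
      (single γ 1 : IterLaurent I n) ^ k = single (k • γ) 1 := by
    intro γ k
    have h2 : ∀ k : ℕ, (single γ 1 : IterLaurent I n) ^ k = single (k • γ) 1 := fun k => by
      rw [single_pow, one_pow]
    obtain ⟨k, rfl | rfl⟩ := k.eq_nat_or_neg
    · rw [zpow_natCast, h2, natCast_zsmul]
    · rw [zpow_neg, zpow_natCast, h2, inv_single, inv_one, neg_smul, natCast_zsmul]
  have h3 : ∀ s : Finset (Fin n), ∏ a ∈ s, (iterVar a : IterLaurent I n) ^ g a =
      single (∑ a ∈ s, g a • toLex (Pi.single a 1)) 1 := by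
    intro s
    induction s using Finset.cons_induction with
    | empty => rfl
    | cons a s ha ih =>
      rw [Finset.prod_cons, Finset.sum_cons, ih, iterVar, h1, single_mul_single, one_mul]
  rw [h3]
  congr 2
  funext b
  change exponentAt b (∑ a, g a • toLex (Pi.single a 1)) = g b
  rw [map_sum, Finset.sum_eq_single b]
  · rw [map_zsmul, exponentAt_single, smul_eq_mul, mul_one]
  · intro a _ hab
    rw [map_zsmul]
    have h4 : exponentAt b (toLex (Pi.single a (1 : ℤ))) = 0 := Pi.single_eq_of_ne hab.symm _
    rw [h4, smul_zero]
  · exact fun h => absurd (Finset.mem_univ b) h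

lemma exists_plug_plugIn (w : Word I) :
    Plug (wordDegree w) (fun a => (w.get a).vertex) (iterVar : Fin w.length → IterLaurent I w.length)
      Finset.univ (plugIn w) := by
  obtain ⟨e, h1, h2, h3, h4⟩ := exists_position w
  refine ⟨plugIn_ne_zero w, Equiv.ofBijective
    (fun p : {p // p ∈ varSet (wordDegree w)} => ⟨e p p.2, Finset.mem_univ _⟩) ⟨?_, ?_⟩,
    fun p => h3 p p.2, fun p => h4 p p.2⟩
  · intro p p' h
    exact Subtype.ext (h1 _ _ _ _ (congrArg
      (fun t : {a // a ∈ (Finset.univ : Finset (Fin w.length))} => (t : Fin w.length)) h))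
  · rintro ⟨a, -⟩
    obtain ⟨p, hp, rfl⟩ := h2 a
    exact ⟨⟨p, hp⟩, rfl⟩

/-- The iterated residues are the coefficients of one series. -/
lemma residuePairing_eq_coeff {w : Word I} (hw : w.length = n) {col : Fin n → I} {d : Fin n → ℤ}
    (hcol : ∀ a : Fin w.length, (w.get a).vertex = col (a.cast hw))
    (hd : ∀ a : Fin w.length, (w.get a).exponent = d (a.cast hw)) {P : LaurentPoly I}
    (hP1 : InVariables (wordDegree w) P) (hP2 : IsSymmetric (wordDegree w) P) :
    residuePairing P w = ((orderedKernel col Finset.univ)⁻¹ *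
      evalOn (wordDegree w) P col iterVar Finset.univ).coeff (toLex d) := by
  subst hw
  obtain rfl : col = fun a => (w.get a).vertex := funext fun a => (hcol a).symm
  rw [(exists_plug_plugIn w).evalOn_eq hP1 hP2, residuePairing_eq, wordKernel]
  have h1 : ∏ a : Fin w.length, (iterVar a : IterLaurent I w.length) ^ (-(w.get a).exponent) =
      single (toLex (-d)) 1 := by
    rw [← prod_iterVar_zpow]
    refine Finset.prod_congr rfl fun a _ => ?_
    rw [hd]
    rfl
  rw [h1, div_eq_mul_inv, mul_assoc, coeff_single_mul, one_mul, zero_sub, ← toLex_neg, neg_neg,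
    orderedKernel]
  simp only [Finset.filter_lt_eq_Ioi]

end Residues

/-! ### Bounds on the exponents, and non-degeneracy. -/

section LaurentSupport

variable {I : Type u} [Fintype I] [LinearOrder I] [Quiver.{v} I] [∀ i j : I, Fintype (i ⟶ j)]
variable {n : ℕ}

/-- The exponents of a monomial after the variables have been plugged in. -/
def pluggedExp {N : I → ℕ} (θ : {p // p ∈ varSet N} ≃ {a // a ∈ (Finset.univ : Finset (Fin n))})
    (m : Var I →₀ ℤ) : Lex (Fin n → ℤ) := toLex fun a => m (θ.symm ⟨a, Finset.mem_univ a⟩)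

lemma prod_varSet_equiv {M : Type*} [CommMonoid M] {N : I → ℕ}
    (θ : {p // p ∈ varSet N} ≃ {a // a ∈ (Finset.univ : Finset (Fin n))}) (F : Var I → M) :
    ∏ p ∈ varSet N, F p = ∏ a : Fin n, F (θ.symm ⟨a, Finset.mem_univ a⟩) := by
  rw [← Finset.prod_coe_sort]
  exact Fintype.prod_equiv (θ.trans (Equiv.subtypeUnivEquiv Finset.mem_univ)) _ _
    fun p => by simp [Equiv.subtypeUnivEquiv]

lemma sum_varSet_equiv {M : Type*} [AddCommMonoid M] {N : I → ℕ}
    (θ : {p // p ∈ varSet N} ≃ {a // a ∈ (Finset.univ : Finset (Fin n))}) (F : Var I → M) :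
    ∑ p ∈ varSet N, F p = ∑ a : Fin n, F (θ.symm ⟨a, Finset.mem_univ a⟩) :=
  prod_varSet_equiv (M := Multiplicative M) θ F

lemma abs_prefixSum_le (d : Fin n → ℤ) (k : ℕ) : |prefixSum d k| ≤ ∑ a, |d a| :=
  (Finset.abs_sum_le_sum_abs _ _).trans (Finset.sum_le_sum_of_subset_of_nonneg
    (Finset.subset_univ _) fun _ _ _ => abs_nonneg _)

lemma evalAt_eq_sum_single {N : I → ℕ} {P : LaurentPoly I} (hP : InVariables N P)
    {θ : {p // p ∈ varSet N} ≃ {a // a ∈ (Finset.univ : Finset (Fin n))}}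
    {y : Var I → IterLaurent I n} (hy : ∀ p : {p // p ∈ varSet N}, y p = iterVar (θ p).1) :
    evalAt y P = ∑ m ∈ P.coeff.support, single (pluggedExp θ m) (P.coeff m) := by
  rw [evalAt, Finsupp.sum]
  refine Finset.sum_congr rfl fun m hm => ?_
  have h1 : m.prod (fun p k => y p ^ k) = single (pluggedExp θ m) 1 := by
    rw [Finsupp.prod, Finset.prod_subset (s₂ := varSet N), prod_varSet_equiv θ, pluggedExp,
      ← prod_iterVar_zpow]
    · refine Finset.prod_congr rfl fun a _ => ?_
      rw [hy, Equiv.apply_symm_apply]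
    · intro p hp
      exact mem_varSet.2 (hP m (Finsupp.mem_support_iff.1 hm) p (Finsupp.mem_support_iff.1 hp))
    · intro p _ hp
      rw [Finsupp.notMem_support_iff.1 hp, zpow_zero]
  rw [h1, ← C_mul_eq_smul, C_apply, single_mul_single, zero_add, mul_one]

lemma pluggedExp_inj {N : I → ℕ} {P : LaurentPoly I} (hP : InVariables N P)
    {θ : {p // p ∈ varSet N} ≃ {a // a ∈ (Finset.univ : Finset (Fin n))}} {m m' : Var I →₀ ℤ}
    (hm : P.coeff m ≠ 0) (hm' : P.coeff m' ≠ 0) (h : pluggedExp θ m = pluggedExp θ m') :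
    m = m' := by
  ext p
  by_cases hp : p ∈ varSet N
  · have := congrFun (toLex.injective h) (θ ⟨p, hp⟩)
    simpa using this
  · rw [mem_varSet] at hp
    have h1 : ∀ m, P.coeff m ≠ 0 → m p = 0 := fun m hm => by
      by_contra h
      exact hp (hP m hm p h)
    rw [h1 m hm, h1 m' hm']

lemma evalAt_ne_zero {N : I → ℕ} {P : LaurentPoly I} (hP : InVariables N P) (hP0 : P ≠ 0)
    {col : Fin n → I} {y : Var I → IterLaurent I n} (hy : Plug N col iterVar Finset.univ y) :
    evalAt y P ≠ 0 := by
  obtain ⟨-, θ, -, hθ⟩ := hy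
  obtain ⟨m, hm⟩ : ∃ m, P.coeff m ≠ 0 := by
    by_contra! h
    exact hP0 (AddMonoidAlgebra.ext (Finsupp.ext h))
  intro h0
  have h1 := congrArg (fun X => HahnSeries.coeff X (pluggedExp θ m)) h0
  rw [evalAt_eq_sum_single hP hθ, coeff_sum, coeff_zero,
    Finset.sum_eq_single_of_mem m (Finsupp.mem_support_iff.2 hm), coeff_single_same] at h1
  · exact hm h1
  · intro m' hm' hne
    rw [coeff_single_of_ne]
    exact fun h => hne (pluggedExp_inj hP (Finsupp.mem_support_iff.1 hm') hm h.symm)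

lemma exists_support_bound {N : I → ℕ} {P : LaurentPoly I} (hP : InVariables N P) :
    ∃ M : ℤ, ∀ (n : ℕ) (col : Fin n → I) (y : Var I → IterLaurent I n),
      Plug N col iterVar Finset.univ y → ∀ γ, (evalAt y P).coeff γ ≠ 0 →
        (∀ k, -M ≤ prefixSum (ofLex γ) k) ∧ prefixSum (ofLex γ) n ≤ M := by
  refine ⟨∑ m ∈ P.coeff.support, ∑ p ∈ varSet N, |m p|, fun n col y hy γ hγ => ?_⟩
  obtain ⟨-, θ, -, hθ⟩ := hy
  rw [evalAt_eq_sum_single hP hθ, coeff_sum] at hγ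
  obtain ⟨m, hm, hne⟩ := Finset.exists_ne_zero_of_sum_ne_zero hγ
  have hγm : γ = pluggedExp θ m := by
    by_contra h
    exact hne (coeff_single_of_ne h)
  rw [hγm]
  have h1 : ∑ a, |ofLex (pluggedExp θ m) a| ≤ ∑ m ∈ P.coeff.support, ∑ p ∈ varSet N, |m p| := by
    have h2 : ∑ p ∈ varSet N, |m p| = ∑ a, |ofLex (pluggedExp θ m) a| := by
      rw [sum_varSet_equiv θ]
      rfl
    rw [← h2]
    exact Finset.single_le_sum (f := fun m : Var I →₀ ℤ => ∑ p ∈ varSet N, |m p|)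
      (fun m _ => Finset.sum_nonneg fun p _ => abs_nonneg _) hm
  exact ⟨fun k => (abs_le.1 ((abs_prefixSum_le _ k).trans h1)).1,
    (abs_le.1 ((abs_prefixSum_le _ n).trans h1)).2⟩

/-- The exponents whose sums of the first components are non-negative and whose total is zero. -/
def dominantExp (n : ℕ) : AddSubmonoid (Lex (Fin n → ℤ)) where
  carrier := {γ | (∀ k, 0 ≤ prefixSum (ofLex γ) k) ∧ prefixSum (ofLex γ) n = 0}
  zero_mem' := ⟨fun k => (Finset.sum_eq_zero fun _ _ => rfl).ge, Finset.sum_eq_zero fun _ _ => rfl⟩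
  add_mem' := by
    rintro γ δ ⟨h1, h2⟩ ⟨h3, h4⟩
    have h : ∀ k, prefixSum (ofLex (γ + δ)) k = prefixSum (ofLex γ) k + prefixSum (ofLex δ) k :=
      fun k => Finset.sum_add_distrib
    exact ⟨fun k => by rw [h]; exact add_nonneg (h1 k) (h3 k), by rw [h, h2, h4, add_zero]⟩

lemma prefixSum_ratioExp (a b : Fin n) (k : ℕ) : prefixSum (ofLex (ratioExp a b)) k =
    (if (a : ℕ) < k then 1 else 0) - if (b : ℕ) < k then 1 else 0 := by
  have h : ∀ a : Fin n, prefixSum (Pi.single a 1) k = if (a : ℕ) < k then 1 else 0 := by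
    intro a
    simp [prefixSum, Pi.single_apply]
  rw [← h, ← h]
  exact Finset.sum_sub_distrib _ _

lemma ratioExp_mem_dominantExp {a b : Fin n} (h : a < b) : ratioExp a b ∈ dominantExp n := by
  refine ⟨fun k => ?_, ?_⟩
  · rw [prefixSum_ratioExp]
    have := Fin.lt_def.1 h
    split_ifs <;> omega
  · rw [prefixSum_ratioExp, if_pos a.2, if_pos b.2, sub_self]

/-- For a < b the series 1/ζ(z_a/z_b) has only non-negative powers of z_a/z_b, whose exponents have
non-negative prefix sums and total zero; such exponents form a monoid. -/
lemma support_inv_orderedKernel (col : Fin n → I) :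
    ((orderedKernel col Finset.univ)⁻¹).support ⊆ dominantExp n := by
  rw [orderedKernel, ← Finset.prod_inv_distrib]
  refine support_prod_subset_submonoid _ _ fun a _ => ?_
  rw [← Finset.prod_inv_distrib]
  refine support_prod_subset_submonoid _ _ fun b hb => ?_
  have hab := (Finset.mem_filter.1 hb).2
  refine (support_inv_zeta_div _ _ hab).trans ?_
  rintro _ ⟨k, hk, rfl⟩
  lift k to ℕ using hk
  rw [natCast_zsmul]
  exact (dominantExp n).nsmul_mem (ratioExp_mem_dominantExp hab) k

lemma prefixSum_add (d d' : Fin n → ℤ) (k : ℕ) :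
    prefixSum (d + d') k = prefixSum d k + prefixSum d' k := Finset.sum_add_distrib

/-- A bound for the exponents of the words on which the iterated residue does not vanish. -/
lemma exists_residuePairing_bound {N : I → ℕ} {P : LaurentPoly I} (hP1 : InVariables N P)
    (hP2 : IsSymmetric N P) : ∃ M : ℤ, ∀ (n : ℕ) (d : Fin n → ℤ) (w : Word I), wordDegree w = N →
      w.map Letter.exponent = List.ofFn d → residuePairing P w ≠ 0 →
        (∀ k, -M ≤ prefixSum d k) ∧ prefixSum d n ≤ M := by
  obtain ⟨M, hM⟩ := exists_support_bound hP1
  refine ⟨M, fun n d w hN hd hne => ?_⟩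
  subst hN
  have hw : w.length = n := by simpa using congrArg List.length hd
  subst hw
  have hd' : ∀ a : Fin w.length, (w.get a).exponent = d a := by
    intro a
    have := congrArg (fun l : List ℤ => l[(a : ℕ)]?) hd
    simpa using this
  rw [residuePairing_eq_coeff rfl (col := fun a => (w.get a).vertex) (d := d) (fun _ => rfl) hd' hP1
    hP2, (exists_plug_plugIn w).evalOn_eq hP1 hP2] at hne
  obtain ⟨γ, h1, δ, h2, h3⟩ := Set.mem_add.1 (support_mul_subset hne)
  obtain ⟨h4, h5⟩ := support_inv_orderedKernel _ h1
  obtain ⟨h6, h7⟩ := hM _ _ _ (exists_plug_plugIn w) δ h2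
  have h8 : d = ofLex γ + ofLex δ := (congrArg ofLex h3).symm
  rw [h8]
  refine ⟨fun k => ?_, ?_⟩
  · rw [prefixSum_add]
    have := h4 k
    have := h6 k
    omega
  · rw [prefixSum_add, h5, zero_add]
    exact h7

lemma wordDegree_ofFn (col : Fin n → I) (d : Fin n → ℤ) (i : I) :
    wordDegree (List.ofFn fun a => mkLetter (col a) (d a)) i =
      (Finset.univ.filter fun a => col a = i).card := by
  have h : (Letter.vertex ∘ fun a => mkLetter (col a) (d a)) = col :=
    funext fun a => mkLetter_vertex _ _
  rw [wordDegree, List.map_ofFn, h, List.ofFn_eq_map, ← Multiset.coe_count, ← Multiset.map_coe,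
    Multiset.count_map]
  simp only [eq_comm (a := i)]
  rfl

/-- A Laurent polynomial is determined by the iterated residues. -/
lemma exists_residuePairing_ne_zero {N : I → ℕ} {P : LaurentPoly I} (hP1 : InVariables N P)
    (hP2 : IsSymmetric N P) (hP0 : P ≠ 0) : ∃ w : Word I, wordDegree w = N ∧
      residuePairing P w ≠ 0 := by
  set n := (varSet N).card
  let e : {p // p ∈ varSet N} ≃ Fin n := (varSet N).equivFin
  let col : Fin n → I := fun a => ((e.symm a : Var I)).1
  have hcard : ∀ i, (Finset.univ.filter fun a => col a = i).card = N i := by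
    intro i
    have h1 := sum_varSet_filter N i fun _ => 1
    rw [Finset.sum_filter, sum_varSet_equiv
      (e.trans (Equiv.subtypeUnivEquiv (p := (· ∈ Finset.univ)) Finset.mem_univ).symm)] at h1
    rw [Finset.card_filter]
    refine Eq.trans ?_ (h1.trans (by simp))
    rfl
  have hdeg : ∀ d : Fin n → ℤ, wordDegree (List.ofFn fun a => mkLetter (col a) (d a)) = N :=
    fun d => funext fun i => by rw [wordDegree_ofFn, hcard]
  obtain ⟨y, hy⟩ := exists_plug (n := N) (col := col) (x := (iterVar : Fin n → IterLaurent I n))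
    (s := Finset.univ) (fun a _ => iterVar_ne_zero a) hcard
  -- In the field of series dividing by the kernel loses nothing, so some coefficient is non-zero,
  -- and its exponents are those of the word sought.
  have h1 := mul_ne_zero (inv_ne_zero (orderedKernel_ne_zero col Finset.univ))
    (evalAt_ne_zero hP1 hP0 hy)
  obtain ⟨γ, hγ⟩ : ∃ γ, ((orderedKernel col Finset.univ)⁻¹ * evalAt y P).coeff γ ≠ 0 := by
    by_contra! h
    exact h1 (HahnSeries.ext (funext h))
  refine ⟨List.ofFn fun a => mkLetter (col a) (ofLex γ a), hdeg _, ?_⟩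
  rw [residuePairing_eq_coeff (List.length_ofFn) (col := col) (d := ofLex γ) (fun a => by
      rw [List.get_ofFn, mkLetter_vertex]) (fun a => by rw [List.get_ofFn, mkLetter_exponent])
    (by rwa [hdeg]) (by rwa [hdeg]), hdeg, hy.evalOn_eq hP1 hP2]
  exact hγ

end LaurentSupport

/-! ### The exponents of two words with non-zero pairing -/

open HahnSeries

section RelatedExponents

variable {n : ℕ}

/-- The exponents of the monomials of `e_v`, expanded and divided by the kernel. Here `π a` is the
position in `v` of the letter that corresponds to the variable `z_a`. -/
def relatedExp (m : ℤ) (D : List ℤ) (s : Finset (Fin n)) : Set (Lex (Fin n → ℤ)) :=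
  {γ | ∃ (π : Fin n → ℕ) (c : Fin n → Fin n → ℤ), Set.InjOn π s ∧ (∀ a ∈ s, π a < D.length) ∧
    (∀ a b, -m ≤ c a b) ∧ ∀ a, ofLex γ a = if a ∈ s then
      D.getD (π a) 0 - (∑ r ∈ s with r < a ∧ π a < π r, c r a) +
        ∑ t ∈ s with a < t ∧ π t < π a, c a t else 0}

lemma ratioExp_apply (a b c : Fin n) : ofLex (ratioExp a b) c =
    (if c = a then 1 else 0) - if c = b then 1 else 0 := by
  change Pi.single (M := fun _ => ℤ) a 1 c - Pi.single (M := fun _ => ℤ) b 1 c = _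
  rw [Pi.single_apply, Pi.single_apply]

lemma ofLex_sum_apply {ι : Type*} (s : Finset ι) (γ : ι → Lex (Fin n → ℤ)) (a : Fin n) :
    ofLex (∑ b ∈ s, γ b) a = ∑ b ∈ s, ofLex (γ b) a := map_sum (exponentAt a) γ s

/-- The first letter goes to z_{a₀} and so precedes all others. Its inversions are the pairs b < a₀,
each contributing a power of z_b/z_{a₀}. -/
lemma relatedExp_cons {m : ℤ} (d : ℤ) {D : List ℤ} {s : Finset (Fin n)} {a₀ : Fin n} (ha₀ : a₀ ∈ s)
    {γ : Lex (Fin n → ℤ)} (hγ : γ ∈ relatedExp m D (s.erase a₀)) {k : Fin n → ℤ}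
    (hk : ∀ b, -m ≤ k b) :
    toLex (Pi.single (M := fun _ => ℤ) a₀ d) + ∑ b ∈ s.erase a₀ with b < a₀, k b • ratioExp b a₀ + γ ∈
      relatedExp m (d :: D) s := by
  obtain ⟨π, c, h1, h2, h3, h4⟩ := hγ
  -- The new letter has position 0 and all other positions shift by one.
  refine ⟨fun a => if a = a₀ then 0 else π a + 1, fun b a => if a = a₀ then k b else c b a,
    ?_, ?_, ?_, ?_⟩
  · intro a ha b hb h
    dsimp only at h
    split_ifs at h with h5 h6 h6
    · rw [h5, h6]
    · exact h1 (Finset.mem_coe.2 (Finset.mem_erase.2 ⟨h5, ha⟩))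
        (Finset.mem_coe.2 (Finset.mem_erase.2 ⟨h6, hb⟩)) (Nat.succ_injective h)
  · intro a ha
    dsimp only
    rw [List.length_cons]
    split_ifs with h5
    · exact Nat.succ_pos _
    · exact Nat.succ_lt_succ (h2 a (Finset.mem_erase.2 ⟨h5, ha⟩))
  · intro a b
    dsimp only
    split_ifs
    · exact hk a
    · exact h3 a b
  · intro a
    have h5 : ofLex (toLex (Pi.single (M := fun _ => ℤ) a₀ d) + ∑ b ∈ s.erase a₀ with b < a₀, k b • ratioExp b a₀ + γ) a =
        (if a = a₀ then d else 0) + ∑ b ∈ s.erase a₀ with b < a₀,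
          k b * ((if a = b then 1 else 0) - if a = a₀ then 1 else 0) + ofLex γ a := by
      have h6 : ∀ b, ofLex (k b • ratioExp b a₀) a =
          k b * ((if a = b then 1 else 0) - if a = a₀ then 1 else 0) := fun b => by
        rw [← ratioExp_apply]
        exact (map_zsmul (exponentAt a) _ _).trans (smul_eq_mul _ _)
      have h7 : ofLex (toLex (Pi.single (M := fun _ => ℤ) a₀ d)) a = if a = a₀ then d else 0 :=
        Pi.single_apply _ _ _
      have h8 := ofLex_sum_apply ((s.erase a₀).filter (· < a₀)) (fun b => k b • ratioExp b a₀) a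
      rw [Finset.sum_congr rfl fun b _ => h6 b] at h8
      rw [← h7, ← h8]
      rfl
    rw [h5, h4]
    by_cases ha : a = a₀
    · subst ha
      simp only [if_true, if_pos ha₀, Finset.notMem_erase, if_false, Nat.not_lt_zero, and_false,
        Finset.filter_false, Finset.sum_empty, List.getD_cons_zero, add_zero]
      rw [sub_eq_add_neg, ← Finset.sum_neg_distrib]
      congr 1
      have h6 : ((s.erase a).filter fun b => b < a) =
          s.filter fun r => r < a ∧ 0 < if r = a then 0 else π r + 1 := by
        ext b
        simp only [Finset.mem_filter, Finset.mem_erase]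
        constructor
        · rintro ⟨⟨h6, h7⟩, h8⟩
          exact ⟨h7, h8, by rw [if_neg h6]; exact Nat.succ_pos _⟩
        · rintro ⟨h7, h8, -⟩
          exact ⟨⟨h8.ne, h7⟩, h8⟩
      rw [h6]
      refine Finset.sum_congr rfl fun b hb => ?_
      rw [if_neg (Finset.mem_filter.1 hb).2.1.ne']
      ring
    · simp only [if_false, sub_zero, mul_ite, mul_one, mul_zero, Finset.sum_ite_eq,
        Finset.mem_filter, Finset.mem_erase, ne_eq, ha, not_false_eq_true, true_and, zero_add]
      by_cases has : a ∈ s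
      · simp only [has, true_and, if_true, List.getD_cons_succ]
        have h6 : (s.filter fun r => r < a ∧ π a + 1 < if r = a₀ then 0 else π r + 1) =
            (s.erase a₀).filter fun r => r < a ∧ π a < π r := by
          ext b
          simp only [Finset.mem_filter, Finset.mem_erase]
          by_cases hb : b = a₀
          · simp [hb]
          · simp [hb]
        have h7 : (s.filter fun t => a < t ∧ (if t = a₀ then 0 else π t + 1) < π a + 1) =
            if a < a₀ then insert a₀ ((s.erase a₀).filter fun t => a < t ∧ π t < π a) else
              (s.erase a₀).filter fun t => a < t ∧ π t < π a := by
          ext b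
          by_cases hb : b = a₀
          · subst hb
            split_ifs with h <;> simp [h, ha₀]
          · split_ifs with h <;> simp [hb]
        rw [h6, h7]
        have h8 : ∑ t ∈ s.erase a₀ with a < t ∧ π t < π a, (if t = a₀ then k a else c a t) =
            ∑ t ∈ s.erase a₀ with a < t ∧ π t < π a, c a t :=
          Finset.sum_congr rfl fun t ht => if_neg (Finset.ne_of_mem_erase (Finset.mem_filter.1 ht).1)
        split_ifs with h
        · rw [Finset.sum_insert (by simp), if_pos rfl, h8]
          ring
        · rw [h8]
          ring
      · simp [has]

end RelatedExponents

/-! ### Expansion of e_v on the contour of an iterated residue. -/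

section Support

variable {I : Type u} [Fintype I] [LinearOrder I] [Quiver.{v} I] [∀ i j : I, Fintype (i ⟶ j)]
variable {n : ℕ}

lemma support_prod_ratio {R : Type*} [Field R] {m : ℤ} (hm : 0 ≤ m) (a₀ : Fin n) (s : Finset (Fin n))
    {X : Fin n → R⟦Lex (Fin n → ℤ)⟧}
    (hX : ∀ b ∈ s, (X b).support ⊆ {δ | ∃ k : ℤ, -m ≤ k ∧ δ = k • ratioExp b a₀}) :
    (∏ b ∈ s, X b).support ⊆
      {γ | ∃ k : Fin n → ℤ, (∀ b, -m ≤ k b) ∧ γ = ∑ b ∈ s, k b • ratioExp b a₀} := by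
  induction s using Finset.cons_induction with
  | empty =>
    rw [Finset.prod_empty]
    exact support_one_subset.trans (Set.singleton_subset_iff.2 ⟨0, fun _ => by
      rw [Pi.zero_apply]; omega, rfl⟩)
  | cons a s ha ih =>
    rw [Finset.prod_cons]
    refine support_mul_subset_of (hX a (Finset.mem_cons_self a s))
      (ih fun b hb => hX b (Finset.mem_cons_of_mem hb)) ?_
    rintro _ ⟨k₀, hk₀, rfl⟩ _ ⟨k, hk, rfl⟩
    refine ⟨Function.update k a k₀, fun b => ?_, ?_⟩
    · by_cases hb : b = a
      · rw [hb, Function.update_self]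
        exact hk₀
      · rw [Function.update_of_ne hb]
        exact hk b
    · rw [Finset.sum_cons, Function.update_self]
      congr 1
      refine Finset.sum_congr rfl fun b hb => ?_
      rw [Function.update_of_ne]
      rintro rfl
      exact ha hb

lemma iterVar_zpow (a : Fin n) (k : ℤ) : (iterVar a : IterLaurent I n) ^ k =
    single (toLex (Pi.single (M := fun _ => ℤ) a k)) 1 := by
  rw [← prod_iterVar_zpow, Finset.prod_eq_single_of_mem a (Finset.mem_univ a), Pi.single_eq_same]
  intro b _ hb
  rw [Pi.single_eq_of_ne hb, zpow_zero]

/-- Pairs in the order of the contour cancel against the kernel; each inversion leaves the quotient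
of ζ(z_a/z_b) by ζ(z_b/z_a). -/
lemma zeta_mul_orderedKernel_inv (col : Fin n → I) {s : Finset (Fin n)} {a : Fin n} (ha : a ∈ s) :
    (∏ b ∈ s.erase a, zeta (col a) (col b) ((iterVar a : IterLaurent I n) / iterVar b)) *
        (orderedKernel col s)⁻¹ =
      (∏ b ∈ s.erase a with b < a, zeta (col a) (col b) ((iterVar a : IterLaurent I n) / iterVar b) *
        (zeta (col b) (col a) ((iterVar b : IterLaurent I n) / iterVar a))⁻¹) *
      (orderedKernel col (s.erase a))⁻¹ := by
  have h2 : ∏ b ∈ s.erase a, zeta (col a) (col b) ((iterVar a : IterLaurent I n) / iterVar b) =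
      (∏ b ∈ s.erase a with b < a, zeta (col a) (col b) (iterVar a / iterVar b)) *
        ∏ b ∈ s.erase a with a < b, zeta (col a) (col b) (iterVar a / iterVar b) := by
    rw [← Finset.prod_filter_mul_prod_filter_not (s.erase a) (fun b => b < a)]
    congr 1
    refine Finset.prod_congr (Finset.filter_congr fun b hb => ?_) fun _ _ => rfl
    rw [not_lt]
    exact ⟨fun h => lt_of_le_of_ne h (Finset.ne_of_mem_erase hb).symm, le_of_lt⟩
  have h3 : ∏ b ∈ s.erase a with a < b, zeta (col a) (col b)
      ((iterVar a : IterLaurent I n) / iterVar b) ≠ 0 :=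
    Finset.prod_ne_zero_iff.2 fun b hb => zeta_iterVar_ne_zero _ _ (Finset.mem_filter.1 hb).2.ne
  rw [h2, orderedKernel_eq col ha, Finset.prod_mul_distrib, Finset.prod_inv_distrib]
  generalize (∏ b ∈ s.erase a with a < b, zeta (col a) (col b)
      ((iterVar a : IterLaurent I n) / iterVar b)) = X at h3 ⊢
  field_simp

lemma support_zpow_mul_prod (col : Fin n → I) (s : Finset (Fin n)) (a : Fin n) (k : ℤ) :
    ((iterVar a : IterLaurent I n) ^ k *
      ∏ b ∈ s.erase a with b < a, zeta (col a) (col b) ((iterVar a : IterLaurent I n) / iterVar b) *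
        (zeta (col b) (col a) ((iterVar b : IterLaurent I n) / iterVar a))⁻¹).support ⊆
      {γ | ∃ c : Fin n → ℤ, (∀ b, -(2 * (Fintype.card (Edge I) : ℤ)) ≤ c b) ∧
        γ = toLex (Pi.single (M := fun _ => ℤ) a k) +
          ∑ b ∈ s.erase a with b < a, c b • ratioExp b a} := by
  have h5 := support_prod_ratio (m := 2 * (Fintype.card (Edge I) : ℤ)) (by positivity) a
    ((s.erase a).filter (· < a)) (X := fun b => zeta (col a) (col b)
      ((iterVar a : IterLaurent I n) / iterVar b) *
      (zeta (col b) (col a) ((iterVar b : IterLaurent I n) / iterVar a))⁻¹) fun b hb =>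
      support_zeta_div_zeta (col b) (col a) (Finset.mem_filter.1 hb).2
  rw [iterVar_zpow]
  intro γ hγ
  obtain ⟨δ, hδ, γ', hγ', h⟩ := Set.mem_add.1 (support_mul_subset hγ)
  obtain ⟨c, hc, h7⟩ := h5 hγ'
  refine ⟨c, hc, ?_⟩
  rw [← h, h7, Set.mem_singleton_iff.1 (support_single_subset hδ)]

lemma support_eVal (col : Fin n → I) (w : Word I) (s : Finset (Fin n)) :
    (eVal col (iterVar : Fin n → IterLaurent I n) w s * (orderedKernel col s)⁻¹).support ⊆
      relatedExp (2 * (Fintype.card (Edge I) : ℤ)) (w.map Letter.exponent) s := by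
  induction w generalizing s with
  | nil =>
    rw [eVal, symRec]
    split_ifs with h
    · subst h
      rw [orderedKernel, Finset.prod_empty, inv_one, mul_one]
      refine support_one_subset.trans (Set.singleton_subset_iff.2 ⟨0, 0, ?_, ?_, ?_, ?_⟩)
      · simp
      · simp
      · intro a b
        exact neg_nonpos.2 (by positivity)
      · intro a
        rw [if_neg (Finset.notMem_empty a)]
        rfl
    · rw [zero_mul, support_zero]
      exact Set.empty_subset _
  | cons l w ih =>
    rw [eVal_cons, Finset.sum_mul]
    refine support_finset_sum_subset _ fun a ha => ?_
    have has := (Finset.mem_filter.1 ha).1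
    have h1 : iterVar a ^ l.exponent * (∏ b ∈ s.erase a, zeta (col a) (col b)
        ((iterVar a : IterLaurent I n) / iterVar b)) * eVal col iterVar w (s.erase a) *
        (orderedKernel col s)⁻¹ = (iterVar a ^ l.exponent *
          ∏ b ∈ s.erase a with b < a, zeta (col a) (col b) ((iterVar a : IterLaurent I n) / iterVar b) *
        (zeta (col b) (col a) ((iterVar b : IterLaurent I n) / iterVar a))⁻¹) *
        (eVal col iterVar w (s.erase a) * (orderedKernel col (s.erase a))⁻¹) := by
      rw [mul_right_comm _ (eVal _ _ _ _), mul_assoc (iterVar a ^ l.exponent),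
        zeta_mul_orderedKernel_inv col has, mul_comm (eVal _ _ _ _)]
      simp only [mul_assoc]
    rw [h1]
    refine support_mul_subset_of (support_zpow_mul_prod col s a l.exponent) (ih (s.erase a)) ?_
    intro δ hδ γ hγ
    obtain ⟨k, hk, h7⟩ := hδ
    rw [h7]
    exact relatedExp_cons _ has hγ hk

lemma Plug.eVal_eq {ι : Type*} [DecidableEq ι] {A : Type*} [Field A] [Algebra (GroundField I) A]
    {n : I → ℕ} {col : ι → I} {x : ι → A} {s : Finset ι} {y : Var I → A} (hy : Plug n col x s y)
    (w : Word I) : eVal col x w s = eVal Prod.fst y w (varSet n) := by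
  obtain ⟨-, θ, hθ, hθ'⟩ := hy
  have h1 : s.attach = (varSet n).attach.map θ.toEmbedding := by
    ext a
    simp only [Finset.mem_attach, Finset.mem_map, true_and, true_iff]
    exact ⟨θ.symm a, θ.apply_symm_apply a⟩
  rw [← Finset.attach_map_val (s := s), h1, eVal, symRec_map, symRec_map]
  conv_rhs => rw [← Finset.attach_map_val (s := varSet n), eVal, symRec_map]
  simp only [Function.Embedding.subtype_apply, Equiv.coe_toEmbedding, hθ' _]
  have h2 : ∀ p : {p // p ∈ varSet n}, col (θ p) = (p : Var I).1 := hθ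
  simp only [h2]

lemma iterVar_injective : Function.Injective (iterVar : Fin n → IterLaurent I n) := by
  intro a b h
  by_contra hab
  have h1 := congrFun (toLex.injective (single_inj one_ne_zero h).1) a
  rw [Pi.single_eq_same, Pi.single_eq_of_ne hab] at h1
  exact one_ne_zero h1

/-- The exponents of words `v` and `w` with non-zero `⟨e_v, f_w⟩` are related. -/
lemma exists_exponent_relation {v w : Word I} {d d' : Fin n → ℤ}
    (hd : v.map Letter.exponent = List.ofFn d) (hd' : w.map Letter.exponent = List.ofFn d')
    (hvw : wordDegree v = wordDegree w) {P : LaurentPoly I} (hP1 : InVariables (wordDegree w) P)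
    (hP2 : IsSymmetric (wordDegree w) P)
    (hP : evalAt zVar P = eVal Prod.fst (zVar : Var I → RatFun I) v (varSet (wordDegree v)))
    (hne : residuePairing P w ≠ 0) :
    ∃ (σ : Equiv.Perm (Fin n)) (c : Fin n → Fin n → ℤ),
      (∀ a b, -(2 * (Fintype.card (Edge I) : ℤ)) ≤ c a b) ∧
      ∀ a, d' a = d (σ a) - (∑ s with s < a ∧ σ a < σ s, c s a) +
        ∑ t with a < t ∧ σ t < σ a, c a t := by
  have hw : w.length = n := by simpa using congrArg List.length hd'
  subst hw
  have hd'' : ∀ a : Fin w.length, (w.get a).exponent = d' a := by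
    intro a
    have := congrArg (fun l : List ℤ => l[(a : ℕ)]?) hd'
    simpa using this
  have hplug := exists_plug_plugIn w
  obtain ⟨P', -, hP'⟩ := exists_laurent_eVal v (wordDegree w)
  have hPP : P = P' := evalAt_zVar_injective (by
    rw [hP, hvw, hP' _ _ (isGenericPoint_zVar _)])
  rw [residuePairing_eq_coeff rfl (col := fun a => (w.get a).vertex) (d := d') (fun _ => rfl) hd''
    hP1 hP2, hplug.evalOn_eq hP1 hP2, hPP,
    ← hP' _ _ (hplug.isGenericPoint iterVar_injective), ← hplug.eVal_eq, mul_comm] at hne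
  obtain ⟨π, c, h1, h2, h3, h4⟩ := support_eVal _ v _ hne
  have hlen : (v.map Letter.exponent).length = w.length := by rw [hd, List.length_ofFn]
  rw [hlen] at h2
  let τ : Fin w.length → Fin w.length := fun a => ⟨π a, h2 a (Finset.mem_univ a)⟩
  have hτ : Function.Injective τ := fun a b h =>
    h1 (Finset.mem_coe.2 (Finset.mem_univ a)) (Finset.mem_coe.2 (Finset.mem_univ b))
      (congrArg Fin.val h)
  refine ⟨Equiv.ofBijective τ (Finite.injective_iff_bijective.1 hτ), c, h3, fun a => ?_⟩
  have h5 := h4 a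
  rw [if_pos (Finset.mem_univ a), hd] at h5
  refine h5.trans ?_
  congr 2
  rw [List.getD_eq_getElem?_getD, List.getElem?_ofFn, dif_pos (h2 a (Finset.mem_univ a))]
  rfl

end Support

/-! ### Words with bounded exponents -/

section Bounded

variable {I : Type u} [Fintype I]

lemma finite_setOf_map_exponent {D : Set (List ℤ)} (hD : D.Finite) :
    {w : Word I | w.map Letter.exponent ∈ D}.Finite := by
  refine hD.preimage' fun l _ => ?_
  refine Set.Finite.of_finite_image (f := List.map Letter.vertex)
    ((List.finite_length_eq I l.length).subset ?_) ?_
  · rintro _ ⟨w, hw, rfl⟩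
    rw [Set.mem_ofPred_eq, ← Set.mem_singleton_iff.1 hw, List.length_map, List.length_map]
  · intro w hw w' hw' h
    have h1 : w.map Letter.exponent = w'.map Letter.exponent :=
      (Set.mem_singleton_iff.1 hw).trans (Set.mem_singleton_iff.1 hw').symm
    clear hw hw'
    induction w generalizing w' with
    | nil => exact (List.map_eq_nil_iff.1 h.symm).symm
    | cons a w ih =>
      cases w' with
      | nil => simp at h
      | cons b w' =>
        simp only [List.map_cons, List.cons.injEq] at h h1
        rw [← mkLetter_eta a, ← mkLetter_eta b, h.1, h1.1, ih h.2 h1.2]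

/-- Larger letters have smaller or equal exponents, so a lower bound on exponents leaves finitely
many letters above a given one. -/
lemma exists_max_letter [LinearOrder I] {M : ℤ} {Z : Set (Letter I)} (hZ : Z.Nonempty)
    (hM : ∀ l ∈ Z, M ≤ l.exponent) : ∃ l ∈ Z, ∀ m ∈ Z, m ≤ l := by
  obtain ⟨l₀, hl₀⟩ := hZ
  have hfin : {l ∈ Z | l₀ ≤ l}.Finite := by
    refine Set.Finite.of_finite_image (f := fun l : Letter I => (l.exponent, l.vertex))
      (((Set.finite_Icc M l₀.exponent).prod Set.finite_univ).subset ?_) ?_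
    · rintro _ ⟨l, ⟨hl, hl'⟩, rfl⟩
      refine ⟨⟨hM l hl, ?_⟩, trivial⟩
      rcases hl'.lt_or_eq with h | rfl
      · exact (letter_lt_iff.1 h).elim le_of_lt fun h => h.1.ge
      · exact le_rfl
    · intro l _ m _ h
      rw [← mkLetter_eta l, ← mkLetter_eta m, (Prod.mk.inj h).1, (Prod.mk.inj h).2]
  obtain ⟨l, hl, hmax⟩ := Set.exists_max_image _ id hfin ⟨l₀, hl₀, le_rfl⟩
  refine ⟨l, hl.1, fun m hm => ?_⟩
  rcases le_total l₀ m with h | h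
  · exact hmax m ⟨hm, h⟩
  · exact h.trans hl.2

/-- The letters are maximized one after the other. A bound on prefix sums bounds the first exponent,
and once the first letter is fixed the tails inherit a shifted bound; bounded length ends the
process. -/
lemma exists_max_word [LinearOrder I] (L : ℕ) {M : ℤ} {Z : Set (Word I)} (hZ : Z.Nonempty)
    (hL : ∀ w ∈ Z, w.length ≤ L)
    (hM : ∀ w ∈ Z, ∀ k, M ≤ ((w.map Letter.exponent).take k).sum) :
    ∃ w ∈ Z, ∀ u ∈ Z, u ≤ w := by
  induction L generalizing M Z with
  | zero =>
    obtain ⟨w, hw⟩ := hZ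
    refine ⟨w, hw, fun u hu => ?_⟩
    rw [List.length_eq_zero_iff.1 (Nat.le_zero.1 (hL u hu)),
      List.length_eq_zero_iff.1 (Nat.le_zero.1 (hL w hw))]
  | succ L ih =>
    by_cases h : ∃ l w, (l :: w : Word I) ∈ Z
    · obtain ⟨l, ⟨w₀, hw₀⟩, hl⟩ := exists_max_letter (Z := {l | ∃ w, (l :: w : Word I) ∈ Z}) (M := M)
        h (by
          rintro l ⟨w, hw⟩
          simpa using hM _ hw 1)
      obtain ⟨w, hw, hmax⟩ := ih (Z := {w | (l :: w : Word I) ∈ Z}) (M := M - l.exponent) ⟨w₀, hw₀⟩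
        (fun w hw => by simpa using hL _ hw) (fun w hw k => by
          have := hM _ hw (k + 1)
          simp only [List.map_cons, List.take_succ_cons, List.sum_cons] at this
          omega)
      refine ⟨l :: w, hw, fun u hu => ?_⟩
      cases u with
      | nil => exact le_of_lt (List.nil_lt_cons l w)
      | cons m u =>
        rcases (hl m ⟨u, hu⟩).lt_or_eq with h1 | rfl
        · exact le_of_lt (List.cons_lt_cons_iff.2 (Or.inl h1))
        · rcases (hmax u hu).lt_or_eq with h2 | rfl
          · exact le_of_lt (List.cons_lt_cons_iff.2 (Or.inr ⟨rfl, h2⟩))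
          · exact le_rfl
    · have hnil : ∀ u ∈ Z, u = [] := by
        rintro (_ | ⟨l, u⟩) hu
        · rfl
        · exact absurd ⟨l, u, hu⟩ h
      obtain ⟨w, hw⟩ := hZ
      exact ⟨w, hw, fun u hu => by rw [hnil u hu, hnil w hw]⟩

lemma IsNonIncreasing.exists_monotone [LinearOrder I] {w : Word I} (hw : IsNonIncreasing w) {n : ℕ}
    (hn : w.length = n) : ∃ d : Fin n →o ℤ, w.map Letter.exponent = List.ofFn d := by
  subst hn
  refine ⟨⟨fun a => (w.get a).exponent, fun a b hab => ?_⟩, ?_⟩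
  · rcases hab.lt_or_eq with h | rfl
    · rcases (List.pairwise_iff_get.1 hw a b h).lt_or_eq with h1 | h1
      · exact (letter_lt_iff.1 h1).elim le_of_lt fun h => h.1.ge
      · exact (congrArg Letter.exponent h1).ge
    · exact le_rfl
  · exact List.ext_get (by simp) fun k h1 h2 => by simp; rfl

end Bounded

/-! ### The pairing -/

section Pairing

variable {I : Type u} [Fintype I] [LinearOrder I] [Quiver.{v} I] [∀ i j : I, Fintype (i ⟶ j)]

/-- A linear left inverse of the evaluation of Laurent polynomials extends the residue to all
families of rational functions; its values outside Laurent polynomials are irrelevant. -/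
lemma exists_residue_functional (w : Word I) :
    ∃ lam : Graded I →ₗ[GroundField I] GroundField I, ∀ (R : Graded I) (P : LaurentPoly I),
      evalAt zVar P = R (wordDegree w) → lam R = residuePairing P w := by
  let E : LaurentPoly I →ₗ[GroundField I] RatFun I :=
    { toFun := evalAt zVar
      map_add' := evalAt_add _
      map_smul' := evalAt_smul _ }
  let r : LaurentPoly I →ₗ[GroundField I] GroundField I :=
    { toFun := fun P => residuePairing P w
      map_add' := fun P P' => residuePairing_add P P' w
      map_smul' := fun c P => residuePairing_smul c P w }
  obtain ⟨g, hg⟩ := LinearMap.exists_leftInverse_of_injective E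
    (LinearMap.ker_eq_bot.2 evalAt_zVar_injective)
  refine ⟨r ∘ₗ g ∘ₗ Finsupp.lapply (wordDegree w), fun R P h => ?_⟩
  have h1 : g (R (wordDegree w)) = P := by
    rw [← h]
    exact LinearMap.congr_fun hg P
  change residuePairing (g (R (wordDegree w))) w = _
  rw [h1]

/-- The pairing of `R` with `f_w` is given by the iterated residue. -/
def IsResiduePairing (B : Graded I →ₗ[GroundField I] Graded I →ₗ[GroundField I] GroundField I) :
    Prop :=
  ∀ R ∈ shuffleAlgebra I, ∀ (w : Word I) (P : LaurentPoly I),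
    evalAt zVar P = R (wordDegree w) → B R (fWord w) = residuePairing P w

lemma exists_isResiduePairing (I : Type u) [Fintype I] [LinearOrder I] [Quiver.{v} I]
    [∀ i j : I, Fintype (i ⟶ j)] :
    ∃ B : Graded I →ₗ[GroundField I] Graded I →ₗ[GroundField I] GroundField I,
      IsResiduePairing B := by
  choose lam hlam using exists_residue_functional (I := I)
  obtain ⟨B, hB⟩ := exists_bilinear_of_relations fWord lam (shuffleAlgebra I) (by
    intro R hR a ha
    choose P hP hPR using hR
    rw [Finsupp.linearCombination_apply, Finsupp.sum] at ha ⊢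
    -- A relation between words of several degrees splits into its homogeneous parts, for which
    -- `sum_residuePairing_eq_zero` is available.
    rw [← Finset.sum_fiberwise_of_maps_to (g := wordDegree) (t := a.support.image wordDegree)
      fun w hw => Finset.mem_image_of_mem _ hw]
    refine Finset.sum_eq_zero fun n _ => ?_
    rw [← sum_residuePairing_eq_zero (hP n).1 (hP n).2.1 (hP n).2.2
      (T := a.support.filter fun w => wordDegree w = n) (a := a)
      (fun w hw => (Finset.mem_filter.1 hw).2)]
    · refine Finset.sum_congr rfl fun w hw => ?_
      have hwn := (Finset.mem_filter.1 hw).2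
      rw [hlam w R (P n) (by rw [hPR, hwn]), smul_eq_mul]
    · have h1 := congrArg (fun X : Graded I => X n) ha
      simp only [Finsupp.finsetSum_apply, Finsupp.zero_apply] at h1
      rw [← h1, Finset.sum_filter]
      refine Finset.sum_congr rfl fun w _ => ?_
      rw [Finsupp.smul_apply, fWord_eq, Finsupp.single_apply]
      split_ifs with h
      · rw [h]
      · rw [smul_zero])
  exact ⟨B, fun R hR w P h => (hB R hR w).trans (hlam w R P h)⟩

variable {B : Graded I →ₗ[GroundField I] Graded I →ₗ[GroundField I] GroundField I}

lemma residuePairing_zero (w : Word I) : residuePairing 0 w = 0 := by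
  have := residuePairing_smul (0 : GroundField I) 0 w
  rwa [zero_smul, zero_mul] at this

lemma IsResiduePairing.wordDegree_mem_support (hB : IsResiduePairing B) {R : Graded I}
    (hR : R ∈ shuffleAlgebra I) {w : Word I} (h : B R (fWord w) ≠ 0) : wordDegree w ∈ R.support := by
  rw [Finsupp.mem_support_iff]
  intro h0
  exact h (by rw [hB R hR w 0 (by rw [evalAt_zero, h0]), residuePairing_zero])

lemma IsResiduePairing.exists_bound (hB : IsResiduePairing B) {R : Graded I}
    (hR : R ∈ shuffleAlgebra I) : ∃ (L : ℕ) (M : ℤ), ∀ w : Word I, B R (fWord w) ≠ 0 →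
      w.length ≤ L ∧ (∀ k, -M ≤ ((w.map Letter.exponent).take k).sum) ∧
        (w.map Letter.exponent).sum ≤ M := by
  choose P hP hPR using hR
  choose M hM using fun n => exists_residuePairing_bound (hP n).1 (hP n).2.1
  obtain ⟨M₀, hM₀⟩ := (R.support.image M).exists_le
  refine ⟨R.support.sup fun n => ∑ i, n i, M₀, fun w hw => ?_⟩
  have hmem := hB.wordDegree_mem_support (fun n => ⟨P n, hP n, hPR n⟩) hw
  have hle := hM₀ _ (Finset.mem_image_of_mem M hmem)
  rw [hB R (fun n => ⟨P n, hP n, hPR n⟩) w _ (hPR _)] at hw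
  have hofFn : w.map Letter.exponent = List.ofFn fun a : Fin w.length => (w.get a).exponent :=
    List.ext_get (by simp) fun k h1 h2 => by simp
  obtain ⟨h1, h2⟩ := hM _ _ _ w rfl hofFn hw
  have h3 : ∀ k, ((w.map Letter.exponent).take k).sum =
      prefixSum (fun a : Fin w.length => (w.get a).exponent) k := fun k => by
    rw [hofFn, List.sum_take_ofFn]
    rfl
  refine ⟨?_, fun k => ?_, ?_⟩
  · rw [← sum_wordDegree]
    exact Finset.le_sup (f := fun n : I → ℕ => ∑ i, n i) hmem
  · rw [h3]
    exact (neg_le_neg hle).trans (h1 k)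
  · have h4 := h3 w.length
    rw [List.take_of_length_le (by simp)] at h4
    rw [h4]
    exact h2.trans hle

lemma IsResiduePairing.finite_support (hB : IsResiduePairing B) {R : Graded I}
    (hR : R ∈ shuffleAlgebra I) : {w : Word I | IsNonIncreasing w ∧ B R (fWord w) ≠ 0}.Finite := by
  obtain ⟨L, M, hLM⟩ := hB.exists_bound hR
  refine (finite_setOf_map_exponent ((Set.finite_Iic L).biUnion fun n _ =>
    (finite_setOf_le_of_prefixSum_eq n (-M) M).image fun d : Fin n →o ℤ => List.ofFn (d : Fin n → ℤ))).subset ?_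
  rintro w ⟨hw, hne⟩
  obtain ⟨h1, h2, h3⟩ := hLM w hne
  obtain ⟨d, hd⟩ := hw.exists_monotone rfl
  refine Set.mem_biUnion h1 ⟨d, ⟨fun a => ?_, ?_⟩, hd.symm⟩
  -- The exponents are non-decreasing, so the bound on the first one bounds all of them from below.
  · have h4 := h2 1
    rw [hd, List.sum_take_ofFn] at h4
    have hn : 0 < w.length := a.pos
    have h5 : (Finset.univ.filter fun b : Fin w.length => (b : ℕ) < 1) = {⟨0, hn⟩} := by
      ext b
      simp [Fin.ext_iff]
    rw [h5, Finset.sum_singleton] at h4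
    exact h4.trans (d.monotone (Fin.mk_le_of_le_val (Nat.zero_le _)))
  · rw [hd, List.sum_ofFn] at h3
    rwa [prefixSum, Finset.filter_true_of_mem fun (a : Fin w.length) _ => a.2]

lemma IsResiduePairing.eq_zero (hB : IsResiduePairing B) {R : Graded I}
    (hR : R ∈ shuffleAlgebra I) (h : ∀ w, B R (fWord w) = 0) : R = 0 := by
  ext n
  obtain ⟨P, hP, hPR⟩ := hR n
  rw [Finsupp.zero_apply, ← hPR]
  by_cases hP0 : P = 0
  · rw [hP0, evalAt_zero]
  · obtain ⟨w, rfl, hw⟩ := exists_residuePairing_ne_zero hP.1 hP.2.1 hP0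
    exact absurd ((hB R hR w P hPR).symm.trans (h w)) hw

open Classical in
/-- The connected component of the exponents of a non-increasing word. -/
def blockOf (w : Word I) : Σ n, (exponentGraph I n).ConnectedComponent :=
  if h : IsNonIncreasing w then
    ⟨w.length, (exponentGraph I w.length).connectedComponentMk (h.exists_monotone rfl).choose⟩
  else ⟨0, (exponentGraph I 0).connectedComponentMk ⟨0, monotone_const⟩⟩

lemma blockOf_eq_iff {w : Word I} (hw : IsNonIncreasing w) {n : ℕ}
    {H : (exponentGraph I n).ConnectedComponent} : blockOf w = ⟨n, H⟩ ↔ ExponentsIn H w := by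
  have h1 := (hw.exists_monotone rfl).choose_spec
  rw [blockOf, dif_pos hw]
  constructor
  · intro h
    cases h
    exact ⟨_, h1, rfl⟩
  · rintro ⟨d, hd, rfl⟩
    have hn : w.length = n := by simpa using congrArg List.length hd
    subst hn
    rw [show (hw.exists_monotone rfl).choose = d from
      DFunLike.coe_injective (List.ofFn_injective (h1.symm.trans hd))]

/-- A non-zero pairing relates the exponents by some permutation. They are equal if it is the
identity; otherwise they are equal or adjacent in G. -/
lemma IsResiduePairing.blockOf_eq (hB : IsResiduePairing B) {v w : Word I} (hv : IsNonIncreasing v)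
    (hw : IsNonIncreasing w) (h : B (eWord v) (fWord w) ≠ 0) : blockOf v = blockOf w := by
  have hvw : wordDegree v = wordDegree w := by
    have := hB.wordDegree_mem_support (eWord_mem v) h
    rw [eWord_eq] at this
    exact (Finset.mem_singleton.1 (Finsupp.support_single_subset this)).symm
  have hlen : v.length = w.length := by rw [← sum_wordDegree, hvw, sum_wordDegree]
  obtain ⟨d, hd⟩ := hv.exists_monotone hlen
  obtain ⟨d', hd'⟩ := hw.exists_monotone rfl
  obtain ⟨P, hP, hPR⟩ := eWord_mem v (wordDegree w)
  rw [hB _ (eWord_mem v) w P hPR] at h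
  rw [eWord_eq, ← hvw, Finsupp.single_eq_same] at hPR
  obtain ⟨σ, c, hc, hσ⟩ := exists_exponent_relation hd hd' hvw hP.1 hP.2.1 hPR h
  rw [(blockOf_eq_iff hv).2 ⟨d, hd, rfl⟩, (blockOf_eq_iff hw).2 ⟨d', hd', rfl⟩]
  congr 1
  by_cases hdd : d = d'
  · rw [hdd]
  · refine SimpleGraph.ConnectedComponent.sound (SimpleGraph.Adj.reachable
      ((exponentGraph_adj I).2 ⟨hdd, σ, ?_, c, fun a b _ _ => hc a b, hσ⟩))
    rintro rfl
    refine hdd (DFunLike.ext _ _ fun a => ?_)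
    rw [hσ a, Finset.filter_false_of_mem fun s _ hs => lt_asymm hs.1 hs.2,
      Finset.filter_false_of_mem fun s _ hs => lt_asymm hs.1 hs.2, Finset.sum_empty,
      Finset.sum_empty, sub_zero, add_zero]
    rfl

lemma setOf_blockOf_eq {n : ℕ} (H : (exponentGraph I n).ConnectedComponent) :
    {w : Word I | w ∈ {w : Word I | IsNonIncreasing w} ∧ blockOf w = ⟨n, H⟩} =
      {w | IsNonIncreasing w ∧ ExponentsIn H w} :=
  Set.ext fun _ => and_congr_right fun h => blockOf_eq_iff h

lemma IsResiduePairing.isTriangularPairing (hB : IsResiduePairing B) :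
    IsTriangularPairing (dualGraded (I := I)) (shuffleAlgebra I) eWord fWord
      {w : Word I | IsNonIncreasing w} blockOf B where
  dual := dualGraded_eWord
  dual_mem R := dualGraded_mem_iff
  mem := eWord_mem
  straighten w hw := by
    have h1 := Submodule.mem_map_of_mem
      (f := (dualGraded (I := I) : Graded I →ₛₗ[dualGround (I := I)] Graded I))
      (eWord_mem_span_of_not_isNonIncreasing hw)
    rw [LinearMap.map_span, Set.image_image, LinearEquiv.coe_coe, dualGraded_eWord] at h1
    refine Submodule.span_mono ?_ h1
    rintro _ ⟨u, hu, rfl⟩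
    exact ⟨u, hu.1, (dualGraded_eWord u).symm⟩
  exists_max R hR Z hZ hne := by
    obtain ⟨L, M, hLM⟩ := hB.exists_bound hR
    exact exists_max_word L hne (fun w hw => (hLM w (hZ hw)).1) fun w hw => (hLM w (hZ hw)).2.1
  nondeg R hR := hB.eq_zero hR
  finite_support R hR := hB.finite_support hR
  orth v hv w hw := hB.blockOf_eq hv hw
  finite := by
    rintro ⟨n, H⟩
    rw [setOf_blockOf_eq]
    refine (finite_setOf_map_exponent ((finite_supp I H).image fun d : Fin n →o ℤ =>
      List.ofFn (d : Fin n → ℤ))).subset ?_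
    rintro w ⟨-, d, hd, hH⟩
    exact ⟨d, hH, hd.symm⟩

/-! ### The pieces -/

open IsTriangularPairing

lemma piece_eWord {n : ℕ} (H : (exponentGraph I n).ConnectedComponent) :
    piece eWord {w : Word I | IsNonIncreasing w} blockOf ⟨n, H⟩ (F := GroundField I) = ePiece H := by
  rw [piece, setOf_blockOf_eq, ePiece]

lemma piece_fWord {n : ℕ} (H : (exponentGraph I n).ConnectedComponent) :
    piece fWord {w : Word I | IsNonIncreasing w} blockOf ⟨n, H⟩ (F := GroundField I) = fPiece H := by
  rw [piece, setOf_blockOf_eq, fPiece]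

lemma map_ePiece {n : ℕ} (H : (exponentGraph I n).ConnectedComponent) :
    (ePiece H).map (dualGraded (I := I) : Graded I →ₛₗ[dualGround (I := I)] Graded I) = fPiece H := by
  rw [ePiece, LinearMap.map_span, Set.image_image]
  exact congrArg _ (Set.image_congr fun w _ => dualGraded_eWord w)

lemma ExponentsIn.length_eq {n : ℕ} {H : (exponentGraph I n).ConnectedComponent} {w : Word I}
    (h : ExponentsIn H w) : w.length = n := by
  obtain ⟨d, hd, -⟩ := h
  simpa using congrArg List.length hd

lemma ePiece_le {n : ℕ} (H : (exponentGraph I n).ConnectedComponent) :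
    ePiece H ≤ shuffleAlgebra I ⊓ ofLength I n := by
  rw [ePiece, Submodule.span_le]
  rintro _ ⟨w, ⟨-, hw⟩, rfl⟩
  refine ⟨eWord_mem w, ?_⟩
  rw [eWord_eq]
  exact Finsupp.single_mem_supported _ _ (by
    rw [Set.mem_ofPred_eq, sum_wordDegree, hw.length_eq])

lemma dualGraded_mem_ofLength {n : ℕ} {R : Graded I} (hR : R ∈ ofLength I n) :
    dualGraded R ∈ ofLength I n := by
  rw [ofLength, Finsupp.mem_supported'] at hR ⊢
  intro m hm
  rw [dualGraded_apply, hR m hm, map_zero]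

/-- Only the blocks of words that pair non-trivially with R are needed, and such words have the
length of R. -/
lemma IsResiduePairing.iSup_ePiece (hB : IsResiduePairing B) (n : ℕ) :
    ⨆ H : (exponentGraph I n).ConnectedComponent, ePiece H = shuffleAlgebra I ⊓ ofLength I n := by
  refine le_antisymm (iSup_le ePiece_le) fun R hR => ?_
  refine (iSup₂_le ?_ : _ ≤ ⨆ H : (exponentGraph I n).ConnectedComponent, ePiece H)
    (hB.isTriangularPairing.mem_iSup_piece hR.1)
  rintro _ ⟨w, ⟨hw, hne⟩, rfl⟩
  have hn : w.length = n := by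
    rw [← sum_wordDegree]
    exact (Finsupp.mem_supported _ _).1 hR.2 (hB.wordDegree_mem_support hR.1 hne)
  obtain ⟨d, hd⟩ := IsNonIncreasing.exists_monotone hw hn
  rw [(blockOf_eq_iff hw).2 ⟨d, hd, rfl⟩, piece_eWord]
  exact le_iSup (fun H : (exponentGraph I n).ConnectedComponent => ePiece H) _

lemma IsResiduePairing.iSup_fPiece (hB : IsResiduePairing B) (n : ℕ) :
    ⨆ H : (exponentGraph I n).ConnectedComponent, fPiece H = shuffleAlgebra I ⊓ ofLength I n := by
  simp only [← map_ePiece]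
  rw [← Submodule.map_iSup, hB.iSup_ePiece]
  ext R
  constructor
  · rintro ⟨R, hR, rfl⟩
    exact ⟨dualGraded_mem hR.1, dualGraded_mem_ofLength hR.2⟩
  · intro hR
    exact ⟨dualGraded R, ⟨dualGraded_mem hR.1, dualGraded_mem_ofLength hR.2⟩, dualGraded_dualGraded R⟩

lemma IsResiduePairing.iSupIndep_ePiece (hB : IsResiduePairing B) (n : ℕ) :
    iSupIndep fun H : (exponentGraph I n).ConnectedComponent => ePiece H := by
  simpa only [Function.comp_def, piece_eWord] using
    hB.isTriangularPairing.iSupIndep_piece.comp (sigma_mk_injective (i := n))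

lemma IsResiduePairing.iSupIndep_fPiece (hB : IsResiduePairing B) (n : ℕ) :
    iSupIndep fun H : (exponentGraph I n).ConnectedComponent => fPiece H := by
  simpa only [Function.comp_def, piece_fWord] using
    hB.isTriangularPairing.iSupIndep_piece_right.comp (sigma_mk_injective (i := n))

lemma setOf_isStandard_blockOf (hB : IsResiduePairing B) {n : ℕ}
    (H : (exponentGraph I n).ConnectedComponent) :
    {w : Word I | w ∈ standard (GroundField I) fWord ∧ blockOf w = ⟨n, H⟩} =
      {w | IsStandard w ∧ ExponentsIn H w} := by
  rw [← hB.isTriangularPairing.standard_eq]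
  refine Set.ext fun w => and_congr_right fun hw => blockOf_eq_iff ?_
  rw [hB.isTriangularPairing.standard_eq] at hw
  exact hB.isTriangularPairing.standard_subset hw

end Pairing

/-! ### Transfer of the abstract structure to the shuffle algebra. -/

section Structure

open IsTriangularPairing

variable {I : Type u} [Fintype I] [LinearOrder I] [Quiver.{v} I] [∀ i j : I, Fintype (i ⟶ j)]
variable {B : Graded I →ₗ[GroundField I] Graded I →ₗ[GroundField I] GroundField I}

/-- The restriction of a bilinear form to the shuffle algebra. -/
def restrictForm (B : Graded I →ₗ[GroundField I] Graded I →ₗ[GroundField I] GroundField I) :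
    shuffleAlgebra I →ₗ[GroundField I] shuffleAlgebra I →ₗ[GroundField I] GroundField I :=
  ((B.domRestrict (shuffleAlgebra I)).flip.domRestrict (shuffleAlgebra I)).flip

lemma restrictForm_apply (R X : shuffleAlgebra I) : restrictForm B R X = B R X := rfl

lemma IsResiduePairing.setOf_isStandard (hB : IsResiduePairing B) :
    {w : Word I | IsStandard w} = standard (GroundField I) fWord :=
  hB.isTriangularPairing.standard_eq

lemma IsResiduePairing.isDirectSumOfLines (hB : IsResiduePairing B) :
    IsDirectSumOfLines (shuffleAlgebra I) eWord {w | IsStandard w} := by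
  refine ⟨linearIndepOn_of_notMem_span eWord, ?_⟩
  rw [hB.setOf_isStandard]
  exact hB.isTriangularPairing.span_eq

lemma IsResiduePairing.isDirectSumOfLines_fWord (hB : IsResiduePairing B) :
    IsDirectSumOfLines (shuffleAlgebra I) fWord {w | IsStandard w} := by
  rw [hB.setOf_isStandard]
  exact ⟨linearIndepOn_of_notMem_span fWord, hB.isTriangularPairing.span_eq_right⟩

variable {n : ℕ} (H : (exponentGraph I n).ConnectedComponent)

lemma IsResiduePairing.finiteDimensional_ePiece (hB : IsResiduePairing B) :
    FiniteDimensional (GroundField I) (ePiece H) := by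
  rw [← piece_eWord]
  exact hB.isTriangularPairing.finiteDimensional_piece eWord ⟨n, H⟩

lemma IsResiduePairing.finiteDimensional_fPiece (hB : IsResiduePairing B) :
    FiniteDimensional (GroundField I) (fPiece H) := by
  rw [← piece_fWord]
  exact hB.isTriangularPairing.finiteDimensional_piece fWord ⟨n, H⟩

lemma IsResiduePairing.isDirectSumOfLines_ePiece (hB : IsResiduePairing B) :
    IsDirectSumOfLines (ePiece H) eWord {w | IsStandard w ∧ ExponentsIn H w} := by
  refine ⟨hB.isDirectSumOfLines.1.mono fun w hw => hw.1, ?_⟩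
  rw [← setOf_isStandard_blockOf hB, hB.isTriangularPairing.span_standard, piece_eWord]

lemma IsResiduePairing.isDirectSumOfLines_fPiece (hB : IsResiduePairing B) :
    IsDirectSumOfLines (fPiece H) fWord {w | IsStandard w ∧ ExponentsIn H w} := by
  refine ⟨hB.isDirectSumOfLines_fWord.1.mono fun w hw => hw.1, ?_⟩
  rw [← setOf_isStandard_blockOf hB, hB.isTriangularPairing.span_standard_right, piece_fWord]

lemma IsResiduePairing.apply_eq_zero (hB : IsResiduePairing B) {n' : ℕ}
    {H' : (exponentGraph I n').ConnectedComponent}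
    (hne : (⟨n, H⟩ : Σ k, (exponentGraph I k).ConnectedComponent) ≠ ⟨n', H'⟩) {x y : Graded I}
    (hx : x ∈ ePiece H) (hy : y ∈ fPiece H') : B x y = 0 := by
  rw [← piece_eWord] at hx
  rw [← piece_fWord] at hy
  exact hB.isTriangularPairing.apply_eq_zero hne hx hy

lemma IsResiduePairing.exists_dual_bases (hB : IsResiduePairing B) :
    (∃! b : Module.Basis {w : Word I // IsStandard w} (GroundField I) (shuffleAlgebra I),
      ∀ v w : {w : Word I // IsStandard w}, B (b v) (fWord w.1) = if v = w then 1 else 0) ∧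
    (∃! b : Module.Basis {w : Word I // IsStandard w} (GroundField I) (shuffleAlgebra I),
      ∀ v w : {w : Word I // IsStandard w}, B (eWord v.1) (b w) = if v = w then 1 else 0) := by
  convert hB.isTriangularPairing.exists_dual_bases (P := IsStandard)
    (Set.ext_iff.1 hB.setOf_isStandard) fWord_mem

end Structure

end

end QuiverShuffle

open QuiverShuffle
theorem mainTheorem6 (I : Type*) [Fintype I] [LinearOrder I] [Quiver I]
    [∀ i j : I, Fintype (i ⟶ j)] :
    -- the PBW decompositions of `𝒮` and `𝒮^op`
    IsDirectSumOfLines (shuffleAlgebra I) eWord {w | IsStandard w} ∧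
    IsDirectSumOfLines (shuffleAlgebra I) fWord {w | IsStandard w} ∧
    -- the pieces of length `n` are the direct sums of the `𝒮_H`, `H` a connected component of `G`
    (∀ n : ℕ,
      (iSupIndep fun H : (exponentGraph I n).ConnectedComponent => ePiece H) ∧
      (⨆ H : (exponentGraph I n).ConnectedComponent, ePiece H) = shuffleAlgebra I ⊓ ofLength I n ∧
      (iSupIndep fun H : (exponentGraph I n).ConnectedComponent => fPiece H) ∧
      (⨆ H : (exponentGraph I n).ConnectedComponent, fPiece H) =
        shuffleAlgebra I ⊓ ofLength I n) ∧
    -- each piece is finite-dimensional, and the direct sum of its lines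
    (∀ (n : ℕ) (H : (exponentGraph I n).ConnectedComponent),
      FiniteDimensional (GroundField I) (ePiece H) ∧
      FiniteDimensional (GroundField I) (fPiece H) ∧
      IsDirectSumOfLines (ePiece H) eWord {w | IsStandard w ∧ ExponentsIn H w} ∧
      IsDirectSumOfLines (fPiece H) fWord {w | IsStandard w ∧ ExponentsIn H w}) ∧
    ∃ (he : ∀ w : Word I, eWord w ∈ shuffleAlgebra I)
      (hf : ∀ w : Word I, fWord w ∈ shuffleAlgebra I)
      -- the pairing `𝒮 ⊗ 𝒮^op → 𝔽`, given by iterated residues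
      (B : shuffleAlgebra I →ₗ[GroundField I] shuffleAlgebra I →ₗ[GroundField I] GroundField I),
      (∀ (R : shuffleAlgebra I) (w : Word I) (P : LaurentPoly I),
        InVariables (wordDegree w) P → evalAt zVar P = (R : Graded I) (wordDegree w) →
          B R ⟨fWord w, hf w⟩ = residuePairing P w) ∧
      -- the pieces are mutually orthogonal
      (∀ (n n' : ℕ) (H : (exponentGraph I n).ConnectedComponent)
        (H' : (exponentGraph I n').ConnectedComponent),
        (⟨n, H⟩ : Σ k, (exponentGraph I k).ConnectedComponent) ≠ ⟨n', H'⟩ →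
          ∀ x y : shuffleAlgebra I, (x : Graded I) ∈ ePiece H → (y : Graded I) ∈ fPiece H' →
            B x y = 0) ∧
      -- the dual bases `e^v` and `f^v`
      (∃! eDual : Module.Basis {w : Word I // IsStandard w} (GroundField I) (shuffleAlgebra I),
        ∀ v w, B (eDual v) ⟨fWord w.1, hf w.1⟩ = if v = w then 1 else 0) ∧
      (∃! fDual : Module.Basis {w : Word I // IsStandard w} (GroundField I) (shuffleAlgebra I),
        ∀ v w, B ⟨eWord v.1, he v.1⟩ (fDual w) = if v = w then 1 else 0) := by
  obtain ⟨B, hB⟩ := exists_isResiduePairing I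
  refine ⟨hB.isDirectSumOfLines, hB.isDirectSumOfLines_fWord, fun n => ⟨hB.iSupIndep_ePiece n,
    hB.iSup_ePiece n, hB.iSupIndep_fPiece n, hB.iSup_fPiece n⟩, fun n H =>
    ⟨hB.finiteDimensional_ePiece H, hB.finiteDimensional_fPiece H, hB.isDirectSumOfLines_ePiece H,
      hB.isDirectSumOfLines_fPiece H⟩, eWord_mem, fWord_mem, restrictForm B, ?_, ?_, ?_, ?_⟩
  · intro R w P _ hP
    rw [restrictForm_apply]
    exact hB R R.2 w P hP
  · intro n n' H H' hne x y hx hy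
    rw [restrictForm_apply]
    exact hB.apply_eq_zero H hne hx hy
  · simp only [restrictForm_apply]
    exact hB.exists_dual_bases.1
  · simp only [restrictForm_apply]
    exact hB.exists_dual_bases.2
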